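/- **Conventions.** Manifolds are smooth, finite-dimensional, Hausdorff and second countable; different components may have different dimensions. A simplicial manifold $X$ has manifolds $X_n$ as levels and smooth structure maps; $\Delta[m]$ is the $m$-simplex, $\partial\Delta[m]$ its boundary, and $\Lambda[m,j]\subset\Delta[m]$ ($0\le j\le m$) its horns. For a simplicial set $A$, $\hom(A,X)$ carries the smooth structure (in general a diffeology) of a subspace of a product of the $X_n$'s. For $A\to B$ and a simplicial smooth map (strict map) $Z\to X$ put $\hom(A\to B,Z\to X)=\hom(A,Z)\times_{\hom(A,X)}\hom(B,X)$. A *Lie 2-groupoid* is a simplicial manifold $X$ such that the restriction $X_m=\hom(\Delta[m],X)\to\hom(\Lambda[m,j],X)$ is a surjective submersion for all $m\ge1$, $0\le j\le m$, and a diffeomorphism for all $m>2$, $0\le j\le m$. A strict map $Z\to X$ of Lie 2-groupoids is a *hypercover* if $Z_m\to\hom(\partial\Delta[m]\to\Delta[m],Z\to X)$ is a surjective submersion for $m=0,1$ and a diffeomorphism for $m=2$. Two Lie 2-groupoids $X,Y$ are *Morita equivalent* if there are a Lie 2-groupoid $Z$ and hypercovers $X\leftarrow Z\to Y$. Let $J=\{\Lambda[k,j]\to\Delta[k]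 : k\ge3,\ 0\le j\le k\}\cup\{\Lambda[2,1]\to\Delta[2]\}$. The *Kan replacement* is $Kan(X)=\operatorname{colim}_{\beta\in\mathbb N}X^\beta$, where $X^0=X$ and $X^{\beta+1}$ is the push-out $$X^{\beta+1}=X^\beta\ \sqcup_{\ \coprod_J\Lambda[k,j]\times\hom(\Lambda[k,j],X^\beta)}\ \coprod_J\Delta[k]\times\hom(\Lambda[k,j],X^\beta),$$ with the push-out and colimit smooth structures in each degree. In particular $Kan(X)_0=X_0$ and $X^{\beta+1}_1=X^\beta_1\sqcup(X^\beta_1\times_{X_0}X^\beta_1)$. The *2-truncation* $\tau_2(K)$ has levels $K_k/\!\sim_k$ with the quotient smooth structure (quotient diffeology). Two 2-simplices are homotopic if $d_ix=d_iy$ for all $i$ and there is $z\in K_3$ with $d_2z=x$, $d_3z=y$ and $d_iz=s_1d_ix$ for $i=0,1$; and for $x,y\in K_k$, $x\sim_ky$ means that the 2-skeleta of $x$ and $y$ are homotopic relative to the 1-skeleton, i.e. $\varphi^*x$ and $\varphi^*y$ are homotopic for every $\varphi:[2]\to[k]$. Thus $\tau_2(K)_k=K_k$ for $k<2$ and $\sim_2$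 is homotopy. **Lemma.** Let $W$ be a Lie 2-groupoid. Then $\tau_2(Kan(W))$ is a Lie 2-groupoid (in particular its levels are manifolds), and it is Morita equivalent to $W$. More precisely, there are a Lie 2-groupoid $Z$ and hypercovers $p:Z\to\tau_2(Kan(W))$ and $q:Z\to W$ such that $q_0:Z_0\to W_0$ is a diffeomorphism and $Z_1$ is built from fibre products of $W_2$ as follows. Put $Z^0_1=W_1$ and $$Z_1^{\beta+1}=Z_1^\beta\ \sqcup\ \big(Z_1^\beta\times_{r,W_1,d_2}W_2\times_{d_0,W_1,r}Z_1^\beta\big),$$ with maps $\ell:Z_1^\beta\to W^\beta_1$ and $r:Z_1^\beta\to W_1$ which are the identity for $\beta=0$, are extended by $r(a,w,b)=d_1w$, and by letting $\ell(a,w,b)\in W^{\beta+1}_1$ be the new edge attached along the horn $(\ell(a),\ell(b))\in\hom(\Lambda[2,1],W^\beta)$. Then $Z_1\cong\bigcup_\beta Z_1^\beta=W_1\sqcup W_2\sqcup(W_2\sqcup W_2^{\times2}\sqcup W_2^{\times2}\sqcup W_2^{\times3})\sqcup\cdots$, where $W_2^{\times k}$ denotes iterated fibre products over $W_1$, and under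 this diffeomorphism $p_1=\ell$ and $q_1=r$. -/

import Mathlib

open CategoryTheory Simplicial Opposite Limits Diffeology
open scoped ContDiff Topology

universe u v w z

noncomputable section

namespace LieKan

/-! ### Initial and final diffeologies -/

/-- The coarsest diffeology on `Y` for which all the maps `f i : Y → B i` are smooth. With one
injective `f` this is the subspace diffeology; with the projections it is the product. -/
@[reducible]
def initialDiffeology {ι : Type v} {Y : Type u} {B : ι → Type w} [∀ i, DiffeologicalSpace (B i)]
    (f : ∀ i, Y → B i) : DiffeologicalSpace Y where
  plots n := {p | ∀ i, IsPlot (fun x : EuclideanSpace ℝ (Fin n) => f i (p x))}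
  constant_plots _ := fun _ => isPlot_const
  plot_reparam hp hf := fun i => isPlot_reparam (hp i) hf
  locality {n p} hp := fun i => DiffeologicalSpace.locality (fun x => by
    obtain ⟨s, hs, hxs, h⟩ := hp x
    exact ⟨s, hs, hxs, fun {m f'} h1 h2 => h h1 h2 i⟩)

/-- The finest diffeology on `Y` for which all the maps `f i : A i → Y` are smooth. For the
inclusions of a disjoint union it is the sum, for a quotient map the quotient diffeology. -/
@[reducible]
def finalDiffeology {ι : Type v} {A : ι → Type w} {Y : Type u} [∀ i, DiffeologicalSpace (A i)]
    (f : ∀ i, A i → Y) : DiffeologicalSpace Y :=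
  DiffeologicalSpace.generateFrom
    {q | ∃ (i : ι) (p : EuclideanSpace ℝ (Fin q.1) → A i), IsPlot p ∧ q.2 = fun x => f i (p x)}

lemma dSmooth_iff_le_initial {Y : Type u} {B : Type w} (d : DiffeologicalSpace Y)
    [DiffeologicalSpace B] (g : Y → B) :
    @DSmooth Y B d _ g ↔ d ≤ initialDiffeology (fun _ : Unit => g) := by
  rw [DiffeologicalSpace.le_iff']
  exact ⟨fun h n p hp _ => h n p hp, fun h n p hp => h n p hp ()⟩

lemma dSmooth_finalDiffeology_iff {ι : Type v} {A : ι → Type w} {Y : Type u} {B : Type z}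
    [∀ i, DiffeologicalSpace (A i)] [DiffeologicalSpace B] (f : ∀ i, A i → Y) (g : Y → B) :
    @DSmooth Y B (finalDiffeology f) _ g ↔ ∀ i, DSmooth (fun a => g (f i a)) := by
  rw [dSmooth_iff_le_initial, finalDiffeology, DiffeologicalSpace.generateFrom_le_iff]
  constructor
  · intro h i n p hp
    exact h n _ ⟨i, p, hp, rfl⟩ ()
  · intro h n p hp _
    obtain ⟨i, q, hq, hqp⟩ : ∃ (i : ι) (q : EuclideanSpace ℝ (Fin n) → A i),
      IsPlot q ∧ p = fun x => f i (q x) := hp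
    subst hqp
    exact h i n q hq

lemma dSmooth_sup_iff {Y : Type u} {B : Type z} (d₁ d₂ : DiffeologicalSpace Y)
    [DiffeologicalSpace B] (g : Y → B) :
    @DSmooth Y B (d₁ ⊔ d₂) _ g ↔ @DSmooth Y B d₁ _ g ∧ @DSmooth Y B d₂ _ g := by
  simp only [dSmooth_iff_le_initial, sup_le_iff]

lemma dSmooth_into_finalDiffeology {ι : Type v} {A : ι → Type w} {Y : Type u}
    [∀ i, DiffeologicalSpace (A i)] (f : ∀ i, A i → Y) (i : ι) :
    @DSmooth (A i) Y _ (finalDiffeology f) (f i) :=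
  fun _ p hp => DiffeologicalSpace.isPlot_generatedFrom_of_mem ⟨i, p, hp, rfl⟩

lemma dSmooth_mono {A : Type w} {Y : Type u} [DiffeologicalSpace A] {d₁ d₂ : DiffeologicalSpace Y}
    (h : d₁ ≤ d₂) {f : A → Y} (hf : @DSmooth A Y _ d₁ f) : @DSmooth A Y _ d₂ f :=
  fun n p hp => DiffeologicalSpace.le_iff'.1 h n _ (hf n p hp)

/-! ### Manifolds, submersions and diffeomorphisms

Manifolds are smooth, Hausdorff and second countable, and, since disjoint unions of manifolds of
different dimensions have to be allowed, their dimension may vary from point to point. They are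
treated as a full subcategory of the category of diffeological spaces. -/

/-- `φ` is a diffeomorphism of `ℝⁿ` onto an open subset of `X` (every point of an `n`-dimensional
manifold lies in such a chart). -/
structure IsChart {X : Type u} [DiffeologicalSpace X] {n : ℕ}
    (φ : EuclideanSpace ℝ (Fin n) → X) : Prop where
  injective : Function.Injective φ
  isPlot : IsPlot φ
  isOpen_range : IsOpen[dTopology] (Set.range φ)
  contDiff_of_isPlot : ∀ {m : ℕ} (q : EuclideanSpace ℝ (Fin m) → EuclideanSpace ℝ (Fin n)),
    IsPlot (fun x => φ (q x)) → ContDiff ℝ ∞ q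

/-- A smooth manifold, possibly with components of different dimensions. -/
structure IsSmoothManifold (X : Type u) [DiffeologicalSpace X] : Prop where
  t2 : @T2Space X dTopology
  secondCountable : @SecondCountableTopology X dTopology
  exists_chart : ∀ x : X, ∃ (n : ℕ) (φ : EuclideanSpace ℝ (Fin n) → X), IsChart φ ∧ x ∈ Set.range φ

/-- `f` is smooth and, near every point of `X`, it is given in charts of `X` and of `Y` by a map
with surjective derivative at this point. -/
structure IsSubmersion {X : Type u} {Y : Type v} [DiffeologicalSpace X] [DiffeologicalSpace Y]
    (f : X → Y) : Prop where
  dSmooth : DSmooth f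
  exists_charts : ∀ x : X, ∃ (m n : ℕ) (φ : EuclideanSpace ℝ (Fin m) → X)
    (ψ : EuclideanSpace ℝ (Fin n) → Y) (g : EuclideanSpace ℝ (Fin m) → EuclideanSpace ℝ (Fin n))
    (a : EuclideanSpace ℝ (Fin m)), IsChart φ ∧ IsChart ψ ∧ φ a = x ∧ (∀ y, f (φ y) = ψ (g y)) ∧
      ContDiff ℝ ∞ g ∧ Function.Surjective (fderiv ℝ g a)

/-- A surjective submersion. If `X` is a manifold and `Y` is Hausdorff, then `Y` is automatically a
manifold: every point of `Y` lies in a chart, and `f` is open. -/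
def IsSurjectiveSubmersion {X : Type u} {Y : Type v} [DiffeologicalSpace X] [DiffeologicalSpace Y]
    (f : X → Y) : Prop :=
  Function.Surjective f ∧ IsSubmersion f

def IsDiffeomorphism {X : Type u} {Y : Type v} [DiffeologicalSpace X] [DiffeologicalSpace Y]
    (f : X → Y) : Prop :=
  DSmooth f ∧ ∃ g : Y → X, DSmooth g ∧ Function.LeftInverse g f ∧ Function.RightInverse g f

/-! ### Simplicial diffeological spaces -/

/-- A simplicial diffeological space; it is a simplicial manifold when every level is a manifold. -/
structure SimplicialDiff where
  toSSet : SSet.{u}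
  diffeology : ∀ n : SimplexCategoryᵒᵖ, DiffeologicalSpace (toSSet.obj n)
  smooth_map : ∀ {m n : SimplexCategoryᵒᵖ} (f : m ⟶ n), DSmooth (fun x => toSSet.map f x)

instance (X : SimplicialDiff.{u}) (n : SimplexCategoryᵒᵖ) :
    DiffeologicalSpace (X.toSSet.obj n) := X.diffeology n

/-- A strict map. -/
structure StrictMap (X Y : SimplicialDiff.{u}) where
  hom : X.toSSet ⟶ Y.toSSet
  smooth : ∀ n : SimplexCategoryᵒᵖ, DSmooth (fun x : X.toSSet.obj n => hom.app n x)

/-- The space `hom(A, X)` for a simplicial set `A`: it is a subspace of the product of copies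
of the `X_n`, one for each `n`-simplex of `A`. -/
instance homDiffeology (A : SSet.{u}) (X : SimplicialDiff.{u}) :
    DiffeologicalSpace (A ⟶ X.toSSet) :=
  initialDiffeology (fun (a : Σ n : SimplexCategoryᵒᵖ, A.obj n) (h : A ⟶ X.toSSet) => h.app a.1 a.2)

/-- The space `hom(A → B, Z → X) = hom(A, Z) ×_{hom(A, X)} hom(B, X)`. -/
def RelHom {A B : SSet.{u}} (i : A ⟶ B) {Z X : SimplicialDiff.{u}} (f : StrictMap Z X) : Type u :=
  {p : (A ⟶ Z.toSSet) × (B ⟶ X.toSSet) // p.1 ≫ f.hom = i ≫ p.2}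

instance {A B : SSet.{u}} (i : A ⟶ B) {Z X : SimplicialDiff.{u}} (f : StrictMap Z X) :
    DiffeologicalSpace (RelHom i f) :=
  initialDiffeology (fun _ : Unit => fun p : RelHom i f => p.1.1) ⊓
    initialDiffeology (fun _ : Unit => fun p : RelHom i f => p.1.2)

/-- `hom(B, Z) → hom(A → B, Z → X)`. -/
def toRelHom {A B : SSet.{u}} (i : A ⟶ B) {Z X : SimplicialDiff.{u}} (f : StrictMap Z X)
    (h : B ⟶ Z.toSSet) : RelHom i f :=
  ⟨(i ≫ h, h ≫ f.hom), Category.assoc _ _ _⟩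

/-- The map `X_m = hom(Δ[m], X) → hom(Λ[m,j], X)`. -/
def hornRestriction (X : SimplicialDiff.{u}) (m : ℕ) (j : Fin (m + 1)) (h : Δ[m] ⟶ X.toSSet) :
    (Λ[m, j] : SSet.{u}) ⟶ X.toSSet :=
  Λ[m, j].ι ≫ h

/-- The map `Z_m = hom(Δ[m], Z) → hom(∂Δ[m] → Δ[m], Z → X)`. -/
def boundaryRestriction {Z X : SimplicialDiff.{u}} (f : StrictMap Z X) (m : ℕ)
    (h : Δ[m] ⟶ Z.toSSet) : RelHom (∂Δ[m].ι : (∂Δ[m] : SSet.{u}) ⟶ Δ[m]) f :=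
  toRelHom _ f h

/-- Lie `n`-groupoids: simplicial manifolds with `Kan(m,j)` for all `m ≥ 1` and `Kan!(m,j)` for all
`m > n`. That the horn spaces are manifolds is a consequence. -/
structure IsLieGroupoid (n : ℕ) (X : SimplicialDiff.{u}) : Prop where
  isSmoothManifold : ∀ m : ℕ, IsSmoothManifold (X.toSSet.obj (op ⦋m⦌))
  kan : ∀ (m : ℕ), 1 ≤ m → ∀ j : Fin (m + 1), IsSurjectiveSubmersion (hornRestriction X m j)
  kan_unique : ∀ (m : ℕ), n < m → ∀ j : Fin (m + 1), IsDiffeomorphism (hornRestriction X m j)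

/-- Hypercovers of Lie `n`-groupoids. -/
structure IsHypercover (n : ℕ) {Z X : SimplicialDiff.{u}} (f : StrictMap Z X) : Prop where
  isSurjectiveSubmersion : ∀ m : ℕ, m < n → IsSurjectiveSubmersion (boundaryRestriction f m)
  isDiffeomorphism : IsDiffeomorphism (boundaryRestriction f n)

/-- Morita equivalence of Lie `n`-groupoids. -/
def MoritaEquivalent (n : ℕ) (X Y : SimplicialDiff.{u}) : Prop :=
  ∃ (Z : SimplicialDiff.{u}) (p : StrictMap Z X) (q : StrictMap Z Y),
    IsLieGroupoid n Z ∧ IsHypercover n p ∧ IsHypercover n q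

/-! ### The Kan replacement -/

/-- The index set `J` of horns `Λ[k,j]`: all those with `k ≥ 3`, and `Λ[2,1]`. -/
structure HornIndex where
  k : ℕ
  j : Fin (k + 1)
  mem : 3 ≤ k ∨ (k = 2 ∧ (j : ℕ) = 1)

/-- `∐_J A_a × H_a` for simplicial sets `A_a` and sets `H_a`. -/
def cells (A : HornIndex → SSet.{u}) (H : HornIndex → Type u) : SSet.{u} where
  obj n := Σ a : HornIndex, (A a).obj n × H a
  map f := TypeCat.ofHom fun c => ⟨c.1, (A c.1).map f c.2.1, c.2.2⟩
  map_id n := by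
    apply ConcreteCategory.hom_ext
    rintro ⟨a, s, h⟩
    exact congrArg (fun t : (A a).obj n => (⟨a, t, h⟩ : Σ a : HornIndex, (A a).obj n × H a))
      ((A a).map_id_apply n s)
  map_comp {m n k} f g := by
    apply ConcreteCategory.hom_ext
    rintro ⟨a, s, h⟩
    exact congrArg (fun t : (A a).obj k => (⟨a, t, h⟩ : Σ a : HornIndex, (A a).obj k × H a))
      ((A a).map_comp_apply f g s)

/-- `∐_J Λ[k,j] × hom(Λ[k,j], X)`. -/
def hornCells (X : SSet.{u}) : SSet.{u} :=
  cells (fun a => Λ[a.k, a.j]) (fun a => (Λ[a.k, a.j] : SSet.{u}) ⟶ X)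

/-- `∐_J Δ[k] × hom(Λ[k,j], X)`. -/
def simplexCells (X : SSet.{u}) : SSet.{u} :=
  cells (fun a => Δ[a.k]) (fun a => (Λ[a.k, a.j] : SSet.{u}) ⟶ X)

def hornCellsInclusion (X : SSet.{u}) : hornCells X ⟶ simplexCells X where
  app n := TypeCat.ofHom fun c => ⟨c.1, Λ[c.1.k, c.1.j].ι.app n c.2.1, c.2.2⟩
  naturality m n f := by
    ext ⟨a, s, h⟩
    rfl

/-- `(a, s, h) ↦ h(s)`. -/
def attachingMap (X : SSet.{u}) : hornCells X ⟶ X where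
  app n := TypeCat.ofHom fun c => c.2.2.app n c.2.1
  naturality m n f := by
    ext ⟨a, s, h⟩
    exact NatTrans.naturality_apply h f s

/-- The simplicial set `X^{β+1}` obtained from `X^β` by the push-out. -/
def kanStepSSet (X : SSet.{u}) : SSet.{u} :=
  pushout (attachingMap X) (hornCellsInclusion X)

def kanStepInl (X : SSet.{u}) : X ⟶ kanStepSSet X :=
  pushout.inl (attachingMap X) (hornCellsInclusion X)

def kanStepInr (X : SSet.{u}) : simplexCells X ⟶ kanStepSSet X :=
  pushout.inr (attachingMap X) (hornCellsInclusion X)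

/-- The push-out diffeology, level by level; the simplices of `Δ[k]` are discrete. -/
@[reducible]
def kanStepDiffeology (X : SimplicialDiff.{u}) (n : SimplexCategoryᵒᵖ) :
    DiffeologicalSpace ((kanStepSSet X.toSSet).obj n) :=
  finalDiffeology (fun _ : Unit => fun x : X.toSSet.obj n => (kanStepInl X.toSSet).app n x) ⊔
    finalDiffeology (fun (c : Σ a : HornIndex, (Δ[a.k] : SSet.{u}).obj n)
      (h : (Λ[c.1.k, c.1.j] : SSet.{u}) ⟶ X.toSSet) => (kanStepInr X.toSSet).app n ⟨c.1, c.2, h⟩)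

/-- The step `X^β ↦ X^{β+1}` of the Kan replacement. -/
def kanStep (X : SimplicialDiff.{u}) : SimplicialDiff.{u} where
  toSSet := kanStepSSet X.toSSet
  diffeology := kanStepDiffeology X
  smooth_map {m n} f := by
    let := kanStepDiffeology X n
    refine (dSmooth_sup_iff _ _ _).2 ⟨(dSmooth_finalDiffeology_iff _ _).2 fun i => ?_,
      (dSmooth_finalDiffeology_iff _ _).2 fun c => ?_⟩
    · have h : (fun x : X.toSSet.obj m =>
          (kanStepSSet X.toSSet).map f ((kanStepInl X.toSSet).app m x)) =
          fun x => (kanStepInl X.toSSet).app n (X.toSSet.map f x) := by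
        funext x
        exact (NatTrans.naturality_apply (kanStepInl X.toSSet) f x).symm
      rw [h]
      exact (dSmooth_mono le_sup_left (dSmooth_into_finalDiffeology
        (fun _ : Unit => fun x : X.toSSet.obj n => (kanStepInl X.toSSet).app n x) ())).comp
        (X.smooth_map f)
    · have h : (fun h : (Λ[c.1.k, c.1.j] : SSet.{u}) ⟶ X.toSSet =>
          (kanStepSSet X.toSSet).map f ((kanStepInr X.toSSet).app m ⟨c.1, c.2, h⟩)) =
          fun h => (kanStepInr X.toSSet).app n ⟨c.1, (Δ[c.1.k] : SSet.{u}).map f c.2, h⟩ := by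
        funext h
        exact (NatTrans.naturality_apply (kanStepInr X.toSSet) f ⟨c.1, c.2, h⟩).symm
      rw [h]
      exact dSmooth_mono le_sup_right (dSmooth_into_finalDiffeology
        (fun (c : Σ a : HornIndex, (Δ[a.k] : SSet.{u}).obj n)
          (h : (Λ[c.1.k, c.1.j] : SSet.{u}) ⟶ X.toSSet) =>
            (kanStepInr X.toSSet).app n ⟨c.1, c.2, h⟩) ⟨c.1, (Δ[c.1.k] : SSet.{u}).map f c.2⟩)

/-- The stages `X = X^0 → X^1 → X^2 → ⋯`. -/
def kanStage (X : SimplicialDiff.{u}) (β : ℕ) : SimplicialDiff.{u} :=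
  Nat.rec X (fun _ Y => kanStep Y) β

def kanSequence (X : SimplicialDiff.{u}) : ℕ ⥤ SSet.{u} :=
  Functor.ofSequence (X := fun β => (kanStage X β).toSSet)
    fun β => kanStepInl (kanStage X β).toSSet

/-- The map `X^β → colim_β X^β`. -/
def kanStageMap (X : SimplicialDiff.{u}) (β : ℕ) :
    (kanStage X β).toSSet ⟶ colimit (kanSequence X) :=
  colimit.ι (kanSequence X) β

/-- The Kan replacement `Kan(X) = colim_β X^β`. -/
def kan (X : SimplicialDiff.{u}) : SimplicialDiff.{u} where
  toSSet := colimit (kanSequence X)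
  diffeology n := finalDiffeology
    (fun (β : ℕ) (x : (kanStage X β).toSSet.obj n) => (kanStageMap X β).app n x)
  smooth_map {m n} f := by
    let : DiffeologicalSpace ((colimit (kanSequence X)).obj n) := finalDiffeology
      (fun (β : ℕ) (x : (kanStage X β).toSSet.obj n) => (kanStageMap X β).app n x)
    refine (dSmooth_finalDiffeology_iff _ _).2 fun β => ?_
    have h : (fun x : (kanStage X β).toSSet.obj m =>
        (colimit (kanSequence X)).map f ((kanStageMap X β).app m x)) =
        fun x => (kanStageMap X β).app n ((kanStage X β).toSSet.map f x) := by
      funext x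
      exact (NatTrans.naturality_apply (kanStageMap X β) f x).symm
    rw [h]
    exact (dSmooth_into_finalDiffeology
      (fun (β : ℕ) (x : (kanStage X β).toSSet.obj n) => (kanStageMap X β).app n x) β).comp
      ((kanStage X β).smooth_map f)

/-! ### The 2-truncation -/

/-- Two 2-simplices are homotopic: they have the same faces, and there is a 3-simplex `z` with
`d_2 z = x`, `d_3 z = y` and `d_i z = s_1 d_i x = s_1 d_i y` for `i < 2`. -/
def Homotopic (X : SSet.{u}) (x y : X _⦋2⦌) : Prop :=
  (∀ i : Fin 3, X.δ i x = X.δ i y) ∧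
    ∃ z : X _⦋3⦌, X.δ 2 z = x ∧ X.δ 3 z = y ∧
      X.δ 0 z = X.σ 1 (X.δ 0 x) ∧ X.δ 1 z = X.σ 1 (X.δ 1 x)

/-- Two `k`-simplices are equivalent if their 2-skeleta are homotopic relative to the 1-skeleton,
that is, if all their corresponding 2-dimensional (possibly degenerate) faces are homotopic. For
`k < 2` this is equality, and for `k = 2` it is `Homotopic`. -/
def TruncRel (X : SSet.{u}) (k : SimplexCategoryᵒᵖ) (x y : X.obj k) : Prop :=
  ∀ φ : k ⟶ op ⦋2⦌, Homotopic X (X.map φ x) (X.map φ y)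

/-- The simplicial set `k ↦ X_k / ∼_k`. -/
def truncSSet (X : SSet.{u}) : SSet.{u} where
  obj k := Quot (TruncRel X k)
  map f := TypeCat.ofHom <| Quot.map (fun x => X.map f x) (fun x y h φ => by
    have := h (f ≫ φ)
    simpa using this)
  map_id k := by
    ext x
    induction x using Quot.ind
    simp [Quot.map]
  map_comp f g := by
    ext x
    induction x using Quot.ind
    simp [Quot.map]

/-- The quotient map `X_k → X_k / ∼_k`. -/
def truncMk (X : SSet.{u}) (k : SimplexCategoryᵒᵖ) (x : X.obj k) : (truncSSet X).obj k :=
  Quot.mk (TruncRel X k) x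

/-- The 2-truncation `τ₂(X)`, with the quotient diffeology in each degree. -/
def tau2 (X : SimplicialDiff.{u}) : SimplicialDiff.{u} where
  toSSet := truncSSet X.toSSet
  diffeology k := finalDiffeology (fun _ : Unit => truncMk X.toSSet k)
  smooth_map {m n} f := by
    let : DiffeologicalSpace ((truncSSet X.toSSet).obj n) :=
      finalDiffeology (fun _ : Unit => truncMk X.toSSet n)
    refine (dSmooth_finalDiffeology_iff _ _).2 fun _ => ?_
    exact (dSmooth_into_finalDiffeology (fun _ : Unit => truncMk X.toSSet n) ()).comp
      (X.smooth_map f)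

/-! ### The space of 1-simplices of the intermediate groupoid

It is the disjoint union of `W_1` and of iterated fibre products of `W_2`: whenever a formal
composite of two edges is added in the Kan replacement, a triangle of `W` filling it is added. -/

/-- A space with smooth-to-be maps to the edges of `X` (left moment map) and of `W` (right moment
map). -/
structure EdgeSpan (X W : SimplicialDiff.{u}) where
  carrier : Type u
  diffeology : DiffeologicalSpace carrier
  left : carrier → X.toSSet _⦋1⦌
  right : carrier → W.toSSet _⦋1⦌

instance {X W : SimplicialDiff.{u}} (S : EdgeSpan X W) : DiffeologicalSpace S.carrier :=
  S.diffeology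

/-- The fibre product `S ×_{W_1, d_2} W_2 ×_{d_0, W_1} S`. The component in `hom(Λ[2,1], X)` is the
horn formed by the left images of the two elements of `S`, and is determined by them. -/
def Filling {X W : SimplicialDiff.{u}} (S : EdgeSpan X W) : Type u :=
  {p : (S.carrier × S.carrier) × W.toSSet _⦋2⦌ × ((Λ[2, 1] : SSet.{u}) ⟶ X.toSSet) //
    S.right p.1.1 = W.toSSet.δ 2 p.2.1 ∧ S.right p.1.2 = W.toSSet.δ 0 p.2.1 ∧
    p.2.2.app (op ⦋1⦌) (SSet.horn.edge 2 1 0 1 (by decide) (by decide)) = S.left p.1.1 ∧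
    p.2.2.app (op ⦋1⦌) (SSet.horn.edge 2 1 1 2 (by decide) (by decide)) = S.left p.1.2}

instance {X W : SimplicialDiff.{u}} (S : EdgeSpan X W) : DiffeologicalSpace (Filling S) :=
  (initialDiffeology (fun _ : Unit => fun p : Filling S => p.1.1.1) ⊓
    initialDiffeology (fun _ : Unit => fun p : Filling S => p.1.1.2)) ⊓
  (initialDiffeology (fun _ : Unit => fun p : Filling S => p.1.2.1) ⊓
    initialDiffeology (fun _ : Unit => fun p : Filling S => p.1.2.2))

/-- The new edge of `X^{β+1}` that composes the horn. -/
def Filling.left {X W : SimplicialDiff.{u}} {S : EdgeSpan X W} (p : Filling S) :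
    (kanStep X).toSSet _⦋1⦌ :=
  (kanStepInr X.toSSet).app (op ⦋1⦌)
    ⟨⟨2, 1, Or.inr ⟨rfl, rfl⟩⟩, SSet.stdSimplex.edge 2 0 2 (by decide), p.1.2.2⟩

/-- The third side `d_1` of the triangle. -/
def Filling.right {X W : SimplicialDiff.{u}} {S : EdgeSpan X W} (p : Filling S) :
    W.toSSet _⦋1⦌ :=
  W.toSSet.δ 1 p.1.2.1

/-- `S ⊔ (S ×_{W_1} W_2 ×_{W_1} S)`. -/
def fillStep {X W : SimplicialDiff.{u}} (S : EdgeSpan X W) : EdgeSpan (kanStep X) W where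
  carrier := S.carrier ⊕ Filling S
  diffeology := finalDiffeology (fun _ : Unit => Sum.inl) ⊔ finalDiffeology (fun _ : Unit => Sum.inr)
  left := Sum.elim (fun s => (kanStepInl X.toSSet).app (op ⦋1⦌) (S.left s)) Filling.left
  right := Sum.elim S.right Filling.right

/-- `W_1`, then `W_1 ⊔ W_2`, then
`W_1 ⊔ W_2 ⊔ (W_2 ⊔ W_2 ×_{W_1} W_2 ⊔ W_2 ×_{W_1} W_2 ⊔ W_2 ×_{W_1} W_2 ×_{W_1} W_2)`, and so on. -/
def fillStage (W : SimplicialDiff.{u}) (β : ℕ) : EdgeSpan (kanStage W β) W :=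
  Nat.rec (motive := fun β => EdgeSpan (kanStage W β) W) ⟨W.toSSet _⦋1⦌, inferInstance, id, id⟩
    (fun _ S => fillStep S) β

/-- The union `Z_1` of these spaces. -/
def FilledEdges (W : SimplicialDiff.{u}) : Type u :=
  W.toSSet _⦋1⦌ ⊕ Σ β : ℕ, Filling (fillStage W β)

instance (W : SimplicialDiff.{u}) : DiffeologicalSpace (FilledEdges W) :=
  finalDiffeology (fun _ : Unit => fun x : W.toSSet _⦋1⦌ => (Sum.inl x : FilledEdges W)) ⊔
    finalDiffeology (fun (β : ℕ) (p : Filling (fillStage W β)) =>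
      (Sum.inr ⟨β, p⟩ : FilledEdges W))

/-- The left moment map `Z_1 → Kan(W)_1`. -/
def FilledEdges.left (W : SimplicialDiff.{u}) : FilledEdges W → (kan W).toSSet _⦋1⦌ :=
  Sum.elim (fun x => (kanStageMap W 0).app (op ⦋1⦌) x)
    (fun p => (kanStageMap W (p.1 + 1)).app (op ⦋1⦌) p.2.left)

/-- The right moment map `Z_1 → W_1`. -/
def FilledEdges.right (W : SimplicialDiff.{u}) : FilledEdges W → W.toSSet _⦋1⦌ :=
  Sum.elim id (fun p => p.2.right)

end LieKan

end

/-!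
Let `E = FilledEdges W`, with its left map to the edges of `Kan(W)` and its right map to the edges
of `W`. The groupoid `Z` is `filledGroupoid W`: the simplices of `W` together with lifts of their
edges along the right map. By construction `Z → W` is a pull-back along the surjective submersion
`E → W_1`. The heart of the proof is that `Z` is also the pull-back of `τ₂(Kan(W))` along the left
map (`exists_isPull_filledGroupoidLeft`). Both projections are then hypercovers
(`IsPull.isHypercover`), and being a Lie 2-groupoid passes from `W` up to `Z` and from `Z` down to
`τ₂(Kan(W))` (`IsPull.isLieGroupoid_source`, `IsPull.isLieGroupoid_target`).

**Transport.** To every filled edge `e` belongs a triangle of `Kan(W)` that deforms the left end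
of `e` into its right end. These triangles are built along the stages of `E`
(`exists_isCylinder`). A triangle of `Kan(W)` with lifts of its edges to `E` is transported along
the deformations of its edges to a triangle of `W` (`IsTransport`). Fillers of horns of dimensions
3 and 4 show that transport is compatible with homotopy and composition, and that it maps the
faces of a tetrahedron to the faces of a tetrahedron (`bounds_of_isTransport`). So, if every
triangle of `Kan(W)` is transported to exactly one triangle of `W`, for every choice of lifts of
its edges, then a simplex of `τ₂(Kan(W))` with lifts of its edges along the left map is the same
as a simplex of `W` with lifts along the right map; this is deduced from
`TransportData.IsComplete`, which `isComplete_transportData` verifies: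

* Targets exist by induction on the stages of `Kan(W)` (`hasTarget_germMk`). New triangles are
  composites attached along `Λ[2,1]`, for which `E` has been made, missing faces of attached
  tetrahedra, for which the transported faces are filled in `W`
  (`TransportData.IsAdmissible.hasTarget_face`), and degenerate ones.
* Whether a target exists does not depend on the lifts, because filled edges with the same left
  end differ by a triangle of `W` (`exists_isComposite_cylGerm`).
* The target is unique, because `W` is a retract of `Kan(W)` (`exists_kan_retraction`), so
  triangles of `W` that are homotopic in `Kan(W)` are equal (`eq_of_homotopic_kan`).

**Smoothness.** The same combinatorial arguments apply to the simplicial sets of germs of plots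
(`germs`), in which horns of `Kan(W)` of dimension at least 3 have fillers: smooth families of
such horns have smooth fillers locally (`kan_hasPlotFillers`). Transport of germs is transport in
smooth families, which makes the bijection above a diffeomorphism.

**Manifolds.** Between spaces with charts, a smooth map is a submersion if and only if plots lift
locally through every given point (`LocSubd.isSubmersion`, `IsSubmersion.locSubd`). Fibre products
along submersions are manifolds (`IsFibreProduct.isSmoothManifold`); charts of fibre products, and
those of `τ₂(Kan(W))`, come from smooth local retractions of Euclidean spaces
(`exists_chart_of_retract`).
-/

namespace LieKan

/-! ### Local smoothness -/

/-- The model spaces of diffeology. -/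
abbrev Euc (n : ℕ) : Type := EuclideanSpace ℝ (Fin n)

/-- Every neighbourhood of the origin contains the image of a smooth self-map of the whole space
which is the identity near the origin. It turns local plots into plots with the same germ. -/
lemma exists_squash {d : ℕ} {s : Set (Euc d)} (hs : s ∈ 𝓝 (0 : Euc d)) :
    ∃ ρ : Euc d → Euc d, ContDiff ℝ ∞ ρ ∧ ρ =ᶠ[𝓝 0] id ∧ ∀ u, ρ u ∈ s := by
  obtain ⟨ε, hε, hεs⟩ := Metric.mem_nhds_iff.1 hs
  let χ : ContDiffBump (0 : Euc d) := ⟨ε / 2, ε, by positivity, by linarith⟩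
  refine ⟨fun u => χ u • u, χ.contDiff.smul contDiff_id, ?_, fun u => hεs ?_⟩
  · filter_upwards [χ.eventuallyEq_one] with u hu
    simp [hu]
  · by_cases hu : u ∈ Metric.ball (0 : Euc d) ε
    · rw [mem_ball_zero_iff] at hu ⊢
      calc ‖χ u • u‖ = χ u * ‖u‖ := by rw [norm_smul, Real.norm_of_nonneg χ.nonneg]
        _ ≤ 1 * ‖u‖ := by gcongr; exact χ.le_one
        _ < ε := by simpa using hu
    · have : χ u = 0 := by
        have h := χ.support_eq
        by_contra h0
        exact hu (by have : u ∈ Function.support χ := h0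
                     rwa [h] at this)
      simpa [this] using hε

lemma tendsto_add_neg {d : ℕ} (x : Euc d) :
    Filter.Tendsto (fun u : Euc d => u + -x) (𝓝 x) (𝓝 0) := by
  have h : Continuous fun u : Euc d => u + -x := by fun_prop
  simpa using h.tendsto x

section

variable {X : Type u} {Y : Type v} {Z : Type w} [DiffeologicalSpace X] [DiffeologicalSpace Y]
  [DiffeologicalSpace Z]

lemma isPlot_translate {d : ℕ} {p : Euc d → X} (hp : IsPlot p) (c : Euc d) :
    IsPlot fun u => p (u + c) :=
  isPlot_reparam hp (contDiff_id.add contDiff_const)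

lemma isPlot_of_locally {d : ℕ} {p : Euc d → X}
    (h : ∀ x, ∃ q : Euc d → X, IsPlot q ∧ p =ᶠ[𝓝 x] q) : IsPlot p := by
  refine DiffeologicalSpace.locality fun x => ?_
  obtain ⟨q, hq, hpq⟩ := h x
  obtain ⟨s, hs, hso, hxs⟩ := eventually_nhds_iff.1 hpq
  refine ⟨s, hso, hxs, fun {m f} hf hfs => ?_⟩
  have : p ∘ f = q ∘ f := funext fun y => hs _ (hf y)
  rw [this]
  exact isPlot_reparam hq hfs

/-- `f` is smooth at `x`: it maps germs of plots at `x` to germs of plots. -/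
def SmAt (f : X → Y) (x : X) : Prop :=
  ∀ ⦃d : ℕ⦄ (p : Euc d → X), IsPlot p → p 0 = x → ∃ q : Euc d → Y, IsPlot q ∧ f ∘ p =ᶠ[𝓝 0] q

lemma smAt_of_dSmooth {f : X → Y} (hf : DSmooth f) (x : X) : SmAt f x :=
  fun _ p hp _ => ⟨_, hf _ p hp, .rfl⟩

lemma dSmooth_of_smAt {f : X → Y} (hf : ∀ x, SmAt f x) : DSmooth f := by
  intro d p hp
  refine isPlot_of_locally fun x => ?_
  obtain ⟨q, hq, hpq⟩ := hf (p x) (fun u => p (u + x)) (isPlot_translate hp x) (by simp)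
  refine ⟨fun u => q (u + -x), isPlot_translate hq _, ?_⟩
  have := tendsto_add_neg x
  filter_upwards [this.eventually hpq] with u hu
  simpa using hu

lemma SmAt.comp {f : X → Y} {g : Y → Z} {x : X} (hg : SmAt g (f x)) (hf : SmAt f x) :
    SmAt (g ∘ f) x := by
  intro d p hp hx
  obtain ⟨q, hq, hpq⟩ := hf p hp hx
  obtain ⟨r, hr, hqr⟩ := hg q hq (by rw [← hpq.self_of_nhds, Function.comp_apply, hx])
  exact ⟨r, hr, by filter_upwards [hpq, hqr] with u h1 h2; simp_all⟩

/-- The filter of neighbourhoods of `x` in the D-topology. -/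
def dNhds (x : X) : Filter X := @nhds X dTopology x

lemma eventually_dNhds_iff {x : X} {P : X → Prop} :
    (∀ᶠ y in dNhds x, P y) ↔ ∃ t : Set X, (∀ y ∈ t, P y) ∧ IsOpen[dTopology] t ∧ x ∈ t :=
  @eventually_nhds_iff X dTopology x P

lemma eventually_eventually_dNhds {x : X} {P : X → Prop} (h : ∀ᶠ y in dNhds x, P y) :
    ∀ᶠ y in dNhds x, ∀ᶠ z in dNhds y, P z :=
  (@eventually_eventually_nhds X dTopology x P).2 h

lemma self_of_dNhds {x : X} {P : X → Prop} (h : ∀ᶠ y in dNhds x, P y) : P x :=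
  @Filter.Eventually.self_of_nhds X dTopology x P h

lemma eventually_mem_of_isOpen {V : Set X} (hV : IsOpen[dTopology] V) {x : X} (hx : x ∈ V) :
    ∀ᶠ y in dNhds x, y ∈ V :=
  eventually_dNhds_iff.2 ⟨V, fun _ => id, hV, hx⟩

lemma DSmooth.tendsto_dNhds {f : X → Y} (hf : DSmooth f) (x : X) :
    Filter.Tendsto f (dNhds x) (dNhds (f x)) :=
  @Continuous.tendsto X Y dTopology dTopology f hf.continuous x

lemma IsPlot.tendsto_dNhds {d : ℕ} {p : Euc d → X} (hp : IsPlot p) (x : Euc d) :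
    Filter.Tendsto p (𝓝 x) (dNhds (p x)) :=
  @Continuous.tendsto _ X _ dTopology p hp.continuous x

/-- A set is open in the D-topology when no germ of a plot can leave it instantly. -/
lemma isOpen_dTopology_of_germ {V : Set X}
    (h : ∀ (d : ℕ) (p : Euc d → X), IsPlot p → p 0 ∈ V → ∀ᶠ u in 𝓝 0, p u ∈ V) :
    IsOpen[dTopology] V := by
  rw [isOpen_iff_preimages_plots]
  intro d p hp
  rw [isOpen_iff_mem_nhds]
  intro x hx
  have := h d (fun u => p (u + x)) (isPlot_translate hp x) (by simpa using hx)
  have ht := tendsto_add_neg x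
  filter_upwards [ht.eventually this] with u hu
  simpa using hu

lemma tendsto_dNhds_of_smAt {f : X → Y} {x : X} (hf : ∀ᶠ y in dNhds x, SmAt f y) :
    Filter.Tendsto f (dNhds x) (dNhds (f x)) := by
  obtain ⟨U, hU, hUo, hxU⟩ := eventually_dNhds_iff.1 hf
  intro s hs
  obtain ⟨V, hVs, hVo, hxV⟩ := eventually_dNhds_iff.1 hs
  refine eventually_dNhds_iff.2 ⟨U ∩ f ⁻¹' V, fun y hy => hVs _ hy.2, ?_, hxU, hxV⟩
  refine isOpen_dTopology_of_germ fun d p hp hp0 => ?_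
  obtain ⟨q, hq, hpq⟩ := hU _ hp0.1 p hp rfl
  have h1 := (IsPlot.tendsto_dNhds hp 0).eventually (eventually_mem_of_isOpen hUo hp0.1)
  have hq0 : q 0 = f (p 0) := hpq.self_of_nhds.symm
  have h2 := (IsPlot.tendsto_dNhds hq 0).eventually
    (eventually_mem_of_isOpen hVo (show q 0 ∈ V from hq0 ▸ hp0.2))
  filter_upwards [h1, h2, hpq] with u hu1 hu2 hu3
  exact ⟨hu1, by rw [Set.mem_preimage, ← Function.comp_apply (f := f), hu3]; exact hu2⟩

/-- A map which is smooth on an open subset of a Euclidean space is smooth at its points. -/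
lemma smAt_of_contDiffOn {m n : ℕ} {f : Euc m → Euc n} {x : Euc m} {s : Set (Euc m)}
    (hs : s ∈ 𝓝 x) (hf : ContDiffOn ℝ ∞ f s) : SmAt f x := by
  intro d p hp hx
  have hs' : (fun u => p u) ⁻¹' interior s ∈ 𝓝 (0 : Euc d) :=
    hp.contDiff.continuous.continuousAt.preimage_mem_nhds
      (hx ▸ isOpen_interior.mem_nhds (mem_interior_iff_mem_nhds.2 hs))
  obtain ⟨ρ, hρ, hρ0, hρs⟩ := exists_squash hs'
  refine ⟨fun u => f (p (ρ u)), ContDiff.isPlot ?_, ?_⟩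
  · exact hf.comp_contDiff (hp.contDiff.comp hρ) fun u => interior_subset (hρs u)
  · filter_upwards [hρ0] with u hu
    simp [hu]

/-- Conversely, as the translations are plots, a map between Euclidean spaces which is smooth at a
point in the sense of germs is smooth there in the usual sense. -/
lemma contDiffAt_of_smAt {m n : ℕ} {f : Euc m → Euc n} {x : Euc m} (hf : SmAt f x) :
    ContDiffAt ℝ ∞ f x := by
  obtain ⟨q, hq, hfq⟩ := hf (fun u => u + x) (contDiff_id.add contDiff_const).isPlot (by simp)
  have ht := tendsto_add_neg x
  have h : f =ᶠ[𝓝 x] fun u => q (u + -x) := by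
    filter_upwards [ht.eventually hfq] with u hu
    simpa using hu
  exact ((isPlot_translate hq (-x)).contDiff.contDiffAt).congr_of_eventuallyEq h

end

/-! ### Plots of final diffeologies -/

/-- The diffeology of the maps which locally belong to a class `G` of maps closed under
reparametrisation. -/
@[reducible]
def localDiffeology {Y : Type u} (G : ∀ n : ℕ, Set (Euc n → Y)) (hc : ∀ n y, (fun _ => y) ∈ G n)
    (hr : ∀ (n m : ℕ) (p : Euc m → Y) (f : Euc n → Euc m), p ∈ G m → ContDiff ℝ ∞ f → p ∘ f ∈ G n) :
    DiffeologicalSpace Y where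
  plots n := {p | ∀ x, ∃ q ∈ G n, p =ᶠ[𝓝 x] q}
  constant_plots y := fun _ => ⟨_, hc _ y, .rfl⟩
  plot_reparam {n m p f} hp hf := fun x => by
    obtain ⟨q, hq, h⟩ := hp (f x)
    exact ⟨q ∘ f, hr _ _ q f hq hf, hf.continuous.continuousAt.eventually h⟩
  locality {n p} hp := fun x => by
    -- squash the whole space into `s` without changing the germ at `x`
    obtain ⟨s, hs, hxs, h⟩ := hp x
    have hsx : (fun u => u + x) ⁻¹' s ∈ 𝓝 (0 : Euc n) :=
      (continuous_id.add continuous_const).continuousAt.preimage_mem_nhds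
        (by simpa using hs.mem_nhds hxs)
    obtain ⟨ρ, hρ, hρ0, hρs⟩ := exists_squash hsx
    have hf : ContDiff ℝ ∞ fun u => ρ (u + -x) + x :=
      (hρ.comp (contDiff_id.add contDiff_const)).add contDiff_const
    obtain ⟨q, hq, hpq⟩ := h (fun u => hρs (u + -x)) hf x
    refine ⟨q, hq, ?_⟩
    have ht := tendsto_add_neg x
    filter_upwards [hpq, ht.eventually hρ0] with u h1 h2
    rw [← h1]
    simp [h2]

/-- Near every point a plot of a final diffeology lifts to a plot of one of the spaces that
generate it. -/
lemma exists_lift_of_isPlot_final {ι : Type v} {A : ι → Type w} {Y : Type u}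
    [∀ i, DiffeologicalSpace (A i)] (f : ∀ i, A i → Y) (hf : ∀ y, ∃ i a, f i a = y) {n : ℕ}
    {p : Euc n → Y} (hp : @IsPlot Y (finalDiffeology f) n p) (x : Euc n) :
    ∃ (i : ι) (q : Euc n → A i), IsPlot q ∧ p =ᶠ[𝓝 x] fun u => f i (q u) := by
  -- the maps that lift locally are the plots of a diffeology containing the generating plots
  let G : ∀ n : ℕ, Set (Euc n → Y) := fun n =>
    {p | ∃ (i : ι) (q : Euc n → A i), IsPlot q ∧ p = fun u => f i (q u)}
  have hle : finalDiffeology f ≤ localDiffeology G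
      (fun n y => by
        obtain ⟨i, a, rfl⟩ := hf y
        exact ⟨i, fun _ => a, isPlot_const, rfl⟩)
      (by
        rintro n m _ g ⟨i, q, hq, rfl⟩ hg
        exact ⟨i, q ∘ g, isPlot_reparam hq hg, rfl⟩) := by
    rw [finalDiffeology, DiffeologicalSpace.generateFrom_le_iff]
    intro n p hp x
    obtain ⟨i, q, hq, hqp⟩ : ∃ (i : ι) (q : Euc n → A i), IsPlot q ∧ p = fun x => f i (q x) := hp
    exact ⟨_, ⟨i, q, hq, rfl⟩, hqp ▸ .rfl⟩
  obtain ⟨_, ⟨i, q, hq, rfl⟩, h⟩ := DiffeologicalSpace.le_iff'.1 hle n p hp x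
  exact ⟨i, q, hq, h⟩

/-- The same for the join of two final diffeologies, as it occurs in push-outs. -/
lemma exists_lift_of_isPlot_sup {ι ι' : Type*} {A : ι → Type*} {A' : ι' → Type*} {Y : Type u}
    [∀ i, DiffeologicalSpace (A i)] [∀ i, DiffeologicalSpace (A' i)] (f : ∀ i, A i → Y)
    (f' : ∀ i, A' i → Y) (hf : ∀ y, (∃ i a, f i a = y) ∨ ∃ i a, f' i a = y) {n : ℕ}
    {p : Euc n → Y} (hp : @IsPlot Y (finalDiffeology f ⊔ finalDiffeology f') n p) (x : Euc n) :
    (∃ (i : ι) (q : Euc n → A i), IsPlot q ∧ p =ᶠ[𝓝 x] fun u => f i (q u)) ∨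
    ∃ (i : ι') (q : Euc n → A' i), IsPlot q ∧ p =ᶠ[𝓝 x] fun u => f' i (q u) := by
  let G : ∀ n : ℕ, Set (Euc n → Y) := fun n =>
    {p | (∃ (i : ι) (q : Euc n → A i), IsPlot q ∧ p = fun u => f i (q u)) ∨
      ∃ (i : ι') (q : Euc n → A' i), IsPlot q ∧ p = fun u => f' i (q u)}
  have hle : finalDiffeology f ⊔ finalDiffeology f' ≤ localDiffeology G
      (fun n y => by
        obtain ⟨i, a, rfl⟩ | ⟨i, a, rfl⟩ := hf y
        · exact Or.inl ⟨i, fun _ => a, isPlot_const, rfl⟩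
        · exact Or.inr ⟨i, fun _ => a, isPlot_const, rfl⟩)
      (by
        rintro n m _ g (⟨i, q, hq, rfl⟩ | ⟨i, q, hq, rfl⟩) hg
        · exact Or.inl ⟨i, q ∘ g, isPlot_reparam hq hg, rfl⟩
        · exact Or.inr ⟨i, q ∘ g, isPlot_reparam hq hg, rfl⟩) := by
    refine sup_le ?_ ?_ <;> rw [finalDiffeology, DiffeologicalSpace.generateFrom_le_iff] <;>
      intro n p hp x
    · obtain ⟨i, q, hq, hqp⟩ : ∃ (i : ι) (q : Euc n → A i), IsPlot q ∧ p = fun x => f i (q x) := hp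
      exact ⟨_, Or.inl ⟨i, q, hq, rfl⟩, hqp ▸ .rfl⟩
    · obtain ⟨i, q, hq, hqp⟩ :
        ∃ (i : ι') (q : Euc n → A' i), IsPlot q ∧ p = fun x => f' i (q x) := hp
      exact ⟨_, Or.inr ⟨i, q, hq, rfl⟩, hqp ▸ .rfl⟩
  obtain ⟨_, ⟨i, q, hq, rfl⟩ | ⟨i, q, hq, rfl⟩, h⟩ := DiffeologicalSpace.le_iff'.1 hle n p hp x
  · exact Or.inl ⟨i, q, hq, h⟩
  · exact Or.inr ⟨i, q, hq, h⟩

/-! ### Charts -/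

/-- Every point lies in a chart. -/
def HasCharts (X : Type u) [DiffeologicalSpace X] : Prop :=
  ∀ x : X, ∃ (n : ℕ) (φ : Euc n → X), IsChart φ ∧ x ∈ Set.range φ

lemma IsSmoothManifold.hasCharts {X : Type u} [DiffeologicalSpace X] (h : IsSmoothManifold X) :
    HasCharts X := h.exists_chart

section

variable {X : Type u} {Y : Type v} {Z : Type w} [DiffeologicalSpace X] [DiffeologicalSpace Y]
  [DiffeologicalSpace Z]

lemma IsChart.invFun_apply {n : ℕ} {φ : Euc n → X} (hφ : IsChart φ) (v : Euc n) :
    Function.invFun φ (φ v) = v :=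
  Function.leftInverse_invFun hφ.injective v

lemma IsChart.eventually_mem_range {n : ℕ} {φ : Euc n → X} (hφ : IsChart φ) {x : X}
    (hx : x ∈ Set.range φ) : ∀ᶠ y in dNhds x, y ∈ Set.range φ :=
  eventually_mem_of_isOpen hφ.isOpen_range hx

lemma IsChart.smAt_invFun {n : ℕ} {φ : Euc n → X} (hφ : IsChart φ) {x : X}
    (hx : x ∈ Set.range φ) : SmAt (Function.invFun φ) x := by
  intro d p hp hpx
  have h := (IsPlot.tendsto_dNhds hp 0).eventually (hφ.eventually_mem_range (hpx ▸ hx))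
  obtain ⟨ρ, hρ, hρ0, hρs⟩ := exists_squash h
  refine ⟨fun u => Function.invFun φ (p (ρ u)), ContDiff.isPlot ?_, ?_⟩
  · refine hφ.contDiff_of_isPlot _ ?_
    have : (fun u => φ (Function.invFun φ (p (ρ u)))) = p ∘ ρ :=
      funext fun u => Function.invFun_eq (hρs u)
    rw [this]
    exact isPlot_reparam hp hρ
  · filter_upwards [hρ0] with u hu
    simp [hu]

lemma IsChart.eventually_smAt_invFun {n : ℕ} {φ : Euc n → X} (hφ : IsChart φ) {x : X}
    (hx : x ∈ Set.range φ) : ∀ᶠ y in dNhds x, SmAt (Function.invFun φ) y :=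
  (hφ.eventually_mem_range hx).mono fun _ => hφ.smAt_invFun

lemma IsChart.tendsto_invFun {n : ℕ} {φ : Euc n → X} (hφ : IsChart φ) {x : X}
    (hx : x ∈ Set.range φ) :
    Filter.Tendsto (Function.invFun φ) (dNhds x) (𝓝 (Function.invFun φ x)) :=
  tendsto_dNhds_of_smAt (hφ.eventually_smAt_invFun hx)

/-- A local diffeomorphism between a Euclidean space and `X`, given by a pair of partially inverse
and partially smooth maps, yields a chart (defined on the whole Euclidean space), whose range may be
made as small as desired. -/
lemma exists_chart_of_local {n : ℕ} (c : Euc n → X) (s : X → Euc n) (t₀ : Euc n)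
    (hc : ∀ᶠ t in 𝓝 t₀, SmAt c t ∧ s (c t) = t)
    (hs : ∀ᶠ y in dNhds (c t₀), SmAt s y ∧ c (s y) = y) {P : X → Prop}
    (hP : ∀ᶠ y in dNhds (c t₀), P y) :
    ∃ φ : Euc n → X, IsChart φ ∧ φ 0 = c t₀ ∧ ∀ t, P (φ t) := by
  have hct : Filter.Tendsto c (𝓝 t₀) (dNhds (c t₀)) :=
    tendsto_dNhds_of_smAt (x := t₀) (hc.mono fun _ h => h.1)
  have hall : ∀ᶠ t in 𝓝 t₀, (SmAt c t ∧ s (c t) = t) ∧ P (c t) ∧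
      ∀ᶠ y in dNhds (c t), SmAt s y ∧ c (s y) = y :=
    hc.and ((hct.eventually hP).and (hct.eventually (eventually_eventually_dNhds hs)))
  -- restrict to a ball on which everything holds, and identify the ball with the whole space
  obtain ⟨ε, hε, hB⟩ := Metric.eventually_nhds_iff_ball.1 hall
  let b := OpenPartialHomeomorph.univBall t₀ ε
  have hbt : b.target = Metric.ball t₀ ε := OpenPartialHomeomorph.univBall_target t₀ hε
  have hbs : b.source = Set.univ := OpenPartialHomeomorph.univBall_source t₀ ε
  have hb : ∀ t, b t ∈ Metric.ball t₀ ε := fun t => by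
    rw [← hbt]
    exact b.map_source (by rw [hbs]; trivial)
  have hinv : ∀ t, b.symm (b t) = t := fun t => b.left_inv (by rw [hbs]; trivial)
  have hb0 : b 0 = t₀ := OpenPartialHomeomorph.univBall_apply_zero t₀ ε
  have hbc : ContDiff ℝ ∞ b := OpenPartialHomeomorph.contDiff_univBall
  refine ⟨fun t => c (b t), ⟨?_, ?_, ?_, ?_⟩, by simp [hb0], fun t => (hB _ (hb t)).2.1⟩
  · intro t t' h
    have h' := congrArg s h
    simp only [(hB _ (hb _)).1.2] at h'
    rw [← hinv t, h', hinv]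
  · exact (dSmooth_of_smAt fun t => SmAt.comp (hB _ (hb t)).1.1
      (smAt_of_dSmooth hbc.dSmooth t)).isPlot
  · refine isOpen_dTopology_of_germ fun d p hp hp0 => ?_
    obtain ⟨t, ht⟩ := hp0
    have h1 : ∀ᶠ y in dNhds (p 0), SmAt s y ∧ c (s y) = y := ht ▸ (hB _ (hb t)).2.2
    have h2 : Filter.Tendsto s (dNhds (p 0)) (𝓝 (s (p 0))) :=
      tendsto_dNhds_of_smAt (h1.mono fun _ h => h.1)
    have h3 : s (p 0) ∈ Metric.ball t₀ ε := by
      rw [← ht, (hB _ (hb t)).1.2]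
      exact hb t
    have h4 := h2.eventually (Metric.isOpen_ball.mem_nhds h3)
    filter_upwards [(IsPlot.tendsto_dNhds hp 0).eventually (h1.and h4)] with u hu
    refine ⟨b.symm (s (p u)), ?_⟩
    change c (b (b.symm (s (p u)))) = p u
    rw [b.right_inv (by rw [hbt]; exact hu.2), hu.1.2]
  · intro m q hq
    have h1 : ContDiff ℝ ∞ fun x => b (q x) := by
      have h : DSmooth (s ∘ fun x => c (b (q x))) := dSmooth_of_smAt fun x =>
        SmAt.comp (self_of_dNhds (hB _ (hb (q x))).2.2).1 (smAt_of_dSmooth hq.dSmooth x)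
      have : (s ∘ fun x => c (b (q x))) = fun x => b (q x) :=
        funext fun x => (hB _ (hb (q x))).1.2
      rw [this] at h
      exact h.contDiff
    have h2 : q = fun x => b.symm (b (q x)) := funext fun x => (hinv _).symm
    rw [h2]
    exact OpenPartialHomeomorph.contDiffOn_univBall_symm.comp_contDiff h1 fun x => hb _

/-- A chart centred at a given point, with range in a given neighbourhood. -/
lemma HasCharts.exists_chart_at (h : HasCharts X) (x : X) {P : X → Prop}
    (hP : ∀ᶠ y in dNhds x, P y) :
    ∃ (n : ℕ) (φ : Euc n → X), IsChart φ ∧ φ 0 = x ∧ ∀ t, P (φ t) := by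
  obtain ⟨n, φ, hφ, t₀, rfl⟩ := h x
  obtain ⟨ψ, hψ⟩ := exists_chart_of_local φ (Function.invFun φ) t₀
    (.of_forall fun t => ⟨smAt_of_dSmooth hφ.isPlot.dSmooth t, hφ.invFun_apply t⟩)
    ((hφ.eventually_mem_range ⟨t₀, rfl⟩).mono fun y hy => ⟨hφ.smAt_invFun hy,
      Function.invFun_eq hy⟩) hP
  exact ⟨n, ψ, hψ⟩

lemma HasCharts.exists_chart_centred (h : HasCharts X) (x : X) :
    ∃ (n : ℕ) (φ : Euc n → X), IsChart φ ∧ φ 0 = x := by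
  obtain ⟨n, φ, hφ, h0, -⟩ := h.exists_chart_at x (P := fun _ => True) (.of_forall fun _ => trivial)
  exact ⟨n, φ, hφ, h0⟩

/-! ### Local inverses -/

/-- The inverse function theorem, with smoothness of the inverse on an open set. -/
lemma exists_local_inverse {n : ℕ} {f : Euc n → Euc n} {a : Euc n}
    (hf : ∀ᶠ x in 𝓝 a, ContDiffAt ℝ ∞ f x)
    (hf' : fderiv ℝ f a = ContinuousLinearMap.id ℝ (Euc n)) :
    ∃ g : Euc n → Euc n, (∀ᶠ y in 𝓝 (f a), SmAt g y ∧ f (g y) = y) ∧ g (f a) = a ∧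
      ∀ᶠ x in 𝓝 a, g (f x) = x := by
  have ha := hf.self_of_nhds
  have hd : HasFDerivAt f ((ContinuousLinearEquiv.refl ℝ (Euc n) : Euc n ≃L[ℝ] Euc n) :
      Euc n →L[ℝ] Euc n) a := by
    have := (ha.differentiableAt (by simp)).hasFDerivAt
    rw [hf'] at this
    exact this
  let Φ := ha.toOpenPartialHomeomorph f hd (by simp)
  have haΦ : a ∈ Φ.source := ha.mem_toOpenPartialHomeomorph_source hd (by simp)
  have hcoe : (Φ : Euc n → Euc n) = f := ha.toOpenPartialHomeomorph_coe hd (by simp)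
  have hfa : f a ∈ Φ.target := by
    rw [← hcoe]
    exact Φ.map_source haΦ
  have hga : Φ.symm (f a) = a := by
    rw [← hcoe]
    exact Φ.left_inv haΦ
  -- near `a` the derivative stays invertible, so the inverse is smooth on a neighbourhood
  have hcont : ContinuousAt (fderiv ℝ f) a := (ha.fderiv_right (m := 0) (by simp)).continuousAt
  have hinv : ∀ᶠ x in 𝓝 a, ∃ e : Euc n ≃L[ℝ] Euc n, (e : Euc n →L[ℝ] Euc n) = fderiv ℝ f x := by
    have := (ContinuousLinearEquiv.nhds (𝕜 := ℝ) (ContinuousLinearEquiv.refl ℝ (Euc n)))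
    have h2 : Set.range ((↑) : (Euc n ≃L[ℝ] Euc n) → Euc n →L[ℝ] Euc n) ∈ 𝓝 (fderiv ℝ f a) := by
      rw [hf']
      exact this
    exact hcont.eventually h2
  have hsymm : ContinuousAt Φ.symm (f a) := Φ.continuousAt_symm hfa
  have hall : ∀ᶠ y in 𝓝 (f a), ContDiffAt ℝ ∞ Φ.symm y := by
    have h1 := hsymm.eventually (hga.symm ▸ hinv.and hf)
    filter_upwards [h1, Φ.open_target.mem_nhds hfa] with y hy hyt
    obtain ⟨⟨e, he⟩, hy2⟩ := hy
    refine Φ.contDiffAt_symm (f₀' := e) hyt ?_ ?_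
    · rw [hcoe, he]
      exact (hy2.differentiableAt (by simp)).hasFDerivAt
    · rw [hcoe]
      exact hy2
  refine ⟨Φ.symm, ?_, hga, ?_⟩
  · obtain ⟨t, ht, hto, hat⟩ := eventually_nhds_iff.1 hall
    filter_upwards [hto.mem_nhds hat, Φ.open_target.mem_nhds hfa] with y hy hyt
    refine ⟨smAt_of_contDiffOn (hto.mem_nhds hy) fun z hz => (ht z hz).contDiffWithinAt, ?_⟩
    rw [← hcoe]
    exact Φ.right_inv hyt
  · filter_upwards [Φ.open_source.mem_nhds haΦ] with x hx
    rw [← hcoe]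
    exact Φ.left_inv hx

lemma eventually_contDiffAt_of_smAt {m n : ℕ} {f : Euc m → Euc n} {a : Euc m}
    (h : ∀ᶠ x in 𝓝 a, SmAt f x) : ∀ᶠ x in 𝓝 a, ContDiffAt ℝ ∞ f x :=
  h.mono fun _ => contDiffAt_of_smAt

/-- A space which is locally a smooth retract of a Euclidean space has charts: the image of a
smooth idempotent map is a submanifold. -/
lemma exists_chart_of_retract {n : ℕ} {x : X} (s : X → Euc n) (r : Euc n → X)
    (hs : ∀ᶠ y in dNhds x, SmAt s y) (hr : ∀ᶠ v in 𝓝 (s x), SmAt r v)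
    (hrs : ∀ᶠ y in dNhds x, r (s y) = y) :
    ∃ (m : ℕ) (φ : Euc m → X), IsChart φ ∧ x ∈ Set.range φ := by
  set a := s x with ha
  have hra : r a = x := self_of_dNhds (P := fun y => r (s y) = y) hrs
  have hrt : Filter.Tendsto r (𝓝 a) (dNhds x) := by
    have := tendsto_dNhds_of_smAt (x := a) hr
    rwa [hra] at this
  have hst : Filter.Tendsto s (dNhds x) (𝓝 a) := tendsto_dNhds_of_smAt hs
  let ρ : Euc n → Euc n := fun v => s (r v)
  have hρa : ρ a = a := congrArg s hra
  have hρsm : ∀ᶠ v in 𝓝 a, SmAt ρ v := by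
    filter_upwards [hr, hrt.eventually hs] with v h1 h2 using SmAt.comp h2 h1
  have hρρ : ∀ᶠ v in 𝓝 a, ρ (ρ v) = ρ v := by
    filter_upwards [hrt.eventually hrs] with v h
    exact congrArg s h
  have hρc := eventually_contDiffAt_of_smAt hρsm
  have hρd : HasFDerivAt ρ (fderiv ℝ ρ a) a :=
    (hρc.self_of_nhds.differentiableAt (by simp)).hasFDerivAt
  set P := fderiv ℝ ρ a with hP
  have hPP : P.comp P = P := by
    have h1 : HasFDerivAt (ρ ∘ ρ) (P.comp P) a := HasFDerivAt.comp a (hρa.symm ▸ hρd) hρd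
    have h2 : HasFDerivAt (ρ ∘ ρ) P a := hρd.congr_of_eventuallyEq hρρ
    exact h1.unique h2
  have hPP' : ∀ v, P (P v) = P v := fun v => DFunLike.congr_fun hPP v
  -- `f` straightens `ρ`: its derivative at `a` is the identity, and it carries the fixed points of
  -- `ρ` near `a` to the range of `P`
  let f : Euc n → Euc n := fun v => P (ρ v - a) + ((v - ρ v) - P (v - ρ v))
  have hfa : f a = 0 := by simp [f, hρa]
  have hfc : ∀ᶠ v in 𝓝 a, ContDiffAt ℝ ∞ f v := by
    filter_upwards [hρc] with v hv
    exact (P.contDiff.contDiffAt.comp v (hv.sub contDiffAt_const)).add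
      ((contDiffAt_id.sub hv).sub (P.contDiff.contDiffAt.comp v (contDiffAt_id.sub hv)))
  have hfd : fderiv ℝ f a = ContinuousLinearMap.id ℝ (Euc n) := by
    have hid := hasFDerivAt_id (𝕜 := ℝ) a
    have h : HasFDerivAt f (P.comp P + ((ContinuousLinearMap.id ℝ (Euc n) - P) -
        P.comp (ContinuousLinearMap.id ℝ (Euc n) - P))) a :=
      (P.hasFDerivAt.comp a (hρd.sub_const a)).add
        ((hid.sub hρd).sub (P.hasFDerivAt.comp a (hid.sub hρd)))
    rw [h.fderiv, ContinuousLinearMap.comp_sub, hPP]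
    ext v
    simp
  obtain ⟨g, hg, hga, hgf⟩ := exists_local_inverse hfc hfd
  rw [hfa] at hg hga
  -- coordinates on the range of the derivative
  let R := LinearMap.range (P : Euc n →ₗ[ℝ] Euc n)
  let L : R ≃L[ℝ] Euc (Module.finrank ℝ R) := toEuclidean
  let ι : Euc (Module.finrank ℝ R) →L[ℝ] Euc n :=
    R.subtypeL.comp (L.symm : Euc (Module.finrank ℝ R) →L[ℝ] R)
  let π : Euc n →L[ℝ] Euc (Module.finrank ℝ R) :=
    (L : R →L[ℝ] Euc (Module.finrank ℝ R)).comp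
      ((P : Euc n →L[ℝ] Euc n).codRestrict R fun v => ⟨v, rfl⟩)
  have hPι : ∀ t, P (ι t) = ι t := by
    intro t
    obtain ⟨v, hv⟩ := (L.symm t).2
    change P ((L.symm t : R) : Euc n) = ((L.symm t : R) : Euc n)
    rw [← hv]
    exact hPP' v
  have hπι : ∀ t, π (ι t) = t := by
    intro t
    have : ((P : Euc n →L[ℝ] Euc n).codRestrict R (fun v => ⟨v, rfl⟩)) (ι t) = L.symm t :=
      Subtype.ext (hPι t)
    exact (congrArg L this).trans (L.apply_symm_apply t)
  have hιπ : ∀ v, ι (π v) = P v := by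
    intro v
    change ((L.symm (L _) : R) : Euc n) = P v
    rw [L.symm_apply_apply]
    rfl
  have hιt : Filter.Tendsto ι (𝓝 0) (𝓝 0) := by
    simpa using ι.continuous.tendsto 0
  have hgt : Filter.Tendsto g (𝓝 0) (𝓝 a) := by
    have := tendsto_dNhds_of_smAt (x := (0 : Euc n)) (f := g) (hg.mono fun _ h => h.1)
    rwa [hga] at this
  -- on the zero set of `(1 - P) ∘ f` the map `f` does not distinguish `v` and `ρ v`
  have hkey : ∀ᶠ v in 𝓝 a, P (f v) = f v → P (f (ρ v)) = f v := by
    filter_upwards [hρρ] with v hv hPv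
    have h1 : f (ρ v) = P (ρ v - a) := by simp [f, hv]
    have h2 : P (f v) = P (ρ v - a) := by
      simp only [f, map_add, map_sub, hPP']
      abel
    rw [h1, ← h2, hPP', hPv]
  have hx0 : r (g (ι 0)) = x := by simp [hga, hra]
  have hc : ∀ᶠ t in 𝓝 0, SmAt (fun t => r (g (ι t))) t ∧ π (f (s (r (g (ι t))))) = t := by
    filter_upwards [hιt.eventually hg, hιt.eventually (hgt.eventually hkey),
      hιt.eventually (hgt.eventually hr)] with t h1 h2 h3
    refine ⟨(SmAt.comp h3 h1.1).comp (smAt_of_dSmooth ι.contDiff.dSmooth t), ?_⟩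
    rw [h1.2, hPι] at h2
    have h4 := h2 rfl
    change π (f (ρ (g (ι t)))) = t
    have h5 : ι (π (f (ρ (g (ι t))))) = ι t := by rw [hιπ, h4]
    rw [← hπι (π (f (ρ (g (ι t))))), h5, hπι]
  have hsc : ∀ᶠ y in dNhds x, SmAt (fun y => π (f (s y))) y ∧ r (g (ι (π (f (s y))))) = y := by
    have hfsm : ∀ᶠ v in 𝓝 a, SmAt f v := by
      obtain ⟨t, ht, hto, hat⟩ := eventually_nhds_iff.1 hfc
      filter_upwards [hto.mem_nhds hat] with y hy
      exact smAt_of_contDiffOn (hto.mem_nhds hy) fun z hz => (ht z hz).contDiffWithinAt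
    filter_upwards [hs, hst.eventually hfsm, hrs, hst.eventually hgf] with y h1 h2 h3 h4
    refine ⟨SmAt.comp (f := f ∘ s) (smAt_of_dSmooth π.contDiff.dSmooth _)
      (SmAt.comp (g := f) (f := s) h2 h1), ?_⟩
    have h5 : ρ (s y) = s y := congrArg s h3
    have h6 : f (s y) = P (s y - a) := by simp [f, h5]
    rw [hιπ, h6, hPP', ← h6, h4, h3]
  obtain ⟨φ, hφ, hφ0, -⟩ := exists_chart_of_local (X := X) (P := fun _ => True)
    (fun t => r (g (ι t))) (fun y => π (f (s y))) 0 hc (by rw [hx0]; exact hsc)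
    (.of_forall fun _ => trivial)
  exact ⟨_, φ, hφ, 0, by rw [hφ0, hx0]⟩

end

/-! ### Submersions and local subductions -/

/-- A local subduction: through every point of the source, plots of the target lift as germs. For
manifolds these are the submersions, but the notion is stable under composition and base change
without any manifold structure being at hand. -/
structure LocSubd {X : Type u} {Y : Type v} [DiffeologicalSpace X] [DiffeologicalSpace Y]
    (f : X → Y) : Prop where
  dSmooth : DSmooth f
  lift : ∀ (x : X) {d : ℕ} (p : Euc d → Y), IsPlot p → p 0 = f x →
    ∃ q : Euc d → X, IsPlot q ∧ q 0 = x ∧ f ∘ q =ᶠ[𝓝 0] p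

section

variable {X : Type u} {Y : Type v} {Z : Type w} [DiffeologicalSpace X] [DiffeologicalSpace Y]
  [DiffeologicalSpace Z]

lemma LocSubd.comp {f : X → Y} {g : Y → Z} (hg : LocSubd g) (hf : LocSubd f) :
    LocSubd (g ∘ f) where
  dSmooth := hg.dSmooth.comp hf.dSmooth
  lift x d p hp hpx := by
    obtain ⟨q, hq, hqx, hqp⟩ := hg.lift (f x) p hp hpx
    obtain ⟨r, hr, hrx, hrq⟩ := hf.lift x q hq hqx
    refine ⟨r, hr, hrx, ?_⟩
    filter_upwards [hqp, hrq] with u h1 h2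
    rw [← h1, Function.comp_apply, Function.comp_apply, Function.comp_apply, ← h2]
    rfl

lemma LocSubd.of_comp {f : X → Y} {g : Y → Z} (hf : DSmooth f) (hsurj : Function.Surjective f)
    (hg : DSmooth g) (h : LocSubd (g ∘ f)) : LocSubd g where
  dSmooth := hg
  lift y d p hp hpy := by
    obtain ⟨x, rfl⟩ := hsurj y
    obtain ⟨q, hq, hqx, hqp⟩ := h.lift x p hp hpy
    exact ⟨f ∘ q, hf _ _ hq, congrArg f hqx, hqp⟩

/-- A smooth bijection along which all germs of plots lift is a diffeomorphism. -/
lemma isDiffeomorphism_of_bijective {f : X → Y} (hf : DSmooth f) (hb : Function.Bijective f)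
    (h : ∀ {d : ℕ} (p : Euc d → Y), IsPlot p →
      ∃ q : Euc d → X, IsPlot q ∧ f ∘ q =ᶠ[𝓝 0] p) : IsDiffeomorphism f := by
  refine ⟨hf, Function.surjInv hb.2, ?_, Function.leftInverse_surjInv hb,
    Function.rightInverse_surjInv hb.2⟩
  refine dSmooth_of_smAt fun y d p hp _ => ?_
  obtain ⟨q, hq, hqp⟩ := h p hp
  refine ⟨q, hq, ?_⟩
  filter_upwards [hqp] with u hu
  rw [Function.comp_apply, ← hu]
  exact Function.leftInverse_surjInv hb _

lemma LocSubd.isDiffeomorphism {f : X → Y} (hf : LocSubd f) (hb : Function.Bijective f) :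
    IsDiffeomorphism f := by
  refine isDiffeomorphism_of_bijective hf.dSmooth hb fun {d} p hp => ?_
  obtain ⟨x, hx⟩ := hb.2 (p 0)
  obtain ⟨q, hq, -, h⟩ := hf.lift x p hp hx.symm
  exact ⟨q, hq, h⟩

lemma IsDiffeomorphism.bijective {f : X → Y} (hf : IsDiffeomorphism f) :
    Function.Bijective f := by
  obtain ⟨_, g, _, h1, h2⟩ := hf
  exact ⟨h1.injective, h2.surjective⟩

lemma IsDiffeomorphism.locSubd {f : X → Y} (hf : IsDiffeomorphism f) : LocSubd f := by
  obtain ⟨h, g, hg, h1, h2⟩ := hf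
  refine ⟨h, fun x d p hp hpx => ⟨g ∘ p, hg _ _ hp, ?_, .of_forall fun u => h2 _⟩⟩
  rw [Function.comp_apply, hpx, h1]

lemma LocSubd.isOpen_image {f : X → Y} (hf : LocSubd f) {V : Set X} (hV : IsOpen[dTopology] V) :
    IsOpen[dTopology] (f '' V) := by
  refine isOpen_dTopology_of_germ fun d p hp hp0 => ?_
  obtain ⟨x, hx, hpx⟩ := hp0
  obtain ⟨q, hq, hqx, hqp⟩ := hf.lift x p hp hpx.symm
  have := (IsPlot.tendsto_dNhds hq 0).eventually (eventually_mem_of_isOpen hV (hqx.symm ▸ hx))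
  filter_upwards [this, hqp] with u h1 h2
  exact ⟨q u, h1, h2⟩

lemma secondCountable_of_locSubd {f : X → Y} (hf : LocSubd f) (hsurj : Function.Surjective f)
    (h : @SecondCountableTopology X dTopology) : @SecondCountableTopology Y dTopology := by
  let : TopologicalSpace X := dTopology
  let : TopologicalSpace Y := dTopology
  have hc : Continuous f := hf.dSmooth.continuous
  have ho : IsOpenMap f := fun V hV => hf.isOpen_image hV
  exact (ho.isQuotientMap hc hsurj).secondCountableTopology ho

lemma t2_of_injective {f : X → Y} (hf : DSmooth f) (hinj : Function.Injective f)
    (h : @T2Space Y dTopology) : @T2Space X dTopology := by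
  let : TopologicalSpace X := dTopology
  let : TopologicalSpace Y := dTopology
  exact T2Space.of_injective_continuous hinj hf.continuous

/-- Between spaces with charts, local subductions are submersions; the converse is
`IsSubmersion.locSubd`. -/
lemma LocSubd.isSubmersion {f : X → Y} (hf : LocSubd f) (hX : HasCharts X) (hY : HasCharts Y) :
    IsSubmersion f := by
  refine ⟨hf.dSmooth, fun x => ?_⟩
  obtain ⟨n, ψ, hψ, hψ0⟩ := hY.exists_chart_centred (f x)
  have h1 : ∀ᶠ y in dNhds x, f y ∈ Set.range ψ := (DSmooth.tendsto_dNhds hf.dSmooth x).eventually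
    (hψ.eventually_mem_range ⟨0, hψ0⟩)
  obtain ⟨m, φ, hφ, hφ0, hφr⟩ := hX.exists_chart_at x h1
  have hg : ∀ y, f (φ y) = ψ (Function.invFun ψ (f (φ y))) :=
    fun y => (Function.invFun_eq (hφr y)).symm
  have hgc : ContDiff ℝ ∞ fun y => Function.invFun ψ (f (φ y)) := by
    refine hψ.contDiff_of_isPlot _ ?_
    have : (fun y => ψ (Function.invFun ψ (f (φ y)))) = f ∘ φ := funext fun y => (hg y).symm
    rw [this]
    exact hf.dSmooth _ _ hφ.isPlot
  refine ⟨m, n, φ, ψ, fun y => Function.invFun ψ (f (φ y)), 0, hφ, hψ, hφ0, hg, hgc, ?_⟩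
  -- a lift of the chart `ψ` provides a right inverse of the derivative
  obtain ⟨q, hq, hqx, hqψ⟩ := hf.lift x ψ hψ.isPlot hψ0
  obtain ⟨σ, hσ, hqσ⟩ := hφ.smAt_invFun (x := x) ⟨0, hφ0⟩ q hq hqx
  have hqr : ∀ᶠ u in 𝓝 0, q u ∈ Set.range φ := (IsPlot.tendsto_dNhds hq 0).eventually
    (hφ.eventually_mem_range ⟨0, by rw [hφ0, hqx]⟩)
  have hσ0 : σ 0 = 0 := by
    rw [← hqσ.self_of_nhds, Function.comp_apply, hqx, ← hφ0, hφ.invFun_apply]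
  have hid : (fun y => Function.invFun ψ (f (φ y))) ∘ σ =ᶠ[𝓝 0] id := by
    filter_upwards [hqψ, hqσ, hqr] with u h1 h2 h3
    have h4 : φ (σ u) = q u := by
      rw [← h2]
      exact Function.invFun_eq h3
    change Function.invFun ψ (f (φ (σ u))) = u
    rw [h4]
    exact (congrArg (Function.invFun ψ) h1).trans (hψ.invFun_apply u)
  have hd1 : HasFDerivAt (fun y => Function.invFun ψ (f (φ y)))
      (fderiv ℝ (fun y => Function.invFun ψ (f (φ y))) 0) (σ 0) := by
    rw [hσ0]
    exact (hgc.differentiable (by simp) 0).hasFDerivAt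
  have hd2 : HasFDerivAt σ (fderiv ℝ σ 0) 0 :=
    (hσ.contDiff.differentiable (by simp) 0).hasFDerivAt
  have h := ((hd1.comp 0 hd2).congr_of_eventuallyEq hid.symm).unique (hasFDerivAt_id 0)
  exact fun v => ⟨fderiv ℝ σ 0 v, DFunLike.congr_fun h v⟩

end

lemma eventually_smAt_of_contDiffAt {m n : ℕ} {f : Euc m → Euc n} {a : Euc m}
    (h : ∀ᶠ x in 𝓝 a, ContDiffAt ℝ ∞ f x) : ∀ᶠ x in 𝓝 a, SmAt f x := by
  obtain ⟨t, ht, hto, hat⟩ := eventually_nhds_iff.1 h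
  filter_upwards [hto.mem_nhds hat] with y hy
  exact smAt_of_contDiffOn (hto.mem_nhds hy) fun z hz => (ht z hz).contDiffWithinAt

/-- Local solutions of the equation `f x = y` for a submersion `f` near `x₀`: in charts, a solution
is `D (A η + B ξ + c)` if `η` are the coordinates of `y`; the parameter `ξ` chooses among the
solutions, and if it is itself a solution it is chosen. -/
structure LocalSolution {X : Type u} {Y : Type v} [DiffeologicalSpace X] [DiffeologicalSpace Y]
    (f : X → Y) (x₀ : X) where
  m : ℕ
  n : ℕ
  φ : Euc m → X
  ψ : Euc n → Y
  a : Euc m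
  b : Euc n
  A : Euc n →L[ℝ] Euc m
  B : Euc m →L[ℝ] Euc m
  c : Euc m
  D : Euc m → Euc m
  chart_φ : IsChart φ
  chart_ψ : IsChart ψ
  φ_a : φ a = x₀
  ψ_b : ψ b = f x₀
  smooth : ∀ᶠ w in 𝓝 (A b + B a + c), SmAt D w
  solves : ∀ᶠ q in 𝓝 b ×ˢ 𝓝 a, f (φ (D (A q.1 + B q.2 + c))) = ψ q.1
  fixes : ∀ᶠ ξ in 𝓝 a, ∀ η, f (φ ξ) = ψ η → D (A η + B ξ + c) = ξ

section

variable {X : Type u} {Y : Type v} [DiffeologicalSpace X] [DiffeologicalSpace Y]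

lemma IsSubmersion.nonempty_localSolution {f : X → Y} (hf : IsSubmersion f) (x : X) :
    Nonempty (LocalSolution f x) := by
  obtain ⟨m, n, φ, ψ, g, a, hφ, hψ, hφa, hfg, hg, hsurj⟩ := hf.exists_charts x
  -- `A` is a right inverse of the derivative `G` of `f` in the charts and `B` is the projection to
  -- the kernel of `G` along the range of `A`, so that `F` has the identity as its derivative
  set G := fderiv ℝ g a with hG
  obtain ⟨A', hA'⟩ := LinearMap.exists_rightInverse_of_surjective (G : Euc m →ₗ[ℝ] Euc n)
    (LinearMap.range_eq_top.2 hsurj)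
  let A : Euc n →L[ℝ] Euc m := LinearMap.toContinuousLinearMap A'
  have hGA : ∀ η, G (A η) = η := fun η => LinearMap.congr_fun hA' η
  let B : Euc m →L[ℝ] Euc m := ContinuousLinearMap.id ℝ _ - A.comp G
  have hGB : ∀ ξ, G (B ξ) = 0 := fun ξ => by simp [B, hGA]
  let c : Euc m := -(A (g a) + B a)
  let F : Euc m → Euc m := fun ξ => A (g ξ) + B ξ + c
  have hFc : ContDiff ℝ ∞ F :=
    ((A.contDiff.comp hg).add B.contDiff).add contDiff_const
  have hF0 : F a = 0 := by simp [F, c]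
  have hFd : fderiv ℝ F a = ContinuousLinearMap.id ℝ (Euc m) := by
    have hgd : HasFDerivAt g G a := (hg.differentiable (by simp) a).hasFDerivAt
    have h : HasFDerivAt F (A.comp G + B) a :=
      ((A.hasFDerivAt.comp a hgd).add B.hasFDerivAt).add_const c
    rw [h.fderiv]
    simp [B]
  obtain ⟨D, hD, hDa, hDF⟩ := exists_local_inverse (.of_forall fun x => hFc.contDiffAt) hFd
  rw [hF0] at hD hDa
  have h0 : A (g a) + B a + c = 0 := hF0
  refine ⟨⟨m, n, φ, ψ, a, g a, A, B, c, D, hφ, hψ, hφa, by rw [← hfg, hφa], ?_, ?_, ?_⟩⟩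
  · rw [h0]
    exact hD.mono fun _ h => h.1
  · have ht : Filter.Tendsto (fun q : Euc n × Euc m => A q.1 + B q.2 + c)
        (𝓝 (g a) ×ˢ 𝓝 a) (𝓝 0) := by
      rw [← nhds_prod_eq, ← h0]
      exact (by fun_prop : Continuous fun q : Euc n × Euc m => A q.1 + B q.2 + c).tendsto (g a, a)
    filter_upwards [ht.eventually hD] with q hq
    -- applying `G` to `F (D w) = w` leaves the equation that `D w` should solve
    have h1 := congrArg G hq.2
    simp only [F, map_add, hGA, hGB, add_zero, add_left_inj] at h1
    rw [hfg, h1]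
  · filter_upwards [hDF] with ξ hξ η hη
    rw [hfg] at hη
    rw [← hψ.injective hη]
    exact hξ

/-- A submersion has smooth local sections through every point. -/
lemma IsSubmersion.exists_local_section {f : X → Y} (hf : IsSubmersion f) (x : X) :
    ∃ s : Y → X, s (f x) = x ∧ (∀ᶠ y in dNhds (f x), SmAt s y) ∧
      ∀ᶠ y in dNhds (f x), f (s y) = y := by
  obtain ⟨S⟩ := hf.nonempty_localSolution x
  have hb : Function.invFun S.ψ (f x) = S.b := by rw [← S.ψ_b, S.chart_ψ.invFun_apply]
  have hr : f x ∈ Set.range S.ψ := ⟨_, S.ψ_b⟩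
  have ht : Filter.Tendsto (Function.invFun S.ψ) (dNhds (f x)) (𝓝 S.b) := by
    have := S.chart_ψ.tendsto_invFun hr
    rwa [hb] at this
  let h : Euc S.n → Euc S.m := fun η => S.A η + S.B S.a + S.c
  have hh : ContDiff ℝ ∞ h := (S.A.contDiff.add contDiff_const).add contDiff_const
  have hht : Filter.Tendsto h (𝓝 S.b) (𝓝 (S.A S.b + S.B S.a + S.c)) := hh.continuous.tendsto _
  refine ⟨fun y => S.φ (S.D (h (Function.invFun S.ψ y))), ?_, ?_, ?_⟩
  · change S.φ (S.D (h (Function.invFun S.ψ (f x)))) = x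
    rw [hb, S.fixes.self_of_nhds S.b (by rw [S.φ_a, S.ψ_b]), S.φ_a]
  · filter_upwards [S.chart_ψ.eventually_smAt_invFun hr, ht.eventually (hht.eventually S.smooth)]
      with y h1 h2
    exact SmAt.comp (smAt_of_dSmooth S.chart_φ.isPlot.dSmooth _)
      (SmAt.comp (f := h ∘ Function.invFun S.ψ) h2 (SmAt.comp (smAt_of_dSmooth hh.dSmooth _) h1))
  · have h1 : ∀ᶠ η in 𝓝 S.b, f (S.φ (S.D (h η))) = S.ψ η :=
      S.solves.curry.mono fun η hη => hη.self_of_nhds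
    filter_upwards [ht.eventually h1, S.chart_ψ.eventually_mem_range hr] with y h2 h3
    rw [h2]
    exact Function.invFun_eq h3

lemma IsSubmersion.locSubd {f : X → Y} (hf : IsSubmersion f) : LocSubd f := by
  refine ⟨hf.dSmooth, fun x d p hp hpx => ?_⟩
  obtain ⟨s, hsx, hs, hfs⟩ := hf.exists_local_section x
  obtain ⟨q, hq, hqp⟩ := self_of_dNhds hs p hp hpx
  refine ⟨q, hq, ?_, ?_⟩
  · rw [← hqp.self_of_nhds, Function.comp_apply, hpx, hsx]
  · have := (IsPlot.tendsto_dNhds hp 0).eventually (hpx.symm ▸ hfs)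
    filter_upwards [hqp, this] with u h1 h2
    rw [Function.comp_apply, ← h1]
    exact h2

end

/-! ### Fibre products -/

/-- `S` is the fibre product of `T` with the `X i` over the `Y i`, as a diffeological space. -/
structure IsFibreProduct {S : Type*} {T : Type*} {ι : Type*} {X Y : ι → Type*}
    [DiffeologicalSpace S] [DiffeologicalSpace T] [∀ i, DiffeologicalSpace (X i)]
    (πT : S → T) (π : ∀ i, S → X i) (g : ∀ i, T → Y i) (f : ∀ i, X i → Y i) : Prop where
  isPlot_iff : ∀ {d : ℕ} (p : Euc d → S), IsPlot p ↔
    IsPlot (fun x => πT (p x)) ∧ ∀ i, IsPlot fun x => π i (p x)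
  comm : ∀ s i, f i (π i s) = g i (πT s)
  exists_mk : ∀ (t : T) (x : ∀ i, X i), (∀ i, f i (x i) = g i t) →
    ∃ s, πT s = t ∧ ∀ i, π i s = x i
  ext : ∀ s s' : S, πT s = πT s' → (∀ i, π i s = π i s') → s = s'

section

variable {S : Type*} {T : Type*} {ι : Type*} {X Y : ι → Type*}
    [DiffeologicalSpace T] [∀ i, DiffeologicalSpace (X i)]
    {πT : S → T} {π : ∀ i, S → X i} {g : ∀ i, T → Y i} {f : ∀ i, X i → Y i}

/-- The neighbourhoods of `s` for the topology of the product. -/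
def fibreFilter (πT : S → T) (π : ∀ i, S → X i) (s : S) : Filter S :=
  Filter.comap πT (dNhds (πT s)) ⊓ ⨅ i, Filter.comap (π i) (dNhds (π i s))

lemma tendsto_fibreFilter_left (s : S) :
    Filter.Tendsto πT (fibreFilter πT π s) (dNhds (πT s)) :=
  Filter.tendsto_comap.mono_left inf_le_left

lemma tendsto_fibreFilter_right (s : S) (i : ι) :
    Filter.Tendsto (π i) (fibreFilter πT π s) (dNhds (π i s)) :=
  Filter.tendsto_comap.mono_left (inf_le_right.trans (iInf_le _ i))

variable [DiffeologicalSpace S]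

lemma IsFibreProduct.dSmooth_left (h : IsFibreProduct πT π g f) : DSmooth πT :=
  fun _ p hp => ((h.isPlot_iff p).1 hp).1

lemma IsFibreProduct.dSmooth_right (h : IsFibreProduct πT π g f) (i : ι) : DSmooth (π i) :=
  fun _ p hp => ((h.isPlot_iff p).1 hp).2 i

lemma IsFibreProduct.dNhds_le (h : IsFibreProduct πT π g f) (s : S) :
    dNhds s ≤ fibreFilter πT π s :=
  le_inf ((DSmooth.tendsto_dNhds h.dSmooth_left s).le_comap)
    (le_iInf fun i => (DSmooth.tendsto_dNhds (h.dSmooth_right i) s).le_comap)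

lemma IsFibreProduct.t2 (h : IsFibreProduct πT π g f) (hT : @T2Space T dTopology)
    (hX : ∀ i, @T2Space (X i) dTopology) : @T2Space S dTopology := by
  let : TopologicalSpace S := dTopology
  let : TopologicalSpace T := dTopology
  let : ∀ i, TopologicalSpace (X i) := fun i => dTopology
  refine ⟨fun s s' hss' => ?_⟩
  by_cases hs : πT s = πT s'
  · obtain ⟨i, hi⟩ : ∃ i, π i s ≠ π i s' := by
      by_contra hcon
      push Not at hcon
      exact hss' (h.ext _ _ hs hcon)
    have hc : Continuous (π i) := (h.dSmooth_right i).continuous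
    obtain ⟨U, V, hU, hV, hsU, hsV, hUV⟩ := (hX i).t2 hi
    exact ⟨_, _, hU.preimage hc, hV.preimage hc, hsU, hsV, hUV.preimage _⟩
  · have hc : Continuous πT := h.dSmooth_left.continuous
    obtain ⟨U, V, hU, hV, hsU, hsV, hUV⟩ := hT.t2 hs
    exact ⟨_, _, hU.preimage hc, hV.preimage hc, hsU, hsV, hUV.preimage _⟩

variable [∀ i, DiffeologicalSpace (Y i)]

/-- Near every point, a fibre product of manifolds over submersions is a smooth retract of a
Euclidean space: nearby points of the product are moved into it by solving `f i x = g i t`. -/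
lemma IsFibreProduct.exists_retract [Finite ι] (h : IsFibreProduct πT π g f) (hT : HasCharts T)
    (hg : ∀ i, DSmooth (g i)) (hf : ∀ i, IsSubmersion (f i)) (s₀ : S) :
    ∃ (N : ℕ) (s : S → Euc N) (r : Euc N → S),
      Filter.Tendsto s (fibreFilter πT π s₀) (𝓝 (s s₀)) ∧
      (∀ᶠ y in fibreFilter πT π s₀, SmAt s y) ∧ (∀ᶠ v in 𝓝 (s s₀), SmAt r v) ∧
      ∀ᶠ y in fibreFilter πT π s₀, r (s y) = y := by
  classical
  have := Fintype.ofFinite ι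
  obtain ⟨m, θ, hθ, hθ0⟩ := hT.exists_chart_centred (πT s₀)
  have σ : ∀ i, LocalSolution (f i) (π i s₀) := fun i => ((hf i).nonempty_localSolution _).some
  let E := Euc m × (∀ i, Euc (σ i).m)
  let L : E ≃L[ℝ] Euc (Module.finrank ℝ E) := toEuclidean
  have hL1 : ContDiff ℝ ∞ fun v => (L.symm v).1 := contDiff_fst.comp L.symm.contDiff
  have hL2 : ∀ i, ContDiff ℝ ∞ fun v => (L.symm v).2 i := fun i =>
    (contDiff_pi.1 (contDiff_id (E := ∀ i, Euc (σ i).m)) i).comp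
      (contDiff_snd.comp L.symm.contDiff)
  -- `e` gives the coordinates of a point of `S`; for coordinates `v` of a point `t` of `T` and of
  -- points of the `X i`, `η i v` are the coordinates of `g i t`, and `x v i` is the solution of
  -- `f i (x v i) = g i t` selected by the remaining coordinates
  let e : S → E := fun y => (Function.invFun θ (πT y), fun i => Function.invFun (σ i).φ (π i y))
  let η : ∀ i, Euc (Module.finrank ℝ E) → Euc (σ i).n :=
    fun i v => Function.invFun (σ i).ψ (g i (θ (L.symm v).1))
  let k : ∀ i, Euc (Module.finrank ℝ E) → Euc (σ i).m :=
    fun i v => (σ i).A (η i v) + (σ i).B ((L.symm v).2 i) + (σ i).c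
  let x : Euc (Module.finrank ℝ E) → ∀ i, X i := fun v i => (σ i).φ ((σ i).D (k i v))
  -- away from the solutions, the value of `r` is irrelevant
  have hr : ∀ v, ∃ y : S, (∀ i, f i (x v i) = g i (θ (L.symm v).1)) →
      πT y = θ (L.symm v).1 ∧ ∀ i, π i y = x v i := fun v => by
    by_cases hv : ∀ i, f i (x v i) = g i (θ (L.symm v).1)
    · obtain ⟨y, hy⟩ := h.exists_mk _ _ hv
      exact ⟨y, fun _ => hy⟩
    · exact ⟨s₀, fun h => absurd h hv⟩
  choose r hr using hr
  have hT0 : πT s₀ ∈ Set.range θ := ⟨0, hθ0⟩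
  have hX0 : ∀ i, π i s₀ ∈ Set.range (σ i).φ := fun i => ⟨_, (σ i).φ_a⟩
  have he0 : e s₀ = (0, fun i => (σ i).a) := by
    refine Prod.ext ?_ (funext fun i => ?_)
    · change Function.invFun θ (πT s₀) = 0
      rw [← hθ0, hθ.invFun_apply]
    · change Function.invFun (σ i).φ (π i s₀) = (σ i).a
      exact (congrArg (Function.invFun (σ i).φ) (σ i).φ_a.symm).trans
        ((σ i).chart_φ.invFun_apply _)
  have het : Filter.Tendsto e (fibreFilter πT π s₀) (𝓝 (e s₀)) := by
    rw [nhds_prod_eq, nhds_pi]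
    refine Filter.Tendsto.prodMk ?_ (Filter.tendsto_pi.2 fun i => ?_)
    · exact (hθ.tendsto_invFun hT0).comp (tendsto_fibreFilter_left s₀)
    · exact ((σ i).chart_φ.tendsto_invFun (hX0 i)).comp (tendsto_fibreFilter_right s₀ i)
  set v₀ := L (e s₀) with hv₀
  have hv1 : (L.symm v₀).1 = 0 := by rw [hv₀, L.symm_apply_apply, he0]
  have hv2 : ∀ i, (L.symm v₀).2 i = (σ i).a := fun i => by rw [hv₀, L.symm_apply_apply, he0]
  have ht1 : Filter.Tendsto (fun v => (L.symm v).1) (𝓝 v₀) (𝓝 0) := by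
    have := hL1.continuous.tendsto v₀
    rwa [hv1] at this
  have ht2 : ∀ i, Filter.Tendsto (fun v => (L.symm v).2 i) (𝓝 v₀) (𝓝 (σ i).a) := fun i => by
    have := (hL2 i).continuous.tendsto v₀
    rwa [hv2] at this
  have hgb : ∀ i, g i (θ 0) = (σ i).ψ (σ i).b := fun i => by rw [hθ0, (σ i).ψ_b, h.comm]
  have hgt : ∀ i, Filter.Tendsto (fun v => g i (θ (L.symm v).1)) (𝓝 v₀)
      (dNhds ((σ i).ψ (σ i).b)) := fun i => by
    have h1 := (DSmooth.tendsto_dNhds (hg i) (θ 0)).comp (IsPlot.tendsto_dNhds hθ.isPlot 0)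
    rw [hgb] at h1
    exact h1.comp ht1
  have hηt : ∀ i, Filter.Tendsto (η i) (𝓝 v₀) (𝓝 (σ i).b) := fun i => by
    have h1 := (σ i).chart_ψ.tendsto_invFun ⟨(σ i).b, rfl⟩
    rw [(σ i).chart_ψ.invFun_apply] at h1
    exact h1.comp (hgt i)
  have hηs : ∀ i, ∀ᶠ v in 𝓝 v₀, ContDiffAt ℝ ∞ (η i) v := fun i => by
    filter_upwards [(hgt i).eventually ((σ i).chart_ψ.eventually_smAt_invFun ⟨(σ i).b, rfl⟩)]
      with v hv
    exact contDiffAt_of_smAt (SmAt.comp (f := fun v => g i (θ (L.symm v).1)) hv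
      (smAt_of_dSmooth ((hg i).comp (hθ.isPlot.dSmooth.comp hL1.dSmooth)) v))
  have hks : ∀ i, ∀ᶠ v in 𝓝 v₀, SmAt (k i) v := fun i => by
    refine eventually_smAt_of_contDiffAt ?_
    filter_upwards [hηs i] with v hv
    exact (((σ i).A.contDiff.contDiffAt.comp v hv).add
      ((σ i).B.contDiff.contDiffAt.comp v (hL2 i).contDiffAt)).add contDiffAt_const
  have hkt : ∀ i, Filter.Tendsto (k i) (𝓝 v₀)
      (𝓝 ((σ i).A (σ i).b + (σ i).B (σ i).a + (σ i).c)) := fun i =>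
    ((((σ i).A.continuous.tendsto _).comp (hηt i)).add
      (((σ i).B.continuous.tendsto _).comp (ht2 i))).add tendsto_const_nhds
  have hxs : ∀ᶠ v in 𝓝 v₀, ∀ i, SmAt (fun v => x v i) v := by
    refine Filter.eventually_all.2 fun i => ?_
    filter_upwards [hks i, (hkt i).eventually (σ i).smooth] with v h1 h2
    exact SmAt.comp (smAt_of_dSmooth (σ i).chart_φ.isPlot.dSmooth _)
      (SmAt.comp (f := k i) (g := (σ i).D) h2 h1)
  have hsol : ∀ᶠ v in 𝓝 v₀, ∀ i, f i (x v i) = g i (θ (L.symm v).1) := by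
    refine Filter.eventually_all.2 fun i => ?_
    filter_upwards [((hηt i).prodMk (ht2 i)).eventually (σ i).solves,
      (hgt i).eventually ((σ i).chart_ψ.eventually_mem_range ⟨(σ i).b, rfl⟩)] with v h1 h2
    exact h1.trans (Function.invFun_eq h2)
  refine ⟨_, fun y => L (e y), r, (L.continuous.tendsto _).comp het, ?_, ?_, ?_⟩
  -- the coordinates are smooth
  · have h1 : ∀ᶠ y in fibreFilter πT π s₀, SmAt (Function.invFun θ) (πT y) :=
      (tendsto_fibreFilter_left s₀).eventually (hθ.eventually_smAt_invFun hT0)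
    have h2 : ∀ᶠ y in fibreFilter πT π s₀, ∀ i, SmAt (Function.invFun (σ i).φ) (π i y) :=
      Filter.eventually_all.2 fun i => (tendsto_fibreFilter_right s₀ i).eventually
        ((σ i).chart_φ.eventually_smAt_invFun (hX0 i))
    filter_upwards [h1, h2] with y h1 h2
    intro d p hp hpy
    obtain ⟨q, hq, hqp⟩ := h1 _ (h.dSmooth_left _ _ hp) (congrArg πT hpy)
    choose q' hq' hqp' using fun i => h2 i _ (h.dSmooth_right i _ _ hp) (congrArg (π i) hpy)
    refine ⟨fun u => L (q u, fun i => q' i u), ContDiff.isPlot ?_, ?_⟩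
    · exact L.contDiff.comp (hq.contDiff.prodMk (contDiff_pi.2 fun i => (hq' i).contDiff))
    · filter_upwards [hqp, Filter.eventually_all.2 hqp'] with u h3 h4
      refine congrArg L (Prod.ext h3 (funext fun i => h4 i))
  -- `r` is smooth, as its components `t` and `x v i` are
  · have h1 := eventually_eventually_nhds.2 (hxs.and hsol)
    filter_upwards [h1] with v hv
    intro d p hp hpv
    have h2 : ∀ᶠ u in 𝓝 0, (∀ i, SmAt (fun v => x v i) (p u)) ∧
        ∀ i, f i (x (p u) i) = g i (θ (L.symm (p u)).1) :=
      hp.contDiff.continuous.continuousAt.eventually (hpv.symm ▸ hv)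
    obtain ⟨ρ, hρ, hρ0, hρs⟩ := exists_squash h2
    have hpρ : IsPlot (p ∘ ρ) := isPlot_reparam hp hρ
    refine ⟨fun u => r (p (ρ u)), (h.isPlot_iff _).2 ⟨?_, fun i => ?_⟩, ?_⟩
    · have h3 : (fun u => πT (r (p (ρ u)))) = θ ∘ fun u => (L.symm (p (ρ u))).1 :=
        funext fun u => (hr _ (hρs u).2).1
      rw [h3]
      exact isPlot_reparam hθ.isPlot (hL1.comp hpρ.contDiff)
    · have h3 : (fun u => π i (r (p (ρ u)))) = (fun v => x v i) ∘ (p ∘ ρ) :=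
        funext fun u => (hr _ (hρs u).2).2 i
      rw [h3]
      exact (dSmooth_of_smAt fun u => SmAt.comp ((hρs u).1 i)
        (smAt_of_dSmooth hpρ.dSmooth u)).isPlot
    · filter_upwards [hρ0] with u hu
      simp [hu]
  -- `r` recovers a point from its coordinates, which solve the equations already
  · have h1 : ∀ᶠ y in fibreFilter πT π s₀, πT y ∈ Set.range θ :=
      (tendsto_fibreFilter_left s₀).eventually (hθ.eventually_mem_range hT0)
    have h2 : ∀ᶠ y in fibreFilter πT π s₀, ∀ i, π i y ∈ Set.range (σ i).φ :=
      Filter.eventually_all.2 fun i => (tendsto_fibreFilter_right s₀ i).eventually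
        ((σ i).chart_φ.eventually_mem_range (hX0 i))
    have hLe : Filter.Tendsto (fun y => L (e y)) (fibreFilter πT π s₀) (𝓝 v₀) :=
      (L.continuous.tendsto _).comp het
    have h3 : ∀ᶠ y in fibreFilter πT π s₀, ∀ i, ∀ η,
        f i ((σ i).φ (e y |>.2 i)) = (σ i).ψ η →
          (σ i).D ((σ i).A η + (σ i).B ((e y).2 i) + (σ i).c) = (e y).2 i := by
      refine Filter.eventually_all.2 fun i => ?_
      have h4 : Filter.Tendsto (fun y => (e y).2 i) (fibreFilter πT π s₀) (𝓝 (σ i).a) := by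
        have := (ht2 i).comp hLe
        simpa [Function.comp_def] using this
      exact h4.eventually (σ i).fixes
    have h5 : ∀ᶠ y in fibreFilter πT π s₀, ∀ i,
        g i (θ (L.symm (L (e y))).1) ∈ Set.range (σ i).ψ :=
      Filter.eventually_all.2 fun i => ((hgt i).comp hLe).eventually
        ((σ i).chart_ψ.eventually_mem_range ⟨(σ i).b, rfl⟩)
    filter_upwards [h1, h2, h3, h5, hLe.eventually hsol] with y h1 h2 h3 h5 h6
    obtain ⟨h7, h8⟩ := hr _ h6
    have h9 : θ (L.symm (L (e y))).1 = πT y := by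
      rw [L.symm_apply_apply]
      exact Function.invFun_eq h1
    refine h.ext _ _ (h7.trans h9) fun i => (h8 i).trans ?_
    have h10 : (σ i).φ ((e y).2 i) = π i y := Function.invFun_eq (h2 i)
    have h11 : f i ((σ i).φ ((e y).2 i)) = (σ i).ψ (η i (L (e y))) := by
      rw [h10, h.comm, ← h9]
      exact (Function.invFun_eq (h5 i)).symm
    have h12 := h3 i _ h11
    change (σ i).φ ((σ i).D (k i (L (e y)))) = π i y
    have h13 : k i (L (e y)) = (σ i).A (η i (L (e y))) + (σ i).B ((e y).2 i) + (σ i).c := by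
      simp only [k, L.symm_apply_apply]
    rw [h13, h12, h10]

lemma IsFibreProduct.hasCharts [Finite ι] (h : IsFibreProduct πT π g f) (hT : HasCharts T)
    (hg : ∀ i, DSmooth (g i)) (hf : ∀ i, IsSubmersion (f i)) : HasCharts S := by
  intro s₀
  obtain ⟨N, s, r, -, hs, hr, hrs⟩ := h.exists_retract hT hg hf s₀
  exact exists_chart_of_retract s r (hs.filter_mono (h.dNhds_le s₀)) hr
    (hrs.filter_mono (h.dNhds_le s₀))

/-- The D-topology of a fibre product over submersions is the topology induced by the product; in
general it may be finer. -/
lemma IsFibreProduct.dNhds_eq [Finite ι] (h : IsFibreProduct πT π g f) (hT : HasCharts T)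
    (hg : ∀ i, DSmooth (g i)) (hf : ∀ i, IsSubmersion (f i)) (s₀ : S) :
    dNhds s₀ = fibreFilter πT π s₀ := by
  refine le_antisymm (h.dNhds_le s₀) fun A hA => ?_
  obtain ⟨N, s, r, hst, hs, hr, hrs⟩ := h.exists_retract hT hg hf s₀
  have hr0 : r (s s₀) = s₀ := self_of_dNhds (P := fun y => r (s y) = y)
    (hrs.filter_mono (h.dNhds_le s₀))
  have hrt : Filter.Tendsto r (𝓝 (s s₀)) (dNhds s₀) := by
    have := tendsto_dNhds_of_smAt (x := s s₀) hr
    rwa [hr0] at this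
  filter_upwards [hst.eventually (hrt.eventually (Filter.eventually_mem_set.2 hA)), hrs]
    with y h1 h2
  rwa [h2] at h1

lemma IsFibreProduct.secondCountable [Finite ι] (h : IsFibreProduct πT π g f) (hT : HasCharts T)
    (hg : ∀ i, DSmooth (g i)) (hf : ∀ i, IsSubmersion (f i))
    (hT2 : @SecondCountableTopology T dTopology)
    (hX2 : ∀ i, @SecondCountableTopology (X i) dTopology) :
    @SecondCountableTopology S dTopology := by
  let tT : TopologicalSpace T := dTopology
  let tX : ∀ i, TopologicalSpace (X i) := fun i => dTopology
  have heq : (dTopology : TopologicalSpace S) =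
      ⨅ i : Option ι, i.elim (TopologicalSpace.induced πT tT)
        fun i => TopologicalSpace.induced (π i) (tX i) := by
    refine TopologicalSpace.ext_nhds fun s => ?_
    rw [iInf_option, nhds_inf, nhds_iInf]
    exact (h.dNhds_eq hT hg hf s).trans (congrArg₂ _ (nhds_induced _ _).symm
      (iInf_congr fun i => (nhds_induced _ _).symm))
  rw [heq]
  have : Countable ι := Finite.to_countable
  refine TopologicalSpace.secondCountableTopology_iInf fun i => ?_
  cases i with
  | none => exact TopologicalSpace.secondCountableTopology_induced _ _ _
  | some i => exact TopologicalSpace.secondCountableTopology_induced _ _ _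

/-- A fibre product of manifolds over submersions is a manifold. -/
lemma IsFibreProduct.isSmoothManifold [Finite ι] (h : IsFibreProduct πT π g f)
    (hT : IsSmoothManifold T) (hX : ∀ i, IsSmoothManifold (X i)) (hg : ∀ i, DSmooth (g i))
    (hf : ∀ i, IsSubmersion (f i)) : IsSmoothManifold S where
  t2 := h.t2 hT.t2 fun i => (hX i).t2
  secondCountable := h.secondCountable hT.hasCharts hg hf hT.secondCountable
    fun i => (hX i).secondCountable
  exists_chart := h.hasCharts hT.hasCharts hg hf

end

/-! ### Open inclusions -/

/-- An injective smooth map along which germs of plots lift, that is, a diffeomorphism onto a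
D-open subset. -/
structure IsOpenInclusion {X : Type u} {Y : Type v} [DiffeologicalSpace X] [DiffeologicalSpace Y]
    (f : X → Y) : Prop extends LocSubd f where
  injective : Function.Injective f

section

variable {X : Type u} {Y : Type v} {Z : Type w} [DiffeologicalSpace X] [DiffeologicalSpace Y]
  [DiffeologicalSpace Z]

lemma IsDiffeomorphism.isOpenInclusion {f : X → Y} (hf : IsDiffeomorphism f) :
    IsOpenInclusion f :=
  ⟨hf.locSubd, hf.bijective.1⟩

lemma IsOpenInclusion.isChart {f : X → Y} (hf : IsOpenInclusion f) {n : ℕ} {φ : Euc n → X}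
    (hφ : IsChart φ) : IsChart (fun t => f (φ t)) where
  injective := hf.injective.comp hφ.injective
  isPlot := hf.dSmooth _ _ hφ.isPlot
  isOpen_range := by
    have : Set.range (fun t => f (φ t)) = f '' Set.range φ := Set.range_comp f φ
    rw [this]
    exact hf.isOpen_image hφ.isOpen_range
  contDiff_of_isPlot {m} q hq := by
    refine hφ.contDiff_of_isPlot q (isPlot_of_locally fun x => ?_)
    obtain ⟨q', hq', -, h⟩ := hf.lift (φ (q x)) (fun u => f (φ (q (u + x))))
      (isPlot_translate hq x) (by simp)
    refine ⟨fun u => q' (u + -x), isPlot_translate hq' _, ?_⟩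
    filter_upwards [(tendsto_add_neg x).eventually h] with u hu
    have := hf.injective hu
    simpa using this.symm

lemma hasCharts_of_openInclusions {ι : Type*} {A : ι → Type*} [∀ i, DiffeologicalSpace (A i)]
    (f : ∀ i, A i → Y) (hf : ∀ i, IsOpenInclusion (f i)) (hsurj : ∀ y, ∃ i a, f i a = y)
    (hA : ∀ i, HasCharts (A i)) : HasCharts Y := by
  intro y
  obtain ⟨i, a, rfl⟩ := hsurj y
  obtain ⟨n, φ, hφ, t, rfl⟩ := hA i a
  exact ⟨n, _, (hf i).isChart hφ, t, rfl⟩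

lemma IsDiffeomorphism.hasCharts {f : X → Y} (hf : IsDiffeomorphism f) (hX : HasCharts X) :
    HasCharts Y :=
  hasCharts_of_openInclusions (fun _ : Unit => f) (fun _ => hf.isOpenInclusion)
    (fun y => ⟨(), hf.bijective.2 y⟩) fun _ => hX

lemma IsDiffeomorphism.symm_of {f : X → Y} (hf : IsDiffeomorphism f) :
    ∃ g : Y → X, IsDiffeomorphism g := by
  obtain ⟨h, g, hg, h1, h2⟩ := hf
  exact ⟨g, hg, f, h, h2, h1⟩

lemma secondCountable_of_openInclusions {ι : Type*} [Countable ι] {A : ι → Type*}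
    [∀ i, DiffeologicalSpace (A i)]
    (f : ∀ i, A i → Y) (hf : ∀ i, IsOpenInclusion (f i)) (hsurj : ∀ y, ∃ i a, f i a = y)
    (hA : ∀ i, @SecondCountableTopology (A i) dTopology) :
    @SecondCountableTopology Y dTopology := by
  let : ∀ i, TopologicalSpace (A i) := fun i => dTopology
  let : TopologicalSpace Y := dTopology
  have hc : Continuous fun s : Σ i, A i => f s.1 s.2 :=
    continuous_sigma fun i => (hf i).dSmooth.continuous
  have ho : IsOpenMap fun s : Σ i, A i => f s.1 s.2 :=
    isOpenMap_sigma.2 fun i V hV => (hf i).isOpen_image hV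
  have hs : Function.Surjective fun s : Σ i, A i => f s.1 s.2 := fun y => by
    obtain ⟨i, a, h⟩ := hsurj y
    exact ⟨⟨i, a⟩, h⟩
  exact (ho.isQuotientMap hc hs).secondCountableTopology ho

/-- A space is Hausdorff if any two points lie in a common Hausdorff open subset or in two disjoint
open subsets. -/
lemma t2_of_openInclusions {ι : Type*} {A : ι → Type*} [∀ i, DiffeologicalSpace (A i)]
    (f : ∀ i, A i → Y) (hf : ∀ i, IsOpenInclusion (f i)) (hA : ∀ i, @T2Space (A i) dTopology)
    (h : ∀ y y', ∃ i j a b, f i a = y ∧ f j b = y' ∧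
      (i = j ∨ Disjoint (Set.range (f i)) (Set.range (f j)))) : @T2Space Y dTopology := by
  have huniv : ∀ i, IsOpen[dTopology] (Set.range (f i)) := fun i => by
    rw [← Set.image_univ]
    exact (hf i).isOpen_image (@isOpen_univ _ dTopology)
  refine @T2Space.mk _ dTopology fun y y' hyy' => ?_
  obtain ⟨i, j, a, b, rfl, rfl, rfl | hd⟩ := h y y'
  · obtain ⟨U, V, hU, hV, hsU, hsV, hUV⟩ := @T2Space.t2 _ dTopology (hA i) a b
      fun hab => hyy' (congrArg _ hab)
    exact ⟨_, _, (hf i).isOpen_image hU, (hf i).isOpen_image hV, ⟨a, hsU, rfl⟩, ⟨b, hsV, rfl⟩,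
      (Set.disjoint_image_iff (hf i).injective).2 hUV⟩
  · exact ⟨_, _, huniv i, huniv j, ⟨a, rfl⟩, ⟨b, rfl⟩, hd⟩

end

/-! ### Boundaries of tetrahedra -/

/-- Every horn with missing face `j` of a simplex of dimension `n + 2`, given by its faces, has a
filler; the value `x j` plays no role. -/
def HasFillers (K : SSet.{u}) (n : ℕ) (j : Fin (n + 3)) : Prop :=
  ∀ x : Fin (n + 3) → K _⦋n + 1⦌,
    (∀ i k : Fin (n + 2), i ≤ k → i.castSucc ≠ j → k.succ ≠ j →
      K.δ i (x k.succ) = K.δ k (x i.castSucc)) →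
    ∃ z : K _⦋n + 2⦌, ∀ i, i ≠ j → K.δ i z = x i

/-- The four triangles are the faces of a 3-simplex. -/
def Bounds (K : SSet.{u}) (x₀ x₁ x₂ x₃ : K _⦋2⦌) : Prop :=
  ∃ z : K _⦋3⦌, K.δ 0 z = x₀ ∧ K.δ 1 z = x₁ ∧ K.δ 2 z = x₂ ∧ K.δ 3 z = x₃

section

variable {K L : SSet.{u}} {x₀ x₁ x₂ x₃ y₀ y₁ y₂ y₃ : K _⦋2⦌}

lemma Bounds.map (f : K ⟶ L) (h : Bounds K x₀ x₁ x₂ x₃) :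
    Bounds L (f.app _ x₀) (f.app _ x₁) (f.app _ x₂) (f.app _ x₃) := by
  obtain ⟨z, rfl, rfl, rfl, rfl⟩ := h
  exact ⟨f.app _ z, (SSet.δ_naturality_apply f 0 z).symm, (SSet.δ_naturality_apply f 1 z).symm,
    (SSet.δ_naturality_apply f 2 z).symm, (SSet.δ_naturality_apply f 3 z).symm⟩

/-- The common edges of the faces of a tetrahedron. -/
lemma Bounds.edges (h : Bounds K x₀ x₁ x₂ x₃) :
    (K.δ 0 x₁ = K.δ 0 x₀ ∧ K.δ 0 x₂ = K.δ 1 x₀ ∧ K.δ 0 x₃ = K.δ 2 x₀) ∧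
      (K.δ 1 x₂ = K.δ 1 x₁ ∧ K.δ 1 x₃ = K.δ 2 x₁) ∧ K.δ 2 x₃ = K.δ 2 x₂ := by
  obtain ⟨z, rfl, rfl, rfl, rfl⟩ := h
  exact ⟨⟨K.δ_comp_δ_apply (i := 0) (j := 0) (by decide) z,
    K.δ_comp_δ_apply (i := 0) (j := 1) (by decide) z,
    K.δ_comp_δ_apply (i := 0) (j := 2) (by decide) z⟩,
    ⟨K.δ_comp_δ_apply (i := 1) (j := 1) (by decide) z,
    K.δ_comp_δ_apply (i := 1) (j := 2) (by decide) z⟩,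
    K.δ_comp_δ_apply (i := 2) (j := 2) (by decide) z⟩

lemma bounds_σ_zero (x : K _⦋2⦌) :
    Bounds K x x (K.σ 0 (K.δ 1 x)) (K.σ 0 (K.δ 2 x)) :=
  ⟨K.σ 0 x, K.δ_comp_σ_self_apply 0 x, K.δ_comp_σ_succ_apply 0 x,
    K.δ_comp_σ_of_gt_apply (i := 1) (j := 0) (by decide) x,
    K.δ_comp_σ_of_gt_apply (i := 2) (j := 0) (by decide) x⟩

lemma bounds_σ_one (x : K _⦋2⦌) :
    Bounds K (K.σ 0 (K.δ 0 x)) x x (K.σ 1 (K.δ 2 x)) :=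
  ⟨K.σ 1 x, K.δ_comp_σ_of_le_apply (i := 0) (j := 0) (by decide) x,
    K.δ_comp_σ_self_apply 1 x, K.δ_comp_σ_succ_apply 1 x,
    K.δ_comp_σ_of_gt_apply (i := 2) (j := 1) (by decide) x⟩

lemma bounds_σ_two (x : K _⦋2⦌) :
    Bounds K (K.σ 1 (K.δ 0 x)) (K.σ 1 (K.δ 1 x)) x x :=
  ⟨K.σ 2 x, K.δ_comp_σ_of_le_apply (i := 0) (j := 1) (by decide) x,
    K.δ_comp_σ_of_le_apply (i := 1) (j := 1) (by decide) x,
    K.δ_comp_σ_self_apply 2 x, K.δ_comp_σ_succ_apply 2 x⟩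

section

variable (hK : ∀ j, HasFillers K 1 j)

include hK

lemma exists_bounds_one (h₀₂ : K.δ 0 x₂ = K.δ 1 x₀) (h₀₃ : K.δ 0 x₃ = K.δ 2 x₀)
    (h₂₃ : K.δ 2 x₃ = K.δ 2 x₂) : ∃ x, Bounds K x₀ x x₂ x₃ := by
  obtain ⟨z, hz⟩ := hK 1 ![x₀, x₀, x₂, x₃] (by
    intro i k hik hi hk
    fin_cases i <;> fin_cases k <;> simp at * <;> assumption)
  exact ⟨_, z, hz 0 (by decide), rfl, hz 2 (by decide), hz 3 (by decide)⟩

lemma exists_bounds_two (h₀₁ : K.δ 0 x₁ = K.δ 0 x₀) (h₀₃ : K.δ 0 x₃ = K.δ 2 x₀)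
    (h₁₃ : K.δ 1 x₃ = K.δ 2 x₁) : ∃ x, Bounds K x₀ x₁ x x₃ := by
  obtain ⟨z, hz⟩ := hK 2 ![x₀, x₁, x₀, x₃] (by
    intro i k hik hi hk
    fin_cases i <;> fin_cases k <;> simp at * <;> assumption)
  exact ⟨_, z, hz 0 (by decide), hz 1 (by decide), rfl, hz 3 (by decide)⟩

lemma exists_bounds_three (h₀₁ : K.δ 0 x₁ = K.δ 0 x₀) (h₀₂ : K.δ 0 x₂ = K.δ 1 x₀)
    (h₁₂ : K.δ 1 x₂ = K.δ 1 x₁) : ∃ x, Bounds K x₀ x₁ x₂ x := by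
  obtain ⟨z, hz⟩ := hK 3 ![x₀, x₁, x₂, x₀] (by
    intro i k hik hi hk
    fin_cases i <;> fin_cases k <;> simp at * <;> assumption)
  exact ⟨_, z, hz 0 (by decide), hz 1 (by decide), hz 2 (by decide), rfl⟩

end

/-- If four of the five tetrahedra of the boundary of a 4-simplex can be filled, then so can the
fifth. The triangles are `T i k`, where `i` and `k` are the vertices that they omit. -/
lemma bounds_of_forall_ne {j : Fin 5} (hK : HasFillers K 2 j) (T : Fin 5 → Fin 5 → K _⦋2⦌)
    (hT : ∀ i k, T i k = T k i)
    (h : ∀ i, i ≠ j → Bounds K (T i (i.succAbove 0)) (T i (i.succAbove 1))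
      (T i (i.succAbove 2)) (T i (i.succAbove 3))) :
    Bounds K (T j (j.succAbove 0)) (T j (j.succAbove 1)) (T j (j.succAbove 2))
      (T j (j.succAbove 3)) := by
  have h' : ∀ i, ∃ z : K _⦋3⦌, i ≠ j → ∀ m : Fin 4, K.δ m z = T i (i.succAbove m) := fun i => by
    by_cases hi : i = j
    · exact ⟨K.σ 0 (T 0 0), fun h => absurd hi h⟩
    · obtain ⟨z, h0, h1, h2, h3⟩ := h i hi
      refine ⟨z, fun _ m => ?_⟩
      fin_cases m <;> assumption
  choose z hz using h'
  have hsymm : ∀ i k : Fin 4, i ≤ k →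
      T k.succ (k.succ.succAbove i) = T i.castSucc (i.castSucc.succAbove k) := fun i k hik => by
    rw [Fin.succAbove_of_castSucc_lt _ _ (Fin.castSucc_lt_succ_iff.2 hik),
      Fin.succAbove_of_le_castSucc _ _ (Fin.castSucc_le_castSucc_iff.2 hik), hT]
  obtain ⟨y, hy⟩ := hK z fun i k hik hi hk => by
    rw [hz _ hk, hz _ hi, hsymm i k hik]
  -- by the simplicial identities, the faces of the missing tetrahedron are faces of the others
  have key : ∀ m : Fin 4, K.δ m (K.δ j y) = T j (j.succAbove m) := fun m => by
    rcases lt_or_ge m.castSucc j with hm | hm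
    · obtain ⟨l, rfl⟩ := Fin.exists_succ_eq_of_ne_zero (Fin.ne_zero_of_lt hm)
      have hml : m ≤ l := Fin.castSucc_lt_succ_iff.1 hm
      rw [K.δ_comp_δ_apply hml, hy _ hm.ne, hz _ hm.ne, hsymm m l hml]
    · have hj : j = (j.castLT (lt_of_le_of_lt hm m.isLt)).castSucc := by simp
      set l := j.castLT (lt_of_le_of_lt hm m.isLt) with hl
      have hlm : l ≤ m := by rw [hj] at hm; exact Fin.castSucc_le_castSucc_iff.1 hm
      have hne : m.succ ≠ j := by rw [hj]; exact (Fin.castSucc_lt_succ_iff.2 hlm).ne'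
      rw [hj, ← K.δ_comp_δ_apply hlm, hy _ hne, hz _ hne, hsymm l m hlm]
  exact ⟨K.δ j y, key 0, key 1, key 2, key 3⟩

section

variable (hK : ∀ j, HasFillers K 2 j)
  {t₀₁₂ t₀₁₃ t₀₁₄ t₀₂₃ t₀₂₄ t₀₃₄ t₁₂₃ t₁₂₄ t₁₃₄ t₂₃₄ : K _⦋2⦌}

/-- The triangles of a 4-simplex, indexed by the two vertices that they omit. -/
def triangleTable (t₀₁₂ t₀₁₃ t₀₁₄ t₀₂₃ t₀₂₄ t₀₃₄ t₁₂₃ t₁₂₄ t₁₃₄ t₂₃₄ : K _⦋2⦌) :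
    Fin 5 → Fin 5 → K _⦋2⦌ :=
  ![![t₂₃₄, t₂₃₄, t₁₃₄, t₁₂₄, t₁₂₃], ![t₂₃₄, t₂₃₄, t₀₃₄, t₀₂₄, t₀₂₃],
    ![t₁₃₄, t₀₃₄, t₀₃₄, t₀₁₄, t₀₁₃], ![t₁₂₄, t₀₂₄, t₀₁₄, t₀₁₄, t₀₁₂],
    ![t₁₂₃, t₀₂₃, t₀₁₃, t₀₁₂, t₀₁₂]]

lemma triangleTable_symm (i k : Fin 5) :
    triangleTable t₀₁₂ t₀₁₃ t₀₁₄ t₀₂₃ t₀₂₄ t₀₃₄ t₁₂₃ t₁₂₄ t₁₃₄ t₂₃₄ i k =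
      triangleTable t₀₁₂ t₀₁₃ t₀₁₄ t₀₂₃ t₀₂₄ t₀₃₄ t₁₂₃ t₁₂₄ t₁₃₄ t₂₃₄ k i := by
  fin_cases i <;> fin_cases k <;> rfl

include hK

lemma bounds_omit_zero (h₁ : Bounds K t₂₃₄ t₀₃₄ t₀₂₄ t₀₂₃) (h₂ : Bounds K t₁₃₄ t₀₃₄ t₀₁₄ t₀₁₃)
    (h₃ : Bounds K t₁₂₄ t₀₂₄ t₀₁₄ t₀₁₂) (h₄ : Bounds K t₁₂₃ t₀₂₃ t₀₁₃ t₀₁₂) :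
    Bounds K t₂₃₄ t₁₃₄ t₁₂₄ t₁₂₃ :=
  bounds_of_forall_ne (hK 0)
    (triangleTable t₀₁₂ t₀₁₃ t₀₁₄ t₀₂₃ t₀₂₄ t₀₃₄ t₁₂₃ t₁₂₄ t₁₃₄ t₂₃₄) triangleTable_symm
    fun i hi => by fin_cases i <;> first | (exact absurd rfl hi) | assumption

lemma bounds_omit_one (h₀ : Bounds K t₂₃₄ t₁₃₄ t₁₂₄ t₁₂₃) (h₂ : Bounds K t₁₃₄ t₀₃₄ t₀₁₄ t₀₁₃)
    (h₃ : Bounds K t₁₂₄ t₀₂₄ t₀₁₄ t₀₁₂) (h₄ : Bounds K t₁₂₃ t₀₂₃ t₀₁₃ t₀₁₂) :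
    Bounds K t₂₃₄ t₀₃₄ t₀₂₄ t₀₂₃ :=
  bounds_of_forall_ne (hK 1)
    (triangleTable t₀₁₂ t₀₁₃ t₀₁₄ t₀₂₃ t₀₂₄ t₀₃₄ t₁₂₃ t₁₂₄ t₁₃₄ t₂₃₄) triangleTable_symm
    fun i hi => by fin_cases i <;> first | (exact absurd rfl hi) | assumption

lemma bounds_omit_two (h₀ : Bounds K t₂₃₄ t₁₃₄ t₁₂₄ t₁₂₃) (h₁ : Bounds K t₂₃₄ t₀₃₄ t₀₂₄ t₀₂₃)
    (h₃ : Bounds K t₁₂₄ t₀₂₄ t₀₁₄ t₀₁₂) (h₄ : Bounds K t₁₂₃ t₀₂₃ t₀₁₃ t₀₁₂) :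
    Bounds K t₁₃₄ t₀₃₄ t₀₁₄ t₀₁₃ :=
  bounds_of_forall_ne (hK 2)
    (triangleTable t₀₁₂ t₀₁₃ t₀₁₄ t₀₂₃ t₀₂₄ t₀₃₄ t₁₂₃ t₁₂₄ t₁₃₄ t₂₃₄) triangleTable_symm
    fun i hi => by fin_cases i <;> first | (exact absurd rfl hi) | assumption

lemma bounds_omit_three (h₀ : Bounds K t₂₃₄ t₁₃₄ t₁₂₄ t₁₂₃) (h₁ : Bounds K t₂₃₄ t₀₃₄ t₀₂₄ t₀₂₃)
    (h₂ : Bounds K t₁₃₄ t₀₃₄ t₀₁₄ t₀₁₃) (h₄ : Bounds K t₁₂₃ t₀₂₃ t₀₁₃ t₀₁₂) :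
    Bounds K t₁₂₄ t₀₂₄ t₀₁₄ t₀₁₂ :=
  bounds_of_forall_ne (hK 3)
    (triangleTable t₀₁₂ t₀₁₃ t₀₁₄ t₀₂₃ t₀₂₄ t₀₃₄ t₁₂₃ t₁₂₄ t₁₃₄ t₂₃₄) triangleTable_symm
    fun i hi => by fin_cases i <;> first | (exact absurd rfl hi) | assumption

lemma bounds_omit_four (h₀ : Bounds K t₂₃₄ t₁₃₄ t₁₂₄ t₁₂₃) (h₁ : Bounds K t₂₃₄ t₀₃₄ t₀₂₄ t₀₂₃)
    (h₂ : Bounds K t₁₃₄ t₀₃₄ t₀₁₄ t₀₁₃) (h₃ : Bounds K t₁₂₄ t₀₂₄ t₀₁₄ t₀₁₂) :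
    Bounds K t₁₂₃ t₀₂₃ t₀₁₃ t₀₁₂ :=
  bounds_of_forall_ne (hK 4)
    (triangleTable t₀₁₂ t₀₁₃ t₀₁₄ t₀₂₃ t₀₂₄ t₀₃₄ t₁₂₃ t₁₂₄ t₁₃₄ t₂₃₄) triangleTable_symm
    fun i hi => by fin_cases i <;> first | (exact absurd rfl hi) | assumption

end

/-! ### Homotopies of triangles -/

lemma homotopic_iff {x y : K _⦋2⦌} :
    Homotopic K x y ↔ Bounds K (K.σ 1 (K.δ 0 x)) (K.σ 1 (K.δ 1 x)) x y := by
  constructor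
  · rintro ⟨-, z, h2, h3, h0, h1⟩
    exact ⟨z, h0, h1, h2, h3⟩
  · intro h
    obtain ⟨⟨-, -, h3⟩, ⟨-, h5⟩, h6⟩ := h.edges
    obtain ⟨z, h0, h1, h2, h3'⟩ := h
    have e0 : K.δ 2 (K.σ 1 (K.δ 0 x)) = K.δ 0 x := K.δ_comp_σ_succ_apply 1 _
    have e1 : K.δ 2 (K.σ 1 (K.δ 1 x)) = K.δ 1 x := K.δ_comp_σ_succ_apply 1 _
    refine ⟨fun i => ?_, z, h2, h3', h0, h1⟩
    fin_cases i
    · exact (h3.trans e0).symm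
    · exact (h5.trans e1).symm
    · exact h6.symm

lemma Homotopic.refl (x : K _⦋2⦌) : Homotopic K x x :=
  homotopic_iff.2 (bounds_σ_two x)

/-- The last face of a filled tetrahedron may be replaced by a homotopic triangle: fill a horn of a
4-simplex with vertices `0, 1, 2, 2', 3` whose edge `22'` is degenerate. -/
lemma bounds_congr_three (hK : ∀ j, HasFillers K 2 j) (h : Bounds K x₀ x₁ x₂ x₃)
    (hy : Homotopic K y₃ x₃) : Bounds K x₀ x₁ x₂ y₃ := by
  have e := h.edges
  have h₁ := bounds_σ_one x₁
  rw [e.1.1] at h₁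
  have h₄ := homotopic_iff.1 hy
  rw [hy.1 0, hy.1 1, e.1.2.2, e.2.1.2] at h₄
  exact bounds_omit_two hK (bounds_σ_one x₀) h₁ h h₄

lemma Homotopic.symm (hK : ∀ j, HasFillers K 2 j) {x y : K _⦋2⦌} (h : Homotopic K x y) :
    Homotopic K y x :=
  homotopic_iff.2 (bounds_congr_three hK (bounds_σ_two y) h)

lemma bounds_unique_three (hK : ∀ j, HasFillers K 2 j) (h : Bounds K x₀ x₁ x₂ x₃)
    (h' : Bounds K x₀ x₁ x₂ y₃) : Homotopic K x₃ y₃ := by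
  have e := h.edges
  have e' := h'.edges
  have h1 := bounds_σ_one x₁
  rw [e.1.1] at h1
  have := bounds_omit_four hK (bounds_σ_one x₀) h1 h h'
  rw [homotopic_iff, e.1.2.2, e.2.1.2]
  exact this

lemma Homotopic.trans (hK : ∀ j, HasFillers K 2 j) {x y t : K _⦋2⦌} (h : Homotopic K x y)
    (h' : Homotopic K y t) : Homotopic K x t :=
  homotopic_iff.2 (bounds_congr_three hK (homotopic_iff.1 h) (h'.symm hK))

/-- All faces of a filled tetrahedron may be replaced by homotopic triangles: the first three by
filling a horn of a 4-simplex with vertices `0, 1, 2, 3, 3'` whose edge `33'` is degenerate. -/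
lemma Bounds.congr (hK : ∀ j, HasFillers K 2 j) (h : Bounds K x₀ x₁ x₂ x₃)
    (h₀ : Homotopic K x₀ y₀) (h₁ : Homotopic K x₁ y₁) (h₂ : Homotopic K x₂ y₂)
    (h₃ : Homotopic K x₃ y₃) : Bounds K y₀ y₁ y₂ y₃ := by
  have e := h.edges
  have g₀ := homotopic_iff.1 h₀
  have g₁ := homotopic_iff.1 h₁
  have g₂ := homotopic_iff.1 h₂
  rw [e.1.1] at g₁
  rw [e.1.2.1, e.2.1.1] at g₂
  exact bounds_congr_three hK (bounds_omit_four hK g₀ g₁ g₂ h) (h₃.symm hK)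

lemma bounds_unique_two (hK : ∀ j, HasFillers K 2 j) (h : Bounds K x₀ x₁ x₂ x₃)
    (h' : Bounds K x₀ x₁ y₂ x₃) : Homotopic K x₂ y₂ := by
  have e := h.edges
  have g₀ := homotopic_iff.1 (Homotopic.refl x₀)
  have g₁ := homotopic_iff.1 (Homotopic.refl x₁)
  rw [e.1.1] at g₁
  have := bounds_omit_two hK g₀ g₁ h h'
  rw [homotopic_iff, e.1.2.1, e.2.1.1]
  exact this

lemma bounds_unique_zero (hK : ∀ j, HasFillers K 2 j) (h : Bounds K x₀ x₁ x₂ x₃)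
    (h' : Bounds K y₀ x₁ x₂ x₃) : Homotopic K x₀ y₀ := by
  have e := h.edges
  have g₁ := homotopic_iff.1 (Homotopic.refl x₁)
  have g₂ := homotopic_iff.1 (Homotopic.refl x₂)
  rw [e.1.1] at g₁
  rw [e.1.2.1, e.2.1.1] at g₂
  exact homotopic_iff.2 (bounds_omit_zero hK g₁ g₂ h h')

lemma bounds_unique_one (hK : ∀ j, HasFillers K 2 j) (h : Bounds K x₀ x₁ x₂ x₃)
    (h' : Bounds K x₀ y₁ x₂ x₃) : Homotopic K x₁ y₁ := by
  have e := h.edges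
  have g₀ := homotopic_iff.1 (Homotopic.refl x₀)
  have g₂ := homotopic_iff.1 (Homotopic.refl x₂)
  rw [e.1.2.1, e.2.1.1] at g₂
  have := bounds_omit_one hK g₀ g₂ h h'
  rw [homotopic_iff, e.1.1]
  exact this

end

/-! ### Transport of triangles along deformations of their sides

A deformation of an edge `a` into an edge `b` is a triangle `h` with `d_2 h = a`, `d_1 h = b` and
`d_0 h` degenerate. -/

/-- The triangle `w` is the transport of `x` along deformations `a`, `b`, `c` of the sides
`d_2 x`, `d_0 x`, `d_1 x`: the side `01` is deformed first, which results in a triangle `v` with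
`d_2 v = d_2 w`, `d_0 v = d_0 x` and `d_1 v = d_1 x`, and the sides `12` and `02` are deformed
thereafter. -/
def IsTransport (K : SSet.{u}) (x w a b c : K _⦋2⦌) : Prop :=
  ∃ v, Bounds K b c w v ∧ Bounds K (K.σ 0 (K.δ 0 x)) v x a

/-- The deformation `h` is the composite of the deformation `h'` and the deformation `t`. -/
def IsComposite (K : SSet.{u}) (h' h t : K _⦋2⦌) : Prop :=
  Bounds K (K.σ 0 (K.δ 0 h')) t h h'

section

variable {K L : SSet.{u}} {x x' w w' a b c a' b' c' : K _⦋2⦌}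

lemma IsTransport.map (f : K ⟶ L) (h : IsTransport K x w a b c) :
    IsTransport L (f.app _ x) (f.app _ w) (f.app _ a) (f.app _ b) (f.app _ c) := by
  obtain ⟨v, h1, h2⟩ := h
  refine ⟨f.app _ v, h1.map f, ?_⟩
  have := h2.map f
  rwa [SSet.σ_naturality_apply, SSet.δ_naturality_apply] at this

lemma δ_one_σ_zero (y : K _⦋1⦌) : K.δ 1 (K.σ 0 y) = y := K.δ_comp_σ_succ_apply 0 y

lemma δ_zero_σ_zero (y : K _⦋1⦌) : K.δ 0 (K.σ 0 y) = y := K.δ_comp_σ_self_apply 0 y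

lemma δ_two_σ_zero (y : K _⦋1⦌) : K.δ 2 (K.σ 0 y) = K.σ 0 (K.δ 1 y) :=
  K.δ_comp_σ_of_gt_apply (i := 1) (j := 0) (by decide) y

lemma δ_zero_σ_one (y : K _⦋1⦌) : K.δ 0 (K.σ 1 y) = K.σ 0 (K.δ 0 y) :=
  K.δ_comp_σ_of_le_apply (i := 0) (j := 0) (by decide) y

lemma δ_one_σ_one (y : K _⦋1⦌) : K.δ 1 (K.σ 1 y) = y := K.δ_comp_σ_self_apply 1 y

lemma δ_two_σ_one (y : K _⦋1⦌) : K.δ 2 (K.σ 1 y) = y := K.δ_comp_σ_succ_apply 1 y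

lemma σ_one_σ_zero (y : K _⦋0⦌) : K.σ 1 (K.σ 0 y) = K.σ 0 (K.σ 0 y) :=
  (K.σ_comp_σ_apply (i := 0) (j := 0) le_rfl y).symm

lemma δ_zero_σ_zero_zero (y : K _⦋0⦌) : K.δ 0 (K.σ 0 y) = y := K.δ_comp_σ_self_apply 0 y

lemma δ_one_σ_zero_zero (y : K _⦋0⦌) : K.δ 1 (K.σ 0 y) = y := K.δ_comp_σ_succ_apply 0 y

lemma δ_comp_δ_two (t : K _⦋2⦌) : K.δ 0 (K.δ 1 t) = K.δ 0 (K.δ 0 t) ∧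
    K.δ 0 (K.δ 2 t) = K.δ 1 (K.δ 0 t) ∧ K.δ 1 (K.δ 2 t) = K.δ 1 (K.δ 1 t) :=
  ⟨K.δ_comp_δ_apply (i := 0) (j := 0) (by decide) t,
    K.δ_comp_δ_apply (i := 0) (j := 1) (by decide) t,
    K.δ_comp_δ_apply (i := 1) (j := 1) (by decide) t⟩

/-- The edges of the triangles of a transport. -/
lemma IsTransport.edges (h : IsTransport K x w a b c) :
    (K.δ 2 a = K.δ 2 x ∧ K.δ 2 b = K.δ 0 x ∧ K.δ 2 c = K.δ 1 x) ∧
      (K.δ 1 a = K.δ 2 w ∧ K.δ 1 b = K.δ 0 w ∧ K.δ 1 c = K.δ 1 w) ∧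
      K.δ 0 a = K.σ 0 (K.δ 1 (K.δ 0 x)) ∧ K.δ 0 b = K.δ 0 c := by
  obtain ⟨v, h1, h2⟩ := h
  have e1 := h1.edges
  have e2 := h2.edges
  rw [δ_zero_σ_zero, δ_one_σ_zero, δ_two_σ_zero] at e2
  grind

lemma isTransport_self (x : K _⦋2⦌) :
    IsTransport K x x (K.σ 1 (K.δ 2 x)) (K.σ 1 (K.δ 0 x)) (K.σ 1 (K.δ 1 x)) :=
  ⟨x, bounds_σ_two x, bounds_σ_one x⟩

lemma isComposite_σ_one (y : K _⦋1⦌) :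
    IsComposite K (K.σ 1 y) (K.σ 1 y) (K.σ 1 y) := by
  have := bounds_σ_two (K.σ 1 y)
  rw [δ_zero_σ_one, δ_one_σ_one, σ_one_σ_zero] at this
  rw [IsComposite, δ_zero_σ_one]
  exact this

/-- The transport of a degenerate triangle `002`. -/
lemma isTransport_σ_zero (h : K _⦋2⦌) (y : K _⦋0⦌) (hy : K.δ 1 (K.δ 2 h) = y) :
    IsTransport K (K.σ 0 (K.δ 2 h)) (K.σ 0 (K.δ 1 h)) (K.σ 0 (K.σ 0 y)) h h := by
  refine ⟨K.σ 0 (K.δ 2 h), bounds_σ_zero h, ?_⟩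
  rw [δ_zero_σ_zero]
  have := bounds_σ_zero (K.σ 0 (K.δ 2 h))
  rwa [δ_one_σ_zero, δ_two_σ_zero, hy] at this

section

variable (hK₁ : ∀ j, HasFillers K 1 j)

include hK₁

lemma exists_isTransport_source (h02 : K.δ 1 a = K.δ 2 w) (h12 : K.δ 1 b = K.δ 0 w)
    (h01 : K.δ 1 c = K.δ 1 w) (hb : K.δ 0 b = K.δ 0 c)
    (ha : K.δ 0 a = K.σ 0 (K.δ 1 (K.δ 2 b))) : ∃ x, IsTransport K x w a b c := by
  obtain ⟨v, hv⟩ := exists_bounds_three hK₁ (x₀ := b) (x₁ := c) (x₂ := w) hb.symm h12.symm h01.symm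
  have e := hv.edges
  obtain ⟨x, hx⟩ := exists_bounds_two hK₁ (x₀ := K.σ 0 (K.δ 2 b)) (x₁ := v) (x₃ := a)
    (by rw [δ_zero_σ_zero]; grind) (by rw [δ_two_σ_zero]; grind) (by grind)
  refine ⟨x, v, hv, ?_⟩
  have e' := hx.edges
  rw [δ_one_σ_zero] at e'
  rwa [e'.1.2.1]

lemma exists_isTransport_target (h02 : K.δ 2 a = K.δ 2 x) (h12 : K.δ 2 b = K.δ 0 x)
    (h01 : K.δ 2 c = K.δ 1 x) (hb : K.δ 0 b = K.δ 0 c)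
    (ha : K.δ 0 a = K.σ 0 (K.δ 1 (K.δ 0 x))) : ∃ w, IsTransport K x w a b c := by
  obtain ⟨v, hv⟩ := exists_bounds_one hK₁ (x₀ := K.σ 0 (K.δ 0 x)) (x₂ := x) (x₃ := a)
    (by rw [δ_one_σ_zero]) (by rw [δ_two_σ_zero, ha]) h02
  have e := hv.edges
  rw [δ_zero_σ_zero] at e
  obtain ⟨w, hw⟩ := exists_bounds_two hK₁ (x₀ := b) (x₁ := c) (x₃ := v)
    (by grind) (by grind) (by grind)
  exact ⟨w, v, hw, hv⟩

lemma exists_isTransport_third (h02 : K.δ 2 a = K.δ 2 x) (h12 : K.δ 2 b = K.δ 0 x)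
    (h02' : K.δ 1 a = K.δ 2 w) (h12' : K.δ 1 b = K.δ 0 w)
    (ha : K.δ 0 a = K.σ 0 (K.δ 1 (K.δ 0 x))) : ∃ c, IsTransport K x w a b c := by
  obtain ⟨v, hv⟩ := exists_bounds_one hK₁ (x₀ := K.σ 0 (K.δ 0 x)) (x₂ := x) (x₃ := a)
    (by rw [δ_one_σ_zero]) (by rw [δ_two_σ_zero, ha]) h02
  have e := hv.edges
  rw [δ_zero_σ_zero] at e
  obtain ⟨c, hc⟩ := exists_bounds_one hK₁ (x₀ := b) (x₂ := w) (x₃ := v)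
    (by grind) (by grind) (by grind)
  exact ⟨c, v, hc, hv⟩

lemma exists_isComposite (h0 : K.δ 0 a' = K.σ 0 (K.δ 0 (K.δ 1 a'))) (h : K.δ 1 a' = K.δ 2 a)
    (h0' : K.δ 0 a = K.δ 0 a') : ∃ c, IsComposite K a' c a := by
  obtain ⟨c, hc⟩ := exists_bounds_two hK₁ (x₀ := K.σ 0 (K.δ 0 a')) (x₁ := a) (x₃ := a')
    (by rw [δ_zero_σ_zero, h0']) (by rw [δ_two_σ_zero, h0, δ_one_σ_zero_zero]) h
  exact ⟨c, hc⟩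

end

section

variable (hK₂ : ∀ j, HasFillers K 2 j)

include hK₂

lemma IsTransport.congr (h : IsTransport K x w a b c) (hx : Homotopic K x x')
    (hw : Homotopic K w w') (hc : Homotopic K c c') : IsTransport K x' w' a b c' := by
  obtain ⟨v, h1, h2⟩ := h
  refine ⟨v, h1.congr hK₂ (.refl _) hc hw (.refl _), ?_⟩
  rw [← hx.1 0]
  exact h2.congr hK₂ (.refl _) (.refl _) hx (.refl _)

lemma IsTransport.source_unique (h : IsTransport K x w a b c) (h' : IsTransport K x' w a b c) :
    Homotopic K x x' := by
  have e := h.edges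
  have e' := h'.edges
  obtain ⟨v, h1, h2⟩ := h
  obtain ⟨v', h1', h2'⟩ := h'
  rw [show K.δ 0 x' = K.δ 0 x by grind] at h2'
  exact bounds_unique_two hK₂ h2 (h2'.congr hK₂ (.refl _)
    (bounds_unique_three hK₂ h1' h1) (.refl _) (.refl _))

lemma IsTransport.target_unique (h : IsTransport K x w a b c) (h' : IsTransport K x w' a b c) :
    Homotopic K w w' := by
  obtain ⟨v, h1, h2⟩ := h
  obtain ⟨v', h1', h2'⟩ := h'
  exact bounds_unique_two hK₂ h1 (h1'.congr hK₂ (.refl _) (.refl _) (.refl _)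
    (bounds_unique_one hK₂ h2' h2))

lemma IsTransport.third_unique (h : IsTransport K x w a b c) (h' : IsTransport K x w a b c') :
    Homotopic K c c' := by
  obtain ⟨v, h1, h2⟩ := h
  obtain ⟨v', h1', h2'⟩ := h'
  exact bounds_unique_one hK₂ h1 (h1'.congr hK₂ (.refl _) (.refl _) (.refl _)
    (bounds_unique_one hK₂ h2' h2))

/-- If the faces of the boundary of a tetrahedron are transported and the resulting boundary can be
filled, then so can the original one. This fills the prism between the two tetrahedra. -/
lemma bounds_of_isTransport {x₀ x₁ x₂ x₃ w₀ w₁ w₂ w₃ h₀₁ h₀₂ h₀₃ h₁₂ h₁₃ h₂₃ : K _⦋2⦌}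
    (q₀ : IsTransport K x₀ w₀ h₁₂ h₂₃ h₁₃) (q₁ : IsTransport K x₁ w₁ h₀₂ h₂₃ h₀₃)
    (q₂ : IsTransport K x₂ w₂ h₀₁ h₁₃ h₀₃) (q₃ : IsTransport K x₃ w₃ h₀₁ h₁₂ h₀₂)
    (hw : Bounds K w₀ w₁ w₂ w₃) : Bounds K x₀ x₁ x₂ x₃ := by
  have e₀ := q₀.edges
  have e₁ := q₁.edges
  have e₂ := q₂.edges
  have e₃ := q₃.edges
  obtain ⟨v₀, a₀, b₀⟩ := q₀
  obtain ⟨v₁, a₁, b₁⟩ := q₁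
  obtain ⟨v₂, a₂, b₂⟩ := q₂
  obtain ⟨v₃, a₃, b₃⟩ := q₃
  -- the vertices `0, 1, 2, 3, 3'`
  have hv := bounds_omit_four hK₂ a₀ a₁ a₂ hw
  -- the vertices `0, 1, 2, 2', 3`
  have h01 : K.δ 0 x₁ = K.δ 0 x₀ := by rw [← e₁.1.2.1, ← e₀.1.2.1]
  rw [h01] at b₁
  have hv' := bounds_omit_three hK₂ b₀ b₁ hv a₃
  -- the vertices `0, 1, 1', 2, 3`
  have h02 : K.δ 0 x₂ = K.δ 1 x₀ := by rw [← e₂.1.2.1, ← e₀.1.2.2]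
  have h03 : K.δ 0 x₃ = K.δ 2 x₀ := by rw [← e₃.1.2.1, ← e₀.1.1]
  rw [h02] at b₂
  rw [h03] at b₃
  exact bounds_omit_two hK₂ (bounds_σ_zero x₀) hv' b₂ b₃

/-- Transports can be composed. -/
lemma IsTransport.comp (hK₁ : ∀ j, HasFillers K 1 j) {a'' b'' c'' : K _⦋2⦌}
    (h' : IsTransport K x w' a' b' c') (h : IsTransport K w' w a'' b'' c'')
    (ha : IsComposite K a' a a'') (hb : IsComposite K b' b b'') (hc : IsComposite K c' c c'') :
    IsTransport K x w a b c := by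
  have e' := h'.edges
  have e := h.edges
  have eb := Bounds.edges hb
  have ec := Bounds.edges hc
  simp only [δ_zero_σ_zero, δ_one_σ_zero, δ_two_σ_zero] at eb ec
  obtain ⟨v, hv⟩ := exists_bounds_three hK₁ (x₀ := b) (x₁ := c) (x₂ := w)
    (by grind) (by grind) (by grind)
  refine ⟨v, hv, ?_⟩
  obtain ⟨v', r₁, r₂⟩ := h'
  obtain ⟨v'', s₁, s₂⟩ := h
  unfold IsComposite at ha hb hc
  -- the vertices `0, 1'', 2, 2', 2''`
  have hbc : K.δ 0 b' = K.δ 0 c' := e'.2.2.2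
  rw [hbc] at hb
  have h1 := bounds_omit_four hK₂ hb hc s₁ hv
  -- the vertices `0, 1', 1'', 2, 2'`
  have h2 := bounds_σ_zero b'
  rw [e'.1.2.1, e'.2.1.2.1] at h2
  have h3 := bounds_omit_four hK₂ h2 h1 r₁ s₂
  -- the vertices `0, 1, 1', 1'', 2`
  have h4 := bounds_σ_zero (K.σ 0 (K.δ 0 x))
  rw [δ_one_σ_zero, δ_two_σ_zero] at h4
  rw [e'.2.2.1] at ha
  exact bounds_omit_two hK₂ h4 h3 r₂ ha

lemma IsComposite.congr_right (h : IsComposite K a b c) (hb : Homotopic K b b') :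
    IsComposite K a b' c :=
  Bounds.congr hK₂ h (.refl _) (.refl _) hb (.refl _)

/-- The transport of a degenerate triangle `022`. -/
lemma isTransport_σ_one (hK₁ : ∀ j, HasFillers K 1 j) (h : K _⦋2⦌) (y : K _⦋0⦌)
    (hy : K.δ 0 h = K.σ 0 y) :
    IsTransport K (K.σ 1 (K.δ 2 h)) (K.σ 1 (K.δ 1 h)) h (K.σ 0 (K.σ 0 y)) h := by
  have hd := δ_comp_δ_two h
  rw [hy, δ_zero_σ_zero_zero, δ_one_σ_zero_zero] at hd
  obtain ⟨x, hx⟩ := exists_isTransport_source hK₁ (a := h) (b := K.σ 0 (K.σ 0 y)) (c := h)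
    (w := K.σ 1 (K.δ 1 h)) (δ_two_σ_one _).symm
    (by rw [δ_one_σ_zero, δ_zero_σ_one, hd.1]) (δ_one_σ_one _).symm
    (by rw [δ_zero_σ_zero, hy]) (by rw [δ_two_σ_zero, hy, δ_one_σ_zero_zero, δ_one_σ_zero_zero])
  refine hx.congr hK₂ ?_ (.refl _) (.refl _)
  have e := hx.edges
  obtain ⟨v, h1, h2⟩ := hx
  rw [← e.1.2.1, δ_two_σ_zero, δ_one_σ_zero_zero] at h2
  -- by a 4-simplex with vertices `0, 1, 1', 2, 2'` whose vertices except `0` are all joined by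
  -- degenerate edges, `x` and `σ_1 (d_2 h)` fill the same tetrahedron
  have h0 : Bounds K (K.σ 0 (K.σ 0 y)) (K.σ 0 (K.σ 0 y)) (K.σ 0 (K.σ 0 y)) (K.σ 0 (K.σ 0 y)) := by
    have := bounds_σ_zero (K.σ 0 (K.σ 0 y))
    rwa [δ_one_σ_zero, δ_two_σ_zero, δ_one_σ_zero_zero] at this
  have h3 := bounds_σ_two h
  rw [hy, σ_one_σ_zero] at h3
  have h4 := bounds_omit_two hK₂ h0 h1 h3 h2
  have h5 := bounds_σ_one h
  rw [hy] at h5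
  exact bounds_unique_three hK₂ h4 h5

end

end

/-! ### Pulling back a simplicial set along a map to its edges -/

section

variable {K W : SSet.{u}}

lemma map_map_op {l m n : SimplexCategory} (f : l ⟶ m) (g : m ⟶ n) (x : K.obj (op n)) :
    K.map f.op (K.map g.op x) = K.map (f ≫ g).op x := by
  rw [op_comp, K.map_comp_apply]

lemma δ_map_op {m : ℕ} {n : SimplexCategory} (i : Fin (m + 2)) (g : ⦋m + 1⦌ ⟶ n)
    (x : K.obj (op n)) : K.δ i (K.map g.op x) = K.map (SimplexCategory.δ i ≫ g).op x :=
  map_map_op _ _ _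

lemma σ_map_op {m : ℕ} {n : SimplexCategory} (i : Fin (m + 1)) (g : ⦋m⦌ ⟶ n)
    (x : K.obj (op n)) : K.σ i (K.map g.op x) = K.map (SimplexCategory.σ i ≫ g).op x :=
  map_map_op _ _ _

lemma map_op_δ {m n : ℕ} (i : Fin (n + 2)) (g : ⦋m⦌ ⟶ ⦋n⦌) (x : K _⦋n + 1⦌) :
    K.map g.op (K.δ i x) = K.map (g ≫ SimplexCategory.δ i).op x :=
  map_map_op _ _ _

lemma map_id_op (n : SimplexCategory) (x : K.obj (op n)) : K.map (𝟙 n).op x = x := by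
  rw [op_id, K.map_id_apply]

lemma eq_id_of_zero (f : ⦋0⦌ ⟶ ⦋0⦌) : f = 𝟙 _ := by
  ext i
  exact congrArg Fin.val (Subsingleton.elim (α := Fin 1) _ _)

lemma eq_σ_zero (φ : ⦋1⦌ ⟶ ⦋0⦌) : φ = SimplexCategory.σ 0 := by
  ext i
  exact congrArg Fin.val (Subsingleton.elim (α := Fin 1) _ _)

lemma eq_id_or_eq_σ_comp (φ : ⦋1⦌ ⟶ ⦋1⦌) : φ = 𝟙 _ ∨ ∃ v, φ = SimplexCategory.σ 0 ≫ v := by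
  by_cases hφ : Function.Injective φ.toOrderHom
  · have : Mono φ := SimplexCategory.mono_iff_injective.2 hφ
    exact .inl (SimplexCategory.eq_id_of_mono φ)
  · obtain ⟨i, v, rfl⟩ := SimplexCategory.eq_σ_comp_of_not_injective φ hφ
    obtain rfl : i = 0 := Subsingleton.elim (α := Fin 1) _ _
    exact .inr ⟨v, rfl⟩

lemma δ_zero_σ_zero_comp {n : SimplexCategory} (v : ⦋0⦌ ⟶ n) :
    SimplexCategory.δ 0 ≫ SimplexCategory.σ 0 ≫ v = v :=
  (Category.assoc _ _ _).symm.trans ((congrArg (· ≫ v)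
    (SimplexCategory.δ_comp_σ_self (i := (0 : Fin 1)))).trans (Category.id_comp v))

/-- A map to `[n + 1]` from `[m]` with `m < n` misses a vertex different from a given one. -/
lemma exists_factor_δ {m n : ℕ} (h : m < n) (θ : ⦋m⦌ ⟶ ⦋n + 1⦌) (j : Fin (n + 2)) :
    ∃ i, i ≠ j ∧ ∃ θ' : ⦋m⦌ ⟶ ⦋n⦌, θ = θ' ≫ SimplexCategory.δ i := by
  obtain ⟨i, hi⟩ : ∃ i, i ∉ insert j (Finset.univ.image θ.toOrderHom) := by
    by_contra hcon
    push Not at hcon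
    have h1 := Finset.card_le_card (fun i _ => hcon i :
      Finset.univ ⊆ insert j (Finset.univ.image θ.toOrderHom))
    have h2 := Finset.card_insert_le j (Finset.univ.image θ.toOrderHom)
    have h3 : (Finset.univ.image θ.toOrderHom).card ≤ m + 1 := by
      simpa using (Finset.card_image_le (s := Finset.univ) (f := θ.toOrderHom))
    simp at h1
    omega
  simp only [Finset.mem_insert, Finset.mem_image, Finset.mem_univ, true_and, not_or,
    not_exists] at hi
  exact ⟨i, hi.1, SimplexCategory.eq_comp_δ_of_not_surjective' θ i hi.2⟩

lemma exists_factor_δ' {m n : ℕ} (h : m ≤ n) (θ : ⦋m⦌ ⟶ ⦋n + 1⦌) :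
    ∃ i, ∃ θ' : ⦋m⦌ ⟶ ⦋n⦌, θ = θ' ≫ SimplexCategory.δ i := by
  refine SimplexCategory.eq_comp_δ_of_not_surjective θ fun hs => ?_
  have := Fintype.card_le_of_surjective _ hs
  simp at this
  omega

/-- An `n`-simplex of `W` together with lifts of its edges along `r : E → W_1`, the lifts of
degenerate edges being given by `unit`. -/
def IsLift {E : Type u} (r : E → W _⦋1⦌) (unit : W _⦋0⦌ → E) {n : SimplexCategory}
    (w : W.obj (op n)) (e : (⦋1⦌ ⟶ n) → E) : Prop :=
  (∀ φ, r (e φ) = W.map φ.op w) ∧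
    ∀ v : ⦋0⦌ ⟶ n, e (SimplexCategory.σ 0 ≫ v) = unit (W.map v.op w)

lemma IsLift.map {E : Type u} {r : E → W _⦋1⦌} {unit : W _⦋0⦌ → E} {m n : SimplexCategory}
    {w : W.obj (op n)} {e : (⦋1⦌ ⟶ n) → E} (h : IsLift r unit w e) (f : m ⟶ n) :
    IsLift r unit (W.map f.op w) fun φ => e (φ ≫ f) :=
  ⟨fun φ => by rw [h.1, map_map_op], fun v => by
    simp only [Category.assoc, h.2, map_map_op]⟩

/-! ### The relation between a simplicial set and a transported copy -/

/-- A simplicial set `W` in `K`, a set `E` of edges `left e` of `K` that are deformed into edges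
`right e` of `W` by triangles `cyl e`. -/
structure TransportData (K W : SSet.{u}) (E : Type u) where
  ι : W ⟶ K
  left : E → K _⦋1⦌
  right : E → W _⦋1⦌
  cyl : E → K _⦋2⦌
  unit : W _⦋0⦌ → E
  δ_two_cyl : ∀ e, K.δ 2 (cyl e) = left e
  δ_one_cyl : ∀ e, K.δ 1 (cyl e) = ι.app _ (right e)
  δ_zero_cyl : ∀ e, K.δ 0 (cyl e) = K.σ 0 (K.δ 0 (left e))
  left_unit : ∀ y, left (unit y) = ι.app _ (W.σ 0 y)
  right_unit : ∀ y, right (unit y) = W.σ 0 y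
  cyl_unit : ∀ y, cyl (unit y) = ι.app _ (W.σ 0 (W.σ 0 y))

/-- The conditions under which a simplex of `K` and lifts of its edges to `E` determine a simplex
of `W`, to which it is transported. -/
structure TransportData.IsComplete {E : Type u} (D : TransportData K W E) : Prop where
  fill_source : ∀ n j, HasFillers K (n + 1) j
  fill_target : ∀ n j, HasFillers W n j
  unique_target : ∀ (n : ℕ) (y y' : W _⦋n + 3⦌), (∀ i, i ≠ 0 → W.δ i y = W.δ i y') → y = y'
  eq_of_homotopic : ∀ y y' : W _⦋2⦌, Homotopic K (D.ι.app _ y) (D.ι.app _ y') → y = y'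
  exists_triangle : ∀ (x : K _⦋2⦌) (e₀ e₁ e₂ : E), D.left e₀ = K.δ 0 x → D.left e₁ = K.δ 1 x →
    D.left e₂ = K.δ 2 x → ∃ y : W _⦋2⦌, (D.right e₀ = W.δ 0 y ∧ D.right e₁ = W.δ 1 y ∧
      D.right e₂ = W.δ 2 y) ∧ IsTransport K x (D.ι.app _ y) (D.cyl e₂) (D.cyl e₀) (D.cyl e₁)

namespace TransportData

variable {E : Type u} (D : TransportData K W E)

/-- The edges of `x` are the left ends of the edges `e`, and its triangles are transported to the
triangles of `y`. -/
def Rel {n : SimplexCategory} (x : K.obj (op n)) (y : W.obj (op n)) (e : (⦋1⦌ ⟶ n) → E) : Prop :=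
  (∀ φ, D.left (e φ) = K.map φ.op x) ∧
    ∀ ψ : ⦋2⦌ ⟶ n, IsTransport K (K.map ψ.op x) (D.ι.app _ (W.map ψ.op y))
      (D.cyl (e (SimplexCategory.δ 2 ≫ ψ))) (D.cyl (e (SimplexCategory.δ 0 ≫ ψ)))
      (D.cyl (e (SimplexCategory.δ 1 ≫ ψ)))

variable {D}

lemma Rel.map {m n : SimplexCategory} {x : K.obj (op n)} {y : W.obj (op n)}
    {e : (⦋1⦌ ⟶ n) → E} (h : D.Rel x y e) (f : m ⟶ n) :
    D.Rel (K.map f.op x) (W.map f.op y) fun φ => e (φ ≫ f) :=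
  ⟨fun φ => by rw [h.1, map_map_op], fun ψ => by
    simpa only [map_map_op, Category.assoc] using h.2 (ψ ≫ f)⟩

/-- Degenerate triangles are always transported. -/
lemma isTransport_of_not_injective (hD : D.IsComplete) {n : SimplexCategory} {x : K.obj (op n)}
    {y : W.obj (op n)} {e : (⦋1⦌ ⟶ n) → E} (hx : ∀ φ, D.left (e φ) = K.map φ.op x)
    (hy : IsLift D.right D.unit y e) (ψ : ⦋2⦌ ⟶ n) (hψ : ¬ Function.Injective ψ.toOrderHom) :
    IsTransport K (K.map ψ.op x) (D.ι.app _ (W.map ψ.op y))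
      (D.cyl (e (SimplexCategory.δ 2 ≫ ψ))) (D.cyl (e (SimplexCategory.δ 0 ≫ ψ)))
      (D.cyl (e (SimplexCategory.δ 1 ≫ ψ))) := by
  obtain ⟨i, φ, rfl⟩ := SimplexCategory.eq_σ_comp_of_not_injective ψ hψ
  have h1 : K.map φ.op x = K.δ 2 (D.cyl (e φ)) := by rw [D.δ_two_cyl, hx]
  have h2 : D.ι.app _ (W.map φ.op y) = K.δ 1 (D.cyl (e φ)) := by rw [D.δ_one_cyl, hy.1]
  have h3 : ∀ i : Fin 2, D.ι.app _ (W.δ i (W.map φ.op y)) = K.δ i (K.map φ.op x) := fun i => by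
    have := (δ_comp_δ_two (D.cyl (e φ)))
    rw [D.δ_zero_cyl, δ_zero_σ_zero_zero, δ_one_σ_zero_zero, D.δ_two_cyl, D.δ_one_cyl] at this
    rw [← hx, ← hy.1, SSet.δ_naturality_apply]
    fin_cases i
    · exact this.1
    · exact this.2.2.symm
  have h4 : ∀ v : ⦋0⦌ ⟶ n, D.cyl (e (SimplexCategory.σ 0 ≫ v)) =
      K.σ 0 (K.σ 0 (D.ι.app _ (W.map v.op y))) := fun v => by
    rw [hy.2, D.cyl_unit, SSet.σ_naturality_apply, SSet.σ_naturality_apply]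
  -- `ψ` factors through `σ_0` or `σ_1`, so that the triangle has the form `002` or `022`
  fin_cases i
  · have e2 : SimplexCategory.δ 2 ≫ SimplexCategory.σ 0 ≫ φ =
        SimplexCategory.σ 0 ≫ SimplexCategory.δ 1 ≫ φ := by
      rw [← Category.assoc, ← Category.assoc]
      congr 1
      exact SimplexCategory.δ_comp_σ_of_gt (i := 1) (j := 0) (by decide)
    have e0 : SimplexCategory.δ 0 ≫ SimplexCategory.σ 0 ≫ φ = φ := by
      rw [← Category.assoc]
      exact (congrArg (· ≫ φ) SimplexCategory.δ_comp_σ_self).trans (Category.id_comp _)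
    have e1 : SimplexCategory.δ 1 ≫ SimplexCategory.σ 0 ≫ φ = φ := by
      rw [← Category.assoc]
      exact (congrArg (· ≫ φ) SimplexCategory.δ_comp_σ_succ).trans (Category.id_comp _)
    simp only [Fin.zero_eta]
    rw [e2, e0, e1, h4, ← σ_map_op, ← σ_map_op, SSet.σ_naturality_apply, h1, h2]
    refine isTransport_σ_zero _ _ ?_
    rw [← h1, ← h3, δ_map_op]
  · have e2 : SimplexCategory.δ 2 ≫ SimplexCategory.σ 1 ≫ φ = φ := by
      rw [← Category.assoc]
      exact (congrArg (· ≫ φ) SimplexCategory.δ_comp_σ_succ).trans (Category.id_comp _)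
    have e0 : SimplexCategory.δ 0 ≫ SimplexCategory.σ 1 ≫ φ =
        SimplexCategory.σ 0 ≫ SimplexCategory.δ 0 ≫ φ := by
      rw [← Category.assoc, ← Category.assoc]
      congr 1
      exact SimplexCategory.δ_comp_σ_of_le (i := 0) (j := 0) (by decide)
    have e1 : SimplexCategory.δ 1 ≫ SimplexCategory.σ 1 ≫ φ = φ := by
      rw [← Category.assoc]
      exact (congrArg (· ≫ φ) SimplexCategory.δ_comp_σ_self).trans (Category.id_comp _)
    simp only [Fin.mk_one]
    rw [e2, e0, e1, h4, ← σ_map_op, ← σ_map_op, SSet.σ_naturality_apply, h1, h2]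
    refine isTransport_σ_one (hD.fill_source 1) (hD.fill_source 0) _ _ ?_
    rw [D.δ_zero_cyl, ← δ_map_op, h3, hx]

lemma IsComplete.ι_injective (hD : D.IsComplete) (y y' : W _⦋0⦌)
    (h : D.ι.app _ y = D.ι.app _ y') : y = y' := by
  have h1 := hD.eq_of_homotopic (W.σ 0 (W.σ 0 y)) (W.σ 0 (W.σ 0 y')) (by
    rw [SSet.σ_naturality_apply, SSet.σ_naturality_apply, h, SSet.σ_naturality_apply,
      SSet.σ_naturality_apply]
    exact Homotopic.refl _)
  rw [← δ_zero_σ_zero_zero y, ← δ_zero_σ_zero (W.σ 0 y), h1, δ_zero_σ_zero, δ_zero_σ_zero_zero]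

/-- Simplices of dimension at least 2 of `W` are determined by their triangles. -/
lemma IsComplete.ext (hD : D.IsComplete) (n : ℕ) (y y' : W _⦋n + 2⦌)
    (h : ∀ ψ : ⦋2⦌ ⟶ ⦋n + 2⦌, W.map ψ.op y = W.map ψ.op y') : y = y' := by
  induction n with
  | zero => simpa only [map_id_op] using h (𝟙 _)
  | succ n ih =>
    refine hD.unique_target n y y' fun i _ => ih _ _ fun ψ => ?_
    rw [map_op_δ, map_op_δ, h]

lemma eq_of_isTransport (hD : D.IsComplete) {x a b c : K _⦋2⦌} {y y' : W _⦋2⦌}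
    (h : IsTransport K x (D.ι.app _ y) a b c) (h' : IsTransport K x (D.ι.app _ y') a b c) :
    y = y' :=
  hD.eq_of_homotopic _ _ (h.target_unique (hD.fill_source 1) h')

/-- A simplex of `K` and lifts of its edges determine the transported simplex. -/
lemma Rel.target_unique (hD : D.IsComplete) {n : ℕ} {x : K _⦋n⦌} {y y' : W _⦋n⦌}
    {e : (⦋1⦌ ⟶ ⦋n⦌) → E} (h : D.Rel x y e) (h' : D.Rel x y' e)
    (hy : IsLift D.right D.unit y e) (hy' : IsLift D.right D.unit y' e) : y = y' := by
  match n, x, y, y', e, h, h', hy, hy' with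
  | 0, x, y, y', e, h, h', hy, hy' =>
    have := (hy.1 (SimplexCategory.σ 0)).symm.trans (hy'.1 (SimplexCategory.σ 0))
    have := congrArg (W.δ 0) this
    rw [δ_map_op, δ_map_op] at this
    simpa only [eq_id_of_zero, map_id_op] using this
  | 1, x, y, y', e, h, h', hy, hy' =>
    have := (hy.1 (𝟙 _)).symm.trans (hy'.1 (𝟙 _))
    simpa only [map_id_op] using this
  | n + 2, x, y, y', e, h, h', hy, hy' =>
    exact hD.ext n y y' fun ψ => eq_of_isTransport hD (h.2 ψ) (h'.2 ψ)

lemma Rel.source_homotopic (hD : D.IsComplete) {n : SimplexCategory} {x x' : K.obj (op n)}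
    {y : W.obj (op n)} {e : (⦋1⦌ ⟶ n) → E} (h : D.Rel x y e) (h' : D.Rel x' y e) :
    TruncRel K (op n) x x' :=
  fun φ => (h.2 φ.unop).source_unique (hD.fill_source 1) (h'.2 φ.unop)

end TransportData

lemma TruncRel.map_eq {n : SimplexCategory} {x x' : K.obj (op n)} (h : TruncRel K (op n) x x')
    (φ : ⦋1⦌ ⟶ n) : K.map φ.op x = K.map φ.op x' := by
  have := (h (SimplexCategory.σ 0 ≫ φ).op).1 0
  rw [δ_map_op, δ_map_op] at this
  have e0 : SimplexCategory.δ 0 ≫ SimplexCategory.σ 0 ≫ φ = φ := by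
    rw [← Category.assoc]
    exact (congrArg (· ≫ φ) SimplexCategory.δ_comp_σ_self).trans (Category.id_comp _)
  rwa [e0] at this

namespace TransportData

variable {E : Type u} {D : TransportData K W E}

lemma Rel.congr (hD : D.IsComplete) {n : SimplexCategory} {x x' : K.obj (op n)}
    {y : W.obj (op n)} {e : (⦋1⦌ ⟶ n) → E} (h : D.Rel x y e) (hx : TruncRel K (op n) x x') :
    D.Rel x' y e :=
  ⟨fun φ => (h.1 φ).trans (hx.map_eq φ), fun ψ =>
    (h.2 ψ).congr (hD.fill_source 1) (hx ψ.op) (.refl _) (.refl _)⟩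

/-- If the faces of a tetrahedron other than the face `0` are transported to the faces of a
tetrahedron of `W`, then so is the face `0`: the triangle which is transported to the face `0` in
`W` fills the same boundary. -/
lemma isTransport_face_zero (hD : D.IsComplete) {x : K _⦋3⦌} {y : W _⦋3⦌}
    {e : (⦋1⦌ ⟶ ⦋3⦌) → E} (hx : ∀ φ, D.left (e φ) = K.map φ.op x)
    (hy : ∀ φ, D.right (e φ) = W.map φ.op y)
    (h : ∀ i : Fin 3, IsTransport K (K.δ i.succ x) (D.ι.app _ (W.δ i.succ y))
      (D.cyl (e (SimplexCategory.δ 2 ≫ SimplexCategory.δ i.succ)))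
      (D.cyl (e (SimplexCategory.δ 0 ≫ SimplexCategory.δ i.succ)))
      (D.cyl (e (SimplexCategory.δ 1 ≫ SimplexCategory.δ i.succ)))) :
    IsTransport K (K.δ 0 x) (D.ι.app _ (W.δ 0 y))
      (D.cyl (e (SimplexCategory.δ 2 ≫ SimplexCategory.δ 0)))
      (D.cyl (e (SimplexCategory.δ 0 ≫ SimplexCategory.δ 0)))
      (D.cyl (e (SimplexCategory.δ 1 ≫ SimplexCategory.δ 0))) := by
  have hr : ∀ i j, K.δ 1 (D.cyl (e (SimplexCategory.δ i ≫ SimplexCategory.δ j))) =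
      K.δ i (D.ι.app _ (W.δ j y)) := fun i j => by
    rw [D.δ_one_cyl, hy, ← SSet.δ_naturality_apply, ← map_map_op]
    rfl
  have hl : ∀ i j, D.left (e (SimplexCategory.δ i ≫ SimplexCategory.δ j)) =
      K.δ i (K.δ j x) := fun i j => by
    rw [hx, ← map_map_op]
    rfl
  obtain ⟨x₀, hx₀⟩ := exists_isTransport_source (hD.fill_source 0)
    (w := D.ι.app _ (W.δ 0 y))
    (a := D.cyl (e (SimplexCategory.δ 2 ≫ SimplexCategory.δ 0)))
    (b := D.cyl (e (SimplexCategory.δ 0 ≫ SimplexCategory.δ 0)))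
    (c := D.cyl (e (SimplexCategory.δ 1 ≫ SimplexCategory.δ 0)))
    (hr 2 0) (hr 0 0) (hr 1 0)
    (by rw [D.δ_zero_cyl, D.δ_zero_cyl, hl, hl, (δ_comp_δ_two _).1])
    (by rw [D.δ_zero_cyl, D.δ_two_cyl, hl, hl, (δ_comp_δ_two _).2.1])
  -- the index `i.succ` and the compositions of coface maps are put into the normal form in which
  -- the smaller face is taken last
  have h1 := h 0
  have h2 := h 1
  have h3 := h 2
  simp only [show Fin.succ (0 : Fin 3) = 1 from rfl, show Fin.succ (1 : Fin 3) = 2 from rfl,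
    show Fin.succ (2 : Fin 3) = 3 from rfl] at h1 h2 h3
  rw [show SimplexCategory.δ (0 : Fin 3) ≫ SimplexCategory.δ (1 : Fin 4) =
    SimplexCategory.δ 0 ≫ SimplexCategory.δ 0 from
      SimplexCategory.δ_comp_δ (i := 0) (j := 0) (by decide)] at h1
  rw [show SimplexCategory.δ (0 : Fin 3) ≫ SimplexCategory.δ (2 : Fin 4) =
    SimplexCategory.δ 1 ≫ SimplexCategory.δ 0 from
      SimplexCategory.δ_comp_δ (i := 0) (j := 1) (by decide),
    show SimplexCategory.δ (1 : Fin 3) ≫ SimplexCategory.δ (2 : Fin 4) =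
    SimplexCategory.δ 1 ≫ SimplexCategory.δ 1 from
      SimplexCategory.δ_comp_δ (i := 1) (j := 1) (by decide)] at h2
  rw [show SimplexCategory.δ (0 : Fin 3) ≫ SimplexCategory.δ (3 : Fin 4) =
    SimplexCategory.δ 2 ≫ SimplexCategory.δ 0 from
      SimplexCategory.δ_comp_δ (i := 0) (j := 2) (by decide),
    show SimplexCategory.δ (1 : Fin 3) ≫ SimplexCategory.δ (3 : Fin 4) =
    SimplexCategory.δ 2 ≫ SimplexCategory.δ 1 from
      SimplexCategory.δ_comp_δ (i := 1) (j := 2) (by decide),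
    show SimplexCategory.δ (2 : Fin 3) ≫ SimplexCategory.δ (3 : Fin 4) =
    SimplexCategory.δ 2 ≫ SimplexCategory.δ 2 from
      SimplexCategory.δ_comp_δ (i := 2) (j := 2) (by decide)] at h3
  have hB := bounds_of_isTransport (hD.fill_source 1) hx₀ h1 h2 h3
    (Bounds.map D.ι ⟨y, rfl, rfl, rfl, rfl⟩)
  exact hx₀.congr (hD.fill_source 1)
    (bounds_unique_zero (hD.fill_source 1) hB ⟨x, rfl, rfl, rfl, rfl⟩) (.refl _) (.refl _)

/-- Lifts of the edges of `x` along `left`, those of the degenerate edges being given by `unit`. -/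
def IsSourceLift (D : TransportData K W E) {n : SimplexCategory} (x : K.obj (op n))
    (e : (⦋1⦌ ⟶ n) → E) : Prop :=
  (∀ φ, D.left (e φ) = K.map φ.op x) ∧
    ∀ v : ⦋0⦌ ⟶ n, ∃ y, e (SimplexCategory.σ 0 ≫ v) = D.unit y ∧ D.ι.app _ y = K.map v.op x

lemma IsSourceLift.map {m n : SimplexCategory} {x : K.obj (op n)} {e : (⦋1⦌ ⟶ n) → E}
    (h : D.IsSourceLift x e) (f : m ⟶ n) : D.IsSourceLift (K.map f.op x) fun φ => e (φ ≫ f) :=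
  ⟨fun φ => by rw [h.1, map_map_op], fun v => by
    simpa only [Category.assoc, map_map_op] using h.2 (v ≫ f)⟩

lemma isLift_of_faces {r : E → W _⦋1⦌} {unit : W _⦋0⦌ → E} {n : ℕ} {y : W _⦋n + 2⦌}
    {e : (⦋1⦌ ⟶ ⦋n + 2⦌) → E}
    (h : ∀ i, IsLift r unit (W.δ i y) fun φ => e (φ ≫ SimplexCategory.δ i)) :
    IsLift r unit y e := by
  refine ⟨fun φ => ?_, fun v => ?_⟩
  · obtain ⟨i, φ', rfl⟩ := exists_factor_δ' (by omega) φ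
    rw [(h i).1, map_op_δ]
  · obtain ⟨i, v', rfl⟩ := exists_factor_δ' (by omega) v
    have := (h i).2 v'
    simp only [map_op_δ, Category.assoc] at this
    exact this

/-- Existence of the transported simplex. -/
lemma IsSourceLift.exists_rel (hD : D.IsComplete) {n : ℕ} {x : K _⦋n⦌} {e : (⦋1⦌ ⟶ ⦋n⦌) → E}
    (h : D.IsSourceLift x e) : ∃ y : W _⦋n⦌, IsLift D.right D.unit y e ∧ D.Rel x y e := by
  -- for `n ≤ 1` all triangles are degenerate
  have hdeg : ∀ {n : ℕ} {x : K _⦋n⦌} {e : (⦋1⦌ ⟶ ⦋n⦌) → E} {y : W _⦋n⦌}, n ≤ 1 →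
      D.IsSourceLift x e → IsLift D.right D.unit y e → D.Rel x y e :=
    fun {n x e y} hn h hy => ⟨h.1, fun ψ => isTransport_of_not_injective hD h.1 hy ψ fun hi => by
      have := Fintype.card_le_of_injective _ hi
      simp at this
      omega⟩
  induction n using Nat.strong_induction_on with
  | _ n ih =>
  match n, x, e, h, ih with
  | 0, x, e, h, ih =>
    obtain ⟨y, hy, hyx⟩ := h.2 (𝟙 _)
    rw [Category.comp_id] at hy
    have h2 : IsLift D.right D.unit y e := by
      refine ⟨fun φ => ?_, fun v => ?_⟩
      · rw [eq_σ_zero φ, hy, D.right_unit]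
        rfl
      · rw [eq_id_of_zero v, Category.comp_id, hy, map_id_op]
    exact ⟨y, h2, hdeg zero_le_one h h2⟩
  | 1, x, e, h, ih =>
    have hι : ∀ i : Fin 2, D.ι.app _ (W.δ i (D.right (e (𝟙 _)))) = K.δ i x := fun i => by
      have := (δ_comp_δ_two (D.cyl (e (𝟙 _))))
      rw [D.δ_zero_cyl, δ_zero_σ_zero_zero, δ_one_σ_zero_zero, D.δ_two_cyl, D.δ_one_cyl] at this
      have hx := h.1 (𝟙 _)
      rw [map_id_op] at hx
      rw [← hx, SSet.δ_naturality_apply]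
      fin_cases i
      · exact this.1
      · exact this.2.2.symm
    have h0 : ∀ v : ⦋0⦌ ⟶ ⦋1⦌, e (SimplexCategory.σ 0 ≫ v) =
        D.unit (W.map v.op (D.right (e (𝟙 _)))) := fun v => by
      obtain ⟨y, hy, hyx⟩ := h.2 v
      rw [hy]
      obtain ⟨i, v', rfl⟩ := exists_factor_δ' le_rfl v
      rw [eq_id_of_zero v', Category.id_comp] at hyx ⊢
      exact congrArg D.unit (hD.ι_injective _ _ (hyx.trans (hι i).symm))
    have h2 : IsLift D.right D.unit (D.right (e (𝟙 _))) e := by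
      refine ⟨fun φ => ?_, h0⟩
      rcases eq_id_or_eq_σ_comp φ with rfl | ⟨v, rfl⟩
      · rw [map_id_op]
      · rw [h0, D.right_unit, σ_map_op]
    exact ⟨_, h2, hdeg le_rfl h h2⟩
  | 2, x, e, h, ih =>
    obtain ⟨y, ⟨h0, h1, h2⟩, hy⟩ := hD.exists_triangle x _ _ _ (h.1 (SimplexCategory.δ 0))
      (h.1 (SimplexCategory.δ 1)) (h.1 (SimplexCategory.δ 2))
    have hδ : ∀ i, D.right (e (SimplexCategory.δ i)) = W.δ i y := fun i => by
      fin_cases i <;> assumption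
    have h3 : IsLift D.right D.unit y e := by
      refine isLift_of_faces (n := 0) fun i => ?_
      obtain ⟨y', hy', -⟩ := ih 1 (by omega) (h.map (SimplexCategory.δ i))
      have := hy'.1 (𝟙 _)
      simp only [Category.id_comp, hδ, map_id_op] at this
      rwa [this]
    refine ⟨y, h3, h.1, fun ψ => ?_⟩
    by_cases hψ : Function.Injective ψ.toOrderHom
    · have : Mono ψ := SimplexCategory.mono_iff_injective.2 hψ
      rw [SimplexCategory.eq_id_of_mono ψ]
      simpa only [map_id_op, Category.comp_id] using hy
    · exact isTransport_of_not_injective hD h.1 h3 ψ hψ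
  | n + 3, x, e, h, ih =>
    choose y hy hyx using fun i => ih (n + 2) (by omega) (h.map (SimplexCategory.δ i))
    obtain ⟨t, ht⟩ := hD.fill_target (n + 1) 0 y fun i k hik hi hk => by
      have h1 := hy k.succ |>.map (SimplexCategory.δ i)
      have h2 := hy i.castSucc |>.map (SimplexCategory.δ k)
      have g1 := hyx k.succ |>.map (SimplexCategory.δ i)
      have g2 := hyx i.castSucc |>.map (SimplexCategory.δ k)
      simp only [Category.assoc, map_map_op] at h1 h2 g1 g2
      rw [SimplexCategory.δ_comp_δ hik] at g1 h1
      exact g1.target_unique hD g2 h1 h2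
    -- the face `0` of the filler is the right one too, because its triangles are
    -- the transports of triangles of `x`
    have key : W.δ 0 t = y 0 := by
      rcases n with _ | n
      · have hrt : ∀ φ, D.right (e φ) = W.map φ.op t := fun φ => by
          obtain ⟨i, hi, φ', rfl⟩ := exists_factor_δ (n := 2) (by omega) φ 0
          rw [← map_op_δ, ht i hi]
          exact (hy i).1 φ'
        have h1 := isTransport_face_zero hD h.1 hrt fun i => by
          have := (hyx i.succ).2 (𝟙 _)
          simp only [Category.comp_id, map_id_op] at this
          rw [ht _ (Fin.succ_ne_zero i)]
          exact this
        have h2 := (hyx 0).2 (𝟙 _)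
        simp only [Category.comp_id, map_id_op] at h2
        exact eq_of_isTransport hD h1 h2
      · refine hD.ext _ _ _ fun ψ => ?_
        obtain ⟨i, hi, ψ', hψ⟩ := exists_factor_δ (n := n + 3) (by omega)
          (ψ ≫ SimplexCategory.δ 0) 0
        have h1 := (hyx i).2 ψ'
        rw [← ht i hi, map_op_δ, ← hψ, ← map_op_δ] at h1
        have h2 := (hyx 0).2 ψ
        simp only [Category.assoc, map_map_op, ← hψ] at h1 h2
        exact eq_of_isTransport hD h1 h2
    have ht' : ∀ i, W.δ i t = y i := fun i => by
      by_cases hi : i = 0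
      · rw [hi, key]
      · exact ht i hi
    refine ⟨t, isLift_of_faces (n := n + 1) fun i => by rw [ht']; exact hy i, h.1, fun ψ => ?_⟩
    obtain ⟨i, ψ', rfl⟩ := exists_factor_δ' (n := n + 2) (by omega) ψ
    have := (hyx i).2 ψ'
    rwa [← ht', map_op_δ, map_map_op] at this

/-- The simplices of `W` with lifted edges. -/
def Lifts (D : TransportData K W E) (n : ℕ) : Type u :=
  {p : W _⦋n⦌ × ((⦋1⦌ ⟶ ⦋n⦌) → E) // IsLift D.right D.unit p.1 p.2}

/-- The faces of a simplex with lifted edges. -/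
def Lifts.δ {n : ℕ} (p : D.Lifts (n + 1)) (i : Fin (n + 2)) : D.Lifts n :=
  ⟨(W.δ i p.1.1, fun φ => p.1.2 (φ ≫ SimplexCategory.δ i)), p.2.map _⟩

lemma Lifts.δ_δ {n : ℕ} (p : D.Lifts (n + 2)) {i k : Fin (n + 2)} (h : i ≤ k) :
    (p.δ k.succ).δ i = (p.δ i.castSucc).δ k := by
  refine Subtype.ext (Prod.ext (W.δ_comp_δ_apply h _) (funext fun φ => ?_))
  simp only [Lifts.δ, Category.assoc, SimplexCategory.δ_comp_δ h]

/-- For a triangle of `W` with lifted edges there is a triangle transported to it, obtained by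
running the deformations backwards. -/
lemma exists_rel_two (hD : D.IsComplete) (p : D.Lifts 2) :
    ∃ x : K _⦋2⦌, (∀ i, K.δ i x = D.left (p.1.2 (SimplexCategory.δ i))) ∧
      IsTransport K x (D.ι.app _ p.1.1) (D.cyl (p.1.2 (SimplexCategory.δ 2)))
        (D.cyl (p.1.2 (SimplexCategory.δ 0))) (D.cyl (p.1.2 (SimplexCategory.δ 1))) := by
  obtain ⟨⟨y, e⟩, hy⟩ := p
  have h1 : ∀ i, K.δ 1 (D.cyl (e (SimplexCategory.δ i))) = K.δ i (D.ι.app _ y) := fun i => by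
    rw [D.δ_one_cyl, hy.1, ← SSet.δ_naturality_apply]
    rfl
  have h2 := fun i => δ_comp_δ_two (D.cyl (e (SimplexCategory.δ i)))
  simp only [D.δ_zero_cyl, δ_zero_σ_zero_zero, δ_one_σ_zero_zero, D.δ_two_cyl, h1] at h2
  have h3 := δ_comp_δ_two (D.ι.app _ y)
  obtain ⟨x, hx⟩ := exists_isTransport_source (hD.fill_source 0) (h1 2) (h1 0) (h1 1)
    (by rw [D.δ_zero_cyl, D.δ_zero_cyl, ← (h2 0).1, ← (h2 1).1, h3.1])
    (by rw [D.δ_zero_cyl, D.δ_two_cyl, ← (h2 2).1, (h2 0).2.2, h3.2.1])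
  have e := hx.edges
  simp only [D.δ_two_cyl] at e
  refine ⟨x, fun i => ?_, hx⟩
  fin_cases i
  · exact e.1.2.1.symm
  · exact e.1.2.2.symm
  · exact e.1.1.symm

/-- Simplices of `K` can be chosen for all simplices of `W` with lifted edges, compatibly with all
faces except `d_0`: in dimension at least 3 the horns with missing face `0` are filled. -/
lemma exists_compatible_rel (hD : D.IsComplete) (n : ℕ) :
    ∃ (c : D.Lifts n → K _⦋n⦌) (c' : D.Lifts (n + 1) → K _⦋n + 1⦌),
      (∀ p, D.Rel (c p) p.1.1 p.1.2) ∧ (∀ p, D.Rel (c' p) p.1.1 p.1.2) ∧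
      ∀ p i, K.δ (Fin.succ i) (c' p) = c (p.δ i.succ) := by
  have hdeg : ∀ {n : ℕ} {x : K _⦋n⦌} {e : (⦋1⦌ ⟶ ⦋n⦌) → E} {y : W _⦋n⦌}, n ≤ 1 →
      (∀ φ, D.left (e φ) = K.map φ.op x) → IsLift D.right D.unit y e → D.Rel x y e :=
    fun {n x e y} hn h hy => ⟨h, fun ψ => isTransport_of_not_injective hD h hy ψ fun hi => by
      have := Fintype.card_le_of_injective _ hi
      simp at this
      omega⟩
  induction n with
  | zero =>
    have hvert : ∀ p : D.Lifts 1, ∀ i, K.δ i (D.left (p.1.2 (𝟙 _))) =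
        D.ι.app _ (W.δ i p.1.1) := fun p i => by
      have := δ_comp_δ_two (D.cyl (p.1.2 (𝟙 _)))
      rw [D.δ_zero_cyl, δ_zero_σ_zero_zero, δ_one_σ_zero_zero, D.δ_two_cyl, D.δ_one_cyl,
        p.2.1, map_id_op] at this
      rw [SSet.δ_naturality_apply]
      fin_cases i
      · exact this.1.symm
      · exact this.2.2
    refine ⟨fun p => D.ι.app _ p.1.1, fun p => D.left (p.1.2 (𝟙 _)),
      fun p => hdeg zero_le_one (fun φ => ?_) p.2, fun p => hdeg le_rfl (fun φ => ?_) p.2,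
      fun p i => hvert p i.succ⟩
    · obtain rfl := eq_σ_zero φ
      have := p.2.2 (𝟙 _)
      rw [Category.comp_id, map_id_op] at this
      rw [this, D.left_unit, SSet.σ_naturality_apply]
      rfl
    · rcases eq_id_or_eq_σ_comp φ with rfl | ⟨v, rfl⟩
      · rw [map_id_op]
      · obtain ⟨j, v', rfl⟩ := exists_factor_δ' le_rfl v
        rw [p.2.2, D.left_unit, eq_id_of_zero v', Category.id_comp, ← σ_map_op,
          SSet.σ_naturality_apply]
        exact congrArg _ (hvert p j).symm
  | succ n ih =>
    obtain ⟨c, c', hc, hc', hcc⟩ := ih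
    suffices h : ∀ p : D.Lifts (n + 2), ∃ x : K _⦋n + 2⦌, D.Rel x p.1.1 p.1.2 ∧
        ∀ i, K.δ (Fin.succ i) x = c' (p.δ i.succ) by
      choose c'' h h' using h
      exact ⟨c', c'', hc', h, h'⟩
    intro p
    -- in dimension 2 nothing has to be filled: the faces are determined by the edges
    rcases n with _ | n
    · obtain ⟨x, hx, hxp⟩ := exists_rel_two hD p
      have h0 : ∀ i, K.δ i x = c' (p.δ i) := fun i => by
        have := (hc' (p.δ i)).1 (𝟙 _)
        rw [map_id_op] at this
        rw [hx, ← this]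
        simp only [Lifts.δ, Category.id_comp]
      have h1 : ∀ φ, D.left (p.1.2 φ) = K.map φ.op x := fun φ => by
        obtain ⟨i, φ', rfl⟩ := exists_factor_δ' le_rfl φ
        rw [← map_op_δ, h0, ← (hc' (p.δ i)).1]
        rfl
      refine ⟨x, ⟨h1, fun ψ => ?_⟩, fun i => h0 _⟩
      by_cases hψ : Function.Injective ψ.toOrderHom
      · have : Mono ψ := SimplexCategory.mono_iff_injective.2 hψ
        rw [SimplexCategory.eq_id_of_mono ψ]
        simpa only [map_id_op, Category.comp_id] using hxp
      · exact isTransport_of_not_injective hD h1 p.2 ψ hψ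
    · obtain ⟨x, hx⟩ := hD.fill_source n 0 (fun i => c' (p.δ i)) fun i k hik hi hk => by
        obtain ⟨i, rfl⟩ := Fin.exists_succ_eq_of_ne_zero (x := i) fun h => hi (by rw [h]; rfl)
        obtain ⟨k, rfl⟩ := Fin.exists_succ_eq_of_ne_zero (x := k)
          fun h => by rw [h] at hik; exact absurd hik (by simp)
        have hik' := Lifts.δ_δ p hik
        rw [hcc, hik', ← Fin.succ_castSucc, hcc]
      have h1 : ∀ φ, D.left (p.1.2 φ) = K.map φ.op x := fun φ => by
        obtain ⟨i, hi, φ', rfl⟩ := exists_factor_δ (by omega) φ 0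
        rw [← map_op_δ, hx i hi, ← (hc' (p.δ i)).1]
        rfl
      refine ⟨x, ⟨h1, fun ψ => ?_⟩, fun i => hx _ (Fin.succ_ne_zero i)⟩
      have h2 : ∀ i, i ≠ 0 → ∀ ψ' : ⦋2⦌ ⟶ ⦋n + 2⦌,
          IsTransport K (K.map (ψ' ≫ SimplexCategory.δ i).op x)
            (D.ι.app _ (W.map (ψ' ≫ SimplexCategory.δ i).op p.1.1))
            (D.cyl (p.1.2 (SimplexCategory.δ 2 ≫ ψ' ≫ SimplexCategory.δ i)))
            (D.cyl (p.1.2 (SimplexCategory.δ 0 ≫ ψ' ≫ SimplexCategory.δ i)))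
            (D.cyl (p.1.2 (SimplexCategory.δ 1 ≫ ψ' ≫ SimplexCategory.δ i))) := fun i hi ψ' => by
        have := (hc' (p.δ i)).2 ψ'
        rw [← hx i hi, map_op_δ] at this
        simp only [Lifts.δ, map_op_δ, Category.assoc] at this
        exact this
      -- a triangle of a simplex of dimension at least 4 lies in a face other than the face `0`; in
      -- dimension 3 the face `0` has to be treated separately
      rcases n with _ | n
      · obtain ⟨i, ψ', rfl⟩ := exists_factor_δ' le_rfl ψ
        by_cases hi : i = 0
        · by_cases hψ : Function.Injective (ψ' ≫ SimplexCategory.δ i).toOrderHom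
          · have hm : Mono (ψ' ≫ SimplexCategory.δ i) := SimplexCategory.mono_iff_injective.2 hψ
            have : Mono ψ' := mono_of_mono ψ' (SimplexCategory.δ i)
            rw [SimplexCategory.eq_id_of_mono ψ', hi]
            have := isTransport_face_zero hD h1 p.2.1 fun i => by
              have := h2 i.succ (Fin.succ_ne_zero i) (𝟙 _)
              simp only [Category.id_comp] at this
              exact this
            simp only [Category.id_comp]
            exact this
          · exact isTransport_of_not_injective hD h1 p.2 _ hψ
        · exact h2 i hi ψ'
      · obtain ⟨i, hi, ψ', rfl⟩ := exists_factor_δ (by omega) ψ 0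
        exact h2 i hi ψ'

/-- Existence of a simplex that is transported to a given one. -/
lemma exists_rel_of_isLift (hD : D.IsComplete) {n : ℕ} {y : W _⦋n⦌} {e : (⦋1⦌ ⟶ ⦋n⦌) → E}
    (h : IsLift D.right D.unit y e) : ∃ x : K _⦋n⦌, D.Rel x y e := by
  obtain ⟨c, -, hc, -⟩ := exists_compatible_rel hD n
  exact ⟨_, hc ⟨(y, e), h⟩⟩

end TransportData

end

/-! ### Spaces of horns -/

lemma isPlot_hom_iff {A : SSet.{u}} {X : SimplicialDiff.{u}} {d : ℕ}
    (f : Euc d → (A ⟶ X.toSSet)) :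
    IsPlot f ↔ ∀ (n : SimplexCategoryᵒᵖ) (a : A.obj n), IsPlot fun u => (f u).app n a :=
  ⟨fun h n a => h ⟨n, a⟩, fun h a => h a.1 a.2⟩

lemma dSmooth_eval {A : SSet.{u}} (X : SimplicialDiff.{u}) {n : SimplexCategoryᵒᵖ} (a : A.obj n) :
    DSmooth fun f : A ⟶ X.toSSet => f.app n a :=
  fun _ f hf => (isPlot_hom_iff f).1 hf n a

lemma dSmooth_yonedaEquiv_symm (X : SimplicialDiff.{u}) (n : SimplexCategory) :
    DSmooth fun x : X.toSSet.obj (op n) =>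
      (SSet.yonedaEquiv.symm x : SSet.stdSimplex.obj n ⟶ X.toSSet) := by
  intro d p hp
  refine (isPlot_hom_iff _).2 fun m a => ?_
  exact X.smooth_map _ _ _ hp

lemma isDiffeomorphism_yonedaEquiv (X : SimplicialDiff.{u}) (n : SimplexCategory) :
    IsDiffeomorphism fun h : SSet.stdSimplex.obj n ⟶ X.toSSet => SSet.yonedaEquiv h :=
  ⟨dSmooth_eval X _, fun x => SSet.yonedaEquiv.symm x, dSmooth_yonedaEquiv_symm X n,
    SSet.yonedaEquiv.symm_apply_apply, SSet.yonedaEquiv.apply_symm_apply⟩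

lemma isDiffeomorphism_yonedaEquiv_symm (X : SimplicialDiff.{u}) (n : SimplexCategory) :
    IsDiffeomorphism fun x : X.toSSet.obj (op n) =>
      (SSet.yonedaEquiv.symm x : SSet.stdSimplex.obj n ⟶ X.toSSet) :=
  ⟨dSmooth_yonedaEquiv_symm X n, fun h => SSet.yonedaEquiv h, dSmooth_eval X _,
    SSet.yonedaEquiv.apply_symm_apply, SSet.yonedaEquiv.symm_apply_apply⟩

/-- The face `i` of a horn. -/
def hornFace {X : SSet.{u}} {n : ℕ} {j : Fin (n + 2)} (f : (Λ[n + 1, j] : SSet.{u}) ⟶ X)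
    (i : Fin (n + 2)) (h : i ≠ j) : X _⦋n⦌ :=
  f.app _ (SSet.horn.face j i h)

lemma hornFace_ι_comp {X : SSet.{u}} {n : ℕ} {j : Fin (n + 2)} (g : Δ[n + 1] ⟶ X)
    (i : Fin (n + 2)) (h : i ≠ j) :
    hornFace (Λ[n + 1, j].ι ≫ g) i h = X.δ i (SSet.yonedaEquiv g) := by
  rw [hornFace, ← SSet.horn.yonedaEquiv_ι, ← SSet.yonedaEquiv_comp, SSet.horn.ι_ι_assoc,
    SSet.stdSimplex.yonedaEquiv_δ_comp]

/-- Every simplex of a horn is obtained from one of its faces. -/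
lemma horn_exists_face {n : ℕ} {j : Fin (n + 2)} {m : SimplexCategoryᵒᵖ}
    (a : (Λ[n + 1, j] : SSet.{u}).obj m) :
    ∃ (i : Fin (n + 2)) (h : i ≠ j) (θ : m.unop ⟶ ⦋n⦌),
      a = (Λ[n + 1, j] : SSet.{u}).map θ.op (SSet.horn.face j i h) := by
  obtain ⟨m⟩ := m
  induction m using SimplexCategory.rec with | _ m
  obtain ⟨s, hs⟩ := a
  obtain ⟨f, rfl⟩ := SSet.stdSimplex.objEquiv.symm.surjective s
  obtain ⟨i, hi, hif⟩ := (SSet.mem_horn_iff_notMem_range _ _).1 hs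
  obtain ⟨θ, rfl⟩ := SimplexCategory.eq_comp_δ_of_not_surjective' f i
    fun x hx => hif ⟨x, hx⟩
  exact ⟨i, hi, θ, Subtype.ext rfl⟩

lemma isPlot_horn_iff {X : SimplicialDiff.{u}} {n : ℕ} {j : Fin (n + 2)} {d : ℕ}
    (f : Euc d → ((Λ[n + 1, j] : SSet.{u}) ⟶ X.toSSet)) :
    IsPlot f ↔ ∀ i h, IsPlot fun u => hornFace (f u) i h := by
  refine ⟨fun hf i h => (isPlot_hom_iff f).1 hf _ _, fun hf => (isPlot_hom_iff f).2 fun m a => ?_⟩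
  obtain ⟨i, h, θ, rfl⟩ := horn_exists_face a
  have : (fun u => (f u).app m ((Λ[n + 1, j] : SSet.{u}).map θ.op (SSet.horn.face j i h))) =
      fun u => X.toSSet.map θ.op (hornFace (f u) i h) :=
    funext fun u => NatTrans.naturality_apply (f u) θ.op _
  rw [this]
  exact X.smooth_map _ _ _ (hf i h)

lemma dSmooth_hornFace (X : SimplicialDiff.{u}) {n : ℕ} {j : Fin (n + 2)} (i : Fin (n + 2))
    (h : i ≠ j) :
    DSmooth fun f : (Λ[n + 1, j] : SSet.{u}) ⟶ X.toSSet => hornFace f i h :=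
  dSmooth_eval X _

lemma dSmooth_hornRestriction (X : SimplicialDiff.{u}) (n : ℕ) (j : Fin (n + 1)) :
    DSmooth (hornRestriction X n j) :=
  fun _ p hp => (isPlot_hom_iff _).2 fun m a => (isPlot_hom_iff p).1 hp m (Λ[n, j].ι.app m a)

/-- A horn with given faces. -/
lemma exists_horn {X : SSet.{u}} {n : ℕ} {j : Fin (n + 3)} (x : Fin (n + 3) → X _⦋n + 1⦌)
    (hx : ∀ i k : Fin (n + 2), i ≤ k → i.castSucc ≠ j → k.succ ≠ j →
      X.δ i (x k.succ) = X.δ k (x i.castSucc)) :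
    ∃ f : (Λ[n + 2, j] : SSet.{u}) ⟶ X, ∀ i h, hornFace f i h = x i := by
  have hc : SSet.horn.IsCompatible (i := j)
      (fun k _ => (SSet.yonedaEquiv.symm (x k) : Δ[n + 1] ⟶ X)) := by
    rw [SSet.horn.isCompatible_iff]
    intro i k hi hk hik
    obtain ⟨i, rfl⟩ := i.eq_castSucc_of_ne_last (Fin.ne_last_of_lt hik)
    obtain ⟨k, rfl⟩ := k.eq_succ_of_ne_zero (Fin.ne_zero_of_lt hik)
    rw [Fin.pred_succ, Fin.castPred_castSucc, SSet.stdSimplex.δ_comp_yonedaEquiv_symm,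
      SSet.stdSimplex.δ_comp_yonedaEquiv_symm, hx i k (Fin.castSucc_lt_succ_iff.1 hik) hi hk]
  refine ⟨hc.desc, fun i h => ?_⟩
  rw [hornFace, ← SSet.horn.yonedaEquiv_ι, ← SSet.yonedaEquiv_comp, hc.ι_desc,
    Equiv.apply_symm_apply]

lemma hornFace_compat {X : SSet.{u}} {n : ℕ} {j : Fin (n + 3)}
    (f : (Λ[n + 2, j] : SSet.{u}) ⟶ X) (i k : Fin (n + 2)) (hik : i ≤ k) (hi : i.castSucc ≠ j)
    (hk : k.succ ≠ j) : X.δ i (hornFace f k.succ hk) = X.δ k (hornFace f i.castSucc hi) := by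
  have h := (SSet.horn.isCompatible_iff _).1 (SSet.horn.IsCompatible.of_hom f) i.castSucc k.succ
    hi hk (Fin.castSucc_lt_succ_iff.2 hik)
  rw [Fin.pred_succ, Fin.castPred_castSucc] at h
  have h' := congrArg SSet.yonedaEquiv h
  rw [SSet.stdSimplex.yonedaEquiv_δ_comp, SSet.stdSimplex.yonedaEquiv_δ_comp,
    SSet.yonedaEquiv_comp, SSet.yonedaEquiv_comp, SSet.horn.yonedaEquiv_ι,
    SSet.horn.yonedaEquiv_ι] at h'
  exact h'.symm

lemma horn_hom_ext {X : SSet.{u}} {n : ℕ} {j : Fin (n + 2)}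
    {f g : (Λ[n + 1, j] : SSet.{u}) ⟶ X} (h : ∀ i hi, hornFace f i hi = hornFace g i hi) :
    f = g :=
  SSet.horn.hom_ext _ _ h

/-! ### Germs of plots -/

/-- The germs at the origin of plots `ℝ^d → Y`. -/
def PlotGerm (d : ℕ) (Y : Type u) [DiffeologicalSpace Y] : Type u :=
  {g : Filter.Germ (𝓝 (0 : Euc d)) Y // ∃ p : Euc d → Y, IsPlot p ∧ (p : Filter.Germ _ Y) = g}

namespace PlotGerm

variable {d : ℕ} {X : Type u} {Y : Type u} {Z : Type u} [DiffeologicalSpace X]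
  [DiffeologicalSpace Y] [DiffeologicalSpace Z]

/-- The germ of a plot. -/
def mk (p : Euc d → Y) (hp : IsPlot p) : PlotGerm d Y := ⟨p, p, hp, rfl⟩

lemma exists_rep (g : PlotGerm d Y) : ∃ (p : Euc d → Y) (hp : IsPlot p), g = mk p hp := by
  obtain ⟨g, p, hp, rfl⟩ := g
  exact ⟨p, hp, rfl⟩

lemma mk_eq_mk {p q : Euc d → Y} {hp : IsPlot p} {hq : IsPlot q} :
    mk p hp = mk q hq ↔ p =ᶠ[𝓝 0] q :=
  Subtype.ext_iff.trans Filter.Germ.coe_eq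

/-- The map of germs induced by a smooth map. -/
def map (f : X → Y) (hf : DSmooth f) (g : PlotGerm d X) : PlotGerm d Y :=
  ⟨g.1.map f, by
    obtain ⟨p, hp, hg⟩ := g.2
    exact ⟨f ∘ p, hf _ p hp, by rw [← hg]; rfl⟩⟩

end PlotGerm

/-- The simplicial set of germs of plots of a simplicial diffeological space. Statements about
simplices that are proved for all simplicial sets with fillers hold smoothly by applying them to
this simplicial set. -/
def germs (d : ℕ) (X : SimplicialDiff.{u}) : SSet.{u} where
  obj n := PlotGerm d (X.toSSet.obj n)
  map f := TypeCat.ofHom (PlotGerm.map _ (X.smooth_map f))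
  map_id n := by
    ext x
    obtain ⟨p, hp, rfl⟩ := PlotGerm.exists_rep x
    exact Subtype.ext (Filter.Germ.coe_eq.2 <|
      .of_forall fun u => X.toSSet.map_id_apply n (p u))
  map_comp f g := by
    ext x
    obtain ⟨p, hp, rfl⟩ := PlotGerm.exists_rep x
    exact Subtype.ext (Filter.Germ.coe_eq.2 <|
      .of_forall fun u => X.toSSet.map_comp_apply f g (p u))

section

variable {d : ℕ} {X Y : SimplicialDiff.{u}}

/-- The germ of a plot of `n`-simplices. -/
def germMk {n : SimplexCategoryᵒᵖ} (p : Euc d → X.toSSet.obj n) (hp : IsPlot p) :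
    (germs d X).obj n :=
  PlotGerm.mk p hp

lemma exists_germMk {n : SimplexCategoryᵒᵖ} (x : (germs d X).obj n) :
    ∃ (p : Euc d → X.toSSet.obj n) (hp : IsPlot p), x = germMk p hp :=
  PlotGerm.exists_rep x

lemma germMk_eq_iff {n : SimplexCategoryᵒᵖ} {p q : Euc d → X.toSSet.obj n} {hp : IsPlot p}
    {hq : IsPlot q} : germMk p hp = germMk q hq ↔ p =ᶠ[𝓝 0] q :=
  PlotGerm.mk_eq_mk

lemma germMk_congr {n : SimplexCategoryᵒᵖ} {p q : Euc d → X.toSSet.obj n} {hp : IsPlot p}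
    {hq : IsPlot q} (h : p =ᶠ[𝓝 0] q) : germMk p hp = germMk q hq :=
  germMk_eq_iff.2 h

lemma δ_germMk {n : ℕ} (i : Fin (n + 2)) {p : Euc d → X.toSSet _⦋n + 1⦌} (hp : IsPlot p) :
    (germs d X).δ i (germMk p hp) = germMk (fun u => X.toSSet.δ i (p u))
      (X.smooth_map _ _ p hp) := rfl

/-- The map of germs induced by a strict map. -/
def germsMap (d : ℕ) (f : StrictMap X Y) : germs d X ⟶ germs d Y where
  app n := TypeCat.ofHom (PlotGerm.map _ (f.smooth n))
  naturality m n g := by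
    ext x
    obtain ⟨p, hp, rfl⟩ := PlotGerm.exists_rep x
    exact Subtype.ext (Filter.Germ.coe_eq.2 <|
      .of_forall fun u => NatTrans.naturality_apply f.hom g (p u))

/-- The map `p` is a representative of the germ `x`. -/
def Represents {n : SimplexCategoryᵒᵖ} (p : Euc d → X.toSSet.obj n) (x : (germs d X).obj n) :
    Prop :=
  Subtype.val (show PlotGerm d (X.toSSet.obj n) from x) =
    (Filter.Germ.ofFun p : Filter.Germ (𝓝 (0 : Euc d)) (X.toSSet.obj n))

lemma represents_germMk {n : SimplexCategoryᵒᵖ} {p : Euc d → X.toSSet.obj n} (hp : IsPlot p) :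
    Represents p (germMk p hp) := rfl

lemma Represents.map {m n : SimplexCategoryᵒᵖ} {p : Euc d → X.toSSet.obj m}
    {x : (germs d X).obj m} (h : Represents p x) (f : m ⟶ n) :
    Represents (fun t => X.toSSet.map f (p t)) ((germs d X).map f x) :=
  congrArg (Filter.Germ.map fun y => X.toSSet.map f y) h

lemma Represents.eventually_eq {n : SimplexCategoryᵒᵖ} {p q : Euc d → X.toSSet.obj n}
    {x : (germs d X).obj n} (h : Represents p x) (h' : Represents q x) : p =ᶠ[𝓝 0] q :=
  Filter.Germ.coe_eq.1 (h.symm.trans h')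

lemma represents_eq_iff {n : SimplexCategoryᵒᵖ} {p q : Euc d → X.toSSet.obj n}
    {x y : (germs d X).obj n} (h : Represents p x) (h' : Represents q y) :
    x = y ↔ p =ᶠ[𝓝 0] q := by
  refine ⟨fun hxy => h.eventually_eq (hxy ▸ h'), fun hpq => Subtype.ext ?_⟩
  exact h.trans ((Filter.Germ.coe_eq.2 hpq).trans h'.symm)

variable {p₀ p₁ p₂ p₃ p₄ : Euc d → X.toSSet _⦋2⦌} {x₀ x₁ x₂ x₃ x₄ : germs d X _⦋2⦌}

lemma Bounds.eventually (h : Bounds (germs d X) x₀ x₁ x₂ x₃) (h₀ : Represents p₀ x₀)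
    (h₁ : Represents p₁ x₁) (h₂ : Represents p₂ x₂) (h₃ : Represents p₃ x₃) :
    ∀ᶠ t in 𝓝 0, Bounds X.toSSet (p₀ t) (p₁ t) (p₂ t) (p₃ t) := by
  obtain ⟨z, rfl, rfl, rfl, rfl⟩ := h
  obtain ⟨q, hq, rfl⟩ := exists_germMk z
  filter_upwards [((represents_germMk hq).map _).eventually_eq h₀,
    ((represents_germMk hq).map _).eventually_eq h₁,
    ((represents_germMk hq).map _).eventually_eq h₂,
    ((represents_germMk hq).map _).eventually_eq h₃] with t t0 t1 t2 t3
  exact ⟨q t, t0, t1, t2, t3⟩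

lemma Homotopic.eventually (h : Homotopic (germs d X) x₀ x₁) (h₀ : Represents p₀ x₀)
    (h₁ : Represents p₁ x₁) : ∀ᶠ t in 𝓝 0, Homotopic X.toSSet (p₀ t) (p₁ t) :=
  ((homotopic_iff.1 h).eventually ((h₀.map _).map _) ((h₀.map _).map _) h₀ h₁).mono
    fun _ => homotopic_iff.2

lemma IsTransport.eventually (h : IsTransport (germs d X) x₀ x₁ x₂ x₃ x₄)
    (h₀ : Represents p₀ x₀) (h₁ : Represents p₁ x₁) (h₂ : Represents p₂ x₂)
    (h₃ : Represents p₃ x₃) (h₄ : Represents p₄ x₄) :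
    ∀ᶠ t in 𝓝 0, IsTransport X.toSSet (p₀ t) (p₁ t) (p₂ t) (p₃ t) (p₄ t) := by
  obtain ⟨v, e0, e1⟩ := h
  obtain ⟨q, hq, rfl⟩ := exists_germMk v
  filter_upwards [e0.eventually h₃ h₄ h₁ (represents_germMk hq),
    e1.eventually ((h₀.map _).map _) (represents_germMk hq) h₀ h₂] with t t0 t1
  exact ⟨q t, t0, t1⟩

end

/-- Smooth families of horns have smooth fillers, locally. Equivalently, the simplicial sets of
germs of plots have fillers. -/
def HasPlotFillers (X : SimplicialDiff.{u}) (n : ℕ) (j : Fin (n + 3)) : Prop :=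
  ∀ (d : ℕ) (x : Fin (n + 3) → Euc d → X.toSSet _⦋n + 1⦌), (∀ i, IsPlot (x i)) →
    (∀ t, ∀ i k : Fin (n + 2), i ≤ k → i.castSucc ≠ j → k.succ ≠ j →
      X.toSSet.δ i (x k.succ t) = X.toSSet.δ k (x i.castSucc t)) →
    ∃ z : Euc d → X.toSSet _⦋n + 2⦌, IsPlot z ∧
      ∀ᶠ t in 𝓝 0, ∀ i, i ≠ j → X.toSSet.δ i (z t) = x i t

section

variable {X : SimplicialDiff.{u}} {n : ℕ} {j : Fin (n + 3)}

lemma HasPlotFillers.germs (h : HasPlotFillers X n j) (d : ℕ) : HasFillers (germs d X) n j := by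
  intro x hx
  choose p hp hxp using fun i => exists_germMk (x i)
  have hev : ∀ᶠ t in 𝓝 0, ∀ i k : Fin (n + 2), i ≤ k → i.castSucc ≠ j → k.succ ≠ j →
      X.toSSet.δ i (p k.succ t) = X.toSSet.δ k (p i.castSucc t) := by
    refine Filter.eventually_all.2 fun i => Filter.eventually_all.2 fun k => ?_
    by_cases hcond : i ≤ k ∧ i.castSucc ≠ j ∧ k.succ ≠ j
    · have := hx i k hcond.1 hcond.2.1 hcond.2.2
      rw [hxp, hxp, δ_germMk, δ_germMk] at this
      exact ((represents_eq_iff (represents_germMk _) (represents_germMk _)).1 this).mono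
        fun t ht _ _ _ => ht
    · exact .of_forall fun t h1 h2 h3 => absurd ⟨h1, h2, h3⟩ hcond
  obtain ⟨ρ, hρ, hρ0, hρs⟩ := exists_squash hev
  obtain ⟨z, hz, hzx⟩ := h d (fun i t => p i (ρ t)) (fun i => isPlot_reparam (hp i) hρ) hρs
  refine ⟨germMk z hz, fun i hi => ?_⟩
  rw [hxp, δ_germMk]
  refine germMk_congr ?_
  filter_upwards [hzx, hρ0] with t h1 h2
  rw [h1 i hi, h2, id_eq]

lemma HasPlotFillers.hasFillers (h : HasPlotFillers X n j) : HasFillers X.toSSet n j := by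
  intro x hx
  obtain ⟨z, -, hz⟩ := h 0 (fun i _ => x i) (fun i => isPlot_const) fun _ => hx
  exact ⟨z 0, hz.self_of_nhds⟩

/-- A horn filling condition with submersions is one for germs of plots. -/
lemma hasPlotFillers_of_locSubd (h : LocSubd (hornRestriction X (n + 2) j))
    (hs : Function.Surjective (hornRestriction X (n + 2) j)) : HasPlotFillers X n j := by
  intro d x hx hc
  choose f hf using fun t => exists_horn (fun i => x i t) (hc t)
  have hfp : IsPlot f := (isPlot_horn_iff f).2 fun i hi => by
    have : (fun t => hornFace (f t) i hi) = x i := funext fun t => hf t i hi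
    rw [this]
    exact hx i
  obtain ⟨g, hg⟩ := hs (f 0)
  obtain ⟨q, hq, -, hqf⟩ := h.lift g f hfp hg.symm
  refine ⟨fun t => SSet.yonedaEquiv (q t), dSmooth_eval X _ _ q hq, ?_⟩
  filter_upwards [hqf] with t ht i hi
  rw [← hf t i hi, ← ht]
  exact (hornFace_ι_comp (q t) i hi).symm

end

namespace IsLieGroupoid

variable {N : ℕ} {X : SimplicialDiff.{u}} (hX : IsLieGroupoid N X)

include hX

lemma hasPlotFillers (n : ℕ) (j : Fin (n + 3)) : HasPlotFillers X n j :=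
  hasPlotFillers_of_locSubd (hX.kan _ (by omega) j).2.locSubd (hX.kan _ (by omega) j).1

lemma eq_of_faces {n : ℕ} (hn : N ≤ n) (j : Fin (n + 2)) {x y : X.toSSet _⦋n + 1⦌}
    (h : ∀ i, i ≠ j → X.toSSet.δ i x = X.toSSet.δ i y) : x = y := by
  have hi := (hX.kan_unique (n + 1) (by omega) j).bijective.1
  refine SSet.yonedaEquiv.symm.injective (hi (horn_hom_ext fun i hi => ?_))
  simp only [hornRestriction]
  rw [hornFace_ι_comp, hornFace_ι_comp, Equiv.apply_symm_apply, Equiv.apply_symm_apply, h i hi]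

end IsLieGroupoid

/-! ### Pull-backs of simplicial spaces along their edges -/

/-- `Z` is obtained from `S` by replacing the space of edges by `E`: a simplex of `Z` amounts to a
simplex of `S` together with elements of `E` over all its edges, those over degenerate edges being
given by `unit`. -/
structure IsPull {Z S : SimplicialDiff.{u}} (f : StrictMap Z S) {E : Type u}
    [DiffeologicalSpace E] (π : E → S.toSSet _⦋1⦌) (unit : S.toSSet _⦋0⦌ → E)
    (ε : Z.toSSet _⦋1⦌ → E) : Prop where
  locSubd_π : LocSubd π
  surjective_π : Function.Surjective π
  dSmooth_unit : DSmooth unit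
  dSmooth_ε : DSmooth ε
  π_unit : ∀ x, π (unit x) = S.toSSet.σ 0 x
  π_ε : ∀ z, π (ε z) = f.hom.app _ z
  ε_σ : ∀ z : Z.toSSet _⦋0⦌, ε (Z.toSSet.σ 0 z) = unit (f.hom.app _ z)
  isPlot : ∀ {n : SimplexCategory} {d : ℕ} (p : Euc d → Z.toSSet.obj (op n)),
    IsPlot (fun t => f.hom.app _ (p t)) →
    (∀ φ : ⦋1⦌ ⟶ n, IsPlot fun t => ε (Z.toSSet.map φ.op (p t))) → IsPlot p
  ext : ∀ {n : SimplexCategory} {z z' : Z.toSSet.obj (op n)}, f.hom.app _ z = f.hom.app _ z' →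
    (∀ φ : ⦋1⦌ ⟶ n, ε (Z.toSSet.map φ.op z) = ε (Z.toSSet.map φ.op z')) → z = z'
  exists_of_isLift : ∀ {n : SimplexCategory} (x : S.toSSet.obj (op n)) (e : (⦋1⦌ ⟶ n) → E),
    IsLift π unit x e → ∃ z, f.hom.app _ z = x ∧ ∀ φ, ε (Z.toSSet.map φ.op z) = e φ

lemma exists_of_σ_mem {B : SSet.{u}} (A : B.Subcomplex) (v : B _⦋0⦌)
    (hv : B.σ 0 v ∈ A.obj (op ⦋1⦌)) : ∃ w : (A : SSet.{u}) _⦋0⦌, w.1 = v := by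
  refine ⟨⟨v, ?_⟩, rfl⟩
  have h : B.δ 0 (B.σ 0 v) ∈ A.obj (op ⦋0⦌) := A.map (SimplexCategory.δ 0).op hv
  rwa [δ_zero_σ_zero_zero] at h

namespace IsPull

variable {Z S : SimplicialDiff.{u}} {f : StrictMap Z S} {E : Type u} [DiffeologicalSpace E]
  {π : E → S.toSSet _⦋1⦌} {unit : S.toSSet _⦋0⦌ → E} {ε : Z.toSSet _⦋1⦌ → E}
  {A B : SSet.{u}}

lemma dSmooth_postcomp (f : StrictMap Z S) : DSmooth fun h : A ⟶ Z.toSSet => h ≫ f.hom :=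
  fun _ p hp => (isPlot_hom_iff _).2 fun n a => f.smooth n _ _ ((isPlot_hom_iff p).1 hp n a)

/-- Elements of `E` over the edges of `A` along which a map `A ⟶ S` can be lifted to `Z`. -/
structure IsHomLift (π : E → S.toSSet _⦋1⦌) (unit : S.toSSet _⦋0⦌ → E) (g : A ⟶ S.toSSet)
    (e : A _⦋1⦌ → E) : Prop where
  π_eq : ∀ a, π (e a) = g.app _ a
  σ_eq : ∀ v : A _⦋0⦌, e (A.σ 0 v) = unit (g.app _ v)

omit [DiffeologicalSpace E] in
lemma IsHomLift.isLift {g : A ⟶ S.toSSet} {e : A _⦋1⦌ → E} (he : IsHomLift π unit g e)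
    {n : SimplexCategory} (a : A.obj (op n)) :
    IsLift π unit (g.app _ a) fun φ => e (A.map φ.op a) := by
  refine ⟨fun φ => ?_, fun v => ?_⟩
  · rw [he.π_eq, NatTrans.naturality_apply]
  · rw [← NatTrans.naturality_apply g, ← he.σ_eq, σ_map_op]

section

variable (hf : IsPull f π unit ε)

include hf

lemma hom_ext {h h' : A ⟶ Z.toSSet} (h1 : h ≫ f.hom = h' ≫ f.hom)
    (h2 : ∀ a : A _⦋1⦌, ε (h.app _ a) = ε (h'.app _ a)) : h = h' := by
  ext ⟨n⟩ a
  refine hf.ext (congrArg (fun k : A ⟶ S.toSSet => k.app (op n) a) h1) fun φ => ?_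
  exact (congrArg ε (NatTrans.naturality_apply h φ.op a).symm).trans
    ((h2 _).trans (congrArg ε (NatTrans.naturality_apply h' φ.op a)))

lemma exists_hom {g : A ⟶ S.toSSet} {e : A _⦋1⦌ → E} (he : IsHomLift π unit g e) :
    ∃ h : A ⟶ Z.toSSet, h ≫ f.hom = g ∧ ∀ a : A _⦋1⦌, ε (h.app _ a) = e a := by
  choose z hz1 hz2 using fun (n : SimplexCategory) (a : A.obj (op n)) =>
    hf.exists_of_isLift _ _ (he.isLift a)
  refine ⟨⟨fun n => TypeCat.ofHom fun a => z n.unop a, fun m n φ => ?_⟩, ?_, fun a => ?_⟩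
  · ext a
    refine hf.ext ((hz1 _ _).trans ?_) fun ψ => (hz2 _ _ ψ).trans ?_
    · exact (NatTrans.naturality_apply g φ a).trans
        ((congrArg _ (hz1 m.unop a)).symm.trans (NatTrans.naturality_apply f.hom φ _).symm)
    · have h1 := (hz2 m.unop a (ψ ≫ φ.unop)).symm
      rw [← map_map_op ψ φ.unop a, ← map_map_op ψ φ.unop (z m.unop a)] at h1
      exact h1
  · ext n a
    exact hz1 n.unop a
  · have := hz2 ⦋1⦌ a (𝟙 _)
    rwa [map_id_op, map_id_op] at this

lemma isPlot_hom {d : ℕ} (h : Euc d → (A ⟶ Z.toSSet)) (h1 : IsPlot fun t => h t ≫ f.hom)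
    (h2 : ∀ a : A _⦋1⦌, IsPlot fun t => ε ((h t).app _ a)) : IsPlot h := by
  refine (isPlot_hom_iff h).2 fun n a => hf.isPlot _ ((isPlot_hom_iff _).1 h1 n a) fun φ => ?_
  have : (fun t => ε (Z.toSSet.map φ.op ((h t).app n a))) =
      fun t => ε ((h t).app _ (A.map φ.op a)) :=
    funext fun t => by rw [← NatTrans.naturality_apply (h t)]
  exact this ▸ h2 _

/-- A map `B ⟶ S` lifts to `Z`, with prescribed elements of `E` over some of the edges. -/
lemma exists_lift (b : B ⟶ S.toSSet) (D : Set (B _⦋1⦌)) (e : B _⦋1⦌ → E)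
    (he : ∀ x ∈ D, π (e x) = b.app _ x) (hσ : ∀ v, B.σ 0 v ∈ D → e (B.σ 0 v) = unit (b.app _ v)) :
    ∃ h : B ⟶ Z.toSSet, h ≫ f.hom = b ∧ ∀ x ∈ D, ε (h.app _ x) = e x := by
  -- over the remaining edges, the elements of `E` are forced if the edge is degenerate, and free
  -- otherwise
  have hq : ∀ x : B _⦋1⦌, ∃ q : E, (x ∈ D → q = e x) ∧ π q = b.app _ x ∧
      ∀ v, x = B.σ 0 v → q = unit (b.app _ v) := by
    intro x
    by_cases hx : x ∈ D
    · exact ⟨e x, fun _ => rfl, he x hx, fun v hv => by subst hv; exact hσ v hx⟩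
    by_cases hv : ∃ v, x = B.σ 0 v
    · obtain ⟨v, rfl⟩ := hv
      refine ⟨unit (b.app _ v), fun h => absurd h hx, ?_, fun w hw => ?_⟩
      · rw [hf.π_unit, SSet.σ_naturality_apply]
      · have : v = w := by
          have := congrArg (B.δ 0) hw
          rwa [δ_zero_σ_zero_zero, δ_zero_σ_zero_zero] at this
        rw [this]
    · obtain ⟨q, hq⟩ := hf.surjective_π (b.app _ x)
      exact ⟨q, fun h => absurd h hx, hq, fun v h => absurd ⟨v, h⟩ hv⟩
  choose q hq1 hq2 hq3 using hq
  obtain ⟨h, h1, h2⟩ := hf.exists_hom (g := b) (e := q) ⟨hq2, fun v => hq3 _ v rfl⟩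
  exact ⟨h, h1, fun x hx => (h2 x).trans (hq1 x hx)⟩

/-- The smooth version of `exists_lift`: near the origin, a plot of maps `B ⟶ S` lifts to `Z`, with
a prescribed lift `h₀` at the origin and prescribed elements of `E` over some of the edges. -/
lemma exists_plot_lift [Finite (B _⦋1⦌)] {d : ℕ} {b : Euc d → (B ⟶ S.toSSet)} (hb : IsPlot b)
    {h₀ : B ⟶ Z.toSSet} (h0 : h₀ ≫ f.hom = b 0) (D : Set (B _⦋1⦌)) (e : B _⦋1⦌ → Euc d → E)
    (hep : ∀ x ∈ D, IsPlot (e x)) (he0 : ∀ x ∈ D, e x 0 = ε (h₀.app _ x))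
    (he : ∀ x ∈ D, ∀ t, π (e x t) = (b t).app _ x)
    (hσ : ∀ v, B.σ 0 v ∈ D → ∀ t, e (B.σ 0 v) t = unit ((b t).app _ v)) :
    ∃ h : Euc d → (B ⟶ Z.toSSet), IsPlot h ∧ h 0 = h₀ ∧
      ∀ᶠ t in 𝓝 0, h t ≫ f.hom = b t ∧ ∀ x ∈ D, ε ((h t).app _ x) = e x t := by
  have hq : ∀ x : B _⦋1⦌, ∃ q : Euc d → E, IsPlot q ∧ q 0 = ε (h₀.app _ x) ∧
      (∀ᶠ t in 𝓝 0, π (q t) = (b t).app _ x) ∧ (x ∈ D → q = e x) ∧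
      ∀ v, x = B.σ 0 v → ∀ t, q t = unit ((b t).app _ v) := by
    intro x
    by_cases hx : x ∈ D
    · exact ⟨e x, hep x hx, he0 x hx, .of_forall (he x hx), fun _ => rfl,
        fun v hv => by subst hv; exact hσ v hx⟩
    by_cases hv : ∃ v, x = B.σ 0 v
    · obtain ⟨v, rfl⟩ := hv
      refine ⟨fun t => unit ((b t).app _ v), hf.dSmooth_unit _ _ ((isPlot_hom_iff b).1 hb _ v),
        ?_, .of_forall fun t => ?_, fun h => absurd h hx, fun w hw t => ?_⟩
      · change unit ((b 0).app _ v) = _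
        rw [SSet.σ_naturality_apply, hf.ε_σ, ← h0]
        rfl
      · rw [hf.π_unit, SSet.σ_naturality_apply]
      · have : v = w := by
          have := congrArg (B.δ 0) hw
          rwa [δ_zero_σ_zero_zero, δ_zero_σ_zero_zero] at this
        rw [this]
    · obtain ⟨q, hq, hq0, hqb⟩ := hf.locSubd_π.lift (ε (h₀.app _ x)) _
        ((isPlot_hom_iff b).1 hb _ x) (by rw [hf.π_ε, ← h0]; rfl)
      exact ⟨q, hq, hq0, hqb, fun h => absurd h hx, fun v h => absurd ⟨v, h⟩ hv⟩
  choose q hq hq0 hqb hqD hqσ using hq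
  obtain ⟨ρ, hρ, hρ0, hρs⟩ := exists_squash (Filter.eventually_all.2 hqb)
  choose h h1 h2 using fun t => hf.exists_hom (g := b (ρ t)) (e := fun x => q x (ρ t))
    ⟨fun x => hρs t x, fun v => hqσ _ v rfl _⟩
  have hρz : ρ 0 = 0 := hρ0.self_of_nhds
  refine ⟨h, hf.isPlot_hom h ?_ fun a => ?_, ?_, ?_⟩
  · simp only [h1]
    exact isPlot_reparam hb hρ
  · simp only [h2]
    exact isPlot_reparam (hq a) hρ
  · exact hf.hom_ext (by rw [h1, h0, hρz]) fun a => by rw [h2, hρz, hq0]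
  · filter_upwards [hρ0] with t ht
    rw [h1, ht]
    refine ⟨rfl, fun x hx => ?_⟩
    rw [h2, ht, hqD x hx]
    rfl

/-- Every map to `S` lifts to `Z`. If `E` is empty, then so is the space of edges of `S`, and the
lift of edges is vacuous. -/
lemma surjective_postcomp :
    Function.Surjective fun h : A ⟶ Z.toSSet => h ≫ f.hom := fun b => by
  rcases isEmpty_or_nonempty E with hE | ⟨⟨e⟩⟩
  · obtain ⟨h, h1, -⟩ := hf.exists_hom (A := A) (g := b)
      (e := fun x => hE.elim (hf.surjective_π (b.app _ x)).choose)
      ⟨fun x => hE.elim (hf.surjective_π (b.app _ x)).choose,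
        fun v => hE.elim (unit (b.app _ v))⟩
    exact ⟨h, h1⟩
  · obtain ⟨h, h1, -⟩ := hf.exists_lift b ∅ (fun _ => e) (by simp) (by simp)
    exact ⟨h, h1⟩

lemma locSubd_postcomp [Finite (A _⦋1⦌)] : LocSubd fun h : A ⟶ Z.toSSet => h ≫ f.hom where
  dSmooth := dSmooth_postcomp f
  lift h₀ d b hb hb0 := by
    obtain ⟨h, hp, h0, h1⟩ := hf.exists_plot_lift hb hb0.symm ∅ (fun a _ => ε (h₀.app _ a))
      (by simp) (by simp) (by simp) (by simp)
    exact ⟨h, hp, h0, h1.mono fun t ht => ht.1⟩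

end

lemma dSmooth_toRelHom (i : A ⟶ B) (f : StrictMap Z S) : DSmooth (toRelHom i f) := by
  intro d p hp
  refine DiffeologicalSpace.isPlot_inf_iff.2 ⟨fun _ => ?_, fun _ => dSmooth_postcomp f _ _ hp⟩
  exact (isPlot_hom_iff _).2 fun n a => (isPlot_hom_iff p).1 hp n (i.app n a)

lemma isPlot_relHom_iff {i : A ⟶ B} {f : StrictMap Z S} {d : ℕ} {p : Euc d → RelHom i f} :
    IsPlot p ↔ IsPlot (fun t => (p t).1.1) ∧ IsPlot fun t => (p t).1.2 :=
  DiffeologicalSpace.isPlot_inf_iff.trans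
    ⟨fun h => ⟨h.1 (), h.2 ()⟩, fun h => ⟨fun _ => h.1, fun _ => h.2⟩⟩

section

variable (hf : IsPull f π unit ε) (A : B.Subcomplex)

include hf

/-- A map `B ⟶ S` and a lift of its restriction to `A` have a common lift: the lift determines the
elements of `E` over the edges of `A`, and those over other edges can be chosen. -/
lemma surjective_toRelHom : Function.Surjective (toRelHom A.ι f) := by
  rintro ⟨⟨a, b⟩, hab⟩
  rcases isEmpty_or_nonempty E with hE | ⟨⟨e₀⟩⟩
  · obtain ⟨h, h1⟩ := hf.surjective_postcomp b
    refine ⟨h, Subtype.ext (Prod.ext (hf.hom_ext ?_ fun x => hE.elim (ε (a.app _ x))) h1)⟩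
    exact (Category.assoc _ _ _).trans ((congrArg (A.ι ≫ ·) h1).trans hab.symm)
  have hab' : ∀ {n} (x : (A : SSet.{u}).obj n), f.hom.app _ (a.app _ x) = b.app _ x.1 :=
    fun {n} x => congrArg (fun k : (A : SSet.{u}) ⟶ S.toSSet => k.app n x) hab
  obtain ⟨e, he⟩ : ∃ e : B _⦋1⦌ → E, ∀ x : (A : SSet.{u}) _⦋1⦌, e x.1 = ε (a.app _ x) :=
    ⟨Function.extend Subtype.val (fun x => ε (a.app _ x)) fun _ => e₀,
      fun x => Subtype.val_injective.extend_apply _ _ x⟩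
  obtain ⟨h, h1, h2⟩ := hf.exists_lift b {x | x ∈ A.obj _} e
    (fun x hx => (congrArg π (he ⟨x, hx⟩)).trans ((hf.π_ε _).trans (hab' _))) fun v hv => by
      obtain ⟨w, rfl⟩ := exists_of_σ_mem A v hv
      refine (he ((A : SSet.{u}).σ 0 w)).trans ?_
      rw [SSet.σ_naturality_apply, hf.ε_σ, hab']
  refine ⟨h, Subtype.ext (Prod.ext (hf.hom_ext ?_ fun x => ?_) h1)⟩
  · exact (Category.assoc _ _ _).trans ((congrArg (A.ι ≫ ·) h1).trans hab.symm)
  · exact (h2 x.1 x.2).trans (he x)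

/-- The choices in `surjective_toRelHom` can be made smoothly, as `B` has finitely many edges. -/
lemma locSubd_toRelHom [Finite (B _⦋1⦌)] : LocSubd (toRelHom A.ι f) where
  dSmooth := dSmooth_toRelHom _ _
  lift h₀ d p hp hp0 := by
    have hab : ∀ {n} (x : (A : SSet.{u}).obj n) (t), f.hom.app _ ((p t).1.1.app _ x) =
        (p t).1.2.app _ x.1 :=
      fun {n} x t => congrArg (fun k : (A : SSet.{u}) ⟶ S.toSSet => k.app n x) (p t).2
    obtain ⟨hp1, hp2⟩ := isPlot_relHom_iff.1 hp
    obtain ⟨e, he⟩ : ∃ e : B _⦋1⦌ → Euc d → E, ∀ x : (A : SSet.{u}) _⦋1⦌,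
        e x.1 = fun t => ε ((p t).1.1.app _ x) :=
      ⟨Function.extend Subtype.val (fun x t => ε ((p t).1.1.app _ x)) fun x _ => ε (h₀.app _ x),
        fun x => Subtype.val_injective.extend_apply _ _ x⟩
    obtain ⟨h, hh, h0, h1⟩ := hf.exists_plot_lift hp2 (h₀ := h₀) (by rw [hp0]; rfl)
      {x | x ∈ A.obj _} e
      (fun x hx => he ⟨x, hx⟩ ▸ hf.dSmooth_ε _ _ ((isPlot_hom_iff _).1 hp1 _ _))
      (fun x hx => (congrFun (he ⟨x, hx⟩) 0).trans (by rw [hp0]; rfl))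
      (fun x hx t => (congrArg π (congrFun (he ⟨x, hx⟩) t)).trans
        ((hf.π_ε _).trans (hab _ _))) fun v hv t => by
        obtain ⟨w, rfl⟩ := exists_of_σ_mem A v hv
        refine (congrFun (he ((A : SSet.{u}).σ 0 w)) t).trans ?_
        rw [SSet.σ_naturality_apply, hf.ε_σ, hab]
    refine ⟨h, hh, h0, ?_⟩
    filter_upwards [h1] with t ht
    refine Subtype.ext (Prod.ext (hf.hom_ext ?_ fun x => ?_) ht.1)
    · exact (Category.assoc _ _ _).trans ((congrArg (A.ι ≫ ·) ht.1).trans (p t).2.symm)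
    · exact (ht.2 x.1 x.2).trans (congrFun (he x) t)

/-- When `A` contains all edges of `B`, maps `B ⟶ Z` are determined by their restriction to `A`
and their image in `S`. -/
lemma injective_toRelHom (hA : ∀ x : B _⦋1⦌, x ∈ A.obj _) : Function.Injective (toRelHom A.ι f) :=
  fun _ _ hh => hf.hom_ext (congrArg (fun k : RelHom A.ι f => k.1.2) hh) fun x =>
    congrArg (fun k : RelHom A.ι f => ε (k.1.1.app _ (⟨x, hA x⟩ : (A : SSet.{u}) _⦋1⦌))) hh

end

end IsPull

/-! ### Recognising Lie 2-groupoids -/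

section

variable {X : SimplicialDiff.{u}}

lemma isDiffeomorphism_hornFace_one (j : Fin 2) (i : Fin 2) (h : i ≠ j) :
    IsDiffeomorphism fun f : (Λ[1, j] : SSet.{u}) ⟶ X.toSSet => hornFace f i h := by
  have key : ∀ x : X.toSSet _⦋0⦌, hornFace (hornRestriction X 1 j
      (SSet.yonedaEquiv.symm (X.toSSet.σ 0 x))) i h = x := fun x => by
    rw [hornRestriction, hornFace_ι_comp, Equiv.apply_symm_apply]
    have : i = 0 ∨ i = 1 := by omega
    rcases this with rfl | rfl
    · exact X.toSSet.δ_comp_σ_self_apply (i := 0) x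
    · exact X.toSSet.δ_comp_σ_succ_apply (i := 0) x
  have hs : DSmooth fun x : X.toSSet _⦋0⦌ => hornRestriction X 1 j
      (SSet.yonedaEquiv.symm (X.toSSet.σ 0 x)) :=
    ((dSmooth_hornRestriction X 1 j).comp (dSmooth_yonedaEquiv_symm X _)).comp
      (X.smooth_map (SimplexCategory.σ 0).op)
  refine ⟨dSmooth_hornFace X i h, _, hs, fun f => horn_hom_ext fun i' hi' => ?_, key⟩
  obtain rfl : i' = i := by omega
  exact key _

lemma locSubd_δ (hl : ∀ j, LocSubd (hornRestriction X 1 j)) (i : Fin 2) :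
    LocSubd fun x : X.toSSet _⦋1⦌ => X.toSSet.δ i x := by
  obtain ⟨j, hj⟩ : ∃ j : Fin 2, i ≠ j := exists_ne i |>.imp fun _ h => h.symm
  have := ((isDiffeomorphism_hornFace_one (X := X) j i hj).locSubd.comp (hl j)).comp
    (isDiffeomorphism_yonedaEquiv_symm X ⦋1⦌).locSubd
  convert this using 2 with x
  rw [Function.comp_apply, Function.comp_apply, hornRestriction, hornFace_ι_comp,
    Equiv.apply_symm_apply]

lemma eq_or_eq_of_ne : ∀ (j : Fin 3) (i k : Fin 2), i ≤ k → i.castSucc ≠ j → k.succ ≠ j →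
    ∀ l, l ≠ j → l = i.castSucc ∨ l = k.succ := by
  decide

/-- A horn in dimension 2 is a pair of edges with a common vertex. -/
lemma isFibreProduct_horn_two (j : Fin 3) (i k : Fin 2) (hik : i ≤ k) (hi : i.castSucc ≠ j)
    (hk : k.succ ≠ j) :
    IsFibreProduct (fun f : (Λ[2, j] : SSet.{u}) ⟶ X.toSSet => hornFace f i.castSucc hi)
      (fun (_ : Unit) f => hornFace f k.succ hk) (fun _ x => X.toSSet.δ k x)
      (fun _ x => X.toSSet.δ i x) where
  isPlot_iff p := by
    refine (isPlot_horn_iff p).trans ⟨fun h => ⟨h _ _, fun _ => h _ _⟩, fun h l hl => ?_⟩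
    have := eq_or_eq_of_ne j i k hik hi hk l hl
    rcases this with rfl | rfl
    exacts [h.1, h.2 ()]
  comm f _ := hornFace_compat f i k hik hi hk
  exists_mk x y hxy := by
    classical
    have hne : k.succ ≠ i.castSucc := by
      simp only [Fin.ext_iff, Fin.le_def, ne_eq, Fin.val_castSucc, Fin.val_succ] at *; omega
    obtain ⟨f, hf⟩ := exists_horn (X := X.toSSet) (n := 0) (j := j)
      (fun l => if l = i.castSucc then x else y ()) fun i' k' h h1 h2 => by
        have hh : i' = i ∧ k' = k := by
          simp only [Fin.ext_iff, Fin.le_def, ne_eq, Fin.val_castSucc, Fin.val_succ] at *; omega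
        obtain ⟨rfl, rfl⟩ := hh
        rw [if_neg hne, if_pos rfl]
        exact hxy ()
    exact ⟨f, (hf _ _).trans (if_pos rfl), fun _ => (hf _ _).trans (if_neg hne)⟩
  ext f f' h h' := horn_hom_ext fun l hl => by
    have := eq_or_eq_of_ne j i k hik hi hk l hl
    rcases this with rfl | rfl
    exacts [h, h' ()]

lemma hasCharts_horn_two (h0 : HasCharts (X.toSSet _⦋0⦌)) (h1 : HasCharts (X.toSSet _⦋1⦌))
    (hl : ∀ j, LocSubd (hornRestriction X 1 j)) (j : Fin 3) :
    HasCharts ((Λ[2, j] : SSet.{u}) ⟶ X.toSSet) := by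
  obtain ⟨i, k, hik, hi, hk⟩ : ∃ i k : Fin 2, i ≤ k ∧ i.castSucc ≠ j ∧ k.succ ≠ j := by
    fin_cases j
    exacts [⟨1, 1, by decide⟩, ⟨0, 1, by decide⟩, ⟨0, 0, by decide⟩]
  exact (isFibreProduct_horn_two j i k hik hi hk).hasCharts h1
    (fun _ => (locSubd_δ hl k).dSmooth) fun _ => (locSubd_δ hl i).isSubmersion h1 h0

/-- A criterion in which the spaces of horns need not be known to be manifolds. -/
lemma isLieGroupoid_of_locSubd (hM : ∀ m : ℕ, IsSmoothManifold (X.toSSet _⦋m⦌))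
    (hs : ∀ m, 1 ≤ m → ∀ j, Function.Surjective (hornRestriction X m j))
    (hl : ∀ m, 1 ≤ m → ∀ j, LocSubd (hornRestriction X m j))
    (hi : ∀ m, 2 < m → ∀ j, Function.Injective (hornRestriction X m j)) :
    IsLieGroupoid 2 X := by
  have hyon : ∀ m : ℕ, HasCharts ((Δ[m] : SSet.{u}) ⟶ X.toSSet) := fun m =>
    (isDiffeomorphism_yonedaEquiv_symm X ⦋m⦌).hasCharts (hM m).hasCharts
  have hu : ∀ m, 2 < m → ∀ j : Fin (m + 1), IsDiffeomorphism (hornRestriction X m j) :=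
    fun m hm j => (hl m (by omega) j).isDiffeomorphism ⟨hi m hm j, hs m (by omega) j⟩
  refine ⟨hM, fun m hm j => ⟨hs m hm j, (hl m hm j).isSubmersion (hyon m) ?_⟩, hu⟩
  match m, hm, j with
  | 1, _, j =>
    obtain ⟨i, hij⟩ : ∃ i : Fin 2, i ≠ j := exists_ne j
    obtain ⟨g, hg⟩ := (isDiffeomorphism_hornFace_one (X := X) j i hij).symm_of
    exact hg.hasCharts (hM 0).hasCharts
  | 2, _, j => exact hasCharts_horn_two (hM 0).hasCharts (hM 1).hasCharts (hl 1 le_rfl) j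
  | m + 3, _, j => exact (hu (m + 3) (by omega) j).hasCharts (hyon _)

end

/-! ### Edges of horns and boundaries -/

lemma edge_mem_horn {k : ℕ} (hk : 3 ≤ k) (j : Fin (k + 1)) (x : (Δ[k] : SSet.{u}) _⦋1⦌) :
    x ∈ (Λ[k, j] : SSet.Subcomplex.{u} _).obj (op ⦋1⦌) := by
  rw [SSet.mem_horn_iff_notMem_range]
  obtain ⟨i, hi⟩ : ∃ i : Fin (k + 1), i ∉ ({x 0, x 1, j} : Finset (Fin (k + 1))) := by
    by_contra! h
    have h1 := Finset.card_le_card (fun i _ => h i : Finset.univ ⊆ _)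
    have h2 : ({x 0, x 1, j} : Finset (Fin (k + 1))).card ≤ 3 := Finset.card_le_three
    simp only [Finset.card_univ, Fintype.card_fin] at h1
    omega
  simp only [Finset.mem_insert, Finset.mem_singleton, not_or] at hi
  refine ⟨i, hi.2.2, ?_⟩
  rintro ⟨t, rfl⟩
  have := (by decide : ∀ t : Fin 2, t = 0 ∨ t = 1) t
  rcases this with rfl | rfl
  exacts [hi.1 rfl, hi.2.1 rfl]

lemma edge_mem_boundary_two (x : (Δ[2] : SSet.{u}) _⦋1⦌) :
    x ∈ (∂Δ[2] : SSet.Subcomplex.{u} _).obj (op ⦋1⦌) := by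
  rw [SSet.mem_boundary_iff_notMem_range]
  obtain ⟨i, hi⟩ : ∃ i : Fin 3, i ∉ ({x 0, x 1} : Finset (Fin 3)) := by
    by_contra! h
    have h1 := Finset.card_le_card (fun i _ => h i : Finset.univ ⊆ _)
    have h2 : ({x 0, x 1} : Finset (Fin 3)).card ≤ 2 := Finset.card_le_two
    simp only [Finset.card_univ, Fintype.card_fin] at h1
    omega
  simp only [Finset.mem_insert, Finset.mem_singleton, not_or] at hi
  refine ⟨i, ?_⟩
  rintro ⟨t, rfl⟩
  have := (by decide : ∀ t : Fin 2, t = 0 ∨ t = 1) t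
  rcases this with rfl | rfl
  exacts [hi.1 rfl, hi.2 rfl]

/-- The boundary of a simplex of dimension less than 2 consists of vertices, so its edges are
degenerate. -/
lemma boundary_edge_eq_σ {m : ℕ} (hm : m < 2) (x : (∂Δ[m] : SSet.{u}) _⦋1⦌) :
    ∃ w : (∂Δ[m] : SSet.{u}) _⦋0⦌, x = (∂Δ[m] : SSet.{u}).σ 0 w := by
  refine ⟨(∂Δ[m] : SSet.{u}).δ 0 x, Subtype.ext ?_⟩
  obtain ⟨x, hx⟩ := x
  obtain ⟨i, hi⟩ := (SSet.mem_boundary_iff_notMem_range _).1 hx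
  change x = (Δ[m] : SSet.{u}).map (SimplexCategory.σ 0).op
    ((Δ[m] : SSet.{u}).map (SimplexCategory.δ 0).op x)
  have h1 : x 0 = x 1 := by
    have h0 : x 0 ≠ i := fun h => hi ⟨0, h⟩
    have h1 : x 1 ≠ i := fun h => hi ⟨1, h⟩
    rw [ne_eq, Fin.ext_iff] at h0 h1
    rw [Fin.ext_iff]
    omega
  refine SSet.stdSimplex.ext _ _ fun t => ?_
  have := (by decide : ∀ t : Fin 2, t = 0 ∨ t = 1) t
  rcases this with rfl | rfl
  exacts [h1, rfl]

namespace IsPull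

variable {Z S : SimplicialDiff.{u}} {f : StrictMap Z S} {E : Type u} [DiffeologicalSpace E]
  {π : E → S.toSSet _⦋1⦌} {unit : S.toSSet _⦋0⦌ → E} {ε : Z.toSSet _⦋1⦌ → E}
  {B : SSet.{u}}

section

variable (hf : IsPull f π unit ε)

include hf

/-- If all edges of `A` are degenerate, lifts of maps from `A` are unique. -/
lemma isDiffeomorphism_relHom_snd (A : B.Subcomplex)
    (hA : ∀ x : (A : SSet.{u}) _⦋1⦌, ∃ w : (A : SSet.{u}) _⦋0⦌, x = (A : SSet.{u}).σ 0 w) :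
    IsDiffeomorphism fun p : RelHom A.ι f => p.1.2 := by
  have hε : ∀ (a : (A : SSet.{u}) ⟶ Z.toSSet) (w : (A : SSet.{u}) _⦋0⦌),
      ε (a.app _ ((A : SSet.{u}).σ 0 w)) = unit (f.hom.app _ (a.app _ w)) := fun a w => by
    rw [SSet.σ_naturality_apply, hf.ε_σ]
  have hinj : Function.Injective fun p : RelHom A.ι f => p.1.2 := by
    rintro ⟨⟨a, b⟩, hab⟩ ⟨⟨a', b'⟩, hab'⟩ (h : b = b')
    have h1 : a ≫ f.hom = a' ≫ f.hom := by
      refine (show _ = A.ι ≫ b from hab).trans ?_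
      rw [h]
      exact Eq.symm hab'
    refine Subtype.ext (Prod.ext (hf.hom_ext h1 fun x => ?_) h)
    obtain ⟨w, rfl⟩ := hA x
    refine (hε a w).trans (Eq.trans ?_ (hε a' w).symm)
    exact congrArg (fun k : (A : SSet.{u}) ⟶ S.toSSet => unit (k.app _ w)) h1
  refine LocSubd.isDiffeomorphism ⟨fun d p hp => (isPlot_relHom_iff.1 hp).2,
    fun x d b hb hb0 => ?_⟩ ⟨hinj, fun b => ?_⟩
  · choose a ha using fun t => hf.surjective_postcomp (A.ι ≫ b t)
    have hAb : IsPlot fun t => A.ι ≫ b t :=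
      (isPlot_hom_iff _).2 fun n y => (isPlot_hom_iff b).1 hb n _
    refine ⟨fun t => ⟨(a t, b t), ha t⟩, isPlot_relHom_iff.2 ⟨hf.isPlot_hom a ?_ fun y => ?_, hb⟩,
      hinj hb0, .rfl⟩
    · simp only [ha]
      exact hAb
    · obtain ⟨w, rfl⟩ := hA y
      simp only [hε]
      have : (fun t => f.hom.app _ ((a t).app _ w)) = fun t => (b t).app _ w.1 := funext fun t =>
        congrArg (fun k : (A : SSet.{u}) ⟶ S.toSSet => k.app _ w) (ha t)
      exact hf.dSmooth_unit _ _ (this ▸ (isPlot_hom_iff b).1 hb _ _)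
  · obtain ⟨a, ha⟩ := hf.surjective_postcomp (A.ι ≫ b)
    exact ⟨⟨(a, b), ha⟩, rfl⟩

/-- A pull-back along a surjective submersion of edges is a hypercover. In dimensions 0 and 1 the
boundary has no edges of interest, and in dimension 2 it contains all edges of the triangle. -/
lemma isHypercover (hZ : ∀ m : ℕ, HasCharts (Z.toSSet _⦋m⦌))
    (hS : ∀ m : ℕ, HasCharts (S.toSSet _⦋m⦌)) : IsHypercover 2 f where
  isSurjectiveSubmersion m hm := by
    refine ⟨hf.surjective_toRelHom _, (hf.locSubd_toRelHom _).isSubmersion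
      ((isDiffeomorphism_yonedaEquiv_symm Z ⦋m⦌).hasCharts (hZ m)) ?_⟩
    obtain ⟨g, hg⟩ := (hf.isDiffeomorphism_relHom_snd (∂Δ[m] : SSet.Subcomplex.{u} _)
      (boundary_edge_eq_σ hm)).symm_of
    exact hg.hasCharts ((isDiffeomorphism_yonedaEquiv_symm S ⦋m⦌).hasCharts (hS m))
  isDiffeomorphism := (hf.locSubd_toRelHom _).isDiffeomorphism
    ⟨hf.injective_toRelHom _ edge_mem_boundary_two, hf.surjective_toRelHom _⟩

/-! ### Lie 2-groupoids and pull-backs along edges -/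

/-- The simplices of `Z` are the simplices of `S` with elements of `E` over the edges other than the
degenerate ones. -/
lemma isFibreProduct (n : SimplexCategory) :
    IsFibreProduct (fun z : Z.toSSet.obj (op n) => f.hom.app _ z)
      (fun (φ : {φ : ⦋1⦌ ⟶ n // ¬ ∃ v, φ = SimplexCategory.σ 0 ≫ v}) z =>
        ε (Z.toSSet.map φ.1.op z))
      (fun φ x => S.toSSet.map φ.1.op x) (fun _ e => π e) := by
  have hσ : ∀ (v : ⦋0⦌ ⟶ n) (z : Z.toSSet.obj (op n)),
      ε (Z.toSSet.map (SimplexCategory.σ 0 ≫ v).op z) =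
        unit (S.toSSet.map v.op (f.hom.app _ z)) := fun v z => by
    rw [← σ_map_op, hf.ε_σ, NatTrans.naturality_apply]
  refine ⟨fun p => ⟨fun hp => ⟨f.smooth _ _ _ hp, fun φ => hf.dSmooth_ε _ _
    (Z.smooth_map _ _ _ hp)⟩, fun hp => hf.isPlot p hp.1 fun φ => ?_⟩, fun z φ => ?_,
    fun x e he => ?_, fun z z' h h' => hf.ext h fun φ => ?_⟩
  · by_cases hφ : ∃ v, φ = SimplexCategory.σ 0 ≫ v
    · obtain ⟨v, rfl⟩ := hφ
      simp only [hσ]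
      exact hf.dSmooth_unit _ _ (S.smooth_map _ _ _ hp.1)
    · exact hp.2 ⟨φ, hφ⟩
  · rw [hf.π_ε, NatTrans.naturality_apply]
  · classical
    let e' : (⦋1⦌ ⟶ n) → E := fun φ =>
      if h : ∃ v, φ = SimplexCategory.σ 0 ≫ v then unit (S.toSSet.map h.choose.op x) else e ⟨φ, h⟩
    have hl : IsLift π unit x e' := by
      refine ⟨fun φ => ?_, fun v => ?_⟩
      · by_cases h : ∃ v, φ = SimplexCategory.σ 0 ≫ v
        · simp only [e', dif_pos h]
          rw [hf.π_unit, σ_map_op, ← h.choose_spec]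
        · simp only [e', dif_neg h]
          exact he ⟨φ, h⟩
      · have h : ∃ v', SimplexCategory.σ 0 ≫ v = SimplexCategory.σ 0 ≫ v' := ⟨v, rfl⟩
        simp only [e', dif_pos h]
        have := congrArg (fun k => SimplexCategory.δ 0 ≫ k) h.choose_spec.symm
        rw [show h.choose = v from
          (δ_zero_σ_zero_comp _).symm.trans (this.trans (δ_zero_σ_zero_comp v))]
    obtain ⟨z, hz1, hz2⟩ := hf.exists_of_isLift x e' hl
    exact ⟨z, hz1, fun φ => (hz2 φ.1).trans (dif_neg φ.2)⟩
  · by_cases hφ : ∃ v, φ = SimplexCategory.σ 0 ≫ v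
    · obtain ⟨v, rfl⟩ := hφ
      rw [hσ, hσ, h]
    · exact h' ⟨φ, hφ⟩

/-- The pull-back of a Lie 2-groupoid along a surjective submersion of edges is a Lie 2-groupoid:
a horn is filled in `S` first, and the filler is lifted to `Z`. The lift is unique from dimension
3 on, as the horn contains all edges. -/
lemma isLieGroupoid_source (hS : IsLieGroupoid 2 S) (hE : IsSmoothManifold E) :
    IsLieGroupoid 2 Z := by
  have hfill : ∀ m, 1 ≤ m → ∀ j : Fin (m + 1), LocSubd (hornRestriction S m j) ∧
      Function.Surjective (hornRestriction S m j) :=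
    fun m hm j => ⟨(hS.kan m hm j).2.locSubd, (hS.kan m hm j).1⟩
  have hcomp : ∀ (m : ℕ) (j : Fin (m + 1)) (h : Δ[m] ⟶ Z.toSSet),
      hornRestriction Z m j h ≫ f.hom = hornRestriction S m j (h ≫ f.hom) :=
    fun m j h => Category.assoc _ _ _
  refine isLieGroupoid_of_locSubd (fun m => ?_) (fun m hm j a => ?_) (fun m hm j => ?_)
    fun m hm j h h' hh => ?_
  · exact (hf.isFibreProduct ⦋m⦌).isSmoothManifold (hS.isSmoothManifold m) (fun _ => hE)
      (fun φ => S.smooth_map _)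
      fun φ => hf.locSubd_π.isSubmersion hE.hasCharts (hS.isSmoothManifold 1).hasCharts
  · obtain ⟨b, hb⟩ := (hfill m hm j).2 (a ≫ f.hom)
    obtain ⟨h, hh⟩ := hf.surjective_toRelHom (Λ[m, j] : SSet.Subcomplex.{u} _) ⟨(a, b), hb.symm⟩
    exact ⟨h, congrArg (fun k : RelHom _ f => k.1.1) hh⟩
  · refine ⟨dSmooth_hornRestriction Z m j, fun h₀ d a ha ha0 => ?_⟩
    obtain ⟨b, hb, hb0, hba⟩ := (hfill m hm j).1.lift (h₀ ≫ f.hom) (fun t => a t ≫ f.hom)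
      (dSmooth_postcomp f _ _ ha) (by rw [ha0, hcomp])
    obtain ⟨ρ, hρ, hρ0, hρs⟩ := exists_squash hba
    have hρz : ρ 0 = 0 := hρ0.self_of_nhds
    obtain ⟨h, hh, h0, h1⟩ := (hf.locSubd_toRelHom (Λ[m, j] : SSet.Subcomplex.{u} _)).lift h₀
      (fun t => ⟨(a (ρ t), b (ρ t)), Eq.symm (hρs t)⟩)
      (isPlot_relHom_iff.2 ⟨isPlot_reparam ha hρ, isPlot_reparam hb hρ⟩)
      (Subtype.ext (Prod.ext ((congrArg a hρz).trans ha0) ((congrArg b hρz).trans hb0)))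
    refine ⟨h, hh, h0, ?_⟩
    filter_upwards [h1, hρ0] with t ht ht'
    refine (congrArg (fun k : RelHom _ f => k.1.1) ht).trans ?_
    change a (ρ t) = _
    rw [ht', id_eq]
  · refine hf.injective_toRelHom (Λ[m, j] : SSet.Subcomplex.{u} _) (edge_mem_horn hm j)
      (Subtype.ext (Prod.ext hh ?_))
    refine (hS.kan_unique m hm j).bijective.1 ((hcomp m j h).symm.trans ?_)
    rw [hh]
    exact hcomp m j h'

end

end IsPull

namespace IsPull

variable {Z S : SimplicialDiff.{u}} {f : StrictMap Z S} {E : Type u} [DiffeologicalSpace E]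
  {π : E → S.toSSet _⦋1⦌} {unit : S.toSSet _⦋0⦌ → E} {ε : Z.toSSet _⦋1⦌ → E}

section

variable (hf : IsPull f π unit ε)

include hf

lemma surjective_app (n : SimplexCategory) :
    Function.Surjective fun z : Z.toSSet.obj (op n) => f.hom.app _ z := fun x => by
  obtain ⟨h, hh⟩ := hf.surjective_postcomp (SSet.yonedaEquiv.symm x : SSet.stdSimplex.obj n ⟶ _)
  refine ⟨SSet.yonedaEquiv h, ?_⟩
  exact (SSet.yonedaEquiv_comp _ _).symm.trans
    ((congrArg SSet.yonedaEquiv hh).trans (SSet.yonedaEquiv.apply_symm_apply x))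

lemma locSubd_app (n : ℕ) : LocSubd fun z : Z.toSSet _⦋n⦌ => f.hom.app _ z := by
  have := ((isDiffeomorphism_yonedaEquiv S ⦋n⦌).locSubd.comp
    (hf.locSubd_postcomp (A := Δ[n]))).comp (isDiffeomorphism_yonedaEquiv_symm Z ⦋n⦌).locSubd
  convert this using 2 with z
  exact (congrArg _ (SSet.yonedaEquiv.apply_symm_apply z).symm).trans
    (SSet.yonedaEquiv_comp _ _).symm

/-- A local section through `z₀` can be built from local sections of `π` at the edges of `z₀`; it
is then defined near all simplices with the same edges as the image of `z₀`. -/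
lemma exists_local_section (hπ : IsSubmersion π) {n : SimplexCategory} (z₀ : Z.toSSet.obj (op n)) :
    ∃ s : S.toSSet.obj (op n) → Z.toSSet.obj (op n), s (f.hom.app _ z₀) = z₀ ∧
      ∀ x, (∀ φ : ⦋1⦌ ⟶ n, S.toSSet.map φ.op x = S.toSSet.map φ.op (f.hom.app _ z₀)) →
        ∀ᶠ y in dNhds x, SmAt s y ∧ f.hom.app _ (s y) = y := by
  classical
  -- over a degenerate edge the section is forced by `unit`
  have hq : ∀ φ : ⦋1⦌ ⟶ n, ∃ q : S.toSSet.obj (op n) → E,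
      q (f.hom.app _ z₀) = ε (Z.toSSet.map φ.op z₀) ∧
      (∀ v, φ = SimplexCategory.σ 0 ≫ v → ∀ y, q y = unit (S.toSSet.map v.op y)) ∧
      ∀ x, S.toSSet.map φ.op x = S.toSSet.map φ.op (f.hom.app _ z₀) →
        ∀ᶠ y in dNhds x, SmAt q y ∧ π (q y) = S.toSSet.map φ.op y := by
    intro φ
    by_cases hφ : ∃ v, φ = SimplexCategory.σ 0 ≫ v
    · obtain ⟨v, rfl⟩ := hφ
      refine ⟨fun y => unit (S.toSSet.map v.op y), ?_, fun w hw y => ?_, fun x _ =>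
        .of_forall fun y => ⟨smAt_of_dSmooth (hf.dSmooth_unit.comp (S.smooth_map _)) y, ?_⟩⟩
      · rw [← σ_map_op, hf.ε_σ, NatTrans.naturality_apply]
      · have := congrArg (fun k => SimplexCategory.δ 0 ≫ k) hw
        rw [show v = w from
          (δ_zero_σ_zero_comp _).symm.trans (this.trans (δ_zero_σ_zero_comp w))]
      · rw [hf.π_unit, σ_map_op]
    · have hπz : π (ε (Z.toSSet.map φ.op z₀)) = S.toSSet.map φ.op (f.hom.app _ z₀) := by
        rw [hf.π_ε, NatTrans.naturality_apply]
      obtain ⟨s, hs0, hs1, hs2⟩ := hπ.exists_local_section (ε (Z.toSSet.map φ.op z₀))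
      rw [hπz] at hs0 hs1 hs2
      refine ⟨fun y => s (S.toSSet.map φ.op y), hs0, fun v hv => absurd ⟨v, hv⟩ hφ,
        fun x hx => ?_⟩
      have ht := DSmooth.tendsto_dNhds (S.smooth_map φ.op) x
      rw [hx] at ht
      filter_upwards [ht.eventually hs1, ht.eventually hs2] with y h1 h2
      exact ⟨SmAt.comp h1 (smAt_of_dSmooth (S.smooth_map φ.op) y), h2⟩
  choose q hq0 hqσ hq using hq
  -- away from the simplices over which the sections fit together, the value of `s` is irrelevant
  let s : S.toSSet.obj (op n) → Z.toSSet.obj (op n) := fun y =>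
    if h : IsLift π unit y fun φ => q φ y then (hf.exists_of_isLift y _ h).choose else z₀
  have hs : ∀ y, (∀ φ, π (q φ y) = S.toSSet.map φ.op y) →
      f.hom.app _ (s y) = y ∧ ∀ φ, ε (Z.toSSet.map φ.op (s y)) = q φ y := fun y hy => by
    have hl : IsLift π unit y fun φ => q φ y := ⟨hy, fun v => hqσ _ v rfl y⟩
    simp only [s, dif_pos hl]
    exact (hf.exists_of_isLift y _ hl).choose_spec
  refine ⟨s, ?_, fun x hx => ?_⟩
  · have := hs (f.hom.app _ z₀) fun φ => by rw [hq0, hf.π_ε, NatTrans.naturality_apply]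
    exact hf.ext this.1 fun φ => (this.2 φ).trans (hq0 φ)
  · have hev : ∀ᶠ y in dNhds x, ∀ φ, SmAt (q φ) y ∧ π (q φ y) = S.toSSet.map φ.op y :=
      Filter.eventually_all.2 fun φ => hq φ x (hx φ)
    filter_upwards [eventually_eventually_dNhds hev] with y hy
    have hy0 := self_of_dNhds hy
    refine ⟨fun d p hp hp0 => ?_, (hs y fun φ => (hy0 φ).2).1⟩
    choose r hr hqr using fun φ => (hy0 φ).1 p hp hp0
    have h1 := (IsPlot.tendsto_dNhds hp 0).eventually (hp0.symm ▸ hy)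
    obtain ⟨ρ, hρ, hρ0, hρs⟩ := exists_squash (h1.and (Filter.eventually_all.2 hqr))
    have hsρ := fun t => hs (p (ρ t)) fun φ => ((hρs t).1 φ).2
    refine ⟨fun t => s (p (ρ t)), hf.isPlot _ ?_ fun φ => ?_, ?_⟩
    · simp only [hsρ]
      exact isPlot_reparam hp hρ
    · have : (fun t => ε (Z.toSSet.map φ.op (s (p (ρ t))))) = r φ ∘ ρ :=
        funext fun t => ((hsρ t).2 φ).trans ((hρs t).2 φ)
      rw [this]
      exact isPlot_reparam (hr φ) hρ
    · filter_upwards [hρ0] with t ht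
      rw [Function.comp_apply, ht, id_eq]

/-- Local sections make `S` locally a smooth retract of a chart of `Z`. -/
lemma hasCharts_app (hπ : IsSubmersion π) (n : ℕ) (hZ : HasCharts (Z.toSSet _⦋n⦌)) :
    HasCharts (S.toSSet _⦋n⦌) := by
  intro x
  obtain ⟨z₀, rfl⟩ := hf.surjective_app ⦋n⦌ x
  obtain ⟨s, hs0, hs⟩ := hf.exists_local_section hπ z₀
  obtain ⟨m, φ, hφ, hz⟩ := hZ z₀
  have hs := hs _ fun _ => rfl
  have hst := tendsto_dNhds_of_smAt (hs.mono fun _ h => h.1)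
  have hsr : ∀ᶠ y in dNhds (f.hom.app _ z₀), s y ∈ Set.range φ :=
    hst.eventually (hs0.symm ▸ hφ.eventually_mem_range hz)
  refine exists_chart_of_retract (Function.invFun φ ∘ s) (fun v => f.hom.app _ (φ v)) ?_
    (.of_forall fun v => smAt_of_dSmooth ((f.smooth _).comp hφ.isPlot.dSmooth) v) ?_
  · filter_upwards [hs, hsr] with y h1 h2
    exact SmAt.comp (hφ.smAt_invFun h2) h1.1
  · filter_upwards [hs, hsr] with y h1 h2
    change f.hom.app _ (φ (Function.invFun φ (s y))) = y
    rw [Function.invFun_eq h2, h1.2]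

/-- Two simplices of `S` with different edges are separated by them; if they have the same edges, a
local section is defined near both, and separates them. -/
lemma t2_app (hπ : IsSubmersion π) (n : ℕ) (hZ : @T2Space (Z.toSSet _⦋n⦌) dTopology)
    (hS : @T2Space (S.toSSet _⦋1⦌) dTopology) : @T2Space (S.toSSet _⦋n⦌) dTopology := by
  let : TopologicalSpace (S.toSSet _⦋n⦌) := dTopology
  rw [t2Space_iff_disjoint_nhds]
  intro x x' hxx'
  change Disjoint (dNhds x) (dNhds x')
  by_cases hφ : ∃ φ : ⦋1⦌ ⟶ ⦋n⦌, S.toSSet.map φ.op x' ≠ S.toSSet.map φ.op x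
  · obtain ⟨φ, hφ⟩ := hφ
    have := (@t2Space_iff_disjoint_nhds _ dTopology).1 hS hφ.symm
    exact (DSmooth.tendsto_dNhds (S.smooth_map φ.op) x).disjoint this
      (DSmooth.tendsto_dNhds (S.smooth_map φ.op) x')
  · push Not at hφ
    obtain ⟨z₀, rfl⟩ := hf.surjective_app ⦋n⦌ x
    obtain ⟨s, hs0, hs⟩ := hf.exists_local_section hπ z₀
    have h1 := hs _ fun _ => rfl
    have h2 := hs x' hφ
    have hne : s (f.hom.app _ z₀) ≠ s x' := fun h => hxx' <| by
      rw [← self_of_dNhds h2 |>.2, ← h, hs0]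
    exact (tendsto_dNhds_of_smAt (h1.mono fun _ h => h.1)).disjoint
      ((@t2Space_iff_disjoint_nhds _ dTopology).1 hZ hne)
      (tendsto_dNhds_of_smAt (h2.mono fun _ h => h.1))

/-- If the pull-back along a surjective submersion of edges is a Lie 2-groupoid, then so is the
given simplicial space. -/
lemma isLieGroupoid_target (hZ : IsLieGroupoid 2 Z) (hE : HasCharts E)
    (hS1 : IsSmoothManifold (S.toSSet _⦋1⦌)) : IsLieGroupoid 2 S := by
  have hπ : IsSubmersion π := hf.locSubd_π.isSubmersion hE hS1.hasCharts
  have hfill : ∀ m, 1 ≤ m → ∀ j : Fin (m + 1), LocSubd (hornRestriction Z m j) ∧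
      Function.Surjective (hornRestriction Z m j) :=
    fun m hm j => ⟨(hZ.kan m hm j).2.locSubd, (hZ.kan m hm j).1⟩
  have hcomp : ∀ (m : ℕ) (j : Fin (m + 1)) (h : Δ[m] ⟶ Z.toSSet),
      hornRestriction Z m j h ≫ f.hom = hornRestriction S m j (h ≫ f.hom) :=
    fun m j h => Category.assoc _ _ _
  refine isLieGroupoid_of_locSubd (fun m => ?_) (fun m hm j g => ?_) (fun m hm j => ?_)
    fun m hm j b b' hb => ?_
  · have hM := hZ.isSmoothManifold m
    exact ⟨hf.t2_app hπ m hM.t2 hS1.t2, secondCountable_of_locSubd (hf.locSubd_app m)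
      (hf.surjective_app ⦋m⦌) hM.secondCountable, hf.hasCharts_app hπ m hM.hasCharts⟩
  · obtain ⟨a, rfl⟩ := hf.surjective_postcomp g
    obtain ⟨h, rfl⟩ := (hfill m hm j).2 a
    exact ⟨h ≫ f.hom, (hcomp m j h).symm⟩
  · have : Finite ((Λ[m, j] : SSet.{u}) _⦋1⦌) :=
      inferInstanceAs (Finite ((Λ[m, j] : SSet.Subcomplex.{u} _).obj (op ⦋1⦌)))
    refine LocSubd.of_comp (f := fun h : Δ[m] ⟶ Z.toSSet => h ≫ f.hom) (dSmooth_postcomp f)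
      hf.surjective_postcomp (dSmooth_hornRestriction S m j) ?_
    have := hf.locSubd_postcomp.comp (hfill m hm j).1
    exact this
  -- two simplices that agree on a horn of dimension at least 3 have the same edges, so they have
  -- lifts to `Z` with the same edges, which agree on the horn
  · obtain ⟨h, rfl⟩ := hf.surjective_postcomp b
    have hbx : ∀ x : (Δ[m] : SSet.{u}) _⦋1⦌, (h ≫ f.hom).app _ x = b'.app _ x := fun x =>
      congrArg (fun k : (Λ[m, j] : SSet.{u}) ⟶ S.toSSet =>
        k.app (op ⦋1⦌) (⟨x, edge_mem_horn hm j x⟩ : (Λ[m, j] : SSet.{u}) _⦋1⦌)) hb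
    obtain ⟨h', hh', hε⟩ := hf.exists_lift b' Set.univ (fun x => ε (h.app _ x))
      (fun x _ => (hf.π_ε _).trans (hbx x)) fun v _ => by
        rw [SSet.σ_naturality_apply, hf.ε_σ]
        have := congrArg (S.toSSet.δ 0) (hbx ((Δ[m] : SSet.{u}).σ 0 v))
        rw [SSet.σ_naturality_apply, SSet.σ_naturality_apply, δ_zero_σ_zero_zero,
          δ_zero_σ_zero_zero] at this
        exact congrArg unit this
    have heq : h = h' := (hZ.kan_unique m hm j).bijective.1 <| hf.hom_ext
      ((hcomp m j h).trans (hb.trans ((congrArg _ hh'.symm).trans (hcomp m j h').symm)))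
      fun x => (hε x.1 (Set.mem_univ _)).symm
    exact (congrArg (· ≫ f.hom) heq).trans hh'

end

end IsPull

/-! ### The simplices of the Kan replacement -/

section

variable {X : SSet.{u}} {n : SimplexCategoryᵒᵖ}

lemma kanStep_isPushout (X : SSet.{u}) (n : SimplexCategoryᵒᵖ) :
    IsPushout ((attachingMap X).app n) ((hornCellsInclusion X).app n) ((kanStepInl X).app n)
      ((kanStepInr X).app n) :=
  (IsPushout.of_hasPushout (attachingMap X) (hornCellsInclusion X)).map
    ((CategoryTheory.evaluation SimplexCategoryᵒᵖ (Type u)).obj n)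

/-- Simplices of the cells that are not contained in the horns remain distinct, and are not
identified with simplices of `X`. -/
lemma exists_kanStep_split (X : SSet.{u}) (n : SimplexCategoryᵒᵖ) :
    ∃ F : (kanStepSSet X).obj n → X.obj n ⊕ (simplexCells X).obj n,
      (∀ x, F ((kanStepInl X).app n x) = .inl x) ∧
      ∀ c : (simplexCells X).obj n, c.2.1 ∉ Λ[c.1.k, c.1.j].obj n →
        F ((kanStepInr X).app n c) = .inr c := by
  classical
  let F₁ : X.obj n ⟶ X.obj n ⊕ (simplexCells X).obj n := TypeCat.ofHom Sum.inl
  -- simplices of the cells that lie in the horns are sent to the simplices of `X` they are glued to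
  let F₂ : (simplexCells X).obj n ⟶ X.obj n ⊕ (simplexCells X).obj n := TypeCat.ofHom fun c =>
    if h : c.2.1 ∈ Λ[c.1.k, c.1.j].obj n then .inl (c.2.2.app n ⟨c.2.1, h⟩) else .inr c
  have hw : (attachingMap X).app n ≫ F₁ = (hornCellsInclusion X).app n ≫ F₂ := by
    ext ⟨a, s, h⟩
    exact Eq.symm (dif_pos s.2)
  have hP := kanStep_isPushout X n
  refine ⟨hP.desc F₁ F₂ hw, fun x => ?_, fun c hc => ?_⟩
  · exact ConcreteCategory.congr_hom (hP.inl_desc F₁ F₂ hw) x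
  · exact (ConcreteCategory.congr_hom (hP.inr_desc F₁ F₂ hw) c).trans (dif_neg hc)

lemma kanStepInl_injective (X : SSet.{u}) (n : SimplexCategoryᵒᵖ) :
    Function.Injective ((kanStepInl X).app n) := fun x y h => by
  obtain ⟨F, hF, -⟩ := exists_kanStep_split X n
  exact Sum.inl_injective ((hF x).symm.trans ((congrArg F h).trans (hF y)))

lemma kanStepInr_injective {c c' : (simplexCells X).obj n} (hc : c.2.1 ∉ Λ[c.1.k, c.1.j].obj n)
    (hc' : c'.2.1 ∉ Λ[c'.1.k, c'.1.j].obj n)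
    (h : (kanStepInr X).app n c = (kanStepInr X).app n c') : c = c' := by
  obtain ⟨F, -, hF⟩ := exists_kanStep_split X n
  exact Sum.inr_injective ((hF c hc).symm.trans ((congrArg F h).trans (hF c' hc')))

lemma kanStepInl_ne_inr {x : X.obj n} {c : (simplexCells X).obj n}
    (hc : c.2.1 ∉ Λ[c.1.k, c.1.j].obj n) : (kanStepInl X).app n x ≠ (kanStepInr X).app n c := by
  obtain ⟨F, hF, hF'⟩ := exists_kanStep_split X n
  intro h
  cases (hF x).symm.trans ((congrArg F h).trans (hF' c hc))

lemma kanStep_inr_of_mem (a : HornIndex) (s : (Δ[a.k] : SSet.{u}).obj n)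
    (h : (Λ[a.k, a.j] : SSet.{u}) ⟶ X) (hs : s ∈ Λ[a.k, a.j].obj n) :
    (kanStepInr X).app n ⟨a, s, h⟩ = (kanStepInl X).app n (h.app n ⟨s, hs⟩) :=
  (ConcreteCategory.congr_hom (kanStep_isPushout X n).w
    (⟨a, ⟨s, hs⟩, h⟩ : (hornCells X).obj n)).symm

lemma kanStep_cases (y : (kanStepSSet X).obj n) : (∃ x, (kanStepInl X).app n x = y) ∨
    ∃ c : (simplexCells X).obj n, c.2.1 ∉ Λ[c.1.k, c.1.j].obj n ∧
      (kanStepInr X).app n c = y := by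
  rcases Types.eq_or_eq_of_isPushout (kanStep_isPushout X n) y with h | ⟨c, rfl⟩
  · exact .inl h
  · by_cases hc : c.2.1 ∈ Λ[c.1.k, c.1.j].obj n
    · exact .inl ⟨_, (kanStep_inr_of_mem c.1 c.2.1 c.2.2 hc).symm⟩
    · exact .inr ⟨c, hc, rfl⟩

end

section

variable {X : SimplicialDiff.{u}} {n : SimplexCategoryᵒᵖ}

lemma dSmooth_kanStepInl (X : SimplicialDiff.{u}) (n : SimplexCategoryᵒᵖ) :
    DSmooth (Y := (kanStep X).toSSet.obj n) fun x : X.toSSet.obj n =>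
      (kanStepInl X.toSSet).app n x :=
  dSmooth_mono le_sup_left (dSmooth_into_finalDiffeology
    (fun _ : Unit => fun x : X.toSSet.obj n => (kanStepInl X.toSSet).app n x) ())

lemma dSmooth_kanStepInr (X : SimplicialDiff.{u}) (n : SimplexCategoryᵒᵖ) (a : HornIndex)
    (s : (Δ[a.k] : SSet.{u}).obj n) :
    DSmooth (Y := (kanStep X).toSSet.obj n) fun h : (Λ[a.k, a.j] : SSet.{u}) ⟶ X.toSSet =>
      (kanStepInr X.toSSet).app n ⟨a, s, h⟩ :=
  dSmooth_mono le_sup_right (dSmooth_into_finalDiffeology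
    (fun (c : Σ a : HornIndex, (Δ[a.k] : SSet.{u}).obj n)
      (h : (Λ[c.1.k, c.1.j] : SSet.{u}) ⟶ X.toSSet) =>
        (kanStepInr X.toSSet).app n ⟨c.1, c.2, h⟩) ⟨a, s⟩)

/-- Plots of a step of the Kan replacement, locally. -/
lemma kanStep_plot_cases {d : ℕ} {p : Euc d → (kanStep X).toSSet.obj n} (hp : IsPlot p)
    (t₀ : Euc d) :
    (∃ q : Euc d → X.toSSet.obj n, IsPlot q ∧
      p =ᶠ[𝓝 t₀] fun t => (kanStepInl X.toSSet).app n (q t)) ∨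
    ∃ (a : HornIndex) (s : (Δ[a.k] : SSet.{u}).obj n), s ∉ Λ[a.k, a.j].obj n ∧
      ∃ h : Euc d → ((Λ[a.k, a.j] : SSet.{u}) ⟶ X.toSSet), IsPlot h ∧
        p =ᶠ[𝓝 t₀] fun t => (kanStepInr X.toSSet).app n ⟨a, s, h t⟩ := by
  rcases exists_lift_of_isPlot_sup
    (fun _ : Unit => fun x : X.toSSet.obj n => (kanStepInl X.toSSet).app n x)
    (fun (c : Σ a : HornIndex, (Δ[a.k] : SSet.{u}).obj n)
      (h : (Λ[c.1.k, c.1.j] : SSet.{u}) ⟶ X.toSSet) =>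
        (kanStepInr X.toSSet).app n ⟨c.1, c.2, h⟩)
    (fun y => (kanStep_cases y).imp (fun ⟨x, hx⟩ => ⟨(), x, hx⟩)
      fun ⟨c, _, hc⟩ => ⟨⟨c.1, c.2.1⟩, c.2.2, hc⟩) hp t₀ with ⟨_, q, hq, h⟩ | ⟨⟨a, s⟩, h, hh, hph⟩
  · exact .inl ⟨q, hq, h⟩
  · by_cases hs : s ∈ Λ[a.k, a.j].obj n
    · refine .inl ⟨fun t => (h t).app n ⟨s, hs⟩, (isPlot_hom_iff h).1 hh _ _, ?_⟩
      filter_upwards [hph] with t ht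
      rw [ht]
      exact kanStep_inr_of_mem a s (h t) hs
    · exact .inr ⟨a, s, hs, h, hh, hph⟩

lemma kanStep_isOpenInclusion (X : SimplicialDiff.{u}) (n : SimplexCategoryᵒᵖ) :
    IsOpenInclusion (Y := (kanStep X).toSSet.obj n) fun x : X.toSSet.obj n =>
      (kanStepInl X.toSSet).app n x := by
  refine ⟨⟨dSmooth_kanStepInl X n, fun x d p hp hp0 => ?_⟩, kanStepInl_injective X.toSSet n⟩
  rcases kanStep_plot_cases hp 0 with ⟨q, hq, h⟩ | ⟨a, s, hs, h, -, hph⟩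
  · exact ⟨q, hq, kanStepInl_injective X.toSSet n (h.self_of_nhds.symm.trans hp0), h.symm⟩
  · exact absurd (hp0.symm.trans hph.self_of_nhds) (kanStepInl_ne_inr hs)

/-- New simplices of a given shape form an open subspace. -/
lemma kanStep_isOpenInclusion_inr (X : SimplicialDiff.{u}) (n : SimplexCategoryᵒᵖ) (a : HornIndex)
    (s : (Δ[a.k] : SSet.{u}).obj n) (hs : s ∉ Λ[a.k, a.j].obj n) :
    IsOpenInclusion (Y := (kanStep X).toSSet.obj n)
      fun h : (Λ[a.k, a.j] : SSet.{u}) ⟶ X.toSSet =>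
        (kanStepInr X.toSSet).app n ⟨a, s, h⟩ := by
  have hinj : ∀ h h', (kanStepInr X.toSSet).app n ⟨a, s, h⟩ =
      (kanStepInr X.toSSet).app n ⟨a, s, h'⟩ → h = h' := fun h h' hh => by
    cases kanStepInr_injective (c := ⟨a, s, h⟩) (c' := ⟨a, s, h'⟩) hs hs hh
    rfl
  refine ⟨⟨dSmooth_kanStepInr X n a s, fun x d p hp hp0 => ?_⟩, hinj⟩
  rcases kanStep_plot_cases hp 0 with ⟨q, hq, h⟩ | ⟨a', s', hs', h, hh, hph⟩
  · exact absurd (h.self_of_nhds.symm.trans hp0) (kanStepInl_ne_inr hs)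
  · have := kanStepInr_injective (c := ⟨a', s', h 0⟩) (c' := ⟨a, s, x⟩) hs' hs
      (hph.self_of_nhds.symm.trans hp0)
    obtain rfl : a' = a := congrArg Sigma.fst this
    have h2 := eq_of_heq (Sigma.mk.inj this).2
    obtain rfl : s' = s := congrArg Prod.fst h2
    exact ⟨h, hh, congrArg Prod.snd h2, hph.symm⟩

end

section

variable (X : SimplicialDiff.{u}) {n : SimplexCategoryᵒᵖ}

lemma kanSequence_map_succ (β : ℕ) :
    (kanSequence X).map (homOfLE (Nat.le_add_right β 1)) = kanStepInl (kanStage X β).toSSet :=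
  Functor.ofSequence_map_homOfLE_succ (X := fun β => (kanStage X β).toSSet)
    (fun β => kanStepInl (kanStage X β).toSSet) β

lemma kanStageMap_inl (β : ℕ) (x : (kanStage X β).toSSet.obj n) :
    (kanStageMap X (β + 1)).app n ((kanStepInl (kanStage X β).toSSet).app n x) =
      (kanStageMap X β).app n x := by
  have h := colimit.w (kanSequence X) (homOfLE (Nat.le_add_right β 1))
  rw [kanSequence_map_succ] at h
  exact ConcreteCategory.congr_hom (NatTrans.congr_app h n) x

lemma kan_isColimit (n : SimplexCategoryᵒᵖ) :
    Nonempty (IsColimit (((CategoryTheory.evaluation SimplexCategoryᵒᵖ (Type u)).obj n).mapCocone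
      (colimit.cocone (kanSequence X)))) :=
  ⟨isColimitOfPreserves _ (colimit.isColimit (kanSequence X))⟩

lemma kan_exists_stage (x : (kan X).toSSet.obj n) :
    ∃ β y, (kanStageMap X β).app n y = x :=
  Types.jointly_surjective_of_isColimit (kan_isColimit X n).some x

lemma kanSequence_map_injective {β γ : ℕ} (f : β ⟶ γ) :
    Function.Injective (((kanSequence X).map f).app n) := by
  have hle := f.le
  rw [show f = homOfLE hle from rfl]
  clear f
  induction γ, hle using Nat.le_induction with
  | base =>
    have : (kanSequence X).map (homOfLE (le_refl β)) = 𝟙 _ := (kanSequence X).map_id β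
    rw [this]
    exact fun _ _ h => h
  | succ γ h ih =>
    have : (kanSequence X).map (homOfLE (h.trans (Nat.le_add_right γ 1))) =
        (kanSequence X).map (homOfLE h) ≫ (kanSequence X).map (homOfLE (Nat.le_add_right γ 1)) :=
      (kanSequence X).map_comp (homOfLE h) (homOfLE (Nat.le_add_right γ 1))
    rw [this]
    refine Function.Injective.comp (g := ((kanSequence X).map
      (homOfLE (Nat.le_add_right γ 1))).app n) ?_ ih
    rw [kanSequence_map_succ]
    exact kanStepInl_injective _ n

lemma kanStageMap_injective (β : ℕ) (n : SimplexCategoryᵒᵖ) :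
    Function.Injective ((kanStageMap X β).app n) := fun x y h => by
  obtain ⟨γ, f, hf⟩ :=
    (Types.FilteredColimit.isColimit_eq_iff' (kan_isColimit X n).some x y).1 h
  exact kanSequence_map_injective X f hf

lemma dSmooth_kanStageMap (β : ℕ) (n : SimplexCategoryᵒᵖ) :
    DSmooth (Y := (kan X).toSSet.obj n) fun x : (kanStage X β).toSSet.obj n =>
      (kanStageMap X β).app n x :=
  dSmooth_into_finalDiffeology
    (fun (β : ℕ) (x : (kanStage X β).toSSet.obj n) => (kanStageMap X β).app n x) β

lemma kan_plot_exists {d : ℕ} {p : Euc d → (kan X).toSSet.obj n} (hp : IsPlot p) (t₀ : Euc d) :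
    ∃ (β : ℕ) (q : Euc d → (kanStage X β).toSSet.obj n), IsPlot q ∧
      p =ᶠ[𝓝 t₀] fun t => (kanStageMap X β).app n (q t) :=
  exists_lift_of_isPlot_final
    (fun (β : ℕ) (x : (kanStage X β).toSSet.obj n) => (kanStageMap X β).app n x)
    (kan_exists_stage X) hp t₀

lemma kanStage_exists_raise {β γ : ℕ} (h : β ≤ γ) (n : SimplexCategoryᵒᵖ) :
    ∃ r : (kanStage X β).toSSet.obj n → (kanStage X γ).toSSet.obj n, IsOpenInclusion r ∧
      ∀ x, (kanStageMap X γ).app n (r x) = (kanStageMap X β).app n x := by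
  induction γ, h using Nat.le_induction with
  | base => exact ⟨id, ⟨⟨fun _ _ h => h, fun x d p hp hp0 => ⟨p, hp, hp0, .rfl⟩⟩, fun _ _ h => h⟩,
      fun _ => rfl⟩
  | succ γ h ih =>
    obtain ⟨r, hr, hr'⟩ := ih
    have hi := kanStep_isOpenInclusion (kanStage X γ) n
    exact ⟨_, ⟨hi.toLocSubd.comp hr.toLocSubd, hi.injective.comp hr.injective⟩,
      fun x => (kanStageMap_inl X γ (r x)).trans (hr' x)⟩

lemma kanStageMap_isOpenInclusion (β : ℕ) (n : SimplexCategoryᵒᵖ) :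
    IsOpenInclusion (Y := (kan X).toSSet.obj n) fun x : (kanStage X β).toSSet.obj n =>
      (kanStageMap X β).app n x := by
  refine ⟨⟨dSmooth_kanStageMap X β n, fun x d p hp hp0 => ?_⟩, kanStageMap_injective X β n⟩
  obtain ⟨γ, q, hq, hpq⟩ := kan_plot_exists X hp 0
  obtain ⟨r, hr, hrβ⟩ := kanStage_exists_raise X (le_max_left β γ) n
  obtain ⟨r', hr', hrγ⟩ := kanStage_exists_raise X (le_max_right β γ) n
  obtain ⟨q', hq', hq0, h⟩ := hr.toLocSubd.lift x (fun t => r' (q t))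
    (hr'.toLocSubd.dSmooth _ _ hq) (kanStageMap_injective X _ n
      ((hrγ _).trans (hpq.self_of_nhds.symm.trans (hp0.trans (hrβ x).symm))))
  refine ⟨q', hq', hq0, ?_⟩
  filter_upwards [h, hpq] with t h1 h2
  rw [h2, ← hrγ]
  exact (hrβ _).symm.trans (congrArg _ h1)

end

/-! ### Low-dimensional simplices of the Kan replacement -/

/-- The horn `Λ[2,1]`. -/
def innerHorn : HornIndex := ⟨2, 1, Or.inr ⟨rfl, rfl⟩⟩

lemma vertex_mem_horn (a : HornIndex) (s : (Δ[a.k] : SSet.{u}) _⦋0⦌) :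
    s ∈ (Λ[a.k, a.j] : SSet.Subcomplex.{u} _).obj (op ⦋0⦌) := by
  rw [SSet.mem_horn_iff_notMem_range]
  obtain ⟨i, hi⟩ : ∃ i : Fin (a.k + 1), i ∉ ({s 0, a.j} : Finset (Fin (a.k + 1))) := by
    by_contra! h
    have h1 := Finset.card_le_card (fun i _ => h i : Finset.univ ⊆ _)
    have h2 : ({s 0, a.j} : Finset (Fin (a.k + 1))).card ≤ 2 := Finset.card_le_two
    have h3 := a.mem
    simp only [Finset.card_univ, Fintype.card_fin] at h1
    omega
  simp only [Finset.mem_insert, Finset.mem_singleton, not_or] at hi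
  refine ⟨i, hi.2, ?_⟩
  rintro ⟨t, rfl⟩
  exact hi.1 (congrArg s (Subsingleton.elim (α := Fin 1) _ _))

lemma not_mem_innerHorn_iff {d : ℕ} (s : (Δ[2] : SSet.{u}) _⦋d⦌) :
    s ∉ (Λ[2, 1] : SSet.Subcomplex.{u} _).obj (op ⦋d⦌) ↔
      0 ∈ Set.range s ∧ 2 ∈ Set.range s := by
  rw [SSet.mem_horn_iff_notMem_range]
  push Not
  refine ⟨fun h => ⟨h 0 (by decide), h 2 (by decide)⟩, fun h i hi => ?_⟩
  have : i = 0 ∨ i = 2 := by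
    revert hi
    revert i
    decide
  rcases this with rfl | rfl
  exacts [h.1, h.2]

/-- The only edge which is added in a step of the Kan replacement is the composite of the edges
of an inner horn. -/
lemma edge_eq_of_not_mem (a : HornIndex) (s : (Δ[a.k] : SSet.{u}) _⦋1⦌)
    (hs : s ∉ (Λ[a.k, a.j] : SSet.Subcomplex.{u} _).obj (op ⦋1⦌)) :
    (⟨a, s⟩ : Σ a : HornIndex, (Δ[a.k] : SSet.{u}) _⦋1⦌) =
      ⟨innerHorn, SSet.stdSimplex.edge 2 0 2 (by decide)⟩ := by
  obtain ⟨k, j, ha⟩ := a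
  rcases ha with hk | ⟨hk, hj⟩
  · exact absurd (edge_mem_horn hk j s) hs
  · change k = 2 at hk
    subst hk
    obtain rfl : j = 1 := Fin.ext hj
    obtain ⟨⟨t, ht⟩, ⟨t', ht'⟩⟩ := (not_mem_innerHorn_iff s).1 hs
    refine congrArg (Sigma.mk innerHorn) (SSet.stdSimplex.ext _ _ fun r => ?_)
    have hm : s 0 ≤ s 1 := (SSet.stdSimplex.asOrderHom s).monotone (Fin.zero_le _)
    have h01 : s 0 = 0 ∧ s 1 = 2 := by
      have h1 := (by decide : ∀ t : Fin 2, t = 0 ∨ t = 1) t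
      have h2 := (by decide : ∀ t : Fin 2, t = 0 ∨ t = 1) t'
      have key : ∀ x y : Fin 3, x ≤ y → (x = 0 ∨ y = 0) → (x = 2 ∨ y = 2) → x = 0 ∧ y = 2 := by
        decide
      refine key _ _ hm ?_ ?_
      · rcases h1 with rfl | rfl
        exacts [.inl ht, .inr ht]
      · rcases h2 with rfl | rfl
        exacts [.inl ht', .inr ht']
    rcases (by decide : ∀ t : Fin 2, t = 0 ∨ t = 1) r with rfl | rfl
    exacts [h01.1, h01.2]

lemma composite_not_mem : (SSet.stdSimplex.edge 2 0 2 (by decide) : (Δ[2] : SSet.{u}) _⦋1⦌) ∉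
    (Λ[2, 1] : SSet.Subcomplex.{u} _).obj (op ⦋1⦌) :=
  (not_mem_innerHorn_iff _).2 ⟨⟨0, rfl⟩, ⟨1, rfl⟩⟩

section

variable (X : SimplicialDiff.{u})

lemma kanStageMap_vertex_surjective (β : ℕ) :
    Function.Surjective ((kanStageMap X β).app (op ⦋0⦌)) := by
  intro x
  obtain ⟨γ, y, rfl⟩ := kan_exists_stage X x
  suffices h : ∃ y', (kanStageMap X 0).app (op ⦋0⦌) y' = (kanStageMap X γ).app (op ⦋0⦌) y by
    obtain ⟨y', hy'⟩ := h
    obtain ⟨r, -, hr⟩ := kanStage_exists_raise X (Nat.zero_le β) (op ⦋0⦌)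
    exact ⟨r y', (hr y').trans hy'⟩
  induction γ with
  | zero => exact ⟨y, rfl⟩
  | succ γ ih =>
    rcases kanStep_cases y with ⟨x, rfl⟩ | ⟨c, hc, -⟩
    · obtain ⟨y', hy'⟩ := ih x
      exact ⟨y', hy'.trans (kanStageMap_inl X γ x).symm⟩
    · exact absurd (vertex_mem_horn c.1 c.2.1) hc

lemma kanStageMap_vertex_isDiffeomorphism (β : ℕ) :
    IsDiffeomorphism (Y := (kan X).toSSet _⦋0⦌) fun x : (kanStage X β).toSSet _⦋0⦌ =>
      (kanStageMap X β).app (op ⦋0⦌) x :=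
  (kanStageMap_isOpenInclusion X β _).toLocSubd.isDiffeomorphism
    ⟨kanStageMap_injective X β _, kanStageMap_vertex_surjective X β⟩

end

/-! ### Retracting the Kan replacement -/

section

variable {X W : SSet.{u}}

/-- A map to a simplicial set with fillers extends to the next step of the Kan replacement. -/
lemma exists_kanStep_extension
    (hW : ∀ (a : HornIndex) (h : (Λ[a.k, a.j] : SSet.{u}) ⟶ W), ∃ g : Δ[a.k] ⟶ W,
      Λ[a.k, a.j].ι ≫ g = h) (g : X ⟶ W) :
    ∃ g' : kanStepSSet X ⟶ W, kanStepInl X ≫ g' = g := by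
  choose F hF using hW
  let k : simplexCells X ⟶ W :=
    { app := fun n => TypeCat.ofHom fun c => (F c.1 (c.2.2 ≫ g)).app n c.2.1
      naturality := fun m n f => by
        ext ⟨a, s, h⟩
        exact NatTrans.naturality_apply (F a (h ≫ g)) f s }
  refine ⟨pushout.desc g k ?_, pushout.inl_desc _ _ _⟩
  ext n ⟨a, s, h⟩
  exact (congrArg (fun q : (Λ[a.k, a.j] : SSet.{u}) ⟶ W => q.app n s) (hF a (h ≫ g))).symm

end

/-- If the horns that occur in the Kan replacement of `W` can be filled in `W`, then `W` is a
retract of it as a simplicial set; the retraction need not be smooth. -/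
lemma exists_kan_retraction {W : SimplicialDiff.{u}}
    (hW : ∀ (a : HornIndex) (h : (Λ[a.k, a.j] : SSet.{u}) ⟶ W.toSSet),
      ∃ g : Δ[a.k] ⟶ W.toSSet, Λ[a.k, a.j].ι ≫ g = h) :
    ∃ ρ : (kan W).toSSet ⟶ W.toSSet, kanStageMap W 0 ≫ ρ = 𝟙 W.toSSet := by
  choose ext hext using fun (X : SSet.{u}) => exists_kanStep_extension (X := X) hW
  let g : ∀ β, (kanStage W β).toSSet ⟶ W.toSSet := fun β =>
    Nat.rec (𝟙 W.toSSet) (fun β g => ext (kanStage W β).toSSet g) β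
  have hg : ∀ β, (kanSequence W).map (homOfLE (Nat.le_add_right β 1)) ≫ g (β + 1) = g β :=
    fun β => (congrArg (· ≫ g (β + 1)) (kanSequence_map_succ W β)).trans (hext _ (g β))
  let c : Cocone (kanSequence W) := ⟨W.toSSet, NatTrans.ofSequence g fun β =>
    (hg β).trans (Category.comp_id _).symm⟩
  exact ⟨colimit.desc (kanSequence W) c, colimit.ι_desc c 0⟩

/-! ### Filling horns of the Kan replacement smoothly -/

section

variable {X : SimplicialDiff.{u}} {M : Type w} {M' : Type z} [DiffeologicalSpace M]
  [DiffeologicalSpace M'] {n m : SimplexCategoryᵒᵖ}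

/-- A family of simplices of the Kan replacement that is a smooth family in one of the stages. -/
def StageSmooth (c : M → (kan X).toSSet.obj n) : Prop :=
  ∃ (β : ℕ) (q : M → (kanStage X β).toSSet.obj n), DSmooth q ∧
    ∀ x, c x = (kanStageMap X β).app n (q x)

lemma StageSmooth.dSmooth {c : M → (kan X).toSSet.obj n} (hc : StageSmooth c) : DSmooth c := by
  obtain ⟨β, q, hq, h⟩ := hc
  rw [funext h]
  exact (dSmooth_kanStageMap X β n).comp hq

lemma StageSmooth.comp {c : M → (kan X).toSSet.obj n} (hc : StageSmooth c) {g : M' → M}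
    (hg : DSmooth g) : StageSmooth fun x => c (g x) := by
  obtain ⟨β, q, hq, h⟩ := hc
  exact ⟨β, _, hq.comp hg, fun x => h (g x)⟩

lemma StageSmooth.map {c : M → (kan X).toSSet.obj n} (hc : StageSmooth c) (f : n ⟶ m) :
    StageSmooth fun x => (kan X).toSSet.map f (c x) := by
  obtain ⟨β, q, hq, h⟩ := hc
  refine ⟨β, _, ((kanStage X β).smooth_map f).comp hq, fun x => ?_⟩
  refine (congrArg _ (h x)).trans ?_
  exact (NatTrans.naturality_apply (kanStageMap X β) f (q x)).symm

lemma exists_common_stage {ι : Type*} [Finite ι] {c : ι → M → (kan X).toSSet.obj n}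
    (hc : ∀ i, StageSmooth (c i)) : ∃ (β : ℕ) (q : ι → M → (kanStage X β).toSSet.obj n),
      (∀ i, DSmooth (q i)) ∧ ∀ i x, c i x = (kanStageMap X β).app n (q i x) := by
  have := Fintype.ofFinite ι
  choose β q hq h using hc
  choose r hr hr' using fun i =>
    kanStage_exists_raise X (Finset.le_sup (f := β) (Finset.mem_univ i)) n
  refine ⟨Finset.univ.sup β, fun i x => r i (q i x), fun i => (hr i).toLocSubd.dSmooth.comp (hq i),
    fun i x => ?_⟩
  rw [h, hr']

end

/-- The new simplex that fills a horn. -/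
noncomputable def kanStepCell (X : SSet.{u}) (a : HornIndex) (h : (Λ[a.k, a.j] : SSet.{u}) ⟶ X) :
    kanStepSSet X _⦋a.k⦌ :=
  (kanStepInr X).app _ ⟨a, SSet.stdSimplex.objEquiv.symm (𝟙 _), h⟩

lemma kanStepInr_eq_map (X : SSet.{u}) (a : HornIndex) (h : (Λ[a.k, a.j] : SSet.{u}) ⟶ X)
    {n : SimplexCategory} (s : (Δ[a.k] : SSet.{u}).obj (op n)) :
    (kanStepInr X).app _ ⟨a, s, h⟩ =
      (kanStepSSet X).map (SSet.stdSimplex.objEquiv s).op (kanStepCell X a h) := by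
  refine Eq.trans ?_ (NatTrans.naturality_apply (kanStepInr X) (SSet.stdSimplex.objEquiv s).op
    (⟨a, SSet.stdSimplex.objEquiv.symm (𝟙 _), h⟩ : (simplexCells X).obj (op ⦋a.k⦌)))
  refine congrArg _ (congrArg (Sigma.mk a) (Prod.ext ?_ rfl))
  refine (SSet.stdSimplex.objEquiv.symm_apply_apply s).symm.trans ?_
  exact congrArg _ (Category.comp_id _).symm

lemma δ_kanStepCell (X : SSet.{u}) (k : ℕ) (j : Fin (k + 2)) (ha)
    (h : (Λ[k + 1, j] : SSet.{u}) ⟶ X) (i : Fin (k + 2)) (hi : i ≠ j) :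
    (kanStepSSet X).δ i (kanStepCell X ⟨k + 1, j, ha⟩ h) =
      (kanStepInl X).app _ (hornFace h i hi) := by
  refine (NatTrans.naturality_apply (kanStepInr X) (SimplexCategory.δ i).op _).symm.trans ?_
  exact kanStep_inr_of_mem ⟨k + 1, j, ha⟩ _ h (SSet.horn.face j i hi).2

section

variable {X : SimplicialDiff.{u}} {M : Type w} [DiffeologicalSpace M]

/-- Smooth families of horns of dimension at least 3 in a stage are filled in the next one. -/
lemma exists_stageSmooth_filler {n : ℕ} (j : Fin (n + 4))
    {x : Fin (n + 4) → M → (kan X).toSSet _⦋n + 2⦌} (hx : ∀ i, StageSmooth (x i))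
    (hc : ∀ t, ∀ i k : Fin (n + 3), i ≤ k → i.castSucc ≠ j → k.succ ≠ j →
      (kan X).toSSet.δ i (x k.succ t) = (kan X).toSSet.δ k (x i.castSucc t)) :
    ∃ z : M → (kan X).toSSet _⦋n + 3⦌, StageSmooth z ∧
      ∀ t i, i ≠ j → (kan X).toSSet.δ i (z t) = x i t := by
  obtain ⟨β, q, hq, hqx⟩ := exists_common_stage hx
  have hδ : ∀ (i) (y : (kanStage X β).toSSet _⦋n + 2⦌),
      (kan X).toSSet.δ i ((kanStageMap X β).app _ y) =
        (kanStageMap X β).app _ ((kanStage X β).toSSet.δ i y) := fun i y =>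
    (NatTrans.naturality_apply (kanStageMap X β) (SimplexCategory.δ i).op y).symm
  choose f hf using fun t => exists_horn (X := (kanStage X β).toSSet) (j := j) (fun i => q i t)
    fun i k hik hi hk => kanStageMap_injective X β _ <| by
      rw [← hδ, ← hδ, ← hqx, ← hqx, hc t i k hik hi hk]
  have hfs : DSmooth f := fun d p hp => (isPlot_horn_iff _).2 fun i hi => by
    simp only [Function.comp_apply, hf]
    exact hq i _ p hp
  refine ⟨fun t => (kanStageMap X (β + 1)).app _
    (kanStepCell _ ⟨n + 3, j, .inl (Nat.le_add_left 3 n)⟩ (f t)), ⟨β + 1, _,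
    (dSmooth_kanStepInr (kanStage X β) _ ⟨n + 3, j, .inl (Nat.le_add_left 3 n)⟩ _).comp hfs,
    fun _ => rfl⟩, fun t i hi => ?_⟩
  refine (NatTrans.naturality_apply (kanStageMap X (β + 1)) (SimplexCategory.δ i).op _).symm.trans
    ((congrArg _ (δ_kanStepCell _ (n + 2) j _ (f t) i hi)).trans ((kanStageMap_inl X β _).trans ?_))
  rw [hf, ← hqx]

/-- Near the origin, a plot of horns of the Kan replacement lives in a single stage. -/
lemma kan_hasPlotFillers (X : SimplicialDiff.{u}) (n : ℕ) (j : Fin (n + 1 + 3)) :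
    HasPlotFillers (kan X) (n + 1) j := by
  intro d x hx hc
  choose β q hq hxq using fun i => kan_plot_exists X (hx i) 0
  obtain ⟨ρ, hρ, hρ0, hρs⟩ := exists_squash (Filter.eventually_all.2 hxq)
  obtain ⟨z, hz, hzx⟩ := exists_stageSmooth_filler j (x := fun i t => x i (ρ t))
    (fun i => ⟨β i, fun t => q i (ρ t), (isPlot_reparam (hq i) hρ).dSmooth, fun t => hρs t i⟩)
    fun t => hc (ρ t)
  refine ⟨z, hz.dSmooth.isPlot, ?_⟩
  filter_upwards [hρ0] with t ht i hi
  rw [hzx _ i hi]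
  exact congrArg (x i) ht

end

/-! ### Disjoint unions -/

section

variable {A Y Z : Type u} {ι : Type v} {B : ι → Type u} [DiffeologicalSpace A]
  [DiffeologicalSpace Y] [DiffeologicalSpace Z] [∀ i, DiffeologicalSpace (B i)] {f : A → Y}
  {g : ∀ i, B i → Y}

/-- A countable disjoint union of manifolds. -/
lemma isSmoothManifold_of_openInclusions [Countable ι] (hf : IsOpenInclusion f)
    (hg : ∀ i, IsOpenInclusion (g i)) (hs : ∀ y, (∃ a, f a = y) ∨ ∃ i b, g i b = y)
    (hfg : ∀ a i b, f a ≠ g i b) (hgg : ∀ i j b b', g i b = g j b' → i = j)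
    (hA : IsSmoothManifold A) (hB : ∀ i, IsSmoothManifold (B i)) : IsSmoothManifold Y := by
  let S : Option ι → Σ T : Type u, DiffeologicalSpace T := fun o =>
    o.elim ⟨A, inferInstance⟩ fun i => ⟨B i, inferInstance⟩
  let : ∀ o, DiffeologicalSpace (S o).1 := fun o => (S o).2
  let F : ∀ o, (S o).1 → Y := fun o => match o with
    | none => f
    | some i => g i
  have hF : ∀ o, IsOpenInclusion (F o) := fun o => match o with
    | none => hf
    | some i => hg i
  have hS : ∀ o, IsSmoothManifold (S o).1 := fun o => match o with
    | none => hA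
    | some i => hB i
  have hsurj : ∀ y, ∃ o a, F o a = y := fun y => by
    rcases hs y with ⟨a, h⟩ | ⟨i, b, h⟩
    exacts [⟨none, a, h⟩, ⟨some i, b, h⟩]
  refine ⟨t2_of_openInclusions F hF (fun o => (hS o).t2) fun y y' => ?_,
    secondCountable_of_openInclusions F hF hsurj fun o => (hS o).secondCountable,
    hasCharts_of_openInclusions F hF hsurj fun o => (hS o).hasCharts⟩
  obtain ⟨o, a, ha⟩ := hsurj y
  obtain ⟨o', a', ha'⟩ := hsurj y'
  refine ⟨o, o', a, a', ha, ha', or_iff_not_imp_left.2 fun hne => Set.disjoint_left.2 ?_⟩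
  rintro _ ⟨c, rfl⟩ ⟨c', hc'⟩
  match o, o', c, c' with
  | none, none, _, _ => exact hne rfl
  | none, some i, c, c' => exact hfg c i c' hc'.symm
  | some i, none, c, c' => exact hfg c' i c hc'
  | some i, some j, c, c' => exact hne (congrArg some (hgg i j c c' hc'.symm))

/-- The inclusions of a disjoint union are open. -/
lemma isOpenInclusion_of_sup (hd : ∀ {d : ℕ} {p : Euc d → Y}, IsPlot p →
      (∃ q : Euc d → A, IsPlot q ∧ p =ᶠ[𝓝 0] fun t => f (q t)) ∨
        ∃ i, ∃ q : Euc d → B i, IsPlot q ∧ p =ᶠ[𝓝 0] fun t => g i (q t))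
    (hf : DSmooth f) (hg : ∀ i, DSmooth (g i)) (hfi : Function.Injective f)
    (hfg : ∀ a i b, f a ≠ g i b)
    (hgg : ∀ i j b b', g i b = g j b' → (⟨i, b⟩ : Σ i, B i) = ⟨j, b'⟩) :
    IsOpenInclusion f ∧ ∀ i, IsOpenInclusion (g i) := by
  refine ⟨⟨⟨hf, fun x d p hp hp0 => ?_⟩, hfi⟩, fun i => ⟨⟨hg i, fun x d p hp hp0 => ?_⟩,
    fun b b' h => eq_of_heq (Sigma.mk.inj (hgg i i b b' h)).2⟩⟩
  · rcases hd hp with ⟨q, hq, h⟩ | ⟨i, q, hq, h⟩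
    · exact ⟨q, hq, hfi (h.self_of_nhds.symm.trans hp0), h.symm⟩
    · exact absurd (hp0.symm.trans h.self_of_nhds) (hfg _ _ _)
  · rcases hd hp with ⟨q, hq, h⟩ | ⟨j, q, hq, h⟩
    · exact absurd (h.self_of_nhds.symm.trans hp0) (hfg _ _ _)
    · have := hgg _ _ _ _ (h.self_of_nhds.symm.trans hp0)
      obtain rfl : j = i := congrArg Sigma.fst this
      exact ⟨q, hq, eq_of_heq (Sigma.mk.inj this).2, h.symm⟩

lemma locSubd_of_cover {F : Y → Z} (hF : DSmooth F) (hf : DSmooth f) (hg : ∀ i, DSmooth (g i))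
    (hs : ∀ y, (∃ a, f a = y) ∨ ∃ i b, g i b = y) (h1 : LocSubd fun a => F (f a))
    (h2 : ∀ i, LocSubd fun b => F (g i b)) : LocSubd F := by
  refine ⟨hF, fun y d p hp hp0 => ?_⟩
  rcases hs y with ⟨a, rfl⟩ | ⟨i, b, rfl⟩
  · obtain ⟨q, hq, hq0, h⟩ := h1.lift a p hp hp0
    exact ⟨_, hf _ _ hq, congrArg f hq0, h⟩
  · obtain ⟨q, hq, hq0, h⟩ := (h2 i).lift b p hp hp0
    exact ⟨_, hg i _ _ hq, congrArg (g i) hq0, h⟩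

end

/-- Smooth families of horns have smooth fillers starting with a given one. -/
lemma exists_plot_filler_at {X : SimplicialDiff.{u}} {n : ℕ} {j : Fin (n + 3)}
    (h : LocSubd (hornRestriction X (n + 2) j)) {d : ℕ}
    {x : Fin (n + 3) → Euc d → X.toSSet _⦋n + 1⦌} (hx : ∀ i, IsPlot (x i))
    (hc : ∀ᶠ t in 𝓝 0, ∀ i k : Fin (n + 2), i ≤ k → i.castSucc ≠ j → k.succ ≠ j →
      X.toSSet.δ i (x k.succ t) = X.toSSet.δ k (x i.castSucc t)) (w : X.toSSet _⦋n + 2⦌)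
    (hw : ∀ i, i ≠ j → X.toSSet.δ i w = x i 0) :
    ∃ z : Euc d → X.toSSet _⦋n + 2⦌, IsPlot z ∧ z 0 = w ∧
      ∀ᶠ t in 𝓝 0, ∀ i, i ≠ j → X.toSSet.δ i (z t) = x i t := by
  obtain ⟨ρ, hρ, hρ0, hρs⟩ := exists_squash hc
  have hρz : ρ 0 = 0 := hρ0.self_of_nhds
  choose f hf using fun t => exists_horn (fun i => x i (ρ t)) (hρs t)
  have hfp : IsPlot f := (isPlot_horn_iff f).2 fun i hi => by
    have : (fun t => hornFace (f t) i hi) = fun t => x i (ρ t) := funext fun t => hf t i hi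
    rw [this]
    exact isPlot_reparam (hx i) hρ
  obtain ⟨q, hq, hq0, hqf⟩ := h.lift (SSet.yonedaEquiv.symm w) f hfp <| horn_hom_ext fun i hi => by
    rw [hf, hornRestriction, hornFace_ι_comp, Equiv.apply_symm_apply, hw i hi, hρz]
  refine ⟨fun t => SSet.yonedaEquiv (q t), dSmooth_eval X _ _ q hq,
    (congrArg _ hq0).trans (Equiv.apply_symm_apply _ _), ?_⟩
  filter_upwards [hqf, hρ0] with t ht ht' i hi
  have := hf t i hi
  rw [ht'] at this
  rw [id_eq] at this
  rw [← this, ← ht]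
  exact (hornFace_ι_comp (q t) i hi).symm

/-! ### Filled edges -/

lemma horn_edge_zero_one : (SSet.horn.edge 2 1 0 1 (by decide) (by decide) :
    (Λ[2, 1] : SSet.{u}) _⦋1⦌) = SSet.horn.face 1 2 (by decide) := by
  refine Subtype.ext (SSet.stdSimplex.ext _ _ fun t => ?_)
  rcases (by decide : ∀ t : Fin 2, t = 0 ∨ t = 1) t with rfl | rfl <;> rfl

lemma horn_edge_one_two : (SSet.horn.edge 2 1 1 2 (by decide) (by decide) :
    (Λ[2, 1] : SSet.{u}) _⦋1⦌) = SSet.horn.face 1 0 (by decide) := by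
  refine Subtype.ext (SSet.stdSimplex.ext _ _ fun t => ?_)
  rcases (by decide : ∀ t : Fin 2, t = 0 ∨ t = 1) t with rfl | rfl <;> rfl

namespace Filling

variable {X W : SimplicialDiff.{u}} {S : EdgeSpan X W}

lemma face_two (p : Filling S) : hornFace p.1.2.2 2 (by decide) = S.left p.1.1.1 := by
  rw [hornFace, ← horn_edge_zero_one]
  exact p.2.2.2.1

lemma face_zero (p : Filling S) : hornFace p.1.2.2 0 (by decide) = S.left p.1.1.2 := by
  rw [hornFace, ← horn_edge_one_two]
  exact p.2.2.2.2

lemma inner_horn_ext {h h' : (Λ[2, 1] : SSet.{u}) ⟶ X.toSSet}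
    (h2 : hornFace h 2 (by decide) = hornFace h' 2 (by decide))
    (h0 : hornFace h 0 (by decide) = hornFace h' 0 (by decide)) : h = h' :=
  horn_hom_ext fun i hi => by
    have : i = 0 ∨ i = 2 := by
      revert hi
      revert i
      decide
    rcases this with rfl | rfl
    exacts [h0, h2]

lemma ext {p p' : Filling S} (ha : p.1.1.1 = p'.1.1.1) (hb : p.1.1.2 = p'.1.1.2)
    (hw : p.1.2.1 = p'.1.2.1) : p = p' :=
  Subtype.ext (Prod.ext (Prod.ext ha hb) (Prod.ext hw (inner_horn_ext
    (by rw [face_two, face_two, ha]) (by rw [face_zero, face_zero, hb]))))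

lemma left_eq (p : Filling S) :
    p.left = (kanStepSSet X.toSSet).δ 1 (kanStepCell X.toSSet innerHorn p.1.2.2) := by
  have hs : (SSet.stdSimplex.edge 2 0 2 (by decide) : (Δ[2] : SSet.{u}) _⦋1⦌) =
      (Δ[2] : SSet.{u}).map (SimplexCategory.δ 1).op (SSet.stdSimplex.objEquiv.symm (𝟙 _)) := by
    refine SSet.stdSimplex.ext _ _ fun t => ?_
    rcases (by decide : ∀ t : Fin 2, t = 0 ∨ t = 1) t with rfl | rfl <;> rfl
  refine Eq.trans ?_ (NatTrans.naturality_apply (kanStepInr X.toSSet) (SimplexCategory.δ 1).op _)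
  exact congrArg (fun s => (kanStepInr X.toSSet).app (op ⦋1⦌) ⟨innerHorn, s, p.1.2.2⟩) hs

lemma isPlot_iff (hl : DSmooth S.left) {d : ℕ} (p : Euc d → Filling S) :
    IsPlot p ↔ IsPlot (fun t => (p t).1.1.1) ∧ IsPlot (fun t => (p t).1.1.2) ∧
      IsPlot fun t => (p t).1.2.1 := by
  refine ⟨fun h => ?_, fun ⟨ha, hb, hw⟩ => ?_⟩
  · have h' := DiffeologicalSpace.isPlot_inf_iff.1 h
    have h1 := DiffeologicalSpace.isPlot_inf_iff.1 h'.1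
    exact ⟨h1.1 (), h1.2 (), (DiffeologicalSpace.isPlot_inf_iff.1 h'.2).1 ()⟩
  refine DiffeologicalSpace.isPlot_inf_iff.2 ⟨DiffeologicalSpace.isPlot_inf_iff.2
    ⟨fun _ => ha, fun _ => hb⟩, DiffeologicalSpace.isPlot_inf_iff.2 ⟨fun _ => hw, fun _ => ?_⟩⟩
  refine (isPlot_horn_iff _).2 fun i hi => ?_
  have : i = 0 ∨ i = 2 := by
    revert hi
    revert i
    decide
  rcases this with rfl | rfl
  · simp only [face_zero]
    exact hl _ _ hb
  · simp only [face_two]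
    exact hl _ _ ha

end Filling

/-- The properties of the stages of the space of filled edges. -/
structure IsGoodSpan {W : SimplicialDiff.{u}} (β : ℕ) (S : EdgeSpan (kanStage W β) W) : Prop where
  isSmoothManifold : IsSmoothManifold S.carrier
  locSubd_left : LocSubd S.left
  surjective_left : Function.Surjective S.left
  locSubd_right : LocSubd S.right
  surjective_right : Function.Surjective S.right
  ends : ∀ s i, (kan W).toSSet.δ i ((kanStageMap W β).app _ (S.left s)) =
    (kanStageMap W 0).app _ (W.toSSet.δ i (S.right s))

namespace IsGoodSpan

variable {W : SimplicialDiff.{u}} {β : ℕ} {S : EdgeSpan (kanStage W β) W}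

section

variable (hS : IsGoodSpan β S)

include hS

lemma exists_filling {a b : S.carrier} {w : W.toSSet _⦋2⦌} (ha : S.right a = W.toSSet.δ 2 w)
    (hb : S.right b = W.toSSet.δ 0 w) :
    ∃ p : Filling S, p.1.1.1 = a ∧ p.1.1.2 = b ∧ p.1.2.1 = w := by
  have hδ : ∀ (i) (y : (kanStage W β).toSSet _⦋1⦌),
      (kan W).toSSet.δ i ((kanStageMap W β).app _ y) =
        (kanStageMap W β).app _ ((kanStage W β).toSSet.δ i y) := fun i y =>
    (NatTrans.naturality_apply (kanStageMap W β) (SimplexCategory.δ i).op y).symm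
  obtain ⟨h, hh⟩ := exists_horn (X := (kanStage W β).toSSet) (n := 0) (j := 1)
    (fun i => if i = 2 then S.left a else S.left b) fun i k hik hi hk => by
      obtain ⟨rfl, rfl⟩ : i = 0 ∧ k = 1 := by
        revert i k
        decide
      refine kanStageMap_injective W β _ ?_
      rw [← hδ, ← hδ]
      refine (hS.ends a 0).trans (Eq.trans ?_ (hS.ends b 1).symm)
      rw [ha, hb, (δ_comp_δ_two w).2.1]
  refine ⟨⟨((a, b), w, h), ha, hb, ?_, ?_⟩, rfl, rfl, rfl⟩
  · exact (congrArg _ horn_edge_zero_one).trans (hh 2 (by decide))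
  · exact (congrArg _ horn_edge_one_two).trans (hh 0 (by decide))

lemma isFibreProduct_filling :
    IsFibreProduct (fun p : Filling S => p.1.2.1)
      (fun (i : Bool) (p : Filling S) => cond i p.1.1.1 p.1.1.2)
      (fun i w => cond i (W.toSSet.δ 2 w) (W.toSSet.δ 0 w)) (fun _ => S.right) where
  isPlot_iff p := (Filling.isPlot_iff hS.locSubd_left.dSmooth p).trans
    ⟨fun ⟨ha, hb, hw⟩ => ⟨hw, fun i => match i with
      | true => ha
      | false => hb⟩, fun ⟨hw, h⟩ => ⟨h true, h false, hw⟩⟩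
  comm p i := match i with
    | true => p.2.1
    | false => p.2.2.1
  exists_mk w x hx := by
    obtain ⟨p, hp1, hp2, hp3⟩ := hS.exists_filling (hx true) (hx false)
    exact ⟨p, hp3, fun i => match i with
      | true => hp1
      | false => hp2⟩
  ext p p' hw h := Filling.ext (h true) (h false) hw

lemma dSmooth_triangle : DSmooth fun p : Filling S => p.1.2.1 :=
  fun _ p hp => ((Filling.isPlot_iff hS.locSubd_left.dSmooth p).1 hp).2.2

lemma isSmoothManifold_filling (hW : IsLieGroupoid 2 W) : IsSmoothManifold (Filling S) :=
  hS.isFibreProduct_filling.isSmoothManifold (hW.isSmoothManifold 2)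
    (fun _ => hS.isSmoothManifold) (fun i => match i with
      | true => W.smooth_map _
      | false => W.smooth_map _)
    fun _ => hS.locSubd_right.isSubmersion hS.isSmoothManifold.hasCharts
      (hW.isSmoothManifold 1).hasCharts

/-- Paths of triangles and of elements of `S` over their edges can be combined. -/
lemma exists_plot_filling {d : ℕ} {a b : Euc d → S.carrier} {w : Euc d → W.toSSet _⦋2⦌}
    (ha : IsPlot a) (hb : IsPlot b) (hw : IsPlot w)
    (h : ∀ᶠ t in 𝓝 0, S.right (a t) = W.toSSet.δ 2 (w t) ∧ S.right (b t) = W.toSSet.δ 0 (w t))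
    {p₀ : Filling S} (ha0 : a 0 = p₀.1.1.1) (hb0 : b 0 = p₀.1.1.2) (hw0 : w 0 = p₀.1.2.1) :
    ∃ p : Euc d → Filling S, IsPlot p ∧ p 0 = p₀ ∧ ∀ᶠ t in 𝓝 0, (p t).1.1.1 = a t ∧
      (p t).1.1.2 = b t ∧ (p t).1.2.1 = w t := by
  obtain ⟨ρ, hρ, hρ0, hρs⟩ := exists_squash h
  have hρz : ρ 0 = 0 := hρ0.self_of_nhds
  choose p h1 h2 h3 using fun t => hS.exists_filling (hρs t).1 (hρs t).2
  refine ⟨p, (Filling.isPlot_iff hS.locSubd_left.dSmooth p).2 ?_, Filling.ext ?_ ?_ ?_, ?_⟩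
  · simp only [h1, h2, h3]
    exact ⟨isPlot_reparam ha hρ, isPlot_reparam hb hρ, isPlot_reparam hw hρ⟩
  · rw [h1, hρz, ha0]
  · rw [h2, hρz, hb0]
  · rw [h3, hρz, hw0]
  · filter_upwards [hρ0] with t ht
    rw [h1, h2, h3, ht]
    exact ⟨rfl, rfl, rfl⟩

/-- Given a path of edges starting at `d₁` of the triangle of a filling, the zeroth face is moved
along, a horn with missing face 2 is filled by a path of triangles, and the two elements of `S`
follow the remaining faces of the triangles. -/
lemma locSubd_filling_right (hW : IsLieGroupoid 2 W) :
    LocSubd (Filling.right : Filling S → W.toSSet _⦋1⦌) := by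
  refine ⟨(W.smooth_map _).comp hS.dSmooth_triangle, fun p₀ d c hc hc0 => ?_⟩
  obtain ⟨g, hg, hg0, hgc⟩ := (locSubd_δ (fun j => (hW.kan 1 le_rfl j).2.locSubd) 0).lift
    (W.toSSet.δ 0 p₀.1.2.1) (fun t => W.toSSet.δ 0 (c t)) (W.smooth_map _ _ _ hc)
    (by rw [hc0]; exact (δ_comp_δ_two _).1)
  obtain ⟨w, hw, hw0, hwc⟩ := exists_plot_filler_at (X := W) (n := 0) (j := 2)
    (hW.kan 2 (by decide) 2).2.locSubd (x := fun i => if i = 0 then g else c)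
    (fun i => by
      split_ifs
      exacts [hg, hc])
    (hgc.mono fun t ht i k hik hi hk => by
      obtain ⟨rfl, rfl⟩ : i = 0 ∧ k = 0 := by
        revert i k
        decide
      exact ht.symm) p₀.1.2.1 fun i hi => by
        have : i = 0 ∨ i = 1 := by
          revert hi
          revert i
          decide
        rcases this with rfl | rfl
        exacts [hg0.symm, hc0.symm]
  obtain ⟨a, ha, ha0, haw⟩ := hS.locSubd_right.lift p₀.1.1.1 (fun t => W.toSSet.δ 2 (w t))
    (W.smooth_map _ _ _ hw) (by rw [hw0]; exact p₀.2.1.symm)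
  obtain ⟨b, hb, hb0, hbw⟩ := hS.locSubd_right.lift p₀.1.1.2 (fun t => W.toSSet.δ 0 (w t))
    (W.smooth_map _ _ _ hw) (by rw [hw0]; exact p₀.2.2.1.symm)
  obtain ⟨p, hp, hp0, h⟩ := hS.exists_plot_filling ha hb hw (haw.and hbw) ha0 hb0 hw0
  refine ⟨p, hp, hp0, ?_⟩
  filter_upwards [h, hwc] with t h1 h2
  change W.toSSet.δ 1 (p t).1.2.1 = c t
  rw [h1.2.2]
  exact h2 1 (by decide)

/-- The ends of the edges of `S` and of their right images agree. -/
lemma right_compat {h : (Λ[2, 1] : SSet.{u}) ⟶ (kanStage W β).toSSet} {a b : S.carrier}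
    (ha : S.left a = hornFace h 2 (by decide)) (hb : S.left b = hornFace h 0 (by decide)) :
    W.toSSet.δ 0 (S.right a) = W.toSSet.δ 1 (S.right b) := by
  refine kanStageMap_injective W 0 _ ((hS.ends a 0).symm.trans (Eq.trans ?_ (hS.ends b 1)))
  rw [ha, hb]
  have h' := hornFace_compat (X := (kanStage W β).toSSet) (n := 0) (j := 1) h 0 1 (by decide)
    (by decide) (by decide)
  exact (NatTrans.naturality_apply (kanStageMap W β) (SimplexCategory.δ 0).op _).symm.trans
    ((congrArg _ h').trans
      (NatTrans.naturality_apply (kanStageMap W β) (SimplexCategory.δ 1).op _))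

/-- A path of horns is lifted by lifting its two edges along `left`; the right images of the lifts
form a path of horns in `W`, which has a path of fillers. -/
lemma locSubd_filling_horn (hW : IsLieGroupoid 2 W) :
    LocSubd fun p : Filling S => p.1.2.2 := by
  refine ⟨fun d p hp => (DiffeologicalSpace.isPlot_inf_iff.1
    (DiffeologicalSpace.isPlot_inf_iff.1 hp).2).2 (), fun p₀ d h hh hh0 => ?_⟩
  obtain ⟨a, ha, ha0, hah⟩ := hS.locSubd_left.lift p₀.1.1.1 (fun t => hornFace (h t) 2 (by decide))
    (dSmooth_hornFace _ 2 (by decide) _ _ hh) (by rw [hh0, Filling.face_two])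
  obtain ⟨b, hb, hb0, hbh⟩ := hS.locSubd_left.lift p₀.1.1.2 (fun t => hornFace (h t) 0 (by decide))
    (dSmooth_hornFace _ 0 (by decide) _ _ hh) (by rw [hh0, Filling.face_zero])
  obtain ⟨w, hw, hw0, hwc⟩ := exists_plot_filler_at (X := W) (n := 0) (j := 1)
    (hW.kan 2 (by decide) 1).2.locSubd
    (x := fun i t => if i = 2 then S.right (a t) else S.right (b t))
    (fun i => by
      split_ifs
      exacts [hS.locSubd_right.dSmooth _ _ ha, hS.locSubd_right.dSmooth _ _ hb])
    ((hah.and hbh).mono fun t ht i k hik hi hk => by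
      obtain ⟨rfl, rfl⟩ : i = 0 ∧ k = 1 := by
        revert i k
        decide
      exact hS.right_compat ht.1 ht.2) p₀.1.2.1 fun i hi => by
        have : i = 0 ∨ i = 2 := by
          revert hi
          revert i
          decide
        rcases this with rfl | rfl
        · exact p₀.2.2.1.symm.trans (congrArg S.right hb0.symm)
        · exact p₀.2.1.symm.trans (congrArg S.right ha0.symm)
  obtain ⟨p, hp, hp0, h'⟩ := hS.exists_plot_filling ha hb hw
    (hwc.mono fun t ht => ⟨(ht 2 (by decide)).symm, (ht 0 (by decide)).symm⟩) ha0 hb0 hw0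
  refine ⟨p, hp, hp0, ?_⟩
  filter_upwards [h', hah, hbh] with t h1 h2 h3
  refine Filling.inner_horn_ext ?_ ?_
  · exact (Filling.face_two _).trans ((congrArg S.left h1.1).trans h2)
  · exact (Filling.face_zero _).trans ((congrArg S.left h1.2.1).trans h3)

/-- Every inner horn comes from a filling, because the right images of lifts of its edges
form a horn in `W`. -/
lemma surjective_filling_horn (hW : IsLieGroupoid 2 W) :
    Function.Surjective fun p : Filling S => p.1.2.2 := by
  intro h
  obtain ⟨a, ha⟩ := hS.surjective_left (hornFace h 2 (by decide))
  obtain ⟨b, hb⟩ := hS.surjective_left (hornFace h 0 (by decide))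
  obtain ⟨w, hw⟩ := (hW.hasPlotFillers 0 1).hasFillers
    (fun i => if i = 2 then S.right a else S.right b) fun i k hik hi hk => by
      obtain ⟨rfl, rfl⟩ : i = 0 ∧ k = 1 := by
        revert i k
        decide
      exact hS.right_compat ha hb
  obtain ⟨p, hp1, hp2, -⟩ := hS.exists_filling (hw 2 (by decide)).symm (hw 0 (by decide)).symm
  refine ⟨p, Filling.inner_horn_ext ?_ ?_⟩
  · exact (Filling.face_two _).trans ((congrArg S.left hp1).trans ha)
  · exact (Filling.face_zero _).trans ((congrArg S.left hp2).trans hb)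

/-- The new edge ends where its horn ends, hence where the composite `d₁ w` of the right images
ends. -/
lemma filling_ends (p : Filling S) (i : Fin 2) :
    (kan W).toSSet.δ i ((kanStageMap W (β + 1)).app _ p.left) =
      (kanStageMap W 0).app _ (W.toSSet.δ i p.right) := by
  have hδ : ∀ {n : ℕ} (i) (y : (kanStage W (β + 1)).toSSet _⦋n + 1⦌),
      (kan W).toSSet.δ i ((kanStageMap W (β + 1)).app _ y) =
        (kanStageMap W (β + 1)).app _ ((kanStage W (β + 1)).toSSet.δ i y) := fun i y =>
    (NatTrans.naturality_apply (kanStageMap W (β + 1)) (SimplexCategory.δ i).op y).symm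
  have hcell : ∀ i (hi : i ≠ 1), (kan W).toSSet.δ i ((kanStageMap W (β + 1)).app _
      (kanStepCell (kanStage W β).toSSet innerHorn p.1.2.2)) =
        (kanStageMap W β).app _ (hornFace p.1.2.2 i hi) := fun i hi =>
    (hδ _ _).trans ((congrArg _ (δ_kanStepCell _ 1 1 _ p.1.2.2 i hi)).trans
      (kanStageMap_inl W β _))
  have hK := δ_comp_δ_two ((kanStageMap W (β + 1)).app _
      (kanStepCell (kanStage W β).toSSet innerHorn p.1.2.2))
  have hL : (kanStageMap W (β + 1)).app _ p.left =
      (kan W).toSSet.δ 1 ((kanStageMap W (β + 1)).app _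
        (kanStepCell (kanStage W β).toSSet innerHorn p.1.2.2)) := by
    rw [p.left_eq]
    exact (hδ _ _).symm
  have hw := δ_comp_δ_two p.1.2.1
  rw [hL]
  rcases (by decide : ∀ t : Fin 2, t = 0 ∨ t = 1) i with rfl | rfl
  · refine hK.1.trans ((congrArg _ (hcell 0 (by decide))).trans ?_)
    rw [p.face_zero]
    refine (hS.ends _ 0).trans (congrArg _ ?_)
    rw [p.2.2.1]
    exact hw.1.symm
  · refine hK.2.2.symm.trans ((congrArg _ (hcell 2 (by decide))).trans ?_)
    rw [p.face_two]
    refine (hS.ends _ 1).trans (congrArg _ ?_)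
    rw [p.2.1]
    exact hw.2.2

end

end IsGoodSpan

section

variable {X W : SimplicialDiff.{u}}

lemma dSmooth_fillStep_inl (S : EdgeSpan X W) :
    DSmooth (Y := (fillStep S).carrier) (Sum.inl : S.carrier → S.carrier ⊕ Filling S) :=
  dSmooth_mono le_sup_left (dSmooth_into_finalDiffeology
    (fun _ : Unit => (Sum.inl : S.carrier → S.carrier ⊕ Filling S)) ())

lemma dSmooth_fillStep_inr (S : EdgeSpan X W) :
    DSmooth (Y := (fillStep S).carrier) (Sum.inr : Filling S → S.carrier ⊕ Filling S) :=
  dSmooth_mono le_sup_right (dSmooth_into_finalDiffeology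
    (fun _ : Unit => (Sum.inr : Filling S → S.carrier ⊕ Filling S)) ())

lemma fillStep_plot_cases {S : EdgeSpan X W} {d : ℕ} {p : Euc d → (fillStep S).carrier}
    (hp : IsPlot p) (t₀ : Euc d) :
    (∃ q : Euc d → S.carrier, IsPlot q ∧ p =ᶠ[𝓝 t₀] fun t => Sum.inl (q t)) ∨
    ∃ q : Euc d → Filling S, IsPlot q ∧ p =ᶠ[𝓝 t₀] fun t => Sum.inr (q t) := by
  rcases exists_lift_of_isPlot_sup
    (fun _ : Unit => (Sum.inl : S.carrier → S.carrier ⊕ Filling S))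
    (fun _ : Unit => (Sum.inr : Filling S → S.carrier ⊕ Filling S))
    (fun y => by
      rcases y with a | b
      exacts [.inl ⟨(), a, rfl⟩, .inr ⟨(), b, rfl⟩]) hp t₀ with ⟨_, q, h⟩ | ⟨_, q, h⟩
  exacts [.inl ⟨q, h⟩, .inr ⟨q, h⟩]

lemma dSmooth_fillStep {S : EdgeSpan X W} {Z : Type u} [DiffeologicalSpace Z]
    {F : (fillStep S).carrier → Z} (h1 : DSmooth fun a : S.carrier => F (Sum.inl a))
    (h2 : DSmooth fun b : Filling S => F (Sum.inr b)) : DSmooth F :=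
  (dSmooth_sup_iff _ _ _).2 ⟨(dSmooth_finalDiffeology_iff _ _).2 fun _ => h1,
    (dSmooth_finalDiffeology_iff _ _).2 fun _ => h2⟩

lemma locSubd_fillStep {S : EdgeSpan X W} {Z : Type u} [DiffeologicalSpace Z]
    {F : (fillStep S).carrier → Z} (h1 : LocSubd fun a : S.carrier => F (Sum.inl a))
    (h2 : LocSubd fun b : Filling S => F (Sum.inr b)) : LocSubd F :=
  locSubd_of_cover (Y := (fillStep S).carrier) (f := (Sum.inl : S.carrier → S.carrier ⊕ Filling S))
    (g := fun _ : Unit => (Sum.inr : Filling S → S.carrier ⊕ Filling S))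
    (dSmooth_fillStep h1.dSmooth h2.dSmooth) (dSmooth_fillStep_inl S)
    (fun _ => dSmooth_fillStep_inr S) (fun y => by
      rcases y with a | b
      exacts [.inl ⟨a, rfl⟩, .inr ⟨(), b, rfl⟩]) h1 fun _ => h2

end

namespace IsGoodSpan

variable {W : SimplicialDiff.{u}}

/-- Passing to the next stage preserves the properties: the left map is a disjoint union of the
previous one and of the map sending a filling to its horn, and the right map sends a filling `w` to
`d_1 w`. -/
lemma fillStep (hW : IsLieGroupoid 2 W) {β : ℕ} {S : EdgeSpan (kanStage W β) W}
    (hS : IsGoodSpan β S) : IsGoodSpan (β + 1) (fillStep S) where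
  isSmoothManifold := by
    obtain ⟨h1, h2⟩ := isOpenInclusion_of_sup (Y := (LieKan.fillStep S).carrier)
      (B := fun _ : Unit => Filling S)
      (f := (Sum.inl : S.carrier → S.carrier ⊕ Filling S))
      (g := fun _ : Unit => (Sum.inr : Filling S → S.carrier ⊕ Filling S))
      (fun hp => (fillStep_plot_cases hp 0).imp_right fun h => ⟨(), h⟩) (dSmooth_fillStep_inl S)
      (fun _ => dSmooth_fillStep_inr S) Sum.inl_injective (fun _ _ _ h => nomatch h)
      (fun _ _ b b' h => by rw [Sum.inr_injective h])
    exact isSmoothManifold_of_openInclusions h1 h2 (fun y => by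
        rcases y with a | b
        exacts [.inl ⟨a, rfl⟩, .inr ⟨(), b, rfl⟩]) (fun _ _ _ h => nomatch h) (fun _ _ _ _ _ => rfl)
      hS.isSmoothManifold fun _ => hS.isSmoothManifold_filling hW
  locSubd_left := by
    refine locSubd_fillStep (S := S) ?_ ?_
    · exact (kanStep_isOpenInclusion (kanStage W β) _).toLocSubd.comp hS.locSubd_left
    · exact (kanStep_isOpenInclusion_inr (kanStage W β) _ innerHorn _
        composite_not_mem).toLocSubd.comp (hS.locSubd_filling_horn hW)
  surjective_left y := by
    rcases kanStep_cases y with ⟨x, rfl⟩ | ⟨⟨a, s, h⟩, hc, rfl⟩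
    · obtain ⟨s, rfl⟩ := hS.surjective_left x
      exact ⟨Sum.inl s, rfl⟩
    · obtain ⟨rfl, hs⟩ := Sigma.mk.inj (edge_eq_of_not_mem a s hc)
      obtain rfl := eq_of_heq hs
      obtain ⟨p, rfl⟩ := hS.surjective_filling_horn hW h
      exact ⟨Sum.inr p, rfl⟩
  locSubd_right := locSubd_fillStep hS.locSubd_right (hS.locSubd_filling_right hW)
  surjective_right y := by
    obtain ⟨s, rfl⟩ := hS.surjective_right y
    exact ⟨Sum.inl s, rfl⟩
  ends s i := by
    rcases s with s | p
    · exact (congrArg _ (kanStageMap_inl W β _)).trans (hS.ends s i)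
    · exact hS.filling_ends p i

end IsGoodSpan

section

variable {W : SimplicialDiff.{u}} (hW : IsLieGroupoid 2 W)

include hW

lemma isGoodSpan_fillStage (β : ℕ) : IsGoodSpan β (fillStage W β) := by
  induction β with
  | zero =>
    have hid : LocSubd (id : W.toSSet _⦋1⦌ → W.toSSet _⦋1⦌) :=
      ⟨fun _ _ h => h, fun x d p hp hp0 => ⟨p, hp, hp0, .rfl⟩⟩
    exact ⟨hW.isSmoothManifold 1, hid, Function.surjective_id, hid, Function.surjective_id,
      fun s i => (NatTrans.naturality_apply (kanStageMap W 0) (SimplexCategory.δ i).op s).symm⟩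
  | succ β ih => exact ih.fillStep hW

/-! ### The edges of the Kan replacement form a manifold -/

omit hW in
lemma LocSubd.of_isOpenInclusion_comp {X Y Z : Type*} [DiffeologicalSpace X]
    [DiffeologicalSpace Y] [DiffeologicalSpace Z] {f : X → Y} {g : Y → Z} (hg : IsOpenInclusion g)
    (hf : DSmooth f) (h : LocSubd fun x => g (f x)) : LocSubd f := by
  refine ⟨hf, fun x d p hp hp0 => ?_⟩
  obtain ⟨q, hq, hq0, hqp⟩ := h.lift x (fun t => g (p t)) (hg.toLocSubd.dSmooth _ _ hp)
    (congrArg g hp0)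
  exact ⟨q, hq, hq0, hqp.mono fun t ht => hg.injective ht⟩

lemma locSubd_δ_kanStage (β : ℕ) (i : Fin 2) :
    LocSubd fun x : (kanStage W β).toSSet _⦋1⦌ => (kanStage W β).toSSet.δ i x := by
  have hS := isGoodSpan_fillStage hW β
  refine LocSubd.of_comp hS.locSubd_left.dSmooth hS.surjective_left
    ((kanStage W β).smooth_map _) ?_
  refine LocSubd.of_isOpenInclusion_comp (kanStageMap_isOpenInclusion W β _)
    (((kanStage W β).smooth_map _).comp hS.locSubd_left.dSmooth) ?_
  have := ((kanStageMap_isOpenInclusion W 0 (op ⦋0⦌)).toLocSubd.comp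
    (locSubd_δ (fun j => (hW.kan 1 le_rfl j).2.locSubd) i)).comp hS.locSubd_right
  refine cast (congrArg _ (funext fun s => ?_)) this
  exact (hS.ends s i).symm.trans
    (NatTrans.naturality_apply (kanStageMap W β) (SimplexCategory.δ i).op _).symm

/-- The edges of a stage form a disjoint union of the edges of the previous stage and of a fibre
product. -/
lemma isSmoothManifold_kanStage_one (β : ℕ) :
    IsSmoothManifold ((kanStage W β).toSSet _⦋1⦌) := by
  induction β with
  | zero => exact hW.isSmoothManifold 1
  | succ β ih =>
    have h0 : HasCharts ((kanStage W β).toSSet _⦋0⦌) := by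
      obtain ⟨g, hg⟩ := (kanStageMap_vertex_isDiffeomorphism W β).symm_of
      exact hg.hasCharts ((kanStageMap_vertex_isDiffeomorphism W 0).hasCharts
        (hW.isSmoothManifold 0).hasCharts)
    have hhorn : IsSmoothManifold ((Λ[2, 1] : SSet.{u}) ⟶ (kanStage W β).toSSet) :=
      (isFibreProduct_horn_two (X := kanStage W β) 1 0 1 (by decide) (by decide)
        (by decide)).isSmoothManifold ih (fun _ => ih) (fun _ => (kanStage W β).smooth_map _)
        fun _ => (locSubd_δ_kanStage hW β 0).isSubmersion ih.hasCharts h0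
    refine isSmoothManifold_of_openInclusions (ι := Unit) (kanStep_isOpenInclusion (kanStage W β) _)
      (fun _ => kanStep_isOpenInclusion_inr (kanStage W β) _ innerHorn _ composite_not_mem)
      (fun y => ?_) (fun a _ b => kanStepInl_ne_inr composite_not_mem) (fun _ _ _ _ _ => rfl) ih
      fun _ => hhorn
    rcases kanStep_cases y with ⟨x, rfl⟩ | ⟨⟨a, s, h⟩, hc, rfl⟩
    · exact .inl ⟨x, rfl⟩
    · obtain ⟨rfl, hs⟩ := Sigma.mk.inj (edge_eq_of_not_mem a s hc)
      obtain rfl := eq_of_heq hs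
      exact .inr ⟨(), h, rfl⟩

/-- The stages form an increasing union of open submanifolds, and any two edges lie in a common
stage. -/
lemma isSmoothManifold_kan_one : IsSmoothManifold ((kan W).toSSet _⦋1⦌) := by
  have ho := fun β => kanStageMap_isOpenInclusion W β (op ⦋1⦌)
  have hM := isSmoothManifold_kanStage_one hW
  refine ⟨t2_of_openInclusions _ ho (fun β => (hM β).t2) fun y y' => ?_,
    secondCountable_of_openInclusions _ ho (kan_exists_stage W) fun β => (hM β).secondCountable,
    hasCharts_of_openInclusions _ ho (kan_exists_stage W) fun β => (hM β).hasCharts⟩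
  obtain ⟨β, x, rfl⟩ := kan_exists_stage W y
  obtain ⟨γ, x', rfl⟩ := kan_exists_stage W y'
  obtain ⟨r, -, hr⟩ := kanStage_exists_raise W (le_max_left β γ) (op ⦋1⦌)
  obtain ⟨r', -, hr'⟩ := kanStage_exists_raise W (le_max_right β γ) (op ⦋1⦌)
  exact ⟨_, _, r x, r' x', hr x, hr' x', .inl rfl⟩

end

/-! ### The space of filled edges -/

/-- The inclusion of the stage `β` into the space of filled edges. -/
def fillMap (W : SimplicialDiff.{u}) (β : ℕ) : (fillStage W β).carrier → FilledEdges W :=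
  Nat.rec (motive := fun β => (fillStage W β).carrier → FilledEdges W) Sum.inl
    (fun β f => Sum.elim f fun p => Sum.inr ⟨β, p⟩) β

section

variable (W : SimplicialDiff.{u})

lemma left_fillMap (β : ℕ) (s : (fillStage W β).carrier) :
    FilledEdges.left W (fillMap W β s) = (kanStageMap W β).app _ ((fillStage W β).left s) := by
  induction β with
  | zero => rfl
  | succ β ih =>
    rcases s with s | p
    · exact (ih s).trans (kanStageMap_inl W β _).symm
    · rfl

lemma right_fillMap (β : ℕ) (s : (fillStage W β).carrier) :
    FilledEdges.right W (fillMap W β s) = (fillStage W β).right s := by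
  induction β with
  | zero => rfl
  | succ β ih =>
    rcases s with s | p
    · exact ih s
    · rfl

lemma dSmooth_filledEdges_inl :
    DSmooth (Y := FilledEdges W) fun x : W.toSSet _⦋1⦌ => (Sum.inl x : FilledEdges W) :=
  dSmooth_mono le_sup_left (dSmooth_into_finalDiffeology
    (fun _ : Unit => fun x : W.toSSet _⦋1⦌ => (Sum.inl x : FilledEdges W)) ())

lemma dSmooth_filledEdges_inr (β : ℕ) :
    DSmooth (Y := FilledEdges W) fun p : Filling (fillStage W β) =>
      (Sum.inr ⟨β, p⟩ : FilledEdges W) :=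
  dSmooth_mono le_sup_right (dSmooth_into_finalDiffeology
    (fun (β : ℕ) (p : Filling (fillStage W β)) => (Sum.inr ⟨β, p⟩ : FilledEdges W)) β)

lemma dSmooth_fillMap (β : ℕ) : DSmooth (fillMap W β) := by
  induction β with
  | zero => exact dSmooth_filledEdges_inl W
  | succ β ih => exact dSmooth_fillStep ih (dSmooth_filledEdges_inr W β)

lemma filledEdges_plot_cases {d : ℕ} {p : Euc d → FilledEdges W} (hp : IsPlot p) (t₀ : Euc d) :
    (∃ q : Euc d → W.toSSet _⦋1⦌, IsPlot q ∧ p =ᶠ[𝓝 t₀] fun t => Sum.inl (q t)) ∨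
    ∃ β, ∃ q : Euc d → Filling (fillStage W β), IsPlot q ∧
      p =ᶠ[𝓝 t₀] fun t => Sum.inr ⟨β, q t⟩ := by
  rcases exists_lift_of_isPlot_sup
    (fun _ : Unit => fun x : W.toSSet _⦋1⦌ => (Sum.inl x : FilledEdges W))
    (fun (β : ℕ) (p : Filling (fillStage W β)) => (Sum.inr ⟨β, p⟩ : FilledEdges W))
    (fun y => by
      rcases y with a | ⟨β, b⟩
      exacts [.inl ⟨(), a, rfl⟩, .inr ⟨β, b, rfl⟩]) hp t₀ with ⟨_, q, h⟩ | ⟨β, q, h⟩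
  exacts [.inl ⟨q, h⟩, .inr ⟨β, q, h⟩]

lemma fillMap_plot_exists {d : ℕ} {p : Euc d → FilledEdges W} (hp : IsPlot p) (t₀ : Euc d) :
    ∃ β, ∃ q : Euc d → (fillStage W β).carrier, IsPlot q ∧
      p =ᶠ[𝓝 t₀] fun t => fillMap W β (q t) := by
  rcases filledEdges_plot_cases W hp t₀ with ⟨q, hq, h⟩ | ⟨β, q, hq, h⟩
  · exact ⟨0, q, hq, h⟩
  · exact ⟨β + 1, fun t => Sum.inr (q t), dSmooth_fillStep_inr (fillStage W β) _ _ hq, h⟩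

lemma fillMap_exists (e : FilledEdges W) : ∃ β s, fillMap W β s = e := by
  rcases e with x | ⟨β, p⟩
  exacts [⟨0, x, rfl⟩, ⟨β + 1, Sum.inr p, rfl⟩]

lemma fillMap_exists_raise {β γ : ℕ} (h : β ≤ γ) :
    ∃ r : (fillStage W β).carrier → (fillStage W γ).carrier, DSmooth r ∧
      ∀ s, fillMap W γ (r s) = fillMap W β s := by
  induction γ, h using Nat.le_induction with
  | base => exact ⟨id, fun _ _ h => h, fun _ => rfl⟩
  | succ γ h ih =>
    obtain ⟨r, hr, hr'⟩ := ih
    exact ⟨fun s => Sum.inl (r s), (dSmooth_fillStep_inl (fillStage W γ)).comp hr, hr'⟩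

lemma dSmooth_filledEdges {Z : Type u} [DiffeologicalSpace Z] {F : FilledEdges W → Z}
    (h : ∀ β, DSmooth fun s => F (fillMap W β s)) : DSmooth F :=
  (dSmooth_sup_iff _ _ _).2 ⟨(dSmooth_finalDiffeology_iff _ _).2 fun _ => h 0,
    (dSmooth_finalDiffeology_iff _ _).2 fun β =>
      (h (β + 1)).comp (dSmooth_fillStep_inr (fillStage W β))⟩

variable {W} (hW : IsLieGroupoid 2 W)

include hW

lemma isSmoothManifold_filledEdges : IsSmoothManifold (FilledEdges W) := by
  obtain ⟨h1, h2⟩ := isOpenInclusion_of_sup (Y := FilledEdges W)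
    (f := fun x : W.toSSet _⦋1⦌ => (Sum.inl x : FilledEdges W))
    (g := fun (β : ℕ) (p : Filling (fillStage W β)) => (Sum.inr ⟨β, p⟩ : FilledEdges W))
    (fun hp => filledEdges_plot_cases W hp 0) (dSmooth_filledEdges_inl W)
    (dSmooth_filledEdges_inr W) (fun _ _ h => Sum.inl_injective h) (fun _ _ _ h => nomatch h)
    (fun _ _ b b' h => Sum.inr_injective h)
  exact isSmoothManifold_of_openInclusions h1 h2 (fun y => by
      rcases y with a | ⟨β, b⟩
      exacts [.inl ⟨a, rfl⟩, .inr ⟨β, b, rfl⟩]) (fun _ _ _ h => nomatch h)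
    (fun _ _ _ _ h => congrArg Sigma.fst (Sum.inr_injective h))
    (hW.isSmoothManifold 1) fun β => (isGoodSpan_fillStage hW β).isSmoothManifold_filling hW

lemma locSubd_filledEdges_left : LocSubd (FilledEdges.left W) := by
  refine ⟨dSmooth_filledEdges W fun β => ?_, fun e d p hp hp0 => ?_⟩
  · simp only [left_fillMap]
    exact (dSmooth_kanStageMap W β _).comp (isGoodSpan_fillStage hW β).locSubd_left.dSmooth
  · obtain ⟨β, s, rfl⟩ := fillMap_exists W e
    have := (kanStageMap_isOpenInclusion W β (op ⦋1⦌)).toLocSubd.comp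
      (isGoodSpan_fillStage hW β).locSubd_left
    obtain ⟨q, hq, hq0, h⟩ := this.lift s p hp (hp0.trans (left_fillMap W β s))
    exact ⟨_, dSmooth_fillMap W β _ _ hq, congrArg _ hq0,
      h.mono fun t ht => (left_fillMap W β (q t)).trans ht⟩

lemma surjective_filledEdges_left : Function.Surjective (FilledEdges.left W) := fun x => by
  obtain ⟨β, y, rfl⟩ := kan_exists_stage W x
  obtain ⟨s, rfl⟩ := (isGoodSpan_fillStage hW β).surjective_left y
  exact ⟨_, left_fillMap W β s⟩

lemma locSubd_filledEdges_right : LocSubd (FilledEdges.right W) := by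
  refine ⟨dSmooth_filledEdges W fun β => ?_, fun e d p hp hp0 => ?_⟩
  · simp only [right_fillMap]
    exact (isGoodSpan_fillStage hW β).locSubd_right.dSmooth
  · obtain ⟨β, s, rfl⟩ := fillMap_exists W e
    obtain ⟨q, hq, hq0, h⟩ := (isGoodSpan_fillStage hW β).locSubd_right.lift s p hp
      (hp0.trans (right_fillMap W β s))
    exact ⟨_, dSmooth_fillMap W β _ _ hq, congrArg _ hq0,
      h.mono fun t ht => (right_fillMap W β (q t)).trans ht⟩

omit hW in
lemma surjective_filledEdges_right : Function.Surjective (FilledEdges.right W) :=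
  fun x => ⟨Sum.inl x, rfl⟩

end

/-! ### Deforming the filled edges into their right ends -/

section

variable {X : SimplicialDiff.{u}} {M : Type w} [DiffeologicalSpace M]

lemma exists_stageSmooth_bounds_one {x₀ x₂ x₃ : M → (kan X).toSSet _⦋2⦌} (h₀ : StageSmooth x₀)
    (h₂ : StageSmooth x₂) (h₃ : StageSmooth x₃)
    (h₀₂ : ∀ t, (kan X).toSSet.δ 0 (x₂ t) = (kan X).toSSet.δ 1 (x₀ t))
    (h₀₃ : ∀ t, (kan X).toSSet.δ 0 (x₃ t) = (kan X).toSSet.δ 2 (x₀ t))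
    (h₂₃ : ∀ t, (kan X).toSSet.δ 2 (x₃ t) = (kan X).toSSet.δ 2 (x₂ t)) :
    ∃ z : M → (kan X).toSSet _⦋3⦌, StageSmooth z ∧ ∀ t, (kan X).toSSet.δ 0 (z t) = x₀ t ∧
      (kan X).toSSet.δ 2 (z t) = x₂ t ∧ (kan X).toSSet.δ 3 (z t) = x₃ t := by
  obtain ⟨z, hz, hzx⟩ := exists_stageSmooth_filler (n := 0) 1 (x := ![x₀, x₀, x₂, x₃])
    (fun i => by fin_cases i <;> assumption) (fun t i k hik hi hk => by
      have h1 := h₀₂ t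
      have h2 := h₀₃ t
      have h3 := h₂₃ t
      fin_cases i <;> fin_cases k <;> simp at * <;> assumption)
  exact ⟨z, hz, fun t => ⟨hzx t 0 (by decide), hzx t 2 (by decide), hzx t 3 (by decide)⟩⟩

/-- A smooth family of transports of triangles: both tetrahedra depend smoothly on the
parameter. -/
def IsSmoothTransport (X : SimplicialDiff.{u}) (x w a b c : M → X.toSSet _⦋2⦌) : Prop :=
  ∃ z z' : M → X.toSSet _⦋3⦌, DSmooth z ∧ DSmooth z' ∧ ∀ t,
    (X.toSSet.δ 0 (z t) = b t ∧ X.toSSet.δ 1 (z t) = c t ∧ X.toSSet.δ 2 (z t) = w t) ∧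
      X.toSSet.δ 0 (z' t) = X.toSSet.σ 0 (X.toSSet.δ 0 (x t)) ∧
      X.toSSet.δ 1 (z' t) = X.toSSet.δ 3 (z t) ∧ X.toSSet.δ 2 (z' t) = x t ∧
      X.toSSet.δ 3 (z' t) = a t

lemma IsSmoothTransport.isTransport {x w a b c : M → X.toSSet _⦋2⦌}
    (h : IsSmoothTransport X x w a b c) (t : M) :
    IsTransport X.toSSet (x t) (w t) (a t) (b t) (c t) := by
  obtain ⟨z, z', -, -, hz⟩ := h
  obtain ⟨⟨h0, h1, h2⟩, h0', h1', h2', h3'⟩ := hz t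
  exact ⟨_, ⟨z t, h0, h1, h2, rfl⟩, z' t, h0', h1', h2', h3'⟩

/-- A smooth family of transports is a transport of germs along every plot. -/
lemma IsSmoothTransport.isTransport_germs {x w a b c : M → X.toSSet _⦋2⦌}
    (h : IsSmoothTransport X x w a b c) {d : ℕ} {p : Euc d → M} (hp : IsPlot p)
    {x' w' a' b' c' : germs d X _⦋2⦌} (hx : Represents (fun t => x (p t)) x')
    (hw : Represents (fun t => w (p t)) w') (ha : Represents (fun t => a (p t)) a')
    (hb : Represents (fun t => b (p t)) b') (hc : Represents (fun t => c (p t)) c') :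
    IsTransport (germs d X) x' w' a' b' c' := by
  obtain ⟨z, z', hz, hz', h⟩ := h
  have key : ∀ {q q' : Euc d → X.toSSet _⦋2⦌} {y y' : germs d X _⦋2⦌}, Represents q y →
      Represents q' y' → (∀ t, q t = q' t) → y = y' := fun hq hq' h =>
    (represents_eq_iff hq hq').2 (.of_forall h)
  have r := fun i => (represents_germMk (hz _ _ hp)).map (SimplexCategory.δ (n := 2) i).op
  have r' := fun i => (represents_germMk (hz' _ _ hp)).map (SimplexCategory.δ (n := 2) i).op
  exact ⟨(germs d X).δ 3 (germMk _ (hz _ _ hp)),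
    ⟨germMk _ (hz _ _ hp), key (r 0) hb fun t => (h _).1.1, key (r 1) hc fun t => (h _).1.2.1,
      key (r 2) hw fun t => (h _).1.2.2, rfl⟩,
    germMk _ (hz' _ _ hp), key (r' 0) ((hx.map _).map _) fun t => (h _).2.1,
      key (r' 1) (r 3) fun t => (h _).2.2.1, key (r' 2) hx fun t => (h _).2.2.2.1,
      key (r' 3) ha fun t => (h _).2.2.2.2⟩

/-- A transport of triangles along smooth families of deformations of two sides. -/
lemma exists_stageSmooth_transport {a b x w : M → (kan X).toSSet _⦋2⦌} (ha : StageSmooth a)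
    (hb : StageSmooth b) (hx : StageSmooth x) (hw : StageSmooth w)
    (h02 : ∀ t, (kan X).toSSet.δ 2 (a t) = (kan X).toSSet.δ 2 (x t))
    (h12 : ∀ t, (kan X).toSSet.δ 2 (b t) = (kan X).toSSet.δ 0 (x t))
    (h02' : ∀ t, (kan X).toSSet.δ 1 (a t) = (kan X).toSSet.δ 2 (w t))
    (h12' : ∀ t, (kan X).toSSet.δ 1 (b t) = (kan X).toSSet.δ 0 (w t))
    (ha0 : ∀ t, (kan X).toSSet.δ 0 (a t) =
      (kan X).toSSet.σ 0 ((kan X).toSSet.δ 1 ((kan X).toSSet.δ 0 (x t)))) :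
    ∃ c : M → (kan X).toSSet _⦋2⦌, StageSmooth c ∧ IsSmoothTransport (kan X) x w a b c := by
  obtain ⟨z, hz, hzx⟩ := exists_stageSmooth_bounds_one
    ((hx.map (SimplexCategory.δ 0).op).map (SimplexCategory.σ 0).op) hx ha
    (fun t => (δ_one_σ_zero ((kan X).toSSet.δ 0 (x t))).symm)
    (fun t => (ha0 t).trans (δ_two_σ_zero _).symm) h02
  have he : ∀ t, (kan X).toSSet.δ 0 ((kan X).toSSet.δ 1 (z t)) = (kan X).toSSet.δ 2 (b t) ∧
      (kan X).toSSet.δ 2 ((kan X).toSSet.δ 1 (z t)) = (kan X).toSSet.δ 2 (w t) := fun t => by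
    have hB : Bounds (kan X).toSSet _ _ _ _ :=
      ⟨z t, (hzx t).1, rfl, (hzx t).2.1, (hzx t).2.2⟩
    have h1 := hB.edges
    have h2 := δ_zero_σ_zero ((kan X).toSSet.δ 0 (x t))
    exact ⟨h1.1.1.trans (h2.trans (h12 t).symm), h1.2.1.2.symm.trans (h02' t)⟩
  obtain ⟨z', hz', hzx'⟩ := exists_stageSmooth_bounds_one hb hw (hz.map (SimplexCategory.δ 1).op)
    (fun t => (h12' t).symm) (fun t => (he t).1) (fun t => (he t).2)
  exact ⟨_, hz'.map (SimplexCategory.δ 1).op, z', z, hz'.dSmooth, hz.dSmooth, fun t =>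
    ⟨⟨(hzx' t).1, rfl, (hzx' t).2.1⟩, (hzx t).1, (hzx' t).2.2.symm, (hzx t).2⟩⟩

end

/-- The triangle of the Kan replacement which is added together with a filling. -/
noncomputable def compositeTriangle {W : SimplicialDiff.{u}} {β : ℕ} (p : Filling (fillStage W β)) :
    (kan W).toSSet _⦋2⦌ :=
  (kanStageMap W (β + 1)).app _ (kanStepCell _ innerHorn p.1.2.2)

/-- The triangle `c e`, with degenerate face 0, deforms the left end of the filled edge `e` into
its right end. It is degenerate on the edges of `W`. On a filling, the triangle attached along the
horn is transported to the triangle of `W` along the deformations of the two given filled edges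
and of the new one. -/
structure IsCylinder (W : SimplicialDiff.{u}) (c : FilledEdges W → (kan W).toSSet _⦋2⦌) :
    Prop where
  dSmooth : DSmooth c
  δ_two : ∀ e, (kan W).toSSet.δ 2 (c e) = FilledEdges.left W e
  δ_one : ∀ e, (kan W).toSSet.δ 1 (c e) = (kanStageMap W 0).app _ (FilledEdges.right W e)
  δ_zero : ∀ e, (kan W).toSSet.δ 0 (c e) =
    (kan W).toSSet.σ 0 ((kan W).toSSet.δ 0 (FilledEdges.left W e))
  inl : ∀ x, c (Sum.inl x) = (kanStageMap W 0).app _ (W.toSSet.σ 1 x)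
  filling : ∀ β : ℕ, IsSmoothTransport (M := Filling (fillStage W β)) (kan W) compositeTriangle
    (fun p => (kanStageMap W 0).app _ p.1.2.1) (fun p => c (fillMap W β p.1.1.1))
    (fun p => c (fillMap W β p.1.1.2)) fun p => c (Sum.inr ⟨β, p⟩)

section

variable {W : SimplicialDiff.{u}}

lemma δ_compositeTriangle {β : ℕ} (p : Filling (fillStage W β)) :
    (kan W).toSSet.δ 2 (compositeTriangle p) = FilledEdges.left W (fillMap W β p.1.1.1) ∧
    (kan W).toSSet.δ 1 (compositeTriangle p) = FilledEdges.left W (Sum.inr ⟨β, p⟩) ∧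
    (kan W).toSSet.δ 0 (compositeTriangle p) = FilledEdges.left W (fillMap W β p.1.1.2) := by
  have hδ : ∀ i, (kan W).toSSet.δ i (compositeTriangle p) = (kanStageMap W (β + 1)).app _
      ((kanStage W (β + 1)).toSSet.δ i (kanStepCell _ innerHorn p.1.2.2)) := fun i =>
    (NatTrans.naturality_apply (kanStageMap W (β + 1)) (SimplexCategory.δ i).op _).symm
  refine ⟨(hδ 2).trans ?_, (hδ 1).trans ?_, (hδ 0).trans ?_⟩
  · rw [left_fillMap, ← Filling.face_two p]
    exact (congrArg _ (δ_kanStepCell _ 1 1 _ p.1.2.2 2 (by decide))).trans (kanStageMap_inl W β _)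
  · exact congrArg _ (Filling.left_eq p).symm
  · rw [left_fillMap, ← Filling.face_zero p]
    exact (congrArg _ (δ_kanStepCell _ 1 1 _ p.1.2.2 0 (by decide))).trans (kanStageMap_inl W β _)

variable (hW : IsLieGroupoid 2 W)

include hW

lemma stageSmooth_compositeTriangle (β : ℕ) :
    StageSmooth fun p : Filling (fillStage W β) => compositeTriangle p :=
  ⟨β + 1, _, (dSmooth_kanStepInr (kanStage W β) _ innerHorn _).comp
    ((isGoodSpan_fillStage hW β).locSubd_filling_horn hW).dSmooth, fun _ => rfl⟩

/-- A smooth choice of the deformations at one stage. -/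
def IsStageCylinder (W : SimplicialDiff.{u}) (β : ℕ)
    (c : (fillStage W β).carrier → (kan W).toSSet _⦋2⦌) : Prop :=
  StageSmooth c ∧ ∀ s,
    (kan W).toSSet.δ 2 (c s) = FilledEdges.left W (fillMap W β s) ∧
    (kan W).toSSet.δ 1 (c s) = (kanStageMap W 0).app _ (FilledEdges.right W (fillMap W β s)) ∧
    (kan W).toSSet.δ 0 (c s) =
      (kan W).toSSet.σ 0 ((kan W).toSSet.δ 0 (FilledEdges.left W (fillMap W β s)))

omit hW in
lemma isStageCylinder_zero :
    IsStageCylinder W 0 fun x => (kanStageMap W 0).app _ (W.toSSet.σ 1 x) := by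
  refine ⟨⟨0, _, W.smooth_map _, fun _ => rfl⟩, fun (x : W.toSSet _⦋1⦌) => ?_⟩
  have h : (kanStageMap W 0).app _ (W.toSSet.σ 1 x) =
      (kan W).toSSet.σ 1 ((kanStageMap W 0).app _ x) :=
    NatTrans.naturality_apply (kanStageMap W 0) (SimplexCategory.σ 1).op x
  exact ⟨(congrArg _ h).trans (δ_two_σ_one _), (congrArg _ h).trans (δ_one_σ_one _),
    (congrArg _ h).trans (δ_zero_σ_one _)⟩

/-- For a new filling, the attached triangle is transported to the triangle of `W` along the
deformations of the two given filled edges; this produces the deformation of the new filled edge. -/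
lemma IsStageCylinder.exists_succ {β : ℕ} {c : (fillStage W β).carrier → (kan W).toSSet _⦋2⦌}
    (hc : IsStageCylinder W β c) :
    ∃ c' : Filling (fillStage W β) → (kan W).toSSet _⦋2⦌,
      IsStageCylinder W (β + 1) (Sum.elim c c') ∧
      IsSmoothTransport (kan W) compositeTriangle (fun p => (kanStageMap W 0).app _ p.1.2.1)
        (fun p => c p.1.1.1) (fun p => c p.1.1.2) c' := by
  have hF := isGoodSpan_fillStage hW β
  have h1 : DSmooth fun p : Filling (fillStage W β) => p.1.1.1 := fun d p hp =>
    ((Filling.isPlot_iff hF.locSubd_left.dSmooth p).1 hp).1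
  have h2 : DSmooth fun p : Filling (fillStage W β) => p.1.1.2 := fun d p hp =>
    ((Filling.isPlot_iff hF.locSubd_left.dSmooth p).1 hp).2.1
  have hι : ∀ i (w : W.toSSet _⦋2⦌), (kan W).toSSet.δ i ((kanStageMap W 0).app _ w) =
      (kanStageMap W 0).app _ (W.toSSet.δ i w) := fun i w =>
    (NatTrans.naturality_apply (kanStageMap W 0) (SimplexCategory.δ i).op w).symm
  have hδ := fun p : Filling (fillStage W β) => δ_compositeTriangle p
  have hd := fun p : Filling (fillStage W β) => δ_comp_δ_two (compositeTriangle p)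
  obtain ⟨c', hc', hT⟩ := exists_stageSmooth_transport (hc.1.comp h1) (hc.1.comp h2)
    (stageSmooth_compositeTriangle hW β)
    (w := fun p : Filling (fillStage W β) => (kanStageMap W 0).app _ p.1.2.1)
    ⟨0, _, hF.dSmooth_triangle, fun _ => rfl⟩
    (fun p => (hc.2 _).1.trans (hδ p).1.symm) (fun p => (hc.2 _).1.trans (hδ p).2.2.symm)
    (fun p => by rw [(hc.2 _).2.1, right_fillMap, p.2.1, hι])
    (fun p => by rw [(hc.2 _).2.1, right_fillMap, p.2.2.1, hι])
    (fun p => by rw [(hc.2 _).2.2, ← (hδ p).1, (hd p).2.1])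
  refine ⟨c', ⟨?_, ?_⟩, hT⟩
  · obtain ⟨γ, q, hq, hqc⟩ := hc.1
    obtain ⟨γ', q', hq', hqc'⟩ := hc'
    obtain ⟨r, hr, hrs⟩ := kanStage_exists_raise W (le_max_left γ γ') (op ⦋2⦌)
    obtain ⟨r', hr', hrs'⟩ := kanStage_exists_raise W (le_max_right γ γ') (op ⦋2⦌)
    refine ⟨max γ γ', Sum.elim (fun s => r (q s)) fun p => r' (q' p),
      dSmooth_fillStep (S := fillStage W β) (hr.toLocSubd.dSmooth.comp hq)
        (hr'.toLocSubd.dSmooth.comp hq'), ?_⟩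
    rintro (s | p)
    · exact (hqc s).trans (hrs _).symm
    · exact (hqc' p).trans (hrs' _).symm
  · rintro (s | p)
    · exact hc.2 s
    · have e := (hT.isTransport p).edges
      have h3 : (kan W).toSSet.δ 2 (c' p) = FilledEdges.left W (Sum.inr ⟨β, p⟩) :=
        e.1.2.2.trans (hδ p).2.1
      refine ⟨h3, e.2.1.2.2.trans (hι 1 _), ?_⟩
      change (kan W).toSSet.δ 0 (c' p) =
        (kan W).toSSet.σ 0 ((kan W).toSSet.δ 0 (FilledEdges.left W (Sum.inr ⟨β, p⟩)))
      rw [← e.2.2.2, (hc.2 _).2.2, ← (hδ p).2.2, ← (hδ p).2.1, (hd p).1]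

lemma exists_isCylinder : ∃ c, IsCylinder W c := by
  -- `F` extends the deformations by one stage; its value is irrelevant unless `c` is a stage
  -- cylinder.
  choose F hF using fun β c => show ∃ c' : Filling (fillStage W β) → (kan W).toSSet _⦋2⦌,
      IsStageCylinder W β c → IsStageCylinder W (β + 1) (Sum.elim c c') ∧
        IsSmoothTransport (kan W) compositeTriangle (fun p => (kanStageMap W 0).app _ p.1.2.1)
          (fun p => c p.1.1.1) (fun p => c p.1.1.2) c' by
    by_cases hc : IsStageCylinder W β c
    · exact (hc.exists_succ hW).imp fun _ h _ => h
    · exact ⟨fun p => c p.1.1.1, fun h => absurd h hc⟩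
  let C : ∀ β, (fillStage W β).carrier → (kan W).toSSet _⦋2⦌ := fun β =>
    Nat.rec (motive := fun β => (fillStage W β).carrier → (kan W).toSSet _⦋2⦌)
      (fun x => (kanStageMap W 0).app _ (W.toSSet.σ 1 x)) (fun β c => Sum.elim c (F β c)) β
  have hC : ∀ β, IsStageCylinder W β (C β) := fun β => by
    induction β with
    | zero => exact isStageCylinder_zero
    | succ β ih => exact (hF β _ ih).1
  let c : FilledEdges W → (kan W).toSSet _⦋2⦌ :=
    Sum.elim (C 0) fun p => F p.1 (C p.1) p.2
  have hc : ∀ β s, c (fillMap W β s) = C β s := fun β => by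
    induction β with
    | zero => exact fun _ => rfl
    | succ β ih =>
      rintro (s | p)
      · exact ih s
      · rfl
  have hδ : ∀ e, ∃ β s, fillMap W β s = e ∧ C β s = c e := fun e => by
    obtain ⟨β, s, rfl⟩ := fillMap_exists W e
    exact ⟨β, s, rfl, (hc β s).symm⟩
  refine ⟨c, dSmooth_filledEdges W fun β => ?_, fun e => ?_, fun e => ?_, fun e => ?_,
    fun _ => rfl, fun β => ?_⟩
  · simp only [hc]
    exact (hC β).1.dSmooth
  · obtain ⟨β, s, rfl, h⟩ := hδ e
    exact h ▸ ((hC β).2 s).1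
  · obtain ⟨β, s, rfl, h⟩ := hδ e
    exact h ▸ ((hC β).2 s).2.1
  · obtain ⟨β, s, rfl, h⟩ := hδ e
    exact h ▸ ((hC β).2 s).2.2
  · simp only [hc]
    exact (hF β _ (hC β)).2

end

/-! ### Transporting triangles of a Kan replacement -/

section

variable {K W : SSet.{u}} {E : Type u}

/-- Two lifts of the composite edge that are obtained from lifts of a horn by transport differ by
a triangle of `W` if the lifts of the horn do. -/
lemma exists_isComposite_of_isTransport (ι : W ⟶ K) (hι : Function.Injective (ι.app (op ⦋1⦌)))
    (hK₁ : ∀ j, HasFillers K 1 j) (hK₂ : ∀ j, HasFillers K 2 j) (hW : ∀ j, HasFillers W 1 j)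
    {x a b c a' b' c' : K _⦋2⦌} {w w' t₁ t₂ : W _⦋2⦌} (h : IsTransport K x (ι.app _ w) a b c)
    (h' : IsTransport K x (ι.app _ w') a' b' c') (ha : IsComposite K a' a (ι.app _ t₁))
    (hb : IsComposite K b' b (ι.app _ t₂)) (hc : K.δ 0 c' = K.σ 0 (K.δ 0 (K.δ 1 c'))) :
    ∃ t, IsComposite K c' c (ι.app _ t) := by
  have e := h.edges
  have e' := h'.edges
  have ea := Bounds.edges ha
  have eb := Bounds.edges hb
  have hb' := δ_comp_δ_two b'
  simp only [δ_zero_σ_zero, δ_one_σ_zero, δ_two_σ_zero, ← SSet.δ_naturality_apply] at e e' ea eb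
  obtain ⟨c₃, h₃⟩ := exists_isTransport_third hW (a := t₁) (b := t₂) (x := w') (w := w)
    (hι (by grind)) (hι (by grind)) (hι (by grind)) (hι (by grind))
    (hι (by
      rw [SSet.σ_naturality_apply, SSet.δ_naturality_apply ι 1 (W.δ 0 w')]
      grind))
  have e₃ := h₃.edges
  have h₃' := h₃.map ι
  obtain ⟨c'', hc''⟩ := exists_isComposite hK₁ (a' := c') (a := ι.app _ c₃) hc
    (by rw [← SSet.δ_naturality_apply, e₃.1.2.2]; grind)
    (by rw [← SSet.δ_naturality_apply, ← e₃.2.2.2]; grind)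
  have := h'.comp hK₂ hK₁ h₃' ha hb hc''
  exact ⟨c₃, hc''.congr_right hK₂ (this.third_unique hK₂ h)⟩

namespace TransportData

/-- The triangle `x` of `K` can be transported to `W`, along all lifts of its edges. -/
def HasTarget (D : TransportData K W E) (x : K _⦋2⦌) : Prop :=
  ∀ e : Fin 3 → E, (∀ i, D.left (e i) = K.δ i x) → ∃ y : W _⦋2⦌,
    (∀ i, D.right (e i) = W.δ i y) ∧
      IsTransport K x (D.ι.app _ y) (D.cyl (e 2)) (D.cyl (e 0)) (D.cyl (e 1))

/-- Filling conditions, and the condition that lifts of the same edge differ by a triangle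
of `W`. -/
structure IsAdmissible (D : TransportData K W E) : Prop where
  fill_source : ∀ n j, HasFillers K (n + 1) j
  fill_target : ∀ n j, HasFillers W n j
  ι_injective : Function.Injective (D.ι.app (op ⦋1⦌))
  surjective_left : Function.Surjective D.left
  exists_composite : ∀ e e' : E, D.left e = D.left e' →
    ∃ t, IsComposite K (D.cyl e') (D.cyl e) (D.ι.app _ t)

namespace IsAdmissible

variable {D : TransportData K W E} (hD : D.IsAdmissible)

include hD

/-- The target for some lift of the edges determines targets for all other lifts. -/
lemma hasTarget_of_isTransport {x : K _⦋2⦌} {y : W _⦋2⦌} (f : Fin 3 → E)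
    (h : IsTransport K x (D.ι.app _ y) (D.cyl (f 2)) (D.cyl (f 0)) (D.cyl (f 1))) :
    D.HasTarget x := by
  intro e he
  have e₁ := h.edges
  simp only [D.δ_two_cyl, D.δ_one_cyl, D.δ_zero_cyl, ← SSet.δ_naturality_apply] at e₁
  have hf : ∀ i, D.left (f i) = K.δ i x := fun i => by
    fin_cases i
    exacts [e₁.1.2.1, e₁.1.2.2, e₁.1.1]
  have hf' : ∀ i, D.right (f i) = W.δ i y := fun i => hD.ι_injective (by
    fin_cases i
    exacts [e₁.2.1.2.1, e₁.2.1.2.2, e₁.2.1.1])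
  choose t ht using fun i => hD.exists_composite (e i) (f i) ((he i).trans (hf i).symm)
  have hE : ∀ i, W.δ 2 (t i) = W.δ i y ∧ W.δ 1 (t i) = D.right (e i) ∧
      D.ι.app _ (W.δ 0 (t i)) = K.σ 0 (K.δ 0 (K.δ i x)) := fun i => by
    have h2 := Bounds.edges (ht i)
    simp only [D.δ_two_cyl, D.δ_one_cyl, D.δ_zero_cyl, δ_zero_σ_zero, δ_one_σ_zero,
      δ_two_σ_zero, ← SSet.δ_naturality_apply, hf, hf'] at h2
    exact ⟨hD.ι_injective h2.2.1.2.symm, hD.ι_injective h2.2.1.1.symm, h2.1.1⟩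
  have hx := δ_comp_δ_two x
  have hcyl := δ_comp_δ_two (D.cyl (f 0))
  rw [D.δ_two_cyl, D.δ_one_cyl, hf, hf', ← SSet.δ_naturality_apply] at hcyl
  -- The two choices of lifts differ by the triangles `t i` of `W`, along which `y` is transported
  -- inside `W`; the composite of both transports is a transport along the lifts `e`.
  obtain ⟨w, hw⟩ := exists_isTransport_target (hD.fill_target 1) (hE 2).1 (hE 0).1 (hE 1).1
    (hD.ι_injective (by rw [(hE 0).2.2, (hE 1).2.2, hx.1]))
    (hD.ι_injective (by
      rw [(hE 2).2.2, SSet.σ_naturality_apply, hx.2.1, hcyl.2.2,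
        SSet.δ_naturality_apply D.ι 1 (W.δ 0 y)]))
  refine ⟨w, fun i => ?_, h.comp (hD.fill_source 1) (hD.fill_source 0) (hw.map D.ι) (ht 2) (ht 0)
    (ht 1)⟩
  have e₂ := hw.edges
  rw [(hE 0).2.1, (hE 1).2.1, (hE 2).2.1] at e₂
  fin_cases i
  exacts [e₂.2.1.2.1, e₂.2.1.2.2, e₂.2.1.1]

lemma hasTarget_ι (y : W _⦋2⦌) (f : W _⦋1⦌ → E) (hf : ∀ a, D.cyl (f a) = D.ι.app _ (W.σ 1 a)) :
    D.HasTarget (D.ι.app _ y) := by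
  refine hD.hasTarget_of_isTransport (fun i => f (W.δ i y)) (y := y) ?_
  simp only [hf, SSet.σ_naturality_apply, SSet.δ_naturality_apply]
  exact isTransport_self _

lemma hasTarget_σ (i : Fin 2) (x : K _⦋1⦌) : D.HasTarget (K.σ i x) := by
  obtain ⟨g, rfl⟩ := hD.surjective_left x
  have hd := δ_comp_δ_two (D.cyl g)
  rw [D.δ_two_cyl, D.δ_one_cyl, D.δ_zero_cyl, δ_zero_σ_zero_zero, δ_one_σ_zero_zero] at hd
  have hcyl : ∀ v, D.cyl (D.unit v) = K.σ 0 (K.σ 0 (D.ι.app _ v)) := fun v => by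
    rw [D.cyl_unit, SSet.σ_naturality_apply, SSet.σ_naturality_apply]
  fin_cases i
  · refine hD.hasTarget_of_isTransport ![g, g, D.unit (W.δ 1 (D.right g))]
      (y := W.σ 0 (D.right g)) ?_
    have := isTransport_σ_zero (D.cyl g) (D.ι.app _ (W.δ 1 (D.right g))) (by
      rw [D.δ_two_cyl, hd.2.2, SSet.δ_naturality_apply])
    rw [D.δ_two_cyl, D.δ_one_cyl, ← hcyl, ← SSet.σ_naturality_apply] at this
    exact this
  · refine hD.hasTarget_of_isTransport ![D.unit (W.δ 0 (D.right g)), g, g]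
      (y := W.σ 1 (D.right g)) ?_
    have := isTransport_σ_one (hD.fill_source 1) (hD.fill_source 0) (D.cyl g)
      (D.ι.app _ (W.δ 0 (D.right g))) (by rw [D.δ_zero_cyl, SSet.δ_naturality_apply, hd.1])
    rw [D.δ_two_cyl, D.δ_one_cyl, ← hcyl, ← SSet.σ_naturality_apply] at this
    exact this

/-- If three faces of a tetrahedron can be transported, then so can the fourth: the transported
faces are filled in `W`, and the prism over the filling is filled in `K`. -/
lemma hasTarget_face (z : K _⦋3⦌) (j : Fin 4) (h : ∀ i, i ≠ j → D.HasTarget (K.δ i z)) :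
    D.HasTarget (K.δ j z) := by
  intro e he
  -- The given lifts of the edges of the face `j` are extended to lifts `f` of all edges of `z`.
  have he' : ∀ φ : ⦋1⦌ ⟶ ⦋3⦌, ∃ f, D.left f = K.map φ.op z ∧
      ∀ i : Fin 3, φ = SimplexCategory.δ i ≫ SimplexCategory.δ j → f = e i := fun φ => by
    by_cases hφ : ∃ i : Fin 3, φ = SimplexCategory.δ i ≫ SimplexCategory.δ j
    · obtain ⟨i, rfl⟩ := hφ
      refine ⟨e i, by rw [he, ← map_map_op]; rfl, fun i' hi' => ?_⟩
      rw [SimplexCategory.δ_injective ((cancel_mono _).1 hi')]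
    · obtain ⟨f, hf⟩ := hD.surjective_left (K.map φ.op z)
      exact ⟨f, hf, fun i hi => absurd ⟨i, hi⟩ hφ⟩
  choose f hf hfe using he'
  have hl : ∀ i k, D.left (f (SimplexCategory.δ i ≫ SimplexCategory.δ k)) =
      K.δ i (K.δ k z) := fun i k => by
    rw [hf, ← map_map_op]
    rfl
  have hy' := fun i hi => h i hi
    (fun k => f (SimplexCategory.δ k ≫ SimplexCategory.δ i)) fun k => hl k i
  have : Nonempty (W _⦋2⦌) := ⟨(hy' _ (exists_ne j).choose_spec).choose⟩
  choose! y hy hyT using hy'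
  -- The transported faces `y i` with `i ≠ j` are filled by a tetrahedron `w` of `W`.
  obtain ⟨w, hw⟩ := hD.fill_target 1 j y fun i k hik hi hk => by
    rw [← hy _ hi, ← hy _ hk, SimplexCategory.δ_comp_δ hik]
  -- The edges of the face `j` of `w` are also edges of other faces.
  have hr : ∀ i k, D.right (f (SimplexCategory.δ i ≫ SimplexCategory.δ k)) =
      W.δ i (W.δ k w) := by
    intro i k
    by_cases hk : k = j
    · subst hk
      obtain ⟨k', hk', φ, hφ⟩ := exists_factor_δ (n := 2) (by omega)
        (SimplexCategory.δ i ≫ SimplexCategory.δ k) k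
      obtain ⟨i', rfl⟩ : ∃ i', φ = SimplexCategory.δ i' := by
        have : Mono φ := mono_of_mono_fac hφ.symm
        exact SimplexCategory.eq_δ_of_mono φ
      have h1 : W.map (SimplexCategory.δ i ≫ SimplexCategory.δ k).op w =
        W.map (SimplexCategory.δ i' ≫ SimplexCategory.δ k').op w := by rw [hφ]
      rw [← map_map_op, ← map_map_op] at h1
      rw [hφ, hy k' hk', ← hw k' hk']
      exact h1.symm
    · rw [hy k hk, hw k hk]
  have hδ := fun (g : E) => δ_comp_δ_two (D.cyl g)
  simp only [D.δ_two_cyl, D.δ_one_cyl, D.δ_zero_cyl, δ_zero_σ_zero_zero, δ_one_σ_zero_zero] at hδ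
  -- The face `j` of `w` is transported back to a triangle `X j` of `K`, which bounds a tetrahedron
  -- with the other faces of `z`, and is thus homotopic to the face `j` of `z`.
  have hq : ∀ i : Fin 4, ∃ x, (i ≠ j → x = K.δ i z) ∧ IsTransport K x (D.ι.app _ (W.δ i w))
      (D.cyl (f (SimplexCategory.δ 2 ≫ SimplexCategory.δ i)))
      (D.cyl (f (SimplexCategory.δ 0 ≫ SimplexCategory.δ i)))
      (D.cyl (f (SimplexCategory.δ 1 ≫ SimplexCategory.δ i))) := fun i => by
    by_cases hi : i = j
    · have hz := δ_comp_δ_two (K.δ i z)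
      obtain ⟨x, hx⟩ := exists_isTransport_source (hD.fill_source 0)
        (w := D.ι.app _ (W.δ i w))
        (a := D.cyl (f (SimplexCategory.δ 2 ≫ SimplexCategory.δ i)))
        (b := D.cyl (f (SimplexCategory.δ 0 ≫ SimplexCategory.δ i)))
        (c := D.cyl (f (SimplexCategory.δ 1 ≫ SimplexCategory.δ i)))
        (by rw [D.δ_one_cyl, hr, SSet.δ_naturality_apply])
        (by rw [D.δ_one_cyl, hr, SSet.δ_naturality_apply])
        (by rw [D.δ_one_cyl, hr, SSet.δ_naturality_apply])
        (by rw [D.δ_zero_cyl, D.δ_zero_cyl, hl, hl, hz.1])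
        (by rw [D.δ_zero_cyl, D.δ_two_cyl, hl, hl, hz.2.1])
      exact ⟨x, fun h => absurd hi h, hx⟩
    · exact ⟨K.δ i z, fun _ => rfl, hw i hi ▸ hyT i hi⟩
  choose X hX hXT using hq
  have h1 := hXT 1
  have h2 := hXT 2
  have h3 := hXT 3
  rw [show SimplexCategory.δ (0 : Fin 3) ≫ SimplexCategory.δ (1 : Fin 4) =
    SimplexCategory.δ 0 ≫ SimplexCategory.δ 0 from
      SimplexCategory.δ_comp_δ (i := 0) (j := 0) (by decide)] at h1
  rw [show SimplexCategory.δ (0 : Fin 3) ≫ SimplexCategory.δ (2 : Fin 4) =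
    SimplexCategory.δ 1 ≫ SimplexCategory.δ 0 from
      SimplexCategory.δ_comp_δ (i := 0) (j := 1) (by decide),
    show SimplexCategory.δ (1 : Fin 3) ≫ SimplexCategory.δ (2 : Fin 4) =
    SimplexCategory.δ 1 ≫ SimplexCategory.δ 1 from
      SimplexCategory.δ_comp_δ (i := 1) (j := 1) (by decide)] at h2
  rw [show SimplexCategory.δ (0 : Fin 3) ≫ SimplexCategory.δ (3 : Fin 4) =
    SimplexCategory.δ 2 ≫ SimplexCategory.δ 0 from
      SimplexCategory.δ_comp_δ (i := 0) (j := 2) (by decide),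
    show SimplexCategory.δ (1 : Fin 3) ≫ SimplexCategory.δ (3 : Fin 4) =
    SimplexCategory.δ 2 ≫ SimplexCategory.δ 1 from
      SimplexCategory.δ_comp_δ (i := 1) (j := 2) (by decide),
    show SimplexCategory.δ (2 : Fin 3) ≫ SimplexCategory.δ (3 : Fin 4) =
    SimplexCategory.δ 2 ≫ SimplexCategory.δ 2 from
      SimplexCategory.δ_comp_δ (i := 2) (j := 2) (by decide)] at h3
  have hB := bounds_of_isTransport (hD.fill_source 1) (hXT 0) h1 h2 h3
    (Bounds.map D.ι ⟨w, rfl, rfl, rfl, rfl⟩)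
  have hBz : Bounds K (K.δ 0 z) (K.δ 1 z) (K.δ 2 z) (K.δ 3 z) := ⟨z, rfl, rfl, rfl, rfl⟩
  have hj : Homotopic K (X j) (K.δ j z) := by
    have hK₂ := hD.fill_source 1
    fin_cases j
    · rw [hX 1 (by decide), hX 2 (by decide), hX 3 (by decide)] at hB
      exact bounds_unique_zero hK₂ hB hBz
    · rw [hX 0 (by decide), hX 2 (by decide), hX 3 (by decide)] at hB
      exact bounds_unique_one hK₂ hB hBz
    · rw [hX 0 (by decide), hX 1 (by decide), hX 3 (by decide)] at hB
      exact bounds_unique_two hK₂ hB hBz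
    · rw [hX 0 (by decide), hX 1 (by decide), hX 2 (by decide)] at hB
      exact bounds_unique_three hK₂ hB hBz
  have hej : ∀ i, f (SimplexCategory.δ i ≫ SimplexCategory.δ j) = e i := fun i =>
    hfe _ i rfl
  refine ⟨W.δ j w, fun i => by rw [← hej, hr], ?_⟩
  have := (hXT j).congr (hD.fill_source 1) hj (.refl _) (.refl _)
  rwa [hej, hej, hej] at this

end IsAdmissible

end TransportData

end

/-! ### The Kan replacement is transported to the groupoid -/

/-- The inclusion of `W` into its Kan replacement. -/
noncomputable def kanInclusion (W : SimplicialDiff.{u}) : StrictMap W (kan W) :=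
  ⟨kanStageMap W 0, dSmooth_kanStageMap W 0⟩

lemma germsMap_injective {X Y : SimplicialDiff.{u}} (d : ℕ) (f : StrictMap X Y)
    (n : SimplexCategoryᵒᵖ) (h : Function.Injective (f.hom.app n)) :
    Function.Injective ((germsMap d f).app n) := fun x y hxy => by
  obtain ⟨p, hp, rfl⟩ := exists_germMk x
  obtain ⟨q, hq, rfl⟩ := exists_germMk y
  have hpq : (fun t => f.hom.app n (p t)) =ᶠ[𝓝 0] fun t => f.hom.app n (q t) :=
    Filter.Germ.coe_eq.1 (congrArg Subtype.val hxy)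
  exact germMk_congr (hpq.mono fun t ht => h ht)

section

variable {W : SimplicialDiff.{u}} (hW : IsLieGroupoid 2 W)

include hW

/-- A retraction of `kan W` onto `W` maps a homotopy in `kan W` to a homotopy in `W`, where
tetrahedra are determined by three of their faces. -/
lemma eq_of_homotopic_kan {y y' : W.toSSet _⦋2⦌}
    (h : Homotopic (kan W).toSSet ((kanInclusion W).hom.app _ y) ((kanInclusion W).hom.app _ y')) :
    y = y' := by
  obtain ⟨ρ, hρ⟩ := exists_kan_retraction fun a h =>
    (hW.kan a.k (by have := a.mem; omega) a.j).1 h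
  have hρ' : ∀ {n} (x : W.toSSet.obj n), ρ.app n ((kanInclusion W).hom.app _ x) = x := fun {n} x =>
    congrArg (fun k : W.toSSet ⟶ W.toSSet => k.app n x) hρ
  have h1 := (homotopic_iff.1 h).map ρ
  simp only [← SSet.δ_naturality_apply, ← SSet.σ_naturality_apply, hρ'] at h1
  obtain ⟨z, h0, h1, h2, h3⟩ := h1
  obtain ⟨s, s0, s1, s2, s3⟩ : ∃ s, W.toSSet.δ 0 s = W.toSSet.σ 1 (W.toSSet.δ 0 y) ∧
      W.toSSet.δ 1 s = W.toSSet.σ 1 (W.toSSet.δ 1 y) ∧ W.toSSet.δ 2 s = y ∧ W.toSSet.δ 3 s = y :=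
    bounds_σ_two y
  have : z = s := hW.eq_of_faces le_rfl 3 fun i hi => by
    fin_cases i
    exacts [h0.trans s0.symm, h1.trans s1.symm, h2.trans s2.symm, absurd rfl hi]
  rw [← h3, this, s3]

variable {c : FilledEdges W → (kan W).toSSet _⦋2⦌}

omit hW in
/-- The transport data given by the filled edges. -/
noncomputable def transportData (hc : IsCylinder W c) :
    TransportData (kan W).toSSet W.toSSet (FilledEdges W) where
  ι := (kanInclusion W).hom
  left := FilledEdges.left W
  right := FilledEdges.right W
  cyl := c
  unit v := Sum.inl (W.toSSet.σ 0 v)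
  δ_two_cyl := hc.δ_two
  δ_one_cyl := hc.δ_one
  δ_zero_cyl := hc.δ_zero
  left_unit _ := rfl
  right_unit _ := rfl
  cyl_unit v := (hc.inl _).trans (congrArg _ (σ_one_σ_zero v))

/-- The transport data of germs of plots. -/
noncomputable def germTransportData (hc : IsCylinder W c) (d : ℕ) :
    TransportData (germs d (kan W)) (germs d W) (PlotGerm d (FilledEdges W)) where
  ι := germsMap d (kanInclusion W)
  left := PlotGerm.map _ (locSubd_filledEdges_left hW).dSmooth
  right := PlotGerm.map _ (locSubd_filledEdges_right hW).dSmooth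
  cyl := PlotGerm.map c hc.dSmooth
  unit := PlotGerm.map (fun v => Sum.inl (W.toSSet.σ 0 v))
    ((dSmooth_filledEdges_inl W).comp (W.smooth_map _))
  δ_two_cyl e := by
    obtain ⟨p, hp, rfl⟩ := e.exists_rep
    exact Subtype.ext (Filter.Germ.coe_eq.2 (.of_forall fun t => hc.δ_two _))
  δ_one_cyl e := by
    obtain ⟨p, hp, rfl⟩ := e.exists_rep
    exact Subtype.ext (Filter.Germ.coe_eq.2 (.of_forall fun t => hc.δ_one _))
  δ_zero_cyl e := by
    obtain ⟨p, hp, rfl⟩ := e.exists_rep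
    exact Subtype.ext (Filter.Germ.coe_eq.2 (.of_forall fun t => hc.δ_zero _))
  left_unit v := by
    obtain ⟨p, hp, rfl⟩ := exists_germMk v
    rfl
  right_unit v := by
    obtain ⟨p, hp, rfl⟩ := exists_germMk v
    rfl
  cyl_unit v := by
    obtain ⟨p, hp, rfl⟩ := exists_germMk v
    exact Subtype.ext (Filter.Germ.coe_eq.2 (.of_forall fun t => (transportData hc).cyl_unit _))

/-- The germ of the deformations of a family of filled edges. -/
noncomputable def cylGerm (hc : IsCylinder W c) {d : ℕ} (β : ℕ)
    (q : Euc d → (fillStage W β).carrier) (hq : IsPlot q) : germs d (kan W) _⦋2⦌ :=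
  germMk (fun t => c (fillMap W β (q t))) (hc.dSmooth.comp (dSmooth_fillMap W β) _ _ hq)

omit hW in
lemma left_fillMap_ne {β : ℕ} (s : (fillStage W β).carrier) (p : Filling (fillStage W β)) :
    FilledEdges.left W (fillMap W β s) ≠ FilledEdges.left W (Sum.inr ⟨β, p⟩) := fun h => by
  rw [left_fillMap, ← kanStageMap_inl] at h
  exact kanStepInl_ne_inr composite_not_mem (kanStageMap_injective W (β + 1) _ h)

omit hW in
lemma horn_eq_of_left_eq {β : ℕ} {p p' : Filling (fillStage W β)}
    (h : FilledEdges.left W (Sum.inr ⟨β, p⟩) = FilledEdges.left W (Sum.inr ⟨β, p'⟩)) :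
    p.1.2.2 = p'.1.2.2 :=
  (kanStep_isOpenInclusion_inr (kanStage W β) _ innerHorn _ composite_not_mem).injective
    (kanStageMap_injective W (β + 1) _ h)

omit hW in
lemma left_fillMap_eq_of_horn_eq {β : ℕ} {p p' : Filling (fillStage W β)}
    (h : p.1.2.2 = p'.1.2.2) :
    FilledEdges.left W (fillMap W β p.1.1.1) = FilledEdges.left W (fillMap W β p'.1.1.1) ∧
      FilledEdges.left W (fillMap W β p.1.1.2) = FilledEdges.left W (fillMap W β p'.1.1.2) := by
  simp only [left_fillMap, ← Filling.face_two, ← Filling.face_zero, h]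
  exact ⟨rfl, rfl⟩

/-- Two germs of fillings of the same edges differ by a germ of triangles of `W`; the triangle is
found by transport along the tree of fillings. -/
lemma exists_isComposite_cylGerm (hc : IsCylinder W c) {d : ℕ} (β : ℕ) :
    ∀ (q q' : Euc d → (fillStage W β).carrier) (hq : IsPlot q) (hq' : IsPlot q'),
      (∀ᶠ t in 𝓝 0, FilledEdges.left W (fillMap W β (q t)) =
        FilledEdges.left W (fillMap W β (q' t))) →
      ∃ t, IsComposite (germs d (kan W)) (cylGerm hc β q' hq') (cylGerm hc β q hq)
        ((germsMap d (kanInclusion W)).app _ t) := by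
  induction β with
  | zero =>
    intro (q : Euc d → W.toSSet _⦋1⦌) (q' : Euc d → W.toSSet _⦋1⦌) hq hq' h
    have hqq : q =ᶠ[𝓝 0] q' := h.mono fun t ht => kanStageMap_injective W 0 _ ht
    have h1 : cylGerm hc 0 q hq = (germsMap d (kanInclusion W)).app _
        ((germs d W).σ 1 (germMk q hq)) :=
      Subtype.ext (Filter.Germ.coe_eq.2 (.of_forall fun t => hc.inl _))
    have h2 : cylGerm hc 0 q' hq' = cylGerm hc 0 q hq :=
      germMk_congr (hqq.mono fun t ht => congrArg (fun x => c (Sum.inl x)) ht.symm)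
    refine ⟨(germs d W).σ 1 (germMk q hq), ?_⟩
    rw [h2, h1, SSet.σ_naturality_apply]
    exact isComposite_σ_one _
  | succ β ih =>
    intro q q' hq hq' h
    -- A germ of filled edges of stage `β + 1` is a germ of stage `β` or a germ of new fillings. A
    -- filled edge of the one kind does not have the same left end as one of the other kind.
    rcases fillStep_plot_cases (S := fillStage W β) hq 0 with ⟨s, hs, hqs⟩ | ⟨p, hp, hqp⟩ <;>
    rcases fillStep_plot_cases (S := fillStage W β) hq' 0 with ⟨s', hs', hqs'⟩ | ⟨p', hp', hqp'⟩
    · obtain ⟨t, ht⟩ := ih s s' hs hs' (by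
        filter_upwards [h, hqs, hqs'] with t h1 h2 h3
        rw [h2, h3] at h1
        exact h1)
      have h1 : cylGerm hc (β + 1) q hq = cylGerm hc β s hs :=
        germMk_congr (hqs.mono fun t ht => congrArg (fun x => c (fillMap W (β + 1) x)) ht)
      have h2 : cylGerm hc (β + 1) q' hq' = cylGerm hc β s' hs' :=
        germMk_congr (hqs'.mono fun t ht => congrArg (fun x => c (fillMap W (β + 1) x)) ht)
      exact ⟨t, h1 ▸ h2 ▸ ht⟩
    · have := h.self_of_nhds
      rw [hqs.self_of_nhds, hqp'.self_of_nhds] at this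
      exact absurd this (left_fillMap_ne (β := β) (s 0) (p' 0))
    · have := h.self_of_nhds
      rw [hqp.self_of_nhds, hqs'.self_of_nhds] at this
      exact absurd this.symm (left_fillMap_ne (β := β) (s' 0) (p 0))
    · have hF := isGoodSpan_fillStage hW β
      have hpl := (Filling.isPlot_iff hF.locSubd_left.dSmooth p).1 hp
      have hpl' := (Filling.isPlot_iff hF.locSubd_left.dSmooth p').1 hp'
      have hh : ∀ᶠ t in 𝓝 0, (p t).1.2.2 = (p' t).1.2.2 := by
        filter_upwards [h, hqp, hqp'] with t h1 h2 h3
        rw [h2, h3] at h1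
        exact horn_eq_of_left_eq h1
      obtain ⟨t₁, ht₁⟩ := ih _ _ hpl.1 hpl'.1
        (hh.mono fun t ht => (left_fillMap_eq_of_horn_eq ht).1)
      obtain ⟨t₂, ht₂⟩ := ih _ _ hpl.2.1 hpl'.2.1
        (hh.mono fun t ht => (left_fillMap_eq_of_horn_eq ht).2)
      have hX := (stageSmooth_compositeTriangle hW β).dSmooth
      have hXX : germMk _ (hX _ _ hp) = germMk _ (hX _ _ hp') := germMk_congr
        (hh.mono fun t ht => congrArg (fun g => (kanStageMap W (β + 1)).app _
          (kanStepCell _ innerHorn g)) ht)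
      have h1 : cylGerm hc (β + 1) q hq = germMk (fun t => c (Sum.inr ⟨β, p t⟩))
          ((hc.dSmooth.comp (dSmooth_filledEdges_inr W β)) _ _ hp) :=
        germMk_congr (hqp.mono fun t ht => congrArg (fun x => c (fillMap W (β + 1) x)) ht)
      have h2 : cylGerm hc (β + 1) q' hq' = germMk (fun t => c (Sum.inr ⟨β, p' t⟩))
          ((hc.dSmooth.comp (dSmooth_filledEdges_inr W β)) _ _ hp') :=
        germMk_congr (hqp'.mono fun t ht => congrArg (fun x => c (fillMap W (β + 1) x)) ht)
      have hT := (hc.filling β).isTransport_germs hp (represents_germMk (hX _ _ hp))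
        (w' := (germsMap d (kanInclusion W)).app _ (germMk _ hpl.2.2)) rfl
        (a' := cylGerm hc β _ hpl.1) (b' := cylGerm hc β _ hpl.2.1) rfl rfl
        (c' := cylGerm hc (β + 1) q hq) (by rw [h1]; rfl)
      have hT' := (hc.filling β).isTransport_germs hp' (represents_germMk (hX _ _ hp'))
        (w' := (germsMap d (kanInclusion W)).app _ (germMk _ hpl'.2.2)) rfl
        (a' := cylGerm hc β _ hpl'.1) (b' := cylGerm hc β _ hpl'.2.1) rfl rfl
        (c' := cylGerm hc (β + 1) q' hq') (by rw [h2]; rfl)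
      rw [← hXX] at hT'
      refine exists_isComposite_of_isTransport _
        (germsMap_injective d (kanInclusion W) _ (kanStageMap_injective W 0 _))
        ((kan_hasPlotFillers W 0 · |>.germs d)) ((kan_hasPlotFillers W 1 · |>.germs d))
        ((hW.hasPlotFillers 1 · |>.germs d)) hT hT' ht₁ ht₂ ?_
      let D := germTransportData hW hc d
      let e : PlotGerm d (FilledEdges W) := PlotGerm.mk (fun t => fillMap W (β + 1) (q' t))
        (dSmooth_fillMap W (β + 1) _ _ hq')
      change (germs d (kan W)).δ 0 (D.cyl e) =
        (germs d (kan W)).σ 0 ((germs d (kan W)).δ 0 ((germs d (kan W)).δ 1 (D.cyl e)))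
      rw [(δ_comp_δ_two (D.cyl e)).1, D.δ_zero_cyl, δ_zero_σ_zero_zero]

/-- Any two germs of filled edges occur in a common stage, where `exists_isComposite_cylGerm`
compares them. -/
lemma isAdmissible_germTransportData (hc : IsCylinder W c) (d : ℕ) :
    (germTransportData hW hc d).IsAdmissible where
  fill_source n j := (kan_hasPlotFillers W n j).germs d
  fill_target n j := (hW.hasPlotFillers n j).germs d
  ι_injective := germsMap_injective d (kanInclusion W) _ (kanStageMap_injective W 0 _)
  surjective_left x := by
    obtain ⟨p, hp, rfl⟩ := exists_germMk x
    obtain ⟨e, he⟩ := surjective_filledEdges_left hW (p 0)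
    obtain ⟨q, hq, -, h⟩ := (locSubd_filledEdges_left hW).lift e p hp he.symm
    exact ⟨PlotGerm.mk q hq, Subtype.ext (Filter.Germ.coe_eq.2 h)⟩
  exists_composite e e' h := by
    obtain ⟨p, hp, rfl⟩ := e.exists_rep
    obtain ⟨p', hp', rfl⟩ := e'.exists_rep
    obtain ⟨β, q, hq, hpq⟩ := fillMap_plot_exists W hp 0
    obtain ⟨β', q', hq', hpq'⟩ := fillMap_plot_exists W hp' 0
    obtain ⟨r, hr, hrβ⟩ := fillMap_exists_raise W (le_max_left β β')
    obtain ⟨r', hr', hrβ'⟩ := fillMap_exists_raise W (le_max_right β β')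
    have hl : (fun t => FilledEdges.left W (p t)) =ᶠ[𝓝 0] fun t => FilledEdges.left W (p' t) :=
      Filter.Germ.coe_eq.1 (congrArg Subtype.val h)
    obtain ⟨t, ht⟩ := exists_isComposite_cylGerm hW hc (max β β') (fun t => r (q t))
      (fun t => r' (q' t)) (hr _ _ hq) (hr' _ _ hq') (by
        filter_upwards [hl, hpq, hpq'] with t h1 h2 h3
        rw [hrβ, hrβ', ← h2, ← h3, h1])
    have h1 : cylGerm hc (max β β') (fun t => r (q t)) (hr _ _ hq) =
        (germTransportData hW hc d).cyl (PlotGerm.mk p hp) :=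
      Subtype.ext (Filter.Germ.coe_eq.2 (hpq.mono fun t ht =>
        congrArg c ((hrβ _).trans ht.symm)))
    have h2 : cylGerm hc (max β β') (fun t => r' (q' t)) (hr' _ _ hq') =
        (germTransportData hW hc d).cyl (PlotGerm.mk p' hp') :=
      Subtype.ext (Filter.Germ.coe_eq.2 (hpq'.mono fun t ht =>
        congrArg c ((hrβ' _).trans ht.symm)))
    exact ⟨t, h1 ▸ h2 ▸ ht⟩

end

section

variable {W : SimplicialDiff.{u}} (hW : IsLieGroupoid 2 W)
  {c : FilledEdges W → (kan W).toSSet _⦋2⦌}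

/-- A simplex that is not in the horn does not factor through a face of the horn. -/
lemma not_factor_of_not_mem_horn {k m : ℕ} {j : Fin (k + 2)} {s : (Δ[k + 1] : SSet.{u}) _⦋m⦌}
    (hs : s ∉ (Λ[k + 1, j] : SSet.Subcomplex.{u} _).obj (op ⦋m⦌)) (i : Fin (k + 2)) (hi : i ≠ j)
    (θ : ⦋m⦌ ⟶ ⦋k⦌) : SSet.stdSimplex.objEquiv s ≠ θ ≫ SimplexCategory.δ i := by
  intro h
  refine hs ((SSet.mem_horn_iff_notMem_range _ _).2 ⟨i, hi, ?_⟩)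
  obtain rfl : s = SSet.stdSimplex.objEquiv.symm (θ ≫ SimplexCategory.δ i) := by
    rw [← h, Equiv.symm_apply_apply]
  rintro ⟨x, hx⟩
  exact Fin.succAbove_ne i _ hx

include hW

/-- Germs of triangles of the Kan replacement can be transported. By induction on the stage, it
suffices to consider the new triangles: the composites, for which the filled edges have been
constructed, degenerate ones, and the missing faces of tetrahedra. -/
lemma hasTarget_germMk (hc : IsCylinder W c) {d : ℕ} (β : ℕ) :
    ∀ (q : Euc d → (kanStage W β).toSSet _⦋2⦌) (hq : IsPlot q),
      (germTransportData hW hc d).HasTarget (germMk (X := kan W)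
        (fun t => (kanStageMap W β).app _ (q t)) (dSmooth_kanStageMap W β _ _ _ hq)) := by
  have hD := isAdmissible_germTransportData hW hc d
  induction β with
  | zero =>
    intro q hq
    refine hD.hasTarget_ι (germMk q hq) (PlotGerm.map _ (dSmooth_filledEdges_inl W)) fun a => ?_
    obtain ⟨p, hp, rfl⟩ := exists_germMk a
    exact Subtype.ext (Filter.Germ.coe_eq.2 (.of_forall fun t => hc.inl _))
  | succ β ih =>
    intro q hq
    rcases kanStep_plot_cases hq 0 with ⟨q', hq', h⟩ | ⟨a, s, hs, g, hg, h⟩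
    · have := ih q' hq'
      rwa [germMk_congr (X := kan W) (h.mono fun t ht =>
        (kanStageMap_inl W β (q' t)).symm.trans (congrArg _ ht.symm))] at this
    · let z : (germs d (kan W)).obj (op ⦋a.k⦌) := germMk (X := kan W)
        (fun t => (kanStageMap W (β + 1)).app _ (kanStepCell (kanStage W β).toSSet a (g t)))
        (((dSmooth_kanStageMap W (β + 1) _).comp
          (dSmooth_kanStepInr (kanStage W β) _ a _)) _ _ hg)
      have hz : germMk (X := kan W) (fun t => (kanStageMap W (β + 1)).app _ (q t))
          (dSmooth_kanStageMap W (β + 1) _ _ _ hq) =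
            (germs d (kan W)).map (SSet.stdSimplex.objEquiv s).op z :=
        Subtype.ext (Filter.Germ.coe_eq.2 (h.mono fun t ht => (congrArg _ (ht.trans
          (kanStepInr_eq_map _ a (g t) s))).trans (NatTrans.naturality_apply
            (kanStageMap W (β + 1)) (SSet.stdSimplex.objEquiv s).op _)))
      rw [hz]
      by_cases hφ : Function.Injective (SSet.stdSimplex.objEquiv s).toOrderHom
      · have hm : Mono (SSet.stdSimplex.objEquiv s) := SimplexCategory.mono_iff_injective.2 hφ
        obtain ⟨k, j, ha⟩ := a
        -- A new non-degenerate triangle is the cell of `Λ[2,1]`, or the missing face of a cell of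
        -- dimension 3. In cells of higher dimension all triangles belong to the horn.
        obtain rfl | ⟨k, rfl⟩ : k = 2 ∨ ∃ k', k = k' + 3 := by
          rcases show 3 ≤ k ∨ (k = 2 ∧ (j : ℕ) = 1) from ha with hk | hk
          · exact .inr ⟨k - 3, (Nat.sub_add_cancel hk).symm⟩
          · exact .inl hk.1
        · obtain rfl : j = 1 := by
            rcases show 3 ≤ 2 ∨ (2 = 2 ∧ (j : ℕ) = 1) from ha with hk | hk
            · exact absurd hk (by decide)
            · exact Fin.ext hk.2
          have hid : (SSet.stdSimplex.objEquiv s : ⦋2⦌ ⟶ ⦋2⦌) = 𝟙 _ :=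
            SimplexCategory.eq_id_of_mono _
          rw [hid, map_id_op]
          have hF := isGoodSpan_fillStage hW β
          obtain ⟨p₀, hp₀⟩ := hF.surjective_filling_horn hW (g 0)
          obtain ⟨p, hp, -, hpg⟩ := (hF.locSubd_filling_horn hW).lift p₀ g hg hp₀.symm
          have hpl := (Filling.isPlot_iff hF.locSubd_left.dSmooth p).1 hp
          have hX := (stageSmooth_compositeTriangle hW β).dSmooth
          have hzX : z = germMk _ (hX _ _ hp) :=
            (germMk_congr (hpg.mono fun t ht => congrArg (fun g =>
              (kanStageMap W (β + 1)).app _ (kanStepCell _ innerHorn g)) ht)).symm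
          refine hD.hasTarget_of_isTransport (y := germMk _ hpl.2.2)
            ![PlotGerm.mk _ (dSmooth_fillMap W β _ _ hpl.2.1),
              PlotGerm.mk _ (dSmooth_filledEdges_inr W β _ _ hp),
              PlotGerm.mk _ (dSmooth_fillMap W β _ _ hpl.1)] ?_
          exact (hc.filling β).isTransport_germs hp (hzX ▸ represents_germMk _) rfl rfl rfl rfl
        · obtain rfl | ⟨k, rfl⟩ : k = 0 ∨ ∃ k', k = k' + 1 := by
            rcases k with _ | k
            exacts [.inl rfl, .inr ⟨k, rfl⟩]
          · obtain ⟨i, θ, hθ⟩ := exists_factor_δ' (n := 2) le_rfl (SSet.stdSimplex.objEquiv s)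
            obtain rfl : i = j := by
              by_contra hi
              exact not_factor_of_not_mem_horn hs i hi θ hθ
            have : Mono θ := by
              rw [hθ] at hm
              exact mono_of_mono θ (SimplexCategory.δ i)
            obtain rfl : θ = 𝟙 _ := SimplexCategory.eq_id_of_mono _
            rw [hθ, Category.id_comp]
            refine hD.hasTarget_face z i fun l hl => ?_
            have := ih (fun t => hornFace (g t) l hl) (dSmooth_hornFace _ l hl _ _ hg)
            refine Eq.subst (motive := (germTransportData hW hc d).HasTarget) ?_ this
            refine Subtype.ext (Filter.Germ.coe_eq.2 (.of_forall fun t => ?_))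
            refine (kanStageMap_inl W β _).symm.trans ?_
            refine (congrArg _ (δ_kanStepCell _ 2 i ha (g t) l hl).symm).trans ?_
            exact NatTrans.naturality_apply (kanStageMap W (β + 1)) (SimplexCategory.δ l).op _
          · obtain ⟨i, hi, θ, hθ⟩ := exists_factor_δ (n := k + 3) (by omega)
              (SSet.stdSimplex.objEquiv s) j
            exact absurd hθ (not_factor_of_not_mem_horn hs i hi θ)
      · obtain ⟨i, φ, hi⟩ := SimplexCategory.eq_σ_comp_of_not_injective _ hφ
        rw [hi, ← σ_map_op]
        exact hD.hasTarget_σ i _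

/-- Transport in families: the conditions for germs of plots follow from the pointwise ones and from
`hasTarget_germMk`. -/
lemma isComplete_germTransportData (hc : IsCylinder W c) (d : ℕ) :
    (germTransportData hW hc d).IsComplete where
  fill_source := (isAdmissible_germTransportData hW hc d).fill_source
  fill_target := (isAdmissible_germTransportData hW hc d).fill_target
  unique_target n y y' h := by
    obtain ⟨p, hp, rfl⟩ := exists_germMk y
    obtain ⟨p', hp', rfl⟩ := exists_germMk y'
    have h1 : ∀ i, ∀ᶠ t in 𝓝 0, i ≠ 0 → W.toSSet.δ i (p t) = W.toSSet.δ i (p' t) := fun i => by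
      by_cases hi : i = 0
      · exact .of_forall fun t h => absurd hi h
      · have h2 : (fun t => W.toSSet.δ i (p t)) =ᶠ[𝓝 0] fun t => W.toSSet.δ i (p' t) :=
          Filter.Germ.coe_eq.1 (congrArg Subtype.val (h i hi))
        exact h2.mono fun t ht _ => ht
    exact germMk_congr ((Filter.eventually_all.2 h1).mono fun t ht =>
      hW.eq_of_faces (by omega) 0 ht)
  eq_of_homotopic y y' h := by
    obtain ⟨p, hp, rfl⟩ := exists_germMk y
    obtain ⟨p', hp', rfl⟩ := exists_germMk y'
    have := h.eventually (p₀ := fun t => (kanInclusion W).hom.app _ (p t))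
      (p₁ := fun t => (kanInclusion W).hom.app _ (p' t)) rfl rfl
    exact germMk_congr (this.mono fun t ht => eq_of_homotopic_kan hW ht)
  exists_triangle x e₀ e₁ e₂ h0 h1 h2 := by
    obtain ⟨p, hp, rfl⟩ := exists_germMk x
    obtain ⟨β, q, hq, h⟩ := kan_plot_exists W hp 0
    rw [germMk_congr (hq := dSmooth_kanStageMap W β _ _ _ hq) h] at h0 h1 h2 ⊢
    obtain ⟨y, hy, hyT⟩ := hasTarget_germMk hW hc β q hq ![e₀, e₁, e₂] fun i => by
      fin_cases i <;> assumption
    exact ⟨y, ⟨hy 0, hy 1, hy 2⟩, hyT⟩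

/-- Points are germs of plots of dimension zero. -/
lemma isComplete_transportData (hc : IsCylinder W c) : (transportData hc).IsComplete where
  fill_source n j := (kan_hasPlotFillers W n j).hasFillers
  fill_target n j := (hW.hasPlotFillers n j).hasFillers
  unique_target n y y' h := hW.eq_of_faces (by omega) 0 h
  eq_of_homotopic y y' h := eq_of_homotopic_kan hW h
  exists_triangle x e₀ e₁ e₂ h0 h1 h2 := by
    have hl : ∀ {e : FilledEdges W} {i : Fin 3}, FilledEdges.left W e = (kan W).toSSet.δ i x →
        (germTransportData hW hc 0).left (PlotGerm.mk (fun _ => e) isPlot_const) =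
          (germs 0 (kan W)).δ i (germMk (fun _ => x) isPlot_const) := fun h =>
      Subtype.ext (Filter.Germ.coe_eq.2 (.of_forall fun t => h))
    obtain ⟨y, hy, hyT⟩ := (isComplete_germTransportData hW hc 0).exists_triangle
      (germMk (fun _ => x) isPlot_const) _ _ _ (hl h0) (hl h1) (hl h2)
    obtain ⟨p, hp, rfl⟩ := exists_germMk y
    have hr : ∀ {e : FilledEdges W} {i : Fin 3},
        (germTransportData hW hc 0).right (PlotGerm.mk (fun _ => e) isPlot_const) =
          (germs 0 W).δ i (germMk p hp) → FilledEdges.right W e = W.toSSet.δ i (p 0) :=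
      fun {e i} h => by
        have h1 : (fun _ => FilledEdges.right W e) =ᶠ[𝓝 0] fun t => W.toSSet.δ i (p t) :=
          Filter.Germ.coe_eq.1 (congrArg Subtype.val h)
        exact h1.self_of_nhds
    refine ⟨p 0, ⟨hr hy.1, hr hy.2.1, hr hy.2.2⟩, ?_⟩
    exact (hyT.eventually (p₀ := fun _ => x) (p₁ := fun t => (kanInclusion W).hom.app _ (p t))
      (p₂ := fun _ => c e₂) (p₃ := fun _ => c e₀) (p₄ := fun _ => c e₁)
      rfl rfl rfl rfl rfl).self_of_nhds

end

/-! ### The pull-back along a map to the edges -/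

section

variable (S : SimplicialDiff.{u}) {E : Type u} [DiffeologicalSpace E] (r : E → S.toSSet _⦋1⦌)
  (unit : S.toSSet _⦋0⦌ → E)

/-- The simplices of `S` with lifts of their edges to `E`, as a subspace of the product of the
space of simplices of `S` and copies of `E`. -/
def edgePullback : SimplicialDiff.{u} where
  toSSet :=
    { obj n := {p : S.toSSet.obj n × ((⦋1⦌ ⟶ n.unop) → E) // IsLift r unit p.1 p.2}
      map f := TypeCat.ofHom fun p => ⟨(S.toSSet.map f p.1.1, fun φ => p.1.2 (φ ≫ f.unop)),
        p.2.map f.unop⟩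
      map_id n := by
        refine ConcreteCategory.hom_ext _ _ fun p => ?_
        exact Subtype.ext (Prod.ext (S.toSSet.map_id_apply n p.1.1)
          (funext fun φ => congrArg p.1.2 (Category.comp_id φ)))
      map_comp f g := by
        refine ConcreteCategory.hom_ext _ _ fun p => ?_
        exact Subtype.ext (Prod.ext (S.toSSet.map_comp_apply f g p.1.1)
          (funext fun φ => congrArg p.1.2 (Category.assoc φ _ _).symm)) }
  diffeology n := initialDiffeology (fun (_ : Unit) (p : {p : S.toSSet.obj n ×
      ((⦋1⦌ ⟶ n.unop) → E) // IsLift r unit p.1 p.2}) => p.1.1) ⊓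
    initialDiffeology (fun (φ : ⦋1⦌ ⟶ n.unop) (p : {p : S.toSSet.obj n ×
      ((⦋1⦌ ⟶ n.unop) → E) // IsLift r unit p.1 p.2}) => p.1.2 φ)
  smooth_map {m n} f := fun d p hp =>
    ⟨fun _ => S.smooth_map f _ _ (hp.1 ()), fun φ => hp.2 (φ ≫ f.unop)⟩

variable {S r unit}

lemma isPlot_edgePullback_iff {n : SimplexCategoryᵒᵖ} {d : ℕ}
    {p : Euc d → (edgePullback S r unit).toSSet.obj n} :
    IsPlot p ↔ IsPlot (fun t => (p t).1.1) ∧ ∀ φ, IsPlot fun t => (p t).1.2 φ :=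
  ⟨fun h => ⟨h.1 (), h.2⟩, fun h => ⟨fun _ => h.1, h.2⟩⟩

variable (S r unit) in
/-- The projection to `S`. -/
def edgePullbackFst : StrictMap (edgePullback S r unit) S where
  hom := { app n := TypeCat.ofHom fun p => p.1.1 }
  smooth _ _ _ hp := (isPlot_edgePullback_iff.1 hp).1

variable (S r unit) in
/-- The projection to `E`. -/
def edgePullbackEdge (z : (edgePullback S r unit).toSSet _⦋1⦌) : E := z.1.2 (𝟙 _)

lemma edgePullbackEdge_map {n : SimplexCategory} (z : (edgePullback S r unit).toSSet.obj (op n))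
    (φ : ⦋1⦌ ⟶ n) :
    edgePullbackEdge S r unit ((edgePullback S r unit).toSSet.map φ.op z) = z.1.2 φ :=
  congrArg z.1.2 (Category.id_comp φ)

lemma isPlot_edgePullback_of {n : SimplexCategory} {d : ℕ}
    {p : Euc d → (edgePullback S r unit).toSSet.obj (op n)} (h : IsPlot fun t => (p t).1.1)
    (h' : ∀ φ : ⦋1⦌ ⟶ n, IsPlot fun t =>
      edgePullbackEdge S r unit ((edgePullback S r unit).toSSet.map φ.op (p t))) : IsPlot p :=
  isPlot_edgePullback_iff.2 ⟨h, fun φ => by simpa only [edgePullbackEdge_map] using h' φ⟩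

/-- If `r` is a surjective submersion, then `edgePullback S r unit` is a pull-back of `S` along
`r`. -/
lemma isPull_edgePullbackFst (hr : LocSubd r) (hs : Function.Surjective r) (hu : DSmooth unit)
    (h : ∀ x, r (unit x) = S.toSSet.σ 0 x) :
    IsPull (edgePullbackFst S r unit) r unit (edgePullbackEdge S r unit) where
  locSubd_π := hr
  surjective_π := hs
  dSmooth_unit := hu
  dSmooth_ε _ _ hp := (isPlot_edgePullback_iff.1 hp).2 _
  π_unit := h
  π_ε z := (z.2.1 (𝟙 _)).trans (map_id_op _ _)
  ε_σ z := by
    refine (edgePullbackEdge_map z (SimplexCategory.σ 0)).trans ?_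
    have := z.2.2 (𝟙 _)
    rw [map_id_op] at this
    exact (congrArg z.1.2 (Category.comp_id _).symm).trans this
  isPlot _ h1 h2 := isPlot_edgePullback_of h1 h2
  ext h1 h2 := Subtype.ext (Prod.ext h1 (funext fun φ => by
    simpa only [edgePullbackEdge_map] using h2 φ))
  exists_of_isLift x e h := ⟨⟨(x, e), h⟩, rfl, fun φ => edgePullbackEdge_map _ φ⟩

end

namespace IsPull

variable {Z S : SimplicialDiff.{u}} {f : StrictMap Z S} {E : Type u} [DiffeologicalSpace E]
  {π : E → S.toSSet _⦋1⦌} {unit : S.toSSet _⦋0⦌ → E} {ε : Z.toSSet _⦋1⦌ → E}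

lemma σ_zero_comp_ne_id (v : ⦋0⦌ ⟶ ⦋1⦌) : SimplexCategory.σ 0 ≫ v ≠ 𝟙 _ := fun h => by
  have h0 : (SimplexCategory.σ 0 ≫ v).toOrderHom 0 = (SimplexCategory.σ 0 ≫ v).toOrderHom 1 :=
    congrArg v.toOrderHom (Subsingleton.elim (α := Fin 1) _ _)
  rw [h] at h0
  exact absurd h0 (by decide)

section

variable (hf : IsPull f π unit ε)

include hf

/-- Pulling back along the edges does not change the vertices. -/
lemma isDiffeomorphism_vertices :
    IsDiffeomorphism fun z : Z.toSSet _⦋0⦌ => f.hom.app (op ⦋0⦌) z :=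
  (hf.locSubd_app 0).isDiffeomorphism ⟨fun z z' h => hf.ext h fun φ => by
    rw [eq_σ_zero φ]
    exact (hf.ε_σ z).trans ((congrArg unit h).trans (hf.ε_σ z').symm), hf.surjective_app ⦋0⦌⟩

lemma ε_map_σ (z : Z.toSSet _⦋1⦌) (v : ⦋0⦌ ⟶ ⦋1⦌) :
    ε (Z.toSSet.map (SimplexCategory.σ 0 ≫ v).op z) = unit (S.toSSet.map v.op (π (ε z))) := by
  rw [← σ_map_op, hf.ε_σ, NatTrans.naturality_apply, hf.π_ε]

/-- The space of edges of the pull-back is the given one. -/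
lemma isDiffeomorphism_ε : IsDiffeomorphism ε := by
  classical
  have hinj : Function.Injective ε := fun z z' h => by
    refine hf.ext ((hf.π_ε z).symm.trans ((congrArg π h).trans (hf.π_ε z'))) fun φ => ?_
    rcases eq_id_or_eq_σ_comp φ with rfl | ⟨v, rfl⟩
    · rwa [map_id_op, map_id_op]
    · rw [hf.ε_map_σ, hf.ε_map_σ, h]
  have hsurj : Function.Surjective ε := fun t => by
    obtain ⟨e, he, heσ⟩ : ∃ e : (⦋1⦌ ⟶ ⦋1⦌) → E, e (𝟙 _) = t ∧
        ∀ v : ⦋0⦌ ⟶ ⦋1⦌, e (SimplexCategory.σ 0 ≫ v) = unit (S.toSSet.map v.op (π t)) :=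
      ⟨fun φ => if φ = 𝟙 _ then t else
        unit (S.toSSet.map (SimplexCategory.δ 0 ≫ φ).op (π t)), if_pos rfl,
        fun v => (if_neg (σ_zero_comp_ne_id v)).trans (by rw [δ_zero_σ_zero_comp])⟩
    have hl : IsLift π unit (π t) e := by
      refine ⟨fun φ => ?_, heσ⟩
      rcases eq_id_or_eq_σ_comp φ with rfl | ⟨v, rfl⟩
      · rw [he, map_id_op]
      · rw [heσ, hf.π_unit, σ_map_op]
    obtain ⟨z, -, hz⟩ := hf.exists_of_isLift _ _ hl
    refine ⟨z, ?_⟩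
    have := hz (𝟙 _)
    rwa [map_id_op, he] at this
  refine isDiffeomorphism_of_bijective hf.dSmooth_ε ⟨hinj, hsurj⟩ fun {d} p hp => ?_
  choose z hz using fun t => hsurj (p t)
  obtain rfl : p = fun t => ε (z t) := funext fun t => (hz t).symm
  refine ⟨z, hf.isPlot z ?_ fun φ => ?_, .rfl⟩
  · simp only [← hf.π_ε]
    exact hf.locSubd_π.dSmooth _ _ hp
  · rcases eq_id_or_eq_σ_comp φ with rfl | ⟨v, rfl⟩
    · simpa only [map_id_op] using hp
    · simp only [hf.ε_map_σ]
      exact hf.dSmooth_unit _ _ (S.smooth_map _ _ _ (hf.locSubd_π.dSmooth _ _ hp))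

end

end IsPull

/-! ### The 2-truncation -/

section

variable {K : SSet.{u}} (hK : ∀ j, HasFillers K 2 j)

include hK

/-- If horns of dimension 4 have fillers, then homotopy of triangles is an equivalence relation,
so that `TruncRel` is the kernel relation of the quotient map. -/
lemma truncRel_of_truncMk_eq {n : SimplexCategoryᵒᵖ} {x y : K.obj n}
    (h : truncMk K n x = truncMk K n y) : TruncRel K n x y :=
  (Equivalence.eqvGen_iff (r := TruncRel K n) ⟨fun _ _ => .refl _, fun h φ => (h φ).symm hK,
    fun h h' φ => (h φ).trans hK (h' φ)⟩).1 (Quot.eqvGen_exact h)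

omit hK in
lemma TruncRel.eq_one {x y : K _⦋1⦌} (h : TruncRel K (op ⦋1⦌) x y) : x = y := by
  simpa only [map_id_op] using h.map_eq (𝟙 _)

omit hK in
lemma TruncRel.eq_zero {x y : K _⦋0⦌} (h : TruncRel K (op ⦋0⦌) x y) : x = y := by
  have : K.σ 0 x = K.σ 0 y := h.map_eq (SimplexCategory.σ 0)
  rw [← δ_zero_σ_zero_zero x, this, δ_zero_σ_zero_zero]

end

lemma dSmooth_truncMk (X : SimplicialDiff.{u}) (n : SimplexCategoryᵒᵖ) :
    DSmooth (Y := (tau2 X).toSSet.obj n) (truncMk X.toSSet n) :=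
  dSmooth_into_finalDiffeology (fun _ : Unit => truncMk X.toSSet n) ()

lemma exists_lift_truncMk {X : SimplicialDiff.{u}} {n : SimplexCategoryᵒᵖ} {d : ℕ}
    {p : Euc d → (tau2 X).toSSet.obj n} (hp : IsPlot p) (t₀ : Euc d) :
    ∃ q : Euc d → X.toSSet.obj n, IsPlot q ∧ p =ᶠ[𝓝 t₀] fun t => truncMk X.toSSet n (q t) := by
  obtain ⟨-, q, hq, h⟩ := exists_lift_of_isPlot_final (fun _ : Unit => truncMk X.toSSet n)
    (fun y => ⟨(), Quot.exists_rep y⟩) hp t₀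
  exact ⟨q, hq, h⟩

lemma isDiffeomorphism_truncMk (X : SimplicialDiff.{u}) (n : SimplexCategoryᵒᵖ)
    (h : ∀ x y, TruncRel X.toSSet n x y → x = y) :
    IsDiffeomorphism (Y := (tau2 X).toSSet.obj n) (truncMk X.toSSet n) :=
  ⟨dSmooth_truncMk X n, Quot.lift id h, (dSmooth_finalDiffeology_iff _ _).2 fun _ => dSmooth_id,
    fun _ => rfl, fun y => by
      obtain ⟨x, rfl⟩ := Quot.exists_rep y
      rfl⟩

lemma IsDiffeomorphism.isSmoothManifold {X : Type u} {Y : Type v} [DiffeologicalSpace X]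
    [DiffeologicalSpace Y] {f : X → Y} (hf : IsDiffeomorphism f) (hX : IsSmoothManifold X) :
    IsSmoothManifold Y := by
  obtain ⟨g, hg⟩ := hf.symm_of
  exact ⟨t2_of_injective hg.1 hg.bijective.1 hX.t2,
    secondCountable_of_locSubd hf.locSubd hf.bijective.2 hX.secondCountable,
    hf.hasCharts hX.hasCharts⟩

/-! ### The correspondence between the groupoid and the truncated Kan replacement -/

namespace TransportData

variable {K W : SSet.{u}} {E : Type u} {D : TransportData K W E}

lemma exists_rel_of_isLift' (hD : D.IsComplete) {n : SimplexCategory} {y : W.obj (op n)}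
    {e : (⦋1⦌ ⟶ n) → E} (h : IsLift D.right D.unit y e) : ∃ x : K.obj (op n), D.Rel x y e := by
  induction n using SimplexCategory.rec with | _ n
  exact exists_rel_of_isLift hD h

lemma Rel.vertex_eq {n : SimplexCategory} {x : K.obj (op n)} {y : W.obj (op n)}
    {e : (⦋1⦌ ⟶ n) → E} (h : D.Rel x y e) (h' : IsLift D.right D.unit y e) (v : ⦋0⦌ ⟶ n) :
    D.ι.app _ (W.map v.op y) = K.map v.op x := by
  have := h.1 (SimplexCategory.σ 0 ≫ v)
  rw [h'.2, D.left_unit, ← σ_map_op, SSet.σ_naturality_apply] at this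
  rw [← δ_zero_σ_zero_zero (D.ι.app _ _), this, δ_zero_σ_zero_zero]

end TransportData

section

variable {W : SimplicialDiff.{u}} (hW : IsLieGroupoid 2 W)
  {c : FilledEdges W → (kan W).toSSet _⦋2⦌} (hc : IsCylinder W c)

/-- The intermediate groupoid: the simplices of `W` with lifts of their edges to filled edges. -/
@[reducible]
noncomputable def filledGroupoid (W : SimplicialDiff.{u}) : SimplicialDiff.{u} :=
  edgePullback W (FilledEdges.right W) fun v => Sum.inl (W.toSSet.σ 0 v)

section

variable {hW hc} {d : ℕ} {n : SimplexCategory}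
  {x : Euc d → (kan W).toSSet.obj (op n)} {hx : IsPlot x}
  {y : Euc d → W.toSSet.obj (op n)} {hy : IsPlot y} {e : (⦋1⦌ ⟶ n) → Euc d → FilledEdges W}
  {he : ∀ φ, IsPlot (e φ)}

lemma eventually_of_isLift_germs
    (h : IsLift (germTransportData hW hc d).right (germTransportData hW hc d).unit (germMk y hy)
      fun φ => PlotGerm.mk (e φ) (he φ)) :
    ∀ᶠ t in 𝓝 0, IsLift (transportData hc).right (transportData hc).unit (y t) fun φ => e φ t := by
  have h1 : ∀ φ, ∀ᶠ t in 𝓝 0, FilledEdges.right W (e φ t) = W.toSSet.map φ.op (y t) := fun φ =>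
    Filter.Germ.coe_eq.1 (congrArg Subtype.val (h.1 φ))
  have h2 : ∀ v : ⦋0⦌ ⟶ n, ∀ᶠ t in 𝓝 0, e (SimplexCategory.σ 0 ≫ v) t =
      Sum.inl (W.toSSet.σ 0 (W.toSSet.map v.op (y t))) := fun v =>
    Filter.Germ.coe_eq.1 (congrArg Subtype.val (h.2 v))
  filter_upwards [Filter.eventually_all.2 h1, Filter.eventually_all.2 h2] with t t1 t2
  exact ⟨t1, t2⟩

lemma eventually_of_rel_germs (h : (germTransportData hW hc d).Rel (germMk x hx) (germMk y hy)
      fun φ => PlotGerm.mk (e φ) (he φ)) :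
    ∀ᶠ t in 𝓝 0, (transportData hc).Rel (x t) (y t) fun φ => e φ t := by
  have h1 : ∀ φ, ∀ᶠ t in 𝓝 0, FilledEdges.left W (e φ t) = (kan W).toSSet.map φ.op (x t) :=
    fun φ => Filter.Germ.coe_eq.1 (congrArg Subtype.val (h.1 φ))
  filter_upwards [Filter.eventually_all.2 h1, Filter.eventually_all.2 fun ψ =>
    (h.2 ψ).eventually (X := kan W) (p₀ := fun t => (kan W).toSSet.map ψ.op (x t))
      (p₁ := fun t => (kanInclusion W).hom.app _ (W.toSSet.map ψ.op (y t)))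
      (p₂ := fun t => c (e (SimplexCategory.δ 2 ≫ ψ) t))
      (p₃ := fun t => c (e (SimplexCategory.δ 0 ≫ ψ) t))
      (p₄ := fun t => c (e (SimplexCategory.δ 1 ≫ ψ) t)) rfl rfl rfl rfl rfl] with t t1 t2
  exact ⟨t1, t2⟩

end

include hW

lemma exists_rel_filledGroupoid {n : SimplexCategoryᵒᵖ} (z : (filledGroupoid W).toSSet.obj n) :
    ∃ x : (kan W).toSSet.obj n, (transportData hc).Rel x z.1.1 z.1.2 :=
  TransportData.exists_rel_of_isLift' (isComplete_transportData hW hc) z.2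

/-- Families of simplices of `W` with lifted edges are, locally, transported smoothly. -/
lemma exists_rel_plot {n : SimplexCategory} {d : ℕ}
    {z : Euc d → (filledGroupoid W).toSSet.obj (op n)} (hz : IsPlot z) :
    ∃ x : Euc d → (kan W).toSSet.obj (op n), IsPlot x ∧
      ∀ᶠ t in 𝓝 0, (transportData hc).Rel (x t) (z t).1.1 (z t).1.2 := by
  obtain ⟨hy, he⟩ := isPlot_edgePullback_iff.1 hz
  have hl : IsLift (germTransportData hW hc d).right (germTransportData hW hc d).unit
      (germMk (fun t => (z t).1.1) hy) fun φ => PlotGerm.mk (fun t => (z t).1.2 φ) (he φ) :=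
    ⟨fun φ => Subtype.ext (Filter.Germ.coe_eq.2 (.of_forall fun t => (z t).2.1 φ)),
      fun v => Subtype.ext (Filter.Germ.coe_eq.2 (.of_forall fun t => (z t).2.2 v))⟩
  obtain ⟨x, hx⟩ :=
    TransportData.exists_rel_of_isLift' (isComplete_germTransportData hW hc d) hl
  obtain ⟨x, hxp, rfl⟩ := exists_germMk x
  exact ⟨x, hxp, eventually_of_rel_germs hx⟩

lemma truncMk_eq_of_rel {n : SimplexCategory}
    {x x' : (kan W).toSSet.obj (op n)} {y : W.toSSet.obj (op n)}
    {e : (⦋1⦌ ⟶ n) → FilledEdges W} (h : (transportData hc).Rel x y e)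
    (h' : (transportData hc).Rel x' y e) :
    truncMk (kan W).toSSet (op n) x = truncMk (kan W).toSSet (op n) x' :=
  Quot.sound (h.source_homotopic (isComplete_transportData hW hc) h')

/-- The map that sends a simplex of `W` with lifted edges to the corresponding simplex of the
truncated Kan replacement. -/
noncomputable def filledGroupoidLeft : StrictMap (filledGroupoid W) (tau2 (kan W)) where
  hom :=
    { app n := TypeCat.ofHom fun z =>
        truncMk (kan W).toSSet n (exists_rel_filledGroupoid hW hc z).choose
      naturality m n f := by
        refine ConcreteCategory.hom_ext _ _ fun z => ?_
        exact truncMk_eq_of_rel hW hc (exists_rel_filledGroupoid hW hc _).choose_spec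
          ((exists_rel_filledGroupoid hW hc z).choose_spec.map f.unop) }
  smooth n d z hz := by
    refine isPlot_of_locally fun t₀ => ?_
    obtain ⟨x, hx, h⟩ := exists_rel_plot hW hc (isPlot_translate hz t₀)
    refine ⟨fun t => truncMk (kan W).toSSet n (x (t + -t₀)),
      dSmooth_truncMk (kan W) n _ _ (isPlot_translate hx _), ?_⟩
    filter_upwards [(tendsto_add_neg t₀).eventually h] with t ht
    rw [neg_add_cancel_right] at ht
    exact truncMk_eq_of_rel hW hc (exists_rel_filledGroupoid hW hc _).choose_spec ht

lemma filledGroupoidLeft_eq {n : SimplexCategory} {z : (filledGroupoid W).toSSet.obj (op n)}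
    {x : (kan W).toSSet.obj (op n)} (h : (transportData hc).Rel x z.1.1 z.1.2) :
    (filledGroupoidLeft hW hc).hom.app _ z = truncMk (kan W).toSSet (op n) x :=
  truncMk_eq_of_rel hW hc (exists_rel_filledGroupoid hW hc z).choose_spec h

/-- Being transported to a given simplex of `W` is invariant under homotopy, so every
representative of the image of `z` is transported to the simplex of `W` underlying `z`. -/
lemma rel_of_filledGroupoidLeft_eq {n : SimplexCategory}
    {z : (filledGroupoid W).toSSet.obj (op n)} {x : (kan W).toSSet.obj (op n)}
    (h : (filledGroupoidLeft hW hc).hom.app _ z = truncMk (kan W).toSSet (op n) x) :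
    (transportData hc).Rel x z.1.1 z.1.2 := by
  obtain ⟨x', hx'⟩ := exists_rel_filledGroupoid hW hc z
  exact hx'.congr (isComplete_transportData hW hc)
    (truncRel_of_truncMk_eq ((isComplete_transportData hW hc).fill_source 1)
      ((filledGroupoidLeft_eq hW hc hx').symm.trans h))

omit hW in
lemma isDiffeomorphism_kan_vertices : IsDiffeomorphism (Y := (tau2 (kan W)).toSSet _⦋0⦌)
    fun w : W.toSSet _⦋0⦌ => truncMk (kan W).toSSet (op ⦋0⦌) ((kanInclusion W).hom.app _ w) := by
  have h1 := kanStageMap_vertex_isDiffeomorphism W 0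
  have h2 := isDiffeomorphism_truncMk (kan W) (op ⦋0⦌) fun x y h => h.eq_zero
  exact (h2.locSubd.comp h1.locSubd).isDiffeomorphism (h2.bijective.comp h1.bijective)

/-- Under the correspondence, the simplices of `W` with lifted edges are also the simplices of the
truncated Kan replacement with lifted edges. -/
lemma exists_isPull_filledGroupoidLeft :
    ∃ unit : (tau2 (kan W)).toSSet _⦋0⦌ → FilledEdges W, IsPull (filledGroupoidLeft hW hc)
      (fun e => truncMk (kan W).toSSet (op ⦋1⦌) (FilledEdges.left W e)) unit
      (edgePullbackEdge W (FilledEdges.right W) _) := by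
  have hD := isComplete_transportData hW hc
  have h1 := isDiffeomorphism_truncMk (kan W) (op ⦋1⦌) fun x y h => h.eq_one
  have h0 := isDiffeomorphism_truncMk (kan W) (op ⦋0⦌) fun x y h => h.eq_zero
  obtain ⟨hι, g, hg, hgl, hgr⟩ := isDiffeomorphism_kan_vertices (W := W)
  have hvert : ∀ {n : SimplexCategory} {x : (kan W).toSSet.obj (op n)}
      {z : (filledGroupoid W).toSSet.obj (op n)}, (transportData hc).Rel x z.1.1 z.1.2 →
      ∀ v : ⦋0⦌ ⟶ n, g (truncMk (kan W).toSSet (op ⦋0⦌) ((kan W).toSSet.map v.op x)) =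
        W.toSSet.map v.op z.1.1 := fun {n x z} h v => by
    rw [← h.vertex_eq z.2 v]
    exact hgl _
  refine ⟨fun v => (transportData hc).unit (g v), ?_⟩
  refine
    { locSubd_π := h1.locSubd.comp (locSubd_filledEdges_left hW)
      surjective_π := h1.bijective.2.comp (surjective_filledEdges_left hW)
      dSmooth_unit := ((dSmooth_filledEdges_inl W).comp (W.smooth_map _)).comp hg
      dSmooth_ε := fun d p hp => (isPlot_edgePullback_iff.1 hp).2 _
      π_unit := fun v => ?_
      π_ε := fun z => ?_
      ε_σ := fun z => ?_
      isPlot := fun {n d} p hp he => ?_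
      ext := fun {n z z'} h h' => ?_
      exists_of_isLift := fun {n} x e he => ?_ }
  · refine Eq.trans ?_ (congrArg ((tau2 (kan W)).toSSet.σ 0) (hgr v))
    refine congrArg (truncMk (kan W).toSSet (op ⦋1⦌)) ?_
    exact SSet.σ_naturality_apply (kanInclusion W).hom 0 (g v)
  · obtain ⟨x, hx⟩ := exists_rel_filledGroupoid hW hc z
    rw [filledGroupoidLeft_eq hW hc hx]
    exact congrArg _ ((hx.1 (𝟙 _)).trans (map_id_op _ x))
  · obtain ⟨x, hx⟩ := exists_rel_filledGroupoid hW hc z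
    rw [filledGroupoidLeft_eq hW hc hx]
    have := hvert hx (𝟙 _)
    rw [map_id_op, map_id_op] at this
    rw [this]
    refine (edgePullbackEdge_map z (SimplexCategory.σ 0)).trans ?_
    have := z.2.2 (𝟙 _)
    rw [map_id_op] at this
    exact (congrArg z.1.2 (Category.comp_id _).symm).trans this
  · induction n using SimplexCategory.rec with | _ n
    -- Locally, `p` is a family of simplices of `W` to which a family `q` of simplices of `kan W` is
    -- transported along smooth families of filled edges; transport of germs makes it smooth.
    refine isPlot_edgePullback_of (isPlot_of_locally fun t₀ => ?_) he
    have he' : ∀ φ, IsPlot fun t => (p (t + t₀)).1.2 φ := fun φ =>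
      funext (fun t => edgePullbackEdge_map (p (t + t₀)) φ) ▸ isPlot_translate (he φ) t₀
    obtain ⟨q, hq, hpq⟩ := exists_lift_truncMk hp t₀
    have hx := isPlot_translate hq t₀
    have htend : Filter.Tendsto (fun t : Euc d => t + t₀) (𝓝 0) (𝓝 t₀) := by
      have : Continuous fun t : Euc d => t + t₀ := by fun_prop
      simpa using this.tendsto 0
    have hrel := (htend.eventually hpq).mono fun t ht => rel_of_filledGroupoidLeft_eq hW hc ht
    have hs : (germTransportData hW hc d).IsSourceLift (germMk _ hx)
        fun φ => PlotGerm.mk _ (he' φ) := by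
      refine ⟨fun φ => Subtype.ext (Filter.Germ.coe_eq.2 (hrel.mono fun t ht => ht.1 φ)),
        fun v => ⟨germMk (fun t => g (truncMk (kan W).toSSet (op ⦋0⦌)
          ((kan W).toSSet.map v.op (q (t + t₀)))))
          (hg _ _ (dSmooth_truncMk _ _ _ _ ((kan W).smooth_map _ _ _ hx))),
          Subtype.ext (Filter.Germ.coe_eq.2 (hrel.mono fun t ht => ?_)),
          Subtype.ext (Filter.Germ.coe_eq.2 (hrel.mono fun t ht => ?_))⟩⟩
      · exact ((p (t + t₀)).2.2 v).trans
          (congrArg (fun w => Sum.inl (W.toSSet.σ 0 w)) (hvert ht v).symm)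
      · exact (congrArg ((kanInclusion W).hom.app _) (hvert ht v)).trans
          (ht.vertex_eq (p (t + t₀)).2 v)
    obtain ⟨y, hy, hyx⟩ := hs.exists_rel (isComplete_germTransportData hW hc d)
    obtain ⟨y, hyp, rfl⟩ := exists_germMk y
    refine ⟨fun t => y (t + -t₀), isPlot_translate hyp _, ?_⟩
    filter_upwards [(tendsto_add_neg t₀).eventually (hrel.and
      ((eventually_of_isLift_germs hy).and (eventually_of_rel_germs hyx)))] with t ⟨t1, t2, t3⟩
    refine Eq.trans ?_ (t1.target_unique hD t3 (p _).2 t2)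
    rw [neg_add_cancel_right]
  · induction n using SimplexCategory.rec with | _ n
    have he : z.1.2 = z'.1.2 := funext fun φ =>
      (edgePullbackEdge_map z φ).symm.trans ((h' φ).trans (edgePullbackEdge_map z' φ))
    obtain ⟨x, hx⟩ := exists_rel_filledGroupoid hW hc z
    have hx' := rel_of_filledGroupoidLeft_eq hW hc
      (h.symm.trans (filledGroupoidLeft_eq hW hc hx))
    have hz' := z'.2
    rw [← he] at hx' hz'
    exact Subtype.ext (Prod.ext (hx.target_unique hD hx' z.2 hz') he)
  · induction n using SimplexCategory.rec with | _ n
    obtain ⟨x, rfl⟩ := Quot.exists_rep x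
    have hs : (transportData hc).IsSourceLift x e :=
      ⟨fun φ => h1.bijective.1 (he.1 φ), fun v => ⟨_, he.2 v, h0.bijective.1 (hgr _)⟩⟩
    obtain ⟨y, hy, hyx⟩ := hs.exists_rel hD
    exact ⟨⟨(y, e), hy⟩, filledGroupoidLeft_eq hW hc hyx, fun φ => edgePullbackEdge_map _ φ⟩

end

end LieKan

theorem mainTheorem2 (W : LieKan.SimplicialDiff.{u}) (hW : LieKan.IsLieGroupoid 2 W) :
    LieKan.IsLieGroupoid 2 (LieKan.tau2 (LieKan.kan W)) ∧
    LieKan.MoritaEquivalent 2 (LieKan.tau2 (LieKan.kan W)) W ∧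
    ∃ (Z : LieKan.SimplicialDiff.{u}) (p : LieKan.StrictMap Z (LieKan.tau2 (LieKan.kan W)))
      (q : LieKan.StrictMap Z W),
      LieKan.IsLieGroupoid 2 Z ∧ LieKan.IsHypercover 2 p ∧ LieKan.IsHypercover 2 q ∧
      LieKan.IsDiffeomorphism (fun z : Z.toSSet _⦋0⦌ => q.hom.app (op ⦋0⦌) z) ∧
      ∃ e : LieKan.FilledEdges W → Z.toSSet _⦋1⦌, LieKan.IsDiffeomorphism e ∧
        (∀ t, p.hom.app (op ⦋1⦌) (e t) = LieKan.truncMk _ _ (LieKan.FilledEdges.left W t)) ∧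
        ∀ t, q.hom.app (op ⦋1⦌) (e t) = LieKan.FilledEdges.right W t := by
  obtain ⟨c, hc⟩ := LieKan.exists_isCylinder hW
  have hq := LieKan.isPull_edgePullbackFst (LieKan.locSubd_filledEdges_right hW)
    LieKan.surjective_filledEdges_right
    ((LieKan.dSmooth_filledEdges_inl W).comp (W.smooth_map (SimplexCategory.σ 0).op))
    fun _ => rfl
  obtain ⟨unit, hp⟩ := LieKan.exists_isPull_filledGroupoidLeft hW hc
  have hE := LieKan.isSmoothManifold_filledEdges hW
  have hZ : LieKan.IsLieGroupoid 2 (LieKan.filledGroupoid W) := hq.isLieGroupoid_source hW hE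
  have hK : LieKan.IsSmoothManifold ((LieKan.tau2 (LieKan.kan W)).toSSet _⦋1⦌) :=
    (LieKan.isDiffeomorphism_truncMk (LieKan.kan W) (op ⦋1⦌) fun x y h => h.eq_one)
      |>.isSmoothManifold (LieKan.isSmoothManifold_kan_one hW)
  have hT := hp.isLieGroupoid_target hZ hE.hasCharts hK
  have hZc : ∀ m, LieKan.HasCharts ((LieKan.filledGroupoid W).toSSet _⦋m⦌) :=
    fun m => (hZ.isSmoothManifold m).hasCharts
  have hp2 := hp.isHypercover hZc fun m => (hT.isSmoothManifold m).hasCharts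
  have hq2 := hq.isHypercover hZc fun m => (hW.isSmoothManifold m).hasCharts
  obtain ⟨hε, e, he, h1, h2⟩ := hq.isDiffeomorphism_ε
  refine ⟨hT, ⟨_, _, _, hZ, hp2, hq2⟩, _, _, _, hZ, hp2, hq2, hq.isDiffeomorphism_vertices,
    e, ⟨he, _, hε, h2, h1⟩, fun t => ?_, fun t => ?_⟩
  · exact (hp.π_ε (e t)).symm.trans
      (congrArg (fun t => LieKan.truncMk _ _ (LieKan.FilledEdges.left W t)) (h2 t))
  · exact (hq.π_ε (e t)).symm.trans (congrArg _ (h2 t))
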